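/- **Setting.** Let $N\ge 2$, $r\ge 1$, $d\ge 0$ be integers. A database consists of $N$ bit strings $x_1,\dots,x_N\in\{0,1\}^d$; for $\mathbf s=(s^1,\dots,s^r)\in\{1,\dots,N\}^r$ write $\mathbf x_{\mathbf s}=(x_{s^1},\dots,x_{s^r})$. Let $\alpha_1,\dots,\alpha_N$ be $\{0,1\}$-valued functions of $r$-tuples of database entries; a *solution* for $\alpha_i$ is an $\mathbf s$ with $\alpha_i(\mathbf x_{\mathbf s})=1$. We are given, for each $i$, a quantum circuit (time slices of one- and two-qubit unitaries acting on disjoint sets of qubits) that implements $|\mathbf x_{\mathbf j}\rangle|b\rangle\mapsto|\mathbf x_{\mathbf j}\rangle|b\oplus\alpha_i(\mathbf x_{\mathbf j})\rangle$ for all $\mathbf j\in\{1,\dots,N\}^r$, possibly with ancillas that start and end in $|0\rangle$. It is assumed that $d$ is bounded by a fixed polynomial in $\log N$, and that the width (number of qubits) and depth (number of time slices) of the given circuits are bounded by a fixed polynomial in $\log N$, $d$ and $r$. Let $1\le M\le N^r$ be an integer such that every $\alpha_i$ has either no solution or at least $M$ solutions. (For instance, $M$ is the minimum over $i$ of the number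 of solutions for $\alpha_i$, if this is not $0$; $M=1$ is always allowed.) **Theorem (Multi-Grover search).** There is a quantum algorithm which, computably from $(N,r,d,M)$ alone, specifies a sequence of time slices of elementary gates (Hadamard, $T$, CNOT) and of parallel calls to the $N$ given circuits, such that the following holds for the quantum circuit obtained by inserting the given circuits. Started with the database in the basis state $|x_1,\dots,x_N\rangle$ and all other qubits in $|0\rangle$, and followed by a measurement in the computational basis, it outputs for each $i=1,\dots,N$ either an index $\mathbf s_i\in\{1,\dots,N\}^r$ or "no solution". With probability $\Theta(1)$, that is, at least $p$ for an absolute constant $p>0$, all $N$ outputs are simultaneously correct: for every $i$ that has a solution, $\alpha_i(\mathbf x_{\mathbf s_i})=1$, and for every $i$ that has none, the output is "no solution". The circuit has width $\tilde O(N)$ and depth $\tilde O\big(\sqrt{N^r/M}\big)$, where $\tilde O$ neglects a multiplicative factor that is polynomial in $r\log N$; this polynomial depends only on the polynomials bounding $d$ and the widths and depths of the given circuits. -/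

import Mathlib

namespace MultiGrover

/-! ### The quantum circuit model

Qubits are labelled by a finite type `Q`.  A computational basis state is a bit assignment
`Q → Bool`, a state vector is a function on basis states.  In each time slice one- and two-qubit
unitaries may be applied to disjoint sets of qubits. -/

/-- State vectors of a register of qubits labelled by `Q`. -/
abbrev Ket (Q : Type) := (Q → Bool) → ℂ

/-- The computational basis state `|s⟩`. -/
def Ket.basis {Q : Type} [Fintype Q] [DecidableEq Q] (s : Q → Bool) : Ket Q := Pi.single s 1

/-- A one-qubit unitary on the qubit `q`, or a two-qubit unitary on the pair `(p, q)`. -/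
inductive Gate (Q : Type)
  | one (q : Q) (U : Matrix.unitaryGroup Bool ℂ)
  | two (p q : Q) (U : Matrix.unitaryGroup (Bool × Bool) ℂ)

namespace Gate

variable {Q : Type} [DecidableEq Q]

/-- The action of a gate on state vectors (tensored with the identity on all other qubits). -/
def apply : Gate Q → Ket Q → Ket Q
  | one q U, ψ => fun s => ∑ a : Bool, U.1 (s q) a * ψ (Function.update s q a)
  | two p q U, ψ => fun s =>
      ∑ e : Bool × Bool, U.1 (s p, s q) e * ψ (Function.update (Function.update s p e.1) q e.2)

/-- The set of qubits a gate touches. -/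
def support : Gate Q → Finset Q
  | one q _ => {q}
  | two p q _ => {p, q}

/-- A two-qubit gate has to act on two different qubits. -/
def IsValid : Gate Q → Prop
  | one _ _ => True
  | two p q _ => p ≠ q

/-- Relabelling of the qubits. -/
def map {Q₁ Q₂ : Type} (f : Q₁ → Q₂) : Gate Q₁ → Gate Q₂
  | one q U => one (f q) U
  | two p q U => two (f p) (f q) U

end Gate

/-- A circuit is a list of time slices, each of them a list of gates. -/
abbrev Circuit (Q : Type) := List (List (Gate Q))

namespace Circuit

variable {Q : Type}

/-- Gates in the same time slice act on disjoint sets of qubits. -/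
def IsValid [DecidableEq Q] (c : Circuit Q) : Prop :=
  ∀ l ∈ c, (∀ g ∈ l, g.IsValid) ∧ l.Pairwise fun g h => Disjoint g.support h.support

/-- The depth is the number of time slices. -/
def depth (c : Circuit Q) : ℕ := c.length

/-- The width is the total number of qubits, ancillas included. -/
def width [Fintype Q] (_c : Circuit Q) : ℕ := Fintype.card Q

/-- The action of a circuit on state vectors; the head of the list is applied first. -/
def run [DecidableEq Q] (c : Circuit Q) (ψ : Ket Q) : Ket Q :=
  c.flatten.foldl (fun φ g => g.apply φ) ψ

end Circuit

/-! ### Circuits for the predicates -/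

/-- The qubits of a circuit that evaluates a predicate on `r`-tuples of `d`-bit strings:
the `r * d` argument qubits, the target qubit, and `a` ancillas. -/
inductive OracleQubit (r d a : ℕ)
  | arg (l : Fin r) (k : Fin d)
  | target
  | anc (t : Fin a)
  deriving DecidableEq, Fintype

/-- The basis state `|z⟩|b⟩|0⟩`. -/
def OracleQubit.config {r d a : ℕ} (z : Fin r → Fin d → Bool) (b : Bool) :
    OracleQubit r d a → Bool
  | arg l k => z l k
  | target => b
  | anc _ => false

/-- The circuit `A` implements `|z⟩|b⟩ ↦ |z⟩|b ⊕ α z⟩` (with ancillas that start in `|0⟩` and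
are returned to `|0⟩`) on all `r`-tuples `z` of entries of the database `x`. -/
def ComputesOn {N r d a : ℕ} (x : Fin N → Fin d → Bool) (α : (Fin r → Fin d → Bool) → Bool)
    (A : Circuit (OracleQubit r d a)) : Prop :=
  ∀ (s : Fin r → Fin N) (b : Bool),
    A.run (Ket.basis (OracleQubit.config (fun l => x (s l)) b)) =
      Ket.basis (OracleQubit.config (fun l => x (s l)) (b ^^ α (fun l => x (s l))))

/-- The number of solutions `s` in `{1, …, N}^r` to `α (x_{s¹}, …, x_{sʳ}) = 1`. -/
def numSolutions {N r d : ℕ} (x : Fin N → Fin d → Bool)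
    (α : (Fin r → Fin d → Bool) → Bool) : ℕ :=
  (Finset.univ.filter fun s : Fin r → Fin N => α (fun l => x (s l)) = true).card

/-! ### Algorithms

An algorithm is a finite list of instructions: either a time slice of elementary gates from the
universal set `H`, `T`, `CNOT`, or a parallel call of the `N` given circuits for the predicates.
The instructions do not depend on what these circuits are. -/

/-- Names of the qubits an algorithm can address: the qubits holding the database, and, for each
of the `N` processors, the argument registers and the target qubit of its predicate circuit, a flag
qubit and `r` index registers for the output; and scratch qubits. -/
inductive Addr
  | data (j k : ℕ)
  | arg (i l k : ℕ)
  | target (i : ℕ)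
  | found (i : ℕ)
  | out (i l b : ℕ)
  | scratch (t : ℕ)

/-- The elementary gates. -/
inductive BasicGate
  | hadamard (q : Addr)
  | phaseT (q : Addr)
  | cnot (p q : Addr)

/-- One instruction: a time slice of elementary gates, or a call of all `N` predicate circuits in
parallel, the `i`-th one on the argument registers and the target qubit of processor `i`. -/
inductive Step
  | gates (l : List BasicGate)
  | query

/-- An algorithm: the number of scratch qubits and the list of instructions. -/
abbrev Program := ℕ × List Step

/-! Encodings, so that one can say that a program is computed from the parameters. -/

/-- Addresses as a disjoint union. -/
def Addr.equiv : Addr ≃ (ℕ × ℕ) ⊕ (ℕ × ℕ × ℕ) ⊕ ℕ ⊕ ℕ ⊕ (ℕ × ℕ × ℕ) ⊕ ℕ where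
  toFun
    | .data j k => .inl (j, k)
    | .arg i l k => .inr (.inl (i, l, k))
    | .target i => .inr (.inr (.inl i))
    | .found i => .inr (.inr (.inr (.inl i)))
    | .out i l b => .inr (.inr (.inr (.inr (.inl (i, l, b)))))
    | .scratch t => .inr (.inr (.inr (.inr (.inr t))))
  invFun
    | .inl (j, k) => .data j k
    | .inr (.inl (i, l, k)) => .arg i l k
    | .inr (.inr (.inl i)) => .target i
    | .inr (.inr (.inr (.inl i))) => .found i
    | .inr (.inr (.inr (.inr (.inl (i, l, b))))) => .out i l b
    | .inr (.inr (.inr (.inr (.inr t)))) => .scratch t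
  left_inv q := by cases q <;> rfl
  right_inv q := by rcases q with _ | _ | _ | _ | _ | _ <;> rfl

instance : Primcodable Addr := Primcodable.ofEquiv _ Addr.equiv

/-- Elementary gates as a disjoint union. -/
def BasicGate.equiv : BasicGate ≃ Addr ⊕ Addr ⊕ (Addr × Addr) where
  toFun
    | .hadamard q => .inl q
    | .phaseT q => .inr (.inl q)
    | .cnot p q => .inr (.inr (p, q))
  invFun
    | .inl q => .hadamard q
    | .inr (.inl q) => .phaseT q
    | .inr (.inr (p, q)) => .cnot p q
  left_inv g := by cases g <;> rfl
  right_inv g := by rcases g with _ | _ | _ <;> rfl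

instance : Primcodable BasicGate := Primcodable.ofEquiv _ BasicGate.equiv

/-- Instructions as an option type. -/
def Step.equiv : Step ≃ Option (List BasicGate) where
  toFun
    | .gates l => some l
    | .query => none
  invFun
    | some l => .gates l
    | none => .query
  left_inv t := by cases t <;> rfl
  right_inv t := by cases t <;> rfl

instance : Primcodable Step := Primcodable.ofEquiv _ Step.equiv

/-! ### The circuit of an algorithm -/

/-- The qubits of the circuit of an algorithm with `w` scratch qubits, when the `i`-th predicate
circuit has `a i` ancillas: `data j` holds the database entry `x_j`, and the other qubits start in
`|0⟩`. -/
inductive Qubit (N r d w : ℕ) (a : Fin N → ℕ)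
  | data (j : Fin N) (k : Fin d)
  | arg (i : Fin N) (l : Fin r) (k : Fin d)
  | target (i : Fin N)
  | found (i : Fin N)
  | out (i : Fin N) (l : Fin r) (b : Fin (Nat.clog 2 N))
  | scratch (t : Fin w)
  | anc (i : Fin N) (t : Fin (a i))
  deriving DecidableEq, Fintype

/-- The Hadamard gate. -/
noncomputable def hadamardMatrix : Matrix Bool Bool ℂ :=
  fun a b => (if a && b then -1 else 1) * ((Real.sqrt 2 : ℝ) : ℂ)⁻¹

/-- The `T` gate `diag(1, exp(iπ/4))`. -/
noncomputable def phaseTMatrix : Matrix Bool Bool ℂ :=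
  Matrix.diagonal fun a => if a then Complex.exp ((Real.pi / 4 : ℝ) * Complex.I) else 1

/-- The controlled-not gate, with the control in the first component. -/
def cnotMatrix : Matrix (Bool × Bool) (Bool × Bool) ℂ :=
  fun s t => if s = (t.1, t.1 ^^ t.2) then 1 else 0

theorem hadamardMatrix_mem : hadamardMatrix ∈ Matrix.unitaryGroup Bool ℂ := by
  have h : ((Real.sqrt 2 : ℝ) : ℂ)⁻¹ * ((Real.sqrt 2 : ℝ) : ℂ)⁻¹ = 1 / 2 := by
    rw [← mul_inv, ← Complex.ofReal_mul, Real.mul_self_sqrt (by norm_num)]; norm_num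
  rw [Matrix.mem_unitaryGroup_iff]
  ext a b
  cases a <;> cases b <;>
    simp [Matrix.mul_apply, Matrix.star_apply, hadamardMatrix, h] <;> norm_num

theorem phaseTMatrix_mem : phaseTMatrix ∈ Matrix.unitaryGroup Bool ℂ := by
  rw [Matrix.mem_unitaryGroup_iff, phaseTMatrix, Matrix.star_eq_conjTranspose,
    Matrix.diagonal_conjTranspose, Matrix.diagonal_mul_diagonal, ← Matrix.diagonal_one]
  congr 1
  ext a
  cases a
  · simp
  · simp only [if_true, Pi.star_apply, RCLike.star_def]
    rw [Complex.mul_conj, Complex.normSq_eq_norm_sq, Complex.norm_exp_ofReal_mul_I]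
    simp

theorem cnotMatrix_mem : cnotMatrix ∈ Matrix.unitaryGroup (Bool × Bool) ℂ := by
  rw [Matrix.mem_unitaryGroup_iff]
  ext ⟨a, b⟩ ⟨c, e⟩
  cases a <;> cases b <;> cases c <;> cases e <;>
    simp [Matrix.mul_apply, Matrix.star_apply, cnotMatrix, Fintype.sum_prod_type]

section Compile

variable {N r d : ℕ} (w : ℕ) {a : Fin N → ℕ}

/-- The qubit with a given name, if it exists. -/
def Addr.resolve : Addr → Option (Qubit N r d w a)
  | .data j k => if h : j < N ∧ k < d then some (.data ⟨j, h.1⟩ ⟨k, h.2⟩) else none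
  | .arg i l k =>
      if h : i < N ∧ l < r ∧ k < d then some (.arg ⟨i, h.1⟩ ⟨l, h.2.1⟩ ⟨k, h.2.2⟩) else none
  | .target i => if h : i < N then some (.target ⟨i, h⟩) else none
  | .found i => if h : i < N then some (.found ⟨i, h⟩) else none
  | .out i l b =>
      if h : i < N ∧ l < r ∧ b < Nat.clog 2 N then some (.out ⟨i, h.1⟩ ⟨l, h.2.1⟩ ⟨b, h.2.2⟩)
      else none
  | .scratch t => if h : t < w then some (.scratch ⟨t, h⟩) else none

/-- The gate meant by an elementary instruction (none, if it names a qubit that is not there). -/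
noncomputable def BasicGate.resolve : BasicGate → Option (Gate (Qubit N r d w a))
  | .hadamard q => (q.resolve w).map fun q' => Gate.one q' ⟨hadamardMatrix, hadamardMatrix_mem⟩
  | .phaseT q => (q.resolve w).map fun q' => Gate.one q' ⟨phaseTMatrix, phaseTMatrix_mem⟩
  | .cnot p q => (p.resolve w).bind fun p' => (q.resolve w).map fun q' =>
      Gate.two p' q' ⟨cnotMatrix, cnotMatrix_mem⟩

/-- Where the qubits of the `i`-th predicate circuit sit. -/
def embed (i : Fin N) : OracleQubit r d (a i) → Qubit N r d w a
  | .arg l k => .arg i l k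
  | .target => .target i
  | .anc t => .anc i t

/-- The `N` predicate circuits, run in parallel. -/
def queryCircuit (A : ∀ i, Circuit (OracleQubit r d (a i))) : Circuit (Qubit N r d w a) :=
  (List.range (Finset.univ.sup fun i => (A i).depth)).map fun t =>
    (List.finRange N).flatMap fun i => ((A i).getD t []).map (Gate.map (embed w i))

/-- The circuit of one instruction. -/
noncomputable def Step.compile (A : ∀ i, Circuit (OracleQubit r d (a i))) :
    Step → Circuit (Qubit N r d w a)
  | .gates l => [l.filterMap (BasicGate.resolve w)]
  | .query => queryCircuit w A

end Compile

/-- The circuit of an algorithm, for given circuits `A i` of the predicates. -/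
noncomputable def Program.compile {N r d : ℕ} {a : Fin N → ℕ} (P : Program)
    (A : ∀ i, Circuit (OracleQubit r d (a i))) : Circuit (Qubit N r d P.1 a) :=
  P.2.flatMap (Step.compile P.1 A)

/-- The initial basis state: the database in the data qubits, `0` elsewhere. -/
def Qubit.init {N r d w : ℕ} {a : Fin N → ℕ} (x : Fin N → Fin d → Bool) :
    Qubit N r d w a → Bool
  | .data j k => x j k
  | _ => false

/-- The measured bits `m` contain a correct answer for the `i`-th predicate: the flag is `1` and the
output registers of processor `i` hold (in binary) a solution, or the flag is `0` (which stands for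
the answer `no solution`) and there is no solution. -/
def CorrectAt {N r d w : ℕ} {a : Fin N → ℕ} (x : Fin N → Fin d → Bool)
    (α : (Fin r → Fin d → Bool) → Bool) (i : Fin N) (m : Qubit N r d w a → Bool) : Prop :=
  (m (.found i) = true ∧ ∃ s : Fin r → Fin N,
      (∀ l b, m (.out i l b) = (s l : ℕ).testBit b) ∧ α (fun l => x (s l)) = true) ∨
  (m (.found i) = false ∧ ∀ s : Fin r → Fin N, α (fun l => x (s l)) = false)

open Classical in
/-- The probability that, after the circuit `c` has been run on the database `x` and all qubits have
been measured in the computational basis, the answers for all `N` predicates are correct. -/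
noncomputable def successProb {N r d w : ℕ} {a : Fin N → ℕ} (c : Circuit (Qubit N r d w a))
    (x : Fin N → Fin d → Bool) (α : Fin N → (Fin r → Fin d → Bool) → Bool) : ℝ :=
  ∑ m : Qubit N r d w a → Bool,
    if ∀ i, CorrectAt x (α i) i m then ‖c.run (Ket.basis (Qubit.init x)) m‖ ^ 2 else 0

end MultiGrover

namespace MultiGrover

set_option linter.unusedSectionVars false

/-! ### Semantics of gate lists -/

section RunGates

variable {Q : Type} [DecidableEq Q]

/-! Each of the `N` processors runs its own Grover search on private index registers, and all
searches advance in lockstep. The depth is then that of a single search, provided that the `N`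
predicates can be evaluated together, for index registers in superposition, in polylogarithmic depth
and almost linear width. The difficulty is data access: `N * r` registers ask for database entries
at the same time, possibly for the same one.

Data access is solved by reversible routing. Table entries and requests are records in `2 ^ (m + 1)`
columns of scratch qubits. Sorting by address puts each table entry in front of the requests for it;
doubling shifts spread its payload to the right; sorting by column number returns the payloads to
the requests. Sorting is done by a bitonic network, whose correctness (`SortNet.net_sorted`) follows
from the 0-1 principle. The outcome is `view_lookupSlices`. All steps are X, CNOT and Toffoli
operations, each its own inverse, so the scratch space is cleaned by running them backwards.

Lookup, query, `Z` on the targets, query and reversed lookup together multiply a basis state by a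
product of signs, one for each processor (`exec_oraclePhase_indexState`). A test for zero gives the
other Grover phase in the same way. Such signs and Hadamard gates preserve product states
(`exec_phase_indexKet`, `runGates_roundBits`). Hence each register evolves as in the textbook
rotation `groverAmp_succ`, independently of the others, although the routing is shared; this is
`exec_groverRounds`.

The number of solutions is known only to be `0` or at least `M`, and it differs between processors.
The rounds therefore use `(3 ^ k - 1) / 2` iterations for all `k ≤ K`. Tripling the Grover angle
cannot jump over the interval from `π / 6` to `π / 2`, so for each solvable predicate some `k` gives
success probability at least `1 / 4` per round (`exists_quarter_le_sin_sq`). With `4 * (n + 1)`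
rounds for each `k`, where `N ≤ 2 ^ n`, the failure probability of one predicate is at most `1 / (2
* N)`. Independence of the processors (`sum_all_hit_eq`) and Bernoulli's inequality give total
success probability at least `1 / 2` (`half_le_sum_hit`).

There are no intermediate measurements. Every round has its own index registers, and at the end the
predicates are evaluated once more on all of them to record the first solution of each processor
(`exec_recordRounds`). A raised flag is thus always right, and the only possible error is a missed
solution. Register contents are read modulo `N`, so Hadamard gates prepare a usable uniform state;
because `2 * r * N ≤ 2 ^ m`, the rounding costs at most a factor of two in the density of solutions
(`half_le_density`).

For the cost, `3 ^ K` is at most `5 * √(N ^ r / M)` (`three_pow_maxExponent_le`), while all other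
factors of the depth, and the width divided by `N`, are polynomial in `parameterSum` and in the size
of the given circuits (`searchProgram_bounds`). The program is primitive recursive in its
parameters. -/

/-- The action of a list of gates, the head of the list being applied first. -/
def runGates (l : List (Gate Q)) (ψ : Ket Q) : Ket Q := l.foldl (fun φ g => g.apply φ) ψ

theorem Circuit.run_eq_runGates (c : Circuit Q) (ψ : Ket Q) : c.run ψ = runGates c.flatten ψ := rfl

@[simp] theorem runGates_nil (ψ : Ket Q) : runGates [] ψ = ψ := rfl

@[simp] theorem runGates_cons (g : Gate Q) (l : List (Gate Q)) (ψ : Ket Q) :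
    runGates (g :: l) ψ = runGates l (g.apply ψ) := rfl

theorem runGates_append (l₁ l₂ : List (Gate Q)) (ψ : Ket Q) :
    runGates (l₁ ++ l₂) ψ = runGates l₂ (runGates l₁ ψ) := by
  simp [runGates, List.foldl_append]

theorem Gate.apply_add (g : Gate Q) (φ ψ : Ket Q) : g.apply (φ + ψ) = g.apply φ + g.apply ψ := by
  cases g <;> ext s <;> simp only [Gate.apply, Pi.add_apply, mul_add, Finset.sum_add_distrib]

theorem Gate.apply_smul (g : Gate Q) (z : ℂ) (ψ : Ket Q) : g.apply (z • ψ) = z • g.apply ψ := by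
  cases g <;> ext s <;>
    simp only [Gate.apply, Pi.smul_apply, smul_eq_mul, Finset.mul_sum, mul_left_comm z]

theorem runGates_add (l : List (Gate Q)) (φ ψ : Ket Q) :
    runGates l (φ + ψ) = runGates l φ + runGates l ψ := by
  induction l generalizing φ ψ with
  | nil => rfl
  | cons g l ih => simp [Gate.apply_add, ih]

theorem runGates_smul (l : List (Gate Q)) (z : ℂ) (ψ : Ket Q) :
    runGates l (z • ψ) = z • runGates l ψ := by
  induction l generalizing ψ with
  | nil => rfl
  | cons g l ih => simp [Gate.apply_smul, ih]

theorem runGates_zero (l : List (Gate Q)) : runGates l (0 : Ket Q) = 0 := by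
  simpa using runGates_smul l 0 (0 : Ket Q)

theorem runGates_sum {ι : Type*} (l : List (Gate Q)) (s : Finset ι) (f : ι → Ket Q) :
    runGates l (∑ i ∈ s, f i) = ∑ i ∈ s, runGates l (f i) := by
  classical
  induction s using Finset.induction_on with
  | empty => simp [runGates_zero]
  | insert i s hi ih => rw [Finset.sum_insert hi, Finset.sum_insert hi, runGates_add, ih]

theorem update_swap {p q : Q} (h : p ≠ q) (s : Q → Bool) (a b : Bool) :
    Function.update (Function.update s p a) q b = Function.update (Function.update s q b) p a :=
  Function.update_comm h a b s

/-- Gates with disjoint supports commute. -/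
theorem Gate.apply_comm {g h : Gate Q} (H : Disjoint g.support h.support) (ψ : Ket Q) :
    g.apply (h.apply ψ) = h.apply (g.apply ψ) := by
  cases g with
  | one q U =>
    cases h with
    | one q' V =>
      have h1 : q ≠ q' := by simpa [Gate.support] using H
      ext s
      simp only [Gate.apply, Finset.mul_sum]
      rw [Finset.sum_comm]
      refine Finset.sum_congr rfl fun a _ => Finset.sum_congr rfl fun b _ => ?_
      rw [Function.update_of_ne h1, Function.update_of_ne h1.symm, update_swap h1]
      ring
    | two p' q' V =>
      have h1 : q ≠ p' ∧ q ≠ q' := by simpa [Gate.support] using H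
      ext s
      simp only [Gate.apply, Finset.mul_sum]
      rw [Finset.sum_comm]
      refine Finset.sum_congr rfl fun a _ => Finset.sum_congr rfl fun b _ => ?_
      rw [Function.update_of_ne h1.1.symm, Function.update_of_ne h1.2.symm,
        Function.update_of_ne h1.2, Function.update_of_ne h1.1,
        update_swap h1.1 _ b, update_swap h1.2 _ b]
      ring
  | two p q U =>
    cases h with
    | one q' V =>
      have h1 : p ≠ q' ∧ q ≠ q' := by
        simp only [Gate.support, Finset.disjoint_singleton_right, Finset.mem_insert,
          Finset.mem_singleton, not_or] at H
        exact ⟨H.1 ∘ Eq.symm, H.2 ∘ Eq.symm⟩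
      ext s
      simp only [Gate.apply, Finset.mul_sum]
      rw [Finset.sum_comm]
      refine Finset.sum_congr rfl fun a _ => Finset.sum_congr rfl fun b _ => ?_
      rw [Function.update_of_ne h1.1, Function.update_of_ne h1.2,
        Function.update_of_ne h1.2.symm, Function.update_of_ne h1.1.symm,
        update_swap h1.2, update_swap h1.1]
      ring
    | two p' q' V =>
      have h1 : (p' ≠ p ∧ p' ≠ q) ∧ (q' ≠ p ∧ q' ≠ q) := by
        simpa [Gate.support] using H
      obtain ⟨⟨h1, h2⟩, h3, h4⟩ := h1
      ext s
      simp only [Gate.apply, Finset.mul_sum]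
      rw [Finset.sum_comm]
      refine Finset.sum_congr rfl fun a _ => Finset.sum_congr rfl fun b _ => ?_
      rw [Function.update_of_ne h2, Function.update_of_ne h1,
        Function.update_of_ne h4, Function.update_of_ne h3,
        Function.update_of_ne h3.symm, Function.update_of_ne h1.symm,
        Function.update_of_ne h4.symm, Function.update_of_ne h2.symm,
        update_swap h2.symm _ b.2, update_swap h1.symm _ b.1,
        update_swap h4.symm _ b.2, update_swap h3.symm _ b.1]
      ring

theorem runGates_comm_apply {g : Gate Q} {l : List (Gate Q)}
    (H : ∀ h ∈ l, Disjoint g.support h.support) (ψ : Ket Q) :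
    runGates l (g.apply ψ) = g.apply (runGates l ψ) := by
  induction l generalizing ψ with
  | nil => rfl
  | cons h l ih =>
    simp only [List.mem_cons, forall_eq_or_imp] at H
    rw [runGates_cons, runGates_cons, ← Gate.apply_comm H.1, ih H.2]

theorem runGates_comm {l₁ l₂ : List (Gate Q)}
    (H : ∀ g ∈ l₁, ∀ h ∈ l₂, Disjoint g.support h.support) (ψ : Ket Q) :
    runGates l₂ (runGates l₁ ψ) = runGates l₁ (runGates l₂ ψ) := by
  induction l₁ generalizing ψ with
  | nil => rfl
  | cons g l ih =>
    simp only [List.mem_cons, forall_eq_or_imp] at H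
    rw [runGates_cons, runGates_cons, ih H.2, runGates_comm_apply H.1]

/-- Each block of `g` may be moved past all later blocks of `f`. This is the inductive step for
replacing parallel execution by sequential execution. -/
theorem runGates_flatMap_append {ι : Type*} (ts : List ι) (f g : ι → List (Gate Q))
    (H : ∀ t ∈ ts, ∀ t' ∈ ts, ∀ x ∈ f t, ∀ y ∈ g t', Disjoint x.support y.support) (ψ : Ket Q) :
    runGates (ts.flatMap fun t => f t ++ g t) ψ =
      runGates (ts.flatMap g) (runGates (ts.flatMap f) ψ) := by
  induction ts generalizing ψ with
  | nil => rfl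
  | cons t ts ih =>
    simp only [List.flatMap_cons, runGates_append]
    rw [ih fun a ha b hb => H a (List.mem_cons_of_mem _ ha) b (List.mem_cons_of_mem _ hb),
      runGates_comm (l₁ := g t)]
    intro x hx y hy
    obtain ⟨t', ht', hy⟩ := List.mem_flatMap.1 hy
    exact (H t' (List.mem_cons_of_mem _ ht') t List.mem_cons_self y hy x hx).symm

/-- Padding with empty time slices adds no gates, so circuits of different depths can share one
clock. -/
theorem flatMap_range_getD (c : List (List (Gate Q))) {L : ℕ} (hL : c.length ≤ L) :
    ((List.range L).flatMap fun t => c.getD t []) = c.flatten := by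
  induction c generalizing L with
  | nil => simp
  | cons l c ih =>
    obtain ⟨L, rfl⟩ : ∃ L', L = L' + 1 := ⟨L - 1, by simp at hL; omega⟩
    rw [List.range_succ_eq_map, List.flatMap_cons, List.flatMap_map]
    simp only [List.getD_cons_succ, List.getD_cons_zero, List.flatten_cons]
    rw [ih (by simpa using hL)]

/-- Circuits on disjoint sets of qubits may be run in parallel or one after the other. -/
theorem runGates_parallel {ι : Type*} (is : List ι) (c : ι → List (List (Gate Q))) {L : ℕ}
    (hL : ∀ i ∈ is, (c i).length ≤ L)
    (H : is.Pairwise fun i j => ∀ x ∈ (c i).flatten, ∀ y ∈ (c j).flatten,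
      Disjoint x.support y.support) (ψ : Ket Q) :
    runGates ((List.range L).flatMap fun t => is.flatMap fun i => (c i).getD t []) ψ =
      runGates (is.flatMap fun i => (c i).flatten) ψ := by
  have key : ∀ i t, ∀ x ∈ (c i).getD t [], x ∈ (c i).flatten := by
    intro i t x hx
    rw [List.getD_eq_getElem?_getD] at hx
    cases h : (c i)[t]? with
    | none => simp [h] at hx
    | some l =>
      rw [h] at hx
      exact List.mem_flatten.2 ⟨l, List.mem_of_getElem? h, hx⟩
  induction is generalizing ψ with
  | nil => simp [List.flatMap]
  | cons i is ih =>
    simp only [List.flatMap_cons]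
    rw [List.pairwise_cons] at H
    rw [runGates_flatMap_append, flatMap_range_getD _ (hL i List.mem_cons_self), runGates_append,
      ih (fun j hj => hL j (List.mem_cons_of_mem _ hj)) H.2]
    intro t _ t' _ x hx y hy
    obtain ⟨j, hj, hy⟩ := List.mem_flatMap.1 hy
    exact H.1 j hj x (key i t x hx) y (key j t' y hy)

end RunGates

/-! ### Embedding a register into a larger one -/

section Extend

variable {Q₁ Q₂ : Type} [DecidableEq Q₁] [DecidableEq Q₂]

/-- The basis states `m` and `s` agree off the range of `f`. -/
def AgreeOff (f : Q₁ → Q₂) (s m : Q₂ → Bool) : Prop := ∀ q, q ∉ Set.range f → m q = s q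

open Classical in
/-- The state that is `ψ` on the qubits in the range of `f`, and the basis state `s` elsewhere. -/
noncomputable def Ket.extend (f : Q₁ → Q₂) (s : Q₂ → Bool) (ψ : Ket Q₁) : Ket Q₂ :=
  fun m => if AgreeOff f s m then ψ (m ∘ f) else 0

/-- Updating a qubit in the range of `f` does not affect agreement with `s` off the range, and by
injectivity it pulls back to the update of a single qubit. -/
theorem Gate.map_apply_extend {f : Q₁ → Q₂} (hf : Function.Injective f) (s : Q₂ → Bool)
    (g : Gate Q₁) (ψ : Ket Q₁) :
    (g.map f).apply (Ket.extend f s ψ) = Ket.extend f s (g.apply ψ) := by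
  classical
  have h1 : ∀ (m : Q₂ → Bool) (q : Q₁) (a : Bool),
      AgreeOff f s (Function.update m (f q) a) ↔ AgreeOff f s m := by
    intro m q a
    refine forall₂_congr fun q' hq' => ?_
    rw [Function.update_of_ne]
    rintro rfl
    exact hq' ⟨q, rfl⟩
  have h2 : ∀ (m : Q₂ → Bool) (q : Q₁) (a : Bool),
      Function.update m (f q) a ∘ f = Function.update (m ∘ f) q a :=
    fun m q a => Function.update_comp_eq_of_injective m hf q a
  cases g with
  | one q U =>
    ext m
    simp only [Gate.map, Gate.apply, Ket.extend, h1, h2, Function.comp_apply]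
    split_ifs <;> simp
  | two p q U =>
    ext m
    simp only [Gate.map, Gate.apply, Ket.extend, h1, h2, Function.comp_apply]
    split_ifs <;> simp

theorem runGates_map_extend {f : Q₁ → Q₂} (hf : Function.Injective f) (s : Q₂ → Bool)
    (l : List (Gate Q₁)) (ψ : Ket Q₁) :
    runGates (l.map (Gate.map f)) (Ket.extend f s ψ) = Ket.extend f s (runGates l ψ) := by
  induction l generalizing ψ with
  | nil => rfl
  | cons g l ih => rw [List.map_cons, runGates_cons, Gate.map_apply_extend hf, ih, runGates_cons]

theorem eq_extend_iff {f : Q₁ → Q₂} (hf : Function.Injective f) (s m : Q₂ → Bool)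
    (t : Q₁ → Bool) :
    m = Function.extend f t s ↔ AgreeOff f s m ∧ m ∘ f = t := by
  constructor
  · rintro rfl
    refine ⟨fun q hq => Function.extend_apply' _ _ _ fun ⟨a, ha⟩ => hq ⟨a, ha⟩, ?_⟩
    ext q
    simp [hf.extend_apply]
  · rintro ⟨h1, rfl⟩
    ext q
    by_cases hq : q ∈ Set.range f
    · obtain ⟨a, rfl⟩ := hq
      simp [hf.extend_apply]
    · rw [h1 q hq, Function.extend_apply' _ _ _ fun ⟨a, ha⟩ => hq ⟨a, ha⟩]

variable [Fintype Q₁] [Fintype Q₂]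

theorem Ket.basis_apply {Q : Type} [Fintype Q] [DecidableEq Q] (s m : Q → Bool) :
    Ket.basis s m = if m = s then 1 else 0 := by
  simp [Ket.basis, Pi.single_apply]

theorem Ket.extend_basis {f : Q₁ → Q₂} (hf : Function.Injective f) (s : Q₂ → Bool)
    (t : Q₁ → Bool) :
    Ket.extend f s (Ket.basis t) = Ket.basis (Function.extend f t s) := by
  ext m
  rw [Ket.basis_apply, Ket.extend, Ket.basis_apply]
  classical
  rw [if_congr (eq_extend_iff hf s m t) rfl rfl]
  split_ifs <;> simp_all

theorem Ket.extend_sum {ι : Type*} (f : Q₁ → Q₂) (s : Q₂ → Bool) (I : Finset ι)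
    (z : ι → ℂ) (ψ : ι → Ket Q₁) :
    Ket.extend f s (∑ i ∈ I, z i • ψ i) = ∑ i ∈ I, z i • Ket.extend f s (ψ i) := by
  ext m
  simp only [Ket.extend, Finset.sum_apply, Pi.smul_apply, smul_eq_mul]
  split_ifs <;> simp

theorem Ket.eq_sum_basis {Q : Type} [Fintype Q] [DecidableEq Q] (ψ : Ket Q) :
    ψ = ∑ s, ψ s • Ket.basis s := by
  ext m
  simp [Finset.sum_apply, Ket.basis_apply]

theorem Ket.extend_eq_sum {f : Q₁ → Q₂} (hf : Function.Injective f) (s : Q₂ → Bool)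
    (ψ : Ket Q₁) :
    Ket.extend f s ψ = ∑ t, ψ t • Ket.basis (Function.extend f t s) := by
  conv_lhs => rw [Ket.eq_sum_basis ψ, Ket.extend_sum]
  simp_rw [Ket.extend_basis hf]

end Extend

/-! ### Reversible operations and their expansion into elementary gates -/

/-- Operations on wires labelled by `A` from which the algorithm is built. -/
inductive Op (A : Type)
  | nop
  | x (q : A)
  | z (q : A)
  | had (q : A)
  | cnot (p q : A)
  | tof (a b c : A)

namespace Op

/-- The wires of an operation. -/
def wires {A : Type} : Op A → List A
  | nop => []
  | x q => [q]
  | z q => [q]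
  | had q => [q]
  | cnot p q => [p, q]
  | tof a b c => [a, b, c]

/-- Relabelling of the wires. -/
def map {A B : Type} (f : A → B) : Op A → Op B
  | nop => nop
  | x q => x (f q)
  | z q => z (f q)
  | had q => had (f q)
  | cnot p q => cnot (f p) (f q)
  | tof a b c => tof (f a) (f b) (f c)

/-- Operations that permute the computational basis. -/
def IsClassical {A : Type} : Op A → Prop
  | z _ => False
  | had _ => False
  | _ => True

/-- The wire that a classical operation changes. -/
def target {A : Type} : Op A → Option A
  | x q => some q
  | cnot _ q => some q
  | tof _ _ c => some c
  | _ => none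

/-- The bit that a classical operation adds to its target. -/
def ctrl {A : Type} : Op A → (A → Bool) → Bool
  | x _, _ => true
  | cnot p _, s => s p
  | tof a b _, s => s a && s b
  | _, _ => false

/-- The action of a classical operation on bit assignments. -/
def act {A : Type} [DecidableEq A] (o : Op A) (s : A → Bool) : A → Bool :=
  match o.target with
  | some t => Function.update s t (s t ^^ o.ctrl s)
  | none => s

/-- An operation with distinct wires does not read its own target. For this reason classical
operations are involutions, and the operations of a slice can be evaluated independently. -/
theorem ctrl_congr {A : Type} (o : Op A) {s s' : A → Bool}
    (h : ∀ w ∈ o.wires, o.target ≠ some w → s w = s' w) (hn : o.wires.Nodup) :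
    o.ctrl s = o.ctrl s' := by
  cases o with
  | cnot p q =>
    have : q ≠ p := by simp [wires] at hn; tauto
    exact h p (by simp [wires]) (by simpa [target] using this)
  | tof a b c =>
    have : c ≠ a ∧ c ≠ b := by simp [wires] at hn; tauto
    simp only [ctrl]
    rw [h a (by simp [wires]) (by simpa [target] using this.1),
      h b (by simp [wires]) (by simpa [target] using this.2)]
  | _ => rfl

theorem target_mem_wires {A : Type} {o : Op A} {t : A} (h : o.target = some t) : t ∈ o.wires := by
  cases o <;> simp_all [target, wires]

theorem act_of_ne {A : Type} [DecidableEq A] (o : Op A) (s : A → Bool) {w : A}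
    (h : o.target ≠ some w) : o.act s w = s w := by
  unfold act
  cases ht : o.target with
  | none => rfl
  | some t => exact Function.update_of_ne (fun e => h (by rw [ht, e])) _ _

theorem act_of_target {A : Type} [DecidableEq A] (o : Op A) (s : A → Bool) {w : A}
    (h : o.target = some w) : o.act s w = (s w ^^ o.ctrl s) := by
  unfold act
  rw [h]
  exact Function.update_self _ _ _

theorem act_act {A : Type} [DecidableEq A] (o : Op A) (hn : o.wires.Nodup) (s : A → Bool) :
    o.act (o.act s) = s := by
  ext w
  by_cases h : o.target = some w
  · rw [act_of_target _ _ h, act_of_target _ _ h,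
      ctrl_congr o (s := o.act s) (s' := s) (fun v _ hv => act_of_ne _ _ hv) hn]
    simp
  · rw [act_of_ne _ _ h, act_of_ne _ _ h]

end Op

/-- The elementary gates of an operation. -/
def Op.basic : Op Addr → List BasicGate
  | nop => []
  | x q => .hadamard q :: (List.replicate 4 (.phaseT q) ++ [.hadamard q])
  | z q => List.replicate 4 (.phaseT q)
  | had q => [.hadamard q]
  | cnot p q => [.cnot p q]
  | tof a b c =>
      -- Between the Hadamard gates is a doubly controlled `Z`. It comes from `a + b + c - (a ⊕ b) -
      -- (b ⊕ c) - (a ⊕ c) + (a ⊕ b ⊕ c) = 4abc`, with one `T` for each plus sign and `T ^ 7 = T⁻¹`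
      -- for each minus sign.
      .hadamard c :: (([.phaseT a, .phaseT b, .phaseT c] ++
        (.cnot a b :: (List.replicate 7 (.phaseT b) ++ [.cnot a b])) ++
        (.cnot b c :: (List.replicate 7 (.phaseT c) ++ [.cnot b c])) ++
        (.cnot a c :: (List.replicate 7 (.phaseT c) ++ [.cnot a c])) ++
        (.cnot a b :: .cnot b c :: .phaseT c :: [.cnot b c, .cnot a b])) ++ [.hadamard c])

/-! ### Phases and permutations made of H, T and CNOT -/

section Gates

variable {Q : Type} [DecidableEq Q]

/-- The Hadamard gate on a qubit. -/
noncomputable def hGate (q : Q) : Gate Q := .one q ⟨hadamardMatrix, hadamardMatrix_mem⟩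

/-- The `T` gate on a qubit. -/
noncomputable def tGate (q : Q) : Gate Q := .one q ⟨phaseTMatrix, phaseTMatrix_mem⟩

/-- The controlled-not gate on two qubits. -/
noncomputable def cGate (p q : Q) : Gate Q := .two p q ⟨cnotMatrix, cnotMatrix_mem⟩

/-- The gates of an operation. -/
noncomputable def Op.gates : Op Q → List (Gate Q)
  | nop => []
  | x q => hGate q :: (List.replicate 4 (tGate q) ++ [hGate q])
  | z q => List.replicate 4 (tGate q)
  | had q => [hGate q]
  | cnot p q => [cGate p q]
  | tof a b c =>
      hGate c :: (([tGate a, tGate b, tGate c] ++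
        (cGate a b :: (List.replicate 7 (tGate b) ++ [cGate a b])) ++
        (cGate b c :: (List.replicate 7 (tGate c) ++ [cGate b c])) ++
        (cGate a c :: (List.replicate 7 (tGate c) ++ [cGate a c])) ++
        (cGate a b :: cGate b c :: tGate c :: [cGate b c, cGate a b])) ++ [hGate c])

/-- The primitive eighth root of unity in the `T` gate. -/
noncomputable def omega : ℂ := Complex.exp ((Real.pi / 4 : ℝ) * Complex.I)

theorem omega_pow_four : omega ^ 4 = -1 := by
  rw [omega, ← Complex.exp_nat_mul, ← Complex.exp_pi_mul_I]
  congr 1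
  push_cast
  ring

theorem hGate_apply (q : Q) (ψ : Ket Q) (s : Q → Bool) :
    (hGate q).apply ψ s = ((Real.sqrt 2 : ℝ) : ℂ)⁻¹ *
      (ψ (Function.update s q false) +
        (if s q then -1 else 1) * ψ (Function.update s q true)) := by
  simp only [hGate, Gate.apply, Fintype.sum_bool, hadamardMatrix]
  cases s q <;> simp <;> ring

theorem tGate_apply (q : Q) (ψ : Ket Q) (s : Q → Bool) :
    (tGate q).apply ψ s = (if s q then omega else 1) * ψ s := by
  have : Function.update s q (s q) = s := Function.update_eq_self _ _
  simp only [tGate, Gate.apply, Fintype.sum_bool, phaseTMatrix, Matrix.diagonal_apply, omega]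
  cases h : s q <;> rw [h] at this <;> simp [this]

theorem cGate_apply {p q : Q} (_hpq : p ≠ q) (ψ : Ket Q) (s : Q → Bool) :
    (cGate p q).apply ψ s = ψ (Function.update s q (s q ^^ s p)) := by
  have : ∀ b, Function.update (Function.update s p (s p)) q b = Function.update s q b := by
    simp [Function.update_eq_self]
  simp only [cGate, Gate.apply, Fintype.sum_prod_type, Fintype.sum_bool, cnotMatrix]
  cases h : s p <;> cases h' : s q <;> simp [← this, h]

/-- The gate list multiplies amplitudes by a phase. -/
def IsDiag (l : List (Gate Q)) (f : (Q → Bool) → ℂ) : Prop :=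
  ∀ ψ s, runGates l ψ s = f s * ψ s

theorem IsDiag.append {l₁ l₂ : List (Gate Q)} {f₁ f₂ : (Q → Bool) → ℂ} (h₁ : IsDiag l₁ f₁)
    (h₂ : IsDiag l₂ f₂) : IsDiag (l₁ ++ l₂) (fun s => f₁ s * f₂ s) := by
  intro ψ s
  rw [runGates_append, h₂, h₁]
  ring

theorem isDiag_phaseT (q : Q) : IsDiag [tGate q] (fun s => if s q then omega else 1) :=
  fun ψ s => tGate_apply q ψ s

theorem isDiag_replicate (q : Q) (n : ℕ) :
    IsDiag (List.replicate n (tGate q)) (fun s => if s q then omega ^ n else 1) := by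
  induction n with
  | zero => intro ψ s; simp
  | succ n ih =>
    intro ψ s
    rw [List.replicate_succ, runGates_cons, ih, tGate_apply]
    by_cases h : s q = true <;> simp [h]
    ring

/-- The first CNOT puts `q ⊕ p` in place of `q`, so that the phase can be applied to a parity, and
the second restores the basis state. -/
theorem IsDiag.conj {l : List (Gate Q)} {f : (Q → Bool) → ℂ} (h : IsDiag l f) {p q : Q}
    (hpq : p ≠ q) : IsDiag (cGate p q :: (l ++ [cGate p q]))
      (fun s => f (Function.update s q (s q ^^ s p))) := by
  intro ψ s
  rw [runGates_cons, runGates_append, runGates_cons, runGates_nil, cGate_apply hpq, h,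
    cGate_apply hpq]
  congr 2
  rw [Function.update_idem, Function.update_self, Function.update_of_ne hpq]
  simp

/-- In the Hadamard basis of `q` a sign controlled by `g` becomes a bit flip controlled by `g`,
because `g` takes the same value on both branches of `q`. Constant `g` gives X, and a conjunction
gives the Toffoli gate. -/
theorem IsDiag.hadamard_conj {l : List (Gate Q)} {q : Q} {g : (Q → Bool) → Bool}
    (h : IsDiag l (fun s => if s q && g s then -1 else 1))
    (hg : ∀ s a, g (Function.update s q a) = g s) (ψ : Ket Q) :
    runGates (hGate q :: (l ++ [hGate q])) ψ =
      fun s => ψ (Function.update s q (s q ^^ g s)) := by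
  ext s
  have hs : ((Real.sqrt 2 : ℝ) : ℂ)⁻¹ * ((Real.sqrt 2 : ℝ) : ℂ)⁻¹ = 1 / 2 := by
    rw [← mul_inv, ← Complex.ofReal_mul, Real.mul_self_sqrt (by norm_num)]; norm_num
  rw [runGates_cons, runGates_append, runGates_cons, runGates_nil, hGate_apply, h, h,
    hGate_apply, hGate_apply]
  simp only [hg, Function.update_self, Function.update_idem]
  cases h1 : g s <;> cases h2 : s q <;> simp
  · linear_combination (2 * ψ (Function.update s q false)) * hs
  · linear_combination (2 * ψ (Function.update s q true)) * hs
  · linear_combination (2 * ψ (Function.update s q true)) * hs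
  · linear_combination (2 * ψ (Function.update s q false)) * hs

theorem isDiag_z (q : Q) : IsDiag (Op.z q).gates (fun s => if s q then -1 else 1) := by
  have := isDiag_replicate q 4
  rwa [omega_pow_four] at this

theorem IsDiag.congr {l : List (Gate Q)} {f g : (Q → Bool) → ℂ} (h : IsDiag l f)
    (hfg : ∀ s, f s = g s) : IsDiag l g := by
  obtain rfl : f = g := funext hfg
  exact h

/-- A classical operation permutes the amplitudes. -/
theorem runGates_gates_of_isClassical {o : Op Q} (hc : o.IsClassical) (hn : o.wires.Nodup)
    (ψ : Ket Q) : runGates o.gates ψ = fun s => ψ (o.act s) := by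
  have o7 : omega ^ 8 = 1 := by
    rw [show omega ^ 8 = (omega ^ 4) ^ 2 by ring, omega_pow_four]; norm_num
  cases o with
  | nop => rfl
  | x q =>
    exact IsDiag.hadamard_conj (g := fun _ => true)
      ((isDiag_z q).congr fun s => by simp) (fun _ _ => rfl) ψ
  | z q => exact hc.elim
  | had q => exact hc.elim
  | cnot p q =>
    have hpq : p ≠ q := by simpa [Op.wires] using hn
    ext s
    exact cGate_apply hpq ψ s
  | tof a b c =>
    have hn : (a ≠ b ∧ a ≠ c) ∧ b ≠ c := by simpa [Op.wires] using hn
    obtain ⟨⟨hab, hac⟩, hbc⟩ := hn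
    refine IsDiag.hadamard_conj (g := fun s => s a && s b) (IsDiag.congr
      ((((((isDiag_phaseT a).append (isDiag_phaseT b)).append (isDiag_phaseT c)).append
      ((isDiag_replicate b 7).conj hab)).append ((isDiag_replicate c 7).conj hbc)).append
      ((isDiag_replicate c 7).conj hac) |>.append (((isDiag_phaseT c).conj hbc).conj hab))
      fun s => ?_) (fun s e => ?_) ψ
    · simp only [Function.update_self, Function.update_of_ne hbc.symm]
      -- The total exponent of `omega` is 0 if no bit is set, 16 if one or two are set, and 4 if all
      -- three are set.
      cases s a <;> cases s b <;> cases s c <;> simp [← pow_succ, ← pow_succ', o7]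
      · linear_combination (omega ^ 8 + 1) * o7
      · linear_combination (omega ^ 8 + 1) * o7
      · linear_combination (omega ^ 8 + 1) * o7
      · linear_combination omega_pow_four
    · simp [hac, hbc]

end Gates

theorem Gate.support_map {Q₁ Q₂ : Type} [DecidableEq Q₁] [DecidableEq Q₂] (f : Q₁ → Q₂)
    (g : Gate Q₁) : (g.map f).support = g.support.image f := by
  cases g <;> simp [Gate.map, Gate.support, Finset.image_insert]

theorem Gate.IsValid.map {Q₁ Q₂ : Type} {f : Q₁ → Q₂} (hf : Function.Injective f)
    {g : Gate Q₁} (hg : g.IsValid) : (g.map f).IsValid := by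
  cases g with
  | one q U => trivial
  | two p q U => exact fun h => hg (hf h)

namespace Op

theorem support_subset_wires {Q : Type} [DecidableEq Q] (o : Op Q) {g : Gate Q}
    (hg : g ∈ o.gates) : ∀ q ∈ g.support, q ∈ o.wires := by
  cases o <;>
    simp only [Op.gates, List.mem_append, List.mem_cons, List.mem_replicate, List.not_mem_nil,
      or_false, ne_eq] at hg
  case x q => rcases hg with rfl | ⟨-, rfl⟩ | rfl <;> simp [hGate, tGate, Gate.support, wires]
  case z q => rcases hg with ⟨-, rfl⟩; simp [tGate, Gate.support, wires]
  case had q => subst hg; simp [hGate, Gate.support, wires]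
  case cnot p q => subst hg; simp [cGate, Gate.support, wires]
  case tof a b c =>
    have : g = hGate c ∨ g = tGate a ∨ g = tGate b ∨ g = tGate c ∨ g = cGate a b ∨
      g = cGate b c ∨ g = cGate a c := by tauto
    rcases this with rfl | rfl | rfl | rfl | rfl | rfl | rfl <;>
      simp [hGate, tGate, cGate, Gate.support, wires]

theorem isValid_of_mem_gates {Q : Type} [DecidableEq Q] {o : Op Q} (hn : o.wires.Nodup)
    {g : Gate Q} (hg : g ∈ o.gates) : g.IsValid := by
  cases o <;>
    simp only [Op.gates, List.mem_append, List.mem_cons, List.mem_replicate, List.not_mem_nil,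
      or_false, ne_eq] at hg
  case x q => rcases hg with rfl | ⟨-, rfl⟩ | rfl <;> trivial
  case z q => rcases hg with ⟨-, rfl⟩; trivial
  case had q => subst hg; trivial
  case cnot p q => subst hg; exact (by simpa [wires] using hn : p ≠ q)
  case tof a b c =>
    have : g = hGate c ∨ g = tGate a ∨ g = tGate b ∨ g = tGate c ∨ g = cGate a b ∨
      g = cGate b c ∨ g = cGate a c := by tauto
    simp only [wires, List.nodup_cons, List.mem_cons, List.not_mem_nil, or_false, not_or] at hn
    rcases this with rfl | rfl | rfl | rfl | rfl | rfl | rfl <;>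
      first | trivial | exact hn.1.1 | exact hn.2.1 | exact hn.1.2

/-- The longest expansion is that of the Toffoli gate, with 37 gates. The bound 40 is the number of
time slices reserved for a slice of operations. -/
theorem length_gates_le {Q : Type} (o : Op Q) [DecidableEq Q] : o.gates.length ≤ 40 := by
  cases o <;> simp [Op.gates]

theorem wires_map {A B : Type} (f : A → B) (o : Op A) : (o.map f).wires = o.wires.map f := by
  cases o <;> rfl

theorem IsClassical.map {A B : Type} (f : A → B) {o : Op A} (h : o.IsClassical) :
    (o.map f).IsClassical := by
  cases o <;> trivial

end Op

/-! ### Slices of operations -/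

/-- The instructions for a slice of operations on disjoint sets of wires. -/
def sliceSteps (l : List (Op Addr)) : List Step :=
  (List.range 40).map fun t => Step.gates (l.filterMap fun o => o.basic[t]?)

/-- An instruction: a slice of operations, or a call of the predicate circuits. -/
abbrev Instr := Option (List (Op Addr))

/-- The expansion of an instruction. -/
def Instr.steps (c : Instr) : List Step := c.elim [Step.query] sliceSteps

/-- The names of qubits that exist. -/
def Addr.InRange (N r d w : ℕ) : Addr → Prop
  | .data j k => j < N ∧ k < d
  | .arg i l k => i < N ∧ l < r ∧ k < d
  | .target i => i < N
  | .found i => i < N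
  | .out i l b => i < N ∧ l < r ∧ b < Nat.clog 2 N
  | .scratch t => t < w

/-- An operation whose wires exist and are distinct. -/
def Op.Valid (N r d w : ℕ) (o : Op Addr) : Prop :=
  (∀ q ∈ o.wires, q.InRange N r d w) ∧ o.wires.Nodup

/-- A slice of operations whose wires exist and are distinct. -/
def SliceValid (N r d w : ℕ) (l : List (Op Addr)) : Prop :=
  (∀ o ∈ l, o.Valid N r d w) ∧ l.Pairwise fun o o' => o.wires.Disjoint o'.wires

/-! ### From names to qubits: the circuit of a slice -/

section Compile

variable {N r d w : ℕ} {a : Fin N → ℕ}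

/-- The qubit with a given name, with a default value. -/
def Addr.get (q₀ : Qubit N r d w a) (q : Addr) : Qubit N r d w a := (q.resolve w).getD q₀

/-- The bit assignment to the qubits given by a bit assignment to the names; the ancillas of the
predicate circuits are `0`. -/
def Qubit.lift (σ : Addr → Bool) : Qubit N r d w a → Bool
  | .data j k => σ (.data j k)
  | .arg i l k => σ (.arg i l k)
  | .target i => σ (.target i)
  | .found i => σ (.found i)
  | .out i l b => σ (.out i l b)
  | .scratch t => σ (.scratch t)
  | .anc _ _ => false

theorem Addr.resolve_of_inRange {q : Addr} (h : q.InRange N r d w) (q₀ : Qubit N r d w a) :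
    q.resolve w = some (q.get q₀) := by
  cases q <;> simp only [Addr.InRange] at h <;> simp [Addr.get, Addr.resolve, h]

/-- On existing names the default `q₀` never occurs, and the constructors of names and qubits match.
-/
theorem Addr.get_injOn (q₀ : Qubit N r d w a) {p q : Addr} (hp : p.InRange N r d w)
    (hq : q.InRange N r d w) (h : p.get q₀ = q.get q₀) : p = q := by
  cases p <;> cases q <;> simp only [Addr.InRange] at hp hq <;>
    simp_all [Addr.get, Addr.resolve]

theorem Qubit.lift_get (σ : Addr → Bool) (q₀ : Qubit N r d w a) {q : Addr}
    (h : q.InRange N r d w) : Qubit.lift σ (q.get q₀) = σ q := by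
  cases q <;> simp only [Addr.InRange] at h <;> simp [Addr.get, Addr.resolve, h, Qubit.lift]

/-- A qubit is an ancilla or has a name. -/
theorem Qubit.exists_name (q₀ q : Qubit N r d w a) :
    (∃ i t, q = .anc i t) ∨ ∃ p : Addr, p.InRange N r d w ∧ p.get q₀ = q := by
  cases q with
  | data j k => exact .inr ⟨.data j k, ⟨j.2, k.2⟩, by simp [Addr.get, Addr.resolve]⟩
  | arg i l k => exact .inr ⟨.arg i l k, ⟨i.2, l.2, k.2⟩, by simp [Addr.get, Addr.resolve]⟩
  | target i => exact .inr ⟨.target i, i.2, by simp [Addr.get, Addr.resolve]⟩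
  | found i => exact .inr ⟨.found i, i.2, by simp [Addr.get, Addr.resolve]⟩
  | out i l b => exact .inr ⟨.out i l b, ⟨i.2, l.2, b.2⟩, by simp [Addr.get, Addr.resolve]⟩
  | scratch t => exact .inr ⟨.scratch t, t.2, by simp [Addr.get, Addr.resolve]⟩
  | anc i t => exact .inl ⟨i, t, rfl⟩

theorem Addr.get_ne_anc (q₀ : Qubit N r d w a) {q : Addr} (h : q.InRange N r d w) (i : Fin N)
    (t : Fin (a i)) : q.get q₀ ≠ .anc i t := by
  cases q <;> simp only [Addr.InRange] at h <;> simp [Addr.get, Addr.resolve, h]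

instance : DecidableEq Addr := fun _ _ => decidable_of_iff _ Addr.equiv.apply_eq_iff_eq

theorem Qubit.lift_update (σ : Addr → Bool) (q₀ : Qubit N r d w a) {q : Addr}
    (h : q.InRange N r d w) (b : Bool) :
    Qubit.lift (Function.update σ q b) = Function.update (Qubit.lift σ) (q.get q₀) b := by
  ext q'
  rcases Qubit.exists_name q₀ q' with ⟨i, t, rfl⟩ | ⟨p, hp, rfl⟩
  · rw [Function.update_of_ne (Addr.get_ne_anc q₀ h i t).symm]
    rfl
  · rw [Qubit.lift_get _ _ hp]
    by_cases e : p = q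
    · subst e; simp
    · rw [Function.update_of_ne e, Function.update_of_ne fun e' => e (Addr.get_injOn q₀ hp h e'),
        Qubit.lift_get _ _ hp]

/-- Both sides change the same target by the same control bit. This allows all classical reasoning
to take place on assignments to names, where no bounds have to be carried along. -/
theorem Op.lift_act (q₀ : Qubit N r d w a) {o : Op Addr} (h : o.Valid N r d w)
    (σ : Addr → Bool) : Qubit.lift (o.act σ) = (o.map (Addr.get q₀)).act (Qubit.lift σ) := by
  obtain ⟨h, -⟩ := h
  cases o with
  | x q =>
    have hq := h q (by simp [Op.wires])
    simp [Op.act, Op.target, Op.ctrl, Op.map, Qubit.lift_update _ q₀ hq, Qubit.lift_get _ q₀ hq]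
  | cnot p q =>
    have hq := h q (by simp [Op.wires])
    have hp := h p (by simp [Op.wires])
    simp [Op.act, Op.target, Op.ctrl, Op.map, Qubit.lift_update _ q₀ hq, Qubit.lift_get _ q₀ hq,
      Qubit.lift_get _ q₀ hp]
  | tof p q t =>
    have hq := h q (by simp [Op.wires])
    have hp := h p (by simp [Op.wires])
    have ht := h t (by simp [Op.wires])
    simp [Op.act, Op.target, Op.ctrl, Op.map, Qubit.lift_update _ q₀ ht, Qubit.lift_get _ q₀ hq,
      Qubit.lift_get _ q₀ hp, Qubit.lift_get _ q₀ ht]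
  | _ => rfl

theorem Op.basic_resolve (q₀ : Qubit N r d w a) {o : Op Addr}
    (h : ∀ q ∈ o.wires, q.InRange N r d w) :
    o.basic.map (BasicGate.resolve w) = (o.map (Addr.get q₀)).gates.map some := by
  have key := fun q hq => Addr.resolve_of_inRange (h q hq) q₀
  cases o <;> simp only [Op.wires, List.mem_cons, List.not_mem_nil, or_false,
    forall_eq_or_imp, forall_eq] at key <;>
    simp [Op.basic, Op.gates, BasicGate.resolve, key, Op.map, hGate, tGate, cGate,
      List.replicate_succ]

theorem Op.nodup_wires_map (q₀ : Qubit N r d w a) {o : Op Addr} (h : o.Valid N r d w) :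
    (o.map (Addr.get q₀)).wires.Nodup := by
  rw [Op.wires_map]
  exact List.Nodup.map_on (fun p hp q hq e => Addr.get_injOn q₀ (h.1 p hp) (h.1 q hq) e) h.2

/-- Each operation becomes a circuit with one gate per time slice, which is the shape that
`runGates_parallel` expects. -/
theorem compile_sliceSteps (q₀ : Qubit N r d w a) {l : List (Op Addr)}
    (h : ∀ o ∈ l, o.Valid N r d w) (A : ∀ i, Circuit (OracleQubit r d (a i))) :
    (sliceSteps l).flatMap (Step.compile w A) = (List.range 40).map fun t =>
      l.flatMap fun o => ((o.map (Addr.get q₀)).gates.map fun g => [g]).getD t [] := by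
  rw [sliceSteps, List.flatMap_map]
  simp only [Step.compile]
  rw [← List.map_eq_flatMap]
  refine List.map_congr_left fun t _ => ?_
  rw [List.filterMap_filterMap, List.filterMap_eq_flatMap_toList]
  refine List.flatMap_congr fun o ho => ?_
  have := congrArg (·[t]?) (Op.basic_resolve q₀ (h o ho).1)
  simp only [List.getElem?_map] at this
  rw [List.getD_eq_getElem?_getD, List.getElem?_map]
  cases hb : o.basic[t]? <;> cases hg : (Op.map (Addr.get q₀) o).gates[t]? <;>
    simp_all

theorem mem_getD_singletons {α : Type*} {l : List α} {t : ℕ} {x : α}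
    (h : x ∈ (l.map fun g => [g]).getD t []) : x ∈ l := by
  rw [List.getD_eq_getElem?_getD, List.getElem?_map] at h
  cases hl : l[t]? with
  | none => simp [hl] at h
  | some y =>
    simp only [hl, Option.map_some, Option.getD_some, List.mem_singleton] at h
    exact h ▸ List.mem_of_getElem? hl

theorem disjoint_support_of_slice (q₀ : Qubit N r d w a) {o o' : Op Addr}
    (h : o.Valid N r d w) (h' : o'.Valid N r d w) (hd : o.wires.Disjoint o'.wires)
    {x y : Gate (Qubit N r d w a)} (hx : x ∈ (o.map (Addr.get q₀)).gates)
    (hy : y ∈ (o'.map (Addr.get q₀)).gates) : Disjoint x.support y.support := by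
  rw [Finset.disjoint_left]
  intro q hq hq'
  have h1 := Op.support_subset_wires _ hx q hq
  have h2 := Op.support_subset_wires _ hy q hq'
  rw [Op.wires_map, List.mem_map] at h1 h2
  obtain ⟨p, hp, rfl⟩ := h1
  obtain ⟨p', hp', e⟩ := h2
  obtain rfl := Addr.get_injOn q₀ (h'.1 p' hp') (h.1 p hp) e
  exact hd hp hp'

theorem isValid_sliceSteps (q₀ : Qubit N r d w a) {l : List (Op Addr)}
    (h : SliceValid N r d w l) (A : ∀ i, Circuit (OracleQubit r d (a i))) :
    Circuit.IsValid ((sliceSteps l).flatMap (Step.compile w A)) := by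
  rw [compile_sliceSteps q₀ h.1]
  intro c hc
  obtain ⟨t, -, rfl⟩ := List.mem_map.1 hc
  constructor
  · intro g hg
    obtain ⟨o, ho, hg⟩ := List.mem_flatMap.1 hg
    exact Op.isValid_of_mem_gates (Op.nodup_wires_map q₀ (h.1 o ho)) (mem_getD_singletons hg)
  · rw [List.pairwise_flatMap]
    constructor
    · intro o _
      rw [List.getD_eq_getElem?_getD, List.getElem?_map]
      cases (Op.map (Addr.get q₀) o).gates[t]? <;> simp
    · refine h.2.imp_of_mem fun {o o'} ho ho' hd x hx y hy => ?_
      exact disjoint_support_of_slice q₀ (h.1 o ho) (h.1 o' ho') hd (mem_getD_singletons hx)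
        (mem_getD_singletons hy)

theorem run_sliceSteps (q₀ : Qubit N r d w a) {l : List (Op Addr)}
    (h : SliceValid N r d w l) (A : ∀ i, Circuit (OracleQubit r d (a i)))
    (ψ : Ket (Qubit N r d w a)) :
    Circuit.run ((sliceSteps l).flatMap (Step.compile w A)) ψ =
      runGates (l.flatMap fun o => (o.map (Addr.get q₀)).gates) ψ := by
  rw [compile_sliceSteps q₀ h.1, Circuit.run_eq_runGates, ← List.flatMap_def, runGates_parallel]
  · congr 1
    refine List.flatMap_congr fun o _ => ?_
    rw [← List.flatMap_def]
    simp
  · intro o _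
    simpa using Op.length_gates_le _
  · refine h.2.imp_of_mem fun {o o'} ho ho' hd x hx y hy => ?_
    rw [← List.flatMap_def] at hx hy
    exact disjoint_support_of_slice q₀ (h.1 o ho) (h.1 o' ho') hd (by simpa using hx)
      (by simpa using hy)

/-- The action of a list of classical operations on bit assignments. -/
def actList {A : Type} [DecidableEq A] (l : List (Op A)) (σ : A → Bool) : A → Bool :=
  l.foldl (fun s o => o.act s) σ

/-- Amplitudes are pulled back along `o.act`, while basis states are pushed forward. The two
descriptions agree because the operation is an involution. -/
theorem runGates_basis_of_isClassical {Q : Type} [Fintype Q] [DecidableEq Q] {o : Op Q}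
    (hc : o.IsClassical) (hn : o.wires.Nodup) (s : Q → Bool) :
    runGates o.gates (Ket.basis s) = Ket.basis (o.act s) := by
  rw [runGates_gates_of_isClassical hc hn]
  ext m
  rw [Ket.basis_apply, Ket.basis_apply]
  congr 1
  rw [eq_iff_iff]
  constructor
  · rintro rfl; rw [Op.act_act o hn]
  · rintro rfl; rw [Op.act_act o hn]

theorem run_classical_slice (q₀ : Qubit N r d w a) {l : List (Op Addr)}
    (h : SliceValid N r d w l) (hc : ∀ o ∈ l, o.IsClassical)
    (A : ∀ i, Circuit (OracleQubit r d (a i))) (σ : Addr → Bool) :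
    Circuit.run ((sliceSteps l).flatMap (Step.compile w A)) (Ket.basis (Qubit.lift σ)) =
      Ket.basis (Qubit.lift (actList l σ)) := by
  rw [run_sliceSteps q₀ h]
  have h1 := h.1
  clear h
  induction l generalizing σ with
  | nil => rfl
  | cons o l ih =>
    rw [List.flatMap_cons, runGates_append, runGates_basis_of_isClassical
      ((hc o List.mem_cons_self).map _) (Op.nodup_wires_map q₀ (h1 o List.mem_cons_self)),
      ← Op.lift_act q₀ (h1 o List.mem_cons_self),
      ih (fun o ho => hc o (List.mem_cons_of_mem _ ho)) _
        fun o ho => h1 o (List.mem_cons_of_mem _ ho)]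
    rfl

theorem run_z_slice (q₀ : Qubit N r d w a) {l : List Addr}
    (h : SliceValid N r d w (l.map Op.z))
    (A : ∀ i, Circuit (OracleQubit r d (a i))) (σ : Addr → Bool) :
    Circuit.run ((sliceSteps (l.map Op.z)).flatMap (Step.compile w A))
        (Ket.basis (Qubit.lift σ)) =
      (l.map fun q => if σ q then (-1 : ℂ) else 1).prod • Ket.basis (Qubit.lift σ) := by
  rw [run_sliceSteps q₀ h]
  have h1 : ∀ q ∈ l, q.InRange N r d w := fun q hq =>
    (h.1 _ (List.mem_map_of_mem hq)).1 q (by simp [Op.wires])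
  clear h
  induction l with
  | nil => simp
  | cons q l ih =>
    have hq := h1 q List.mem_cons_self
    have : runGates (Op.map (Addr.get q₀) (Op.z q)).gates (Ket.basis (Qubit.lift σ)) =
        (if σ q then (-1 : ℂ) else 1) • Ket.basis (Qubit.lift σ) := by
      ext m
      rw [Op.map, isDiag_z, Pi.smul_apply, smul_eq_mul, Ket.basis_apply]
      split_ifs <;> simp_all [Qubit.lift_get]
    rw [List.map_cons, List.flatMap_cons, runGates_append, this, runGates_smul,
      ih fun q hq => h1 q (List.mem_cons_of_mem _ hq), smul_smul, List.map_cons, List.prod_cons]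

/-! ### Calls of the predicate circuits -/

/-- The action of a call of the predicate circuits on bit assignments. -/
def queryAct (α : Fin N → (Fin r → Fin d → Bool) → Bool) (σ : Addr → Bool) : Addr → Bool
  | .target i => if h : i < N then (σ (.target i) ^^ α ⟨i, h⟩ fun l k => σ (.arg i l k))
      else σ (.target i)
  | q => σ q

theorem embed_injective (i : Fin N) : Function.Injective (embed (r := r) (d := d) (a := a) w i) :=
    by
  intro p q h
  cases p <;> cases q <;> simp_all [embed]

theorem embed_ne {i j : Fin N} (hij : i ≠ j) (p : OracleQubit r d (a i))
    (q : OracleQubit r d (a j)) : embed w i p ≠ embed w j q := by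
  cases p <;> cases q <;> simp [embed, hij]

theorem mem_queryCircuit {A : ∀ i, Circuit (OracleQubit r d (a i))} {i : Fin N} {t : ℕ}
    {g : Gate (Qubit N r d w a)} (hg : g ∈ ((A i).getD t []).map (Gate.map (embed w i))) :
    ∃ l ∈ A i, ∃ g' ∈ l, g'.map (embed w i) = g := by
  obtain ⟨g', hg', rfl⟩ := List.mem_map.1 hg
  rw [List.getD_eq_getElem?_getD] at hg'
  cases hl : (A i)[t]? with
  | none => simp [hl] at hg'
  | some l =>
    rw [hl] at hg'
    exact ⟨l, List.mem_of_getElem? hl, g', hg', rfl⟩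

theorem disjoint_support_embed {i j : Fin N} (hij : i ≠ j) (x : Gate (OracleQubit r d (a i)))
    (y : Gate (OracleQubit r d (a j))) :
    Disjoint (x.map (embed w i)).support (y.map (embed w j)).support := by
  rw [Gate.support_map, Gate.support_map, Finset.disjoint_left]
  intro q hq hq'
  obtain ⟨p, -, rfl⟩ := Finset.mem_image.1 hq
  obtain ⟨p', -, e⟩ := Finset.mem_image.1 hq'
  exact embed_ne hij p p' e.symm

theorem isValid_queryCircuit {A : ∀ i, Circuit (OracleQubit r d (a i))}
    (hA : ∀ i, (A i).IsValid) : (queryCircuit w A).IsValid := by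
  intro c hc
  obtain ⟨t, -, rfl⟩ := List.mem_map.1 hc
  constructor
  · intro g hg
    obtain ⟨i, -, hg⟩ := List.mem_flatMap.1 hg
    obtain ⟨l, hl, g', hg', rfl⟩ := mem_queryCircuit hg
    exact ((hA i l hl).1 g' hg').map (embed_injective i)
  · rw [List.pairwise_flatMap]
    constructor
    · intro i _
      rw [List.getD_eq_getElem?_getD]
      cases hl : (A i)[t]? with
      | none => simp
      | some l =>
        rw [Option.getD_some, List.pairwise_map]
        refine (hA i l (List.mem_of_getElem? hl)).2.imp fun {x y} hxy => ?_
        rw [Gate.support_map, Gate.support_map, Finset.disjoint_image (embed_injective i)]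
        exact hxy
    · refine (List.nodup_finRange N).imp fun {i j} hij x hx y hy => ?_
      obtain ⟨_, -, x', -, rfl⟩ := mem_queryCircuit hx
      obtain ⟨_, -, y', -, rfl⟩ := mem_queryCircuit hy
      exact disjoint_support_embed hij x' y'

/-- On the qubits of processor `i` the state is an admissible input of its circuit, and the rest is
a spectator. `ComputesOn` promises nothing for arguments outside the database or for dirty ancillas,
hence `harg` and `hanc`. -/
theorem run_embed {A : ∀ i, Circuit (OracleQubit r d (a i))} {x : Fin N → Fin d → Bool}
    {α : Fin N → (Fin r → Fin d → Bool) → Bool} {i : Fin N} (hA : ComputesOn x (α i) (A i))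
    (s : Qubit N r d w a → Bool) (sel : Fin r → Fin N)
    (harg : ∀ l k, s (.arg i l k) = x (sel l) k) (hanc : ∀ t, s (.anc i t) = false) :
    runGates ((A i).flatten.map (Gate.map (embed w i))) (Ket.basis s) =
      Ket.basis (Function.update s (.target i)
        (s (.target i) ^^ α i fun l k => s (.arg i l k))) := by
  have h0 : s ∘ embed w i = OracleQubit.config (fun l => x (sel l)) (s (.target i)) := by
    ext q
    cases q <;> simp [embed, OracleQubit.config, harg, hanc]
  have h1 : Ket.basis s = Ket.extend (embed w i) s (Ket.basis (s ∘ embed w i)) := by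
    rw [Ket.extend_basis (embed_injective i)]
    congr 1
    exact (eq_extend_iff (embed_injective i) s s _).2 ⟨fun _ _ => rfl, rfl⟩
  rw [h1, runGates_map_extend (embed_injective i), h0]
  have := hA sel (s (.target i))
  rw [Circuit.run_eq_runGates] at this
  rw [this, Ket.extend_basis (embed_injective i)]
  congr 1
  symm
  rw [eq_extend_iff (embed_injective i)]
  constructor
  · intro q hq
    rw [Function.update_of_ne]
    rintro rfl
    exact hq ⟨.target, rfl⟩
  · ext q
    simp only [harg]
    cases q <;> simp [embed, OracleQubit.config, harg, hanc]

/-- The circuits use disjoint qubits and may be run one after the other. Each of them changes only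
its own target, so the arguments and ancillas of the others stay admissible. -/
theorem run_query {A : ∀ i, Circuit (OracleQubit r d (a i))} {x : Fin N → Fin d → Bool}
    {α : Fin N → (Fin r → Fin d → Bool) → Bool} (hA : ∀ i, ComputesOn x (α i) (A i))
    (σ : Addr → Bool) (harg : ∀ i : Fin N, ∃ sel : Fin r → Fin N, ∀ (l : Fin r) (k : Fin d),
      σ (.arg i l k) = x (sel l) k) :
    (queryCircuit w A).run (Ket.basis (Qubit.lift σ)) =
      Ket.basis (Qubit.lift (queryAct α σ)) := by
  have hseq : ∀ (is : List (Fin N)) (s : Qubit N r d w a → Bool), is.Nodup →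
      (∀ i : Fin N, ∃ sel : Fin r → Fin N, ∀ l k, s (.arg i l k) = x (sel l) k) →
      (∀ i t, s (.anc i t) = false) →
      runGates (is.flatMap fun i => (A i).flatten.map (Gate.map (embed w i))) (Ket.basis s) =
        Ket.basis fun q => match q with
          | .target i => if i ∈ is then (s (.target i) ^^ α i fun l k => s (.arg i l k))
              else s (.target i)
          | q => s q := by
    intro is
    induction is with
    | nil =>
      intro s _ _ _
      simp only [List.flatMap_nil, runGates_nil]
      congr 1
      ext q
      cases q <;> simp
    | cons i is ih =>
      intro s hnd h1 h2
      rw [List.nodup_cons] at hnd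
      obtain ⟨sel, hsel⟩ := h1 i
      rw [List.flatMap_cons, runGates_append, run_embed (hA i) s sel hsel (h2 i), ih _ hnd.2]
      · congr 1
        ext q
        cases q with
        | target j =>
          by_cases hj : j = i
          · subst hj; simp [hnd.1]
          · simp [hj]
        | _ => simp
      · simpa using h1
      · simpa using h2
  rw [Circuit.run_eq_runGates, queryCircuit, ← List.flatMap_def]
  have hpar := runGates_parallel (List.finRange N)
    (fun i => (A i).map fun l => l.map (Gate.map (embed w i)))
    (L := Finset.univ.sup fun i => (A i).depth) (fun i _ => by
      rw [List.length_map]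
      exact Finset.le_sup (f := fun i => (A i).depth) (Finset.mem_univ i)) ?_
    (Ket.basis (Qubit.lift σ))
  · have e1 : ∀ i t, ((A i).map fun l => l.map (Gate.map (embed w i))).getD t [] =
        ((A i).getD t []).map (Gate.map (embed w i)) := by
      intro i t
      rw [List.getD_eq_getElem?_getD, List.getD_eq_getElem?_getD, List.getElem?_map]
      cases (A i)[t]? <;> simp
    simp only [e1] at hpar
    rw [hpar]
    simp only [← List.map_flatten]
    rw [hseq _ _ (List.nodup_finRange N) (by simpa [Qubit.lift] using harg)
      (by simp [Qubit.lift])]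
    congr 1
    ext q
    cases q <;> simp [Qubit.lift, queryAct]
  · refine (List.nodup_finRange N).imp fun {i j} hij x hx y hy => ?_
    rw [← List.map_flatten] at hx hy
    obtain ⟨x', -, rfl⟩ := List.mem_map.1 hx
    obtain ⟨y', -, rfl⟩ := List.mem_map.1 hy
    exact disjoint_support_embed hij x' y'

end Compile

/-! ### A sorting network -/

namespace SortNet

/-- The reflection or shift inside a block of `2 * h` positions
    by which step `(k, j)` pairs them. -/
def pairing (k j i : ℕ) : ℕ :=
  if j = 0 then 2 * 2 ^ (k - j) - 1 - i
  else if j ≤ k then (i + 2 ^ (k - j)) % (2 * 2 ^ (k - j)) else i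

/-- The position with which `p` is compared in step `(k, j)` of the sorting network. -/
def partner (k j p : ℕ) : ℕ :=
  p / (2 * 2 ^ (k - j)) * (2 * 2 ^ (k - j)) + pairing k j (p % (2 * 2 ^ (k - j)))

/-- Whether `p` keeps the larger one of the two entries in step `(k, j)`. -/
def upper (k j p : ℕ) : Bool := decide (2 ^ (k - j) ≤ p % (2 * 2 ^ (k - j)))

/-- A step of the sorting network. -/
def step {β : Type*} [LinearOrder β] (k j : ℕ) (v : ℕ → β) (p : ℕ) : β :=
  if upper k j p then max (v p) (v (partner k j p)) else min (v p) (v (partner k j p))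

/-- The first `s` steps of the sorting network for `2 ^ κ` entries. -/
def net {β : Type*} [LinearOrder β] (κ : ℕ) (v : ℕ → β) : ℕ → ℕ → β
  | 0 => v
  | s + 1 => step (s / κ) (s % κ) (net κ v s)

theorem pairing_lt {k j i : ℕ} (hi : i < 2 * 2 ^ (k - j)) : pairing k j i < 2 * 2 ^ (k - j) := by
  unfold pairing
  split_ifs
  · omega
  · exact Nat.mod_lt _ (by positivity)
  · exact hi

theorem pairing_pairing {k j i : ℕ} (hi : i < 2 * 2 ^ (k - j)) :
    pairing k j (pairing k j i) = i := by
  unfold pairing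
  split_ifs
  · omega
  · generalize 2 ^ (k - j) = h at *
    rcases lt_or_ge i h with h1 | h1
    · rw [Nat.mod_eq_of_lt (show i + h < 2 * h by omega),
        show i + h + h = i + 2 * h by ring, Nat.add_mod_right, Nat.mod_eq_of_lt hi]
    · rw [show i + h = (i - h) + 2 * h by omega, Nat.add_mod_right,
        Nat.mod_eq_of_lt (show i - h < 2 * h by omega), Nat.sub_add_cancel h1,
        Nat.mod_eq_of_lt hi]
  · rfl

theorem partner_div (k j p : ℕ) :
    partner k j p / (2 * 2 ^ (k - j)) = p / (2 * 2 ^ (k - j)) := by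
  have h0 : 0 < 2 * 2 ^ (k - j) := by positivity
  rw [partner, mul_comm, Nat.mul_add_div h0, Nat.div_eq_of_lt (pairing_lt (Nat.mod_lt _ h0)),
    add_zero]

theorem partner_mod (k j p : ℕ) :
    partner k j p % (2 * 2 ^ (k - j)) = pairing k j (p % (2 * 2 ^ (k - j))) := by
  have h0 : 0 < 2 * 2 ^ (k - j) := by positivity
  rw [partner, mul_comm, Nat.mul_add_mod, Nat.mod_eq_of_lt (pairing_lt (Nat.mod_lt _ h0))]

theorem partner_partner (k j p : ℕ) : partner k j (partner k j p) = p := by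
  have h0 : 0 < 2 * 2 ^ (k - j) := by positivity
  conv_lhs => rw [partner]
  rw [partner_div, partner_mod, pairing_pairing (Nat.mod_lt _ h0), Nat.div_add_mod']

theorem partner_lt {κ k j p : ℕ} (hk : k < κ) (hp : p < 2 ^ κ) : partner k j p < 2 ^ κ := by
  have h0 : 0 < 2 * 2 ^ (k - j) := by positivity
  obtain ⟨e, he⟩ : ∃ e, κ = e + (k - j + 1) := ⟨κ - (k - j + 1), by omega⟩
  have h1 : 2 ^ κ = 2 * 2 ^ (k - j) * 2 ^ e := by rw [he, pow_add, pow_succ]; ring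
  rw [h1] at hp ⊢
  have h2 : partner k j p / (2 * 2 ^ (k - j)) < 2 ^ e := by
    rw [partner_div]
    exact Nat.div_lt_of_lt_mul hp
  rw [Nat.div_lt_iff_lt_mul h0] at h2
  linarith

theorem upper_partner {k j p : ℕ} (hj : j ≤ k) : upper k j (partner k j p) = !upper k j p := by
  have h0 : p % (2 * 2 ^ (k - j)) < 2 * 2 ^ (k - j) := Nat.mod_lt _ (by positivity)
  unfold upper
  rw [partner_mod]
  revert h0
  generalize p % (2 * 2 ^ (k - j)) = i
  intro h0
  have : 2 ^ (k - j) ≤ pairing k j i ↔ ¬ 2 ^ (k - j) ≤ i := by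
    unfold pairing
    split_ifs
    · omega
    · generalize 2 ^ (k - j) = h at *
      rcases lt_or_ge i h with h1 | h1
      · rw [Nat.mod_eq_of_lt (show i + h < 2 * h by omega)]; omega
      · rw [show i + h = (i - h) + 2 * h by omega, Nat.add_mod_right,
          Nat.mod_eq_of_lt (show i - h < 2 * h by omega)]; omega
  simp only [this, decide_not]

section

variable {β : Type*} [LinearOrder β]

/-- The schedule reserves `κ` steps for every stage `k`, although only those with `j ≤ k` compare
anything; the uniform length makes stage and step the quotient and remainder by `κ`. -/
theorem step_of_lt {k j : ℕ} (h : k < j) (v : ℕ → β) : step k j v = v := by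
  have : ∀ p, partner k j p = p := by
    intro p
    unfold partner pairing
    rw [if_neg (by omega), if_neg (by omega), Nat.div_add_mod']
  ext p
  simp [step, this]

theorem exists_perm_step (κ : ℕ) {k : ℕ} (hk : k < κ) (j : ℕ) (v : ℕ → β) :
    ∃ σ : Equiv.Perm ℕ, (∀ p < 2 ^ κ, σ p < 2 ^ κ) ∧ ∀ p, step k j v p = v (σ p) := by
  rcases lt_or_ge k j with h | h
  · exact ⟨Equiv.refl _, fun p hp => hp, fun p => by rw [step_of_lt h]; rfl⟩
  -- The strict inequalities make the decision to exchange symmetric in the two partners, also for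
  -- ties, so that the exchange is an involution.
  let swp : ℕ → Prop := fun p =>
    if upper k j p then v p < v (partner k j p) else v (partner k j p) < v p
  have hsw : ∀ p, swp (partner k j p) ↔ swp p := by
    intro p
    simp only [swp, upper_partner h, partner_partner]
    cases upper k j p <;> simp
  classical
  let f : ℕ → ℕ := fun p => if swp p then partner k j p else p
  have hf : Function.Involutive f := by
    intro p
    by_cases hs : swp p
    · simp only [f, if_pos hs, if_pos ((hsw p).2 hs), partner_partner]
    · simp only [f, if_neg hs]
  refine ⟨hf.toPerm, fun p hp => ?_, fun p => ?_⟩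
  · change f p < _
    simp only [f]
    split_ifs
    · exact partner_lt hk hp
    · exact hp
  · change _ = v (f p)
    simp only [step, f, swp]
    cases upper k j p
    · by_cases h1 : v (partner k j p) < v p
      · simp [h1, h1.le]
      · simp [h1, not_lt.1 h1]
    · by_cases h1 : v p < v (partner k j p)
      · simp [h1, h1.le]
      · simp [h1, not_lt.1 h1]

theorem exists_perm_net (κ : ℕ) (v : ℕ → β) {s : ℕ} (hs : s ≤ κ * κ) :
    ∃ σ : Equiv.Perm ℕ, (∀ p < 2 ^ κ, σ p < 2 ^ κ) ∧ ∀ p, net κ v s p = v (σ p) := by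
  induction s with
  | zero => exact ⟨Equiv.refl _, fun p hp => hp, fun p => rfl⟩
  | succ s ih =>
    obtain ⟨σ, h1, h2⟩ := ih (by omega)
    obtain ⟨τ, h3, h4⟩ := exists_perm_step κ (k := s / κ)
      (Nat.div_lt_of_lt_mul (by omega)) (s % κ) (net κ v s)
    refine ⟨τ.trans σ, fun p hp => h1 _ (h3 p hp), fun p => ?_⟩
    rw [net, h4, h2]
    rfl

/-- Monotone maps commute with `min` and `max`; this is the source of the 0-1 principle. -/
theorem step_comp {γ : Type*} [LinearOrder γ] {f : β → γ} (hf : Monotone f) (k j : ℕ)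
    (v : ℕ → β) : step k j (f ∘ v) = f ∘ step k j v := by
  ext p
  simp only [step, Function.comp_apply]
  split_ifs
  · rw [hf.map_max]
  · rw [hf.map_min]

theorem net_comp {γ : Type*} [LinearOrder γ] {f : β → γ} (hf : Monotone f) (κ s : ℕ)
    (v : ℕ → β) : net κ (f ∘ v) s = f ∘ net κ v s := by
  induction s with
  | zero => rfl
  | succ s ih => rw [net, net, ih, step_comp hf]

theorem step_congr {κ k : ℕ} (hk : k < κ) (j : ℕ) {v v' : ℕ → β} (h : ∀ p < 2 ^ κ, v p = v' p) :
    ∀ p < 2 ^ κ, step k j v p = step k j v' p := by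
  intro p hp
  rw [step, step, h p hp, h _ (partner_lt hk hp)]

end

/-! Sequences of bits -/

/-- A sequence of bits that is constant except on an interval. -/
def Bitonic (h : ℕ) (f : ℕ → Bool) : Prop :=
  ∃ a b e, a ≤ b ∧ b ≤ h ∧ ∀ i < h, f i = (decide (a ≤ i ∧ i < b) ^^ e)

theorem Bitonic.not {h : ℕ} {f : ℕ → Bool} (hf : Bitonic h f) : Bitonic h fun i => !f i := by
  obtain ⟨a, b, e, h1, h2, h3⟩ := hf
  exact ⟨a, b, !e, h1, h2, fun i hi => by simp [h3 i hi]⟩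

theorem Bitonic.congr {h : ℕ} {f g : ℕ → Bool} (hf : Bitonic h f) (hfg : ∀ i < h, f i = g i) :
    Bitonic h g := by
  obtain ⟨a, b, e, h1, h2, h3⟩ := hf
  exact ⟨a, b, e, h1, h2, fun i hi => by rw [← hfg i hi, h3 i hi]⟩

theorem bitonic_const (h : ℕ) (e : Bool) : Bitonic h fun _ => e :=
  ⟨0, 0, e, le_rfl, Nat.zero_le _, fun i _ => by simp⟩

/-- An interval of length at most `h` never contains both `i` and `i + h`, so all conjunctions
vanish; a longer one always contains one of the two, so all disjunctions hold. The half that is not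
constant is an interval or the complement of one. -/
theorem halfClean_of_interval {h a b : ℕ} {f : ℕ → Bool} (hab : a ≤ b) (hb : b ≤ 2 * h)
    (hf : ∀ i < 2 * h, f i = decide (a ≤ i ∧ i < b)) :
    Bitonic h (fun i => f i && f (i + h)) ∧ Bitonic h (fun i => f i || f (i + h)) ∧
      ((∀ i < h, (f i && f (i + h)) = false) ∨ ∀ i < h, (f i || f (i + h)) = true) := by
  have h1 : ∀ i < h, (f i && f (i + h)) = decide ((a ≤ i ∧ i < b) ∧ a ≤ i + h ∧ i + h < b) := by
    intro i hi
    rw [hf i (by omega), hf (i + h) (by omega)]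
    simp
  have h2 : ∀ i < h, (f i || f (i + h)) = decide ((a ≤ i ∧ i < b) ∨ a ≤ i + h ∧ i + h < b) := by
    intro i hi
    rw [hf i (by omega), hf (i + h) (by omega)]
    simp
  by_cases hc : b - a ≤ h
  · have h3 : ∀ i < h, (f i && f (i + h)) = false := by
      intro i hi
      rw [h1 i hi, decide_eq_false_iff_not]
      omega
    refine ⟨(bitonic_const h false).congr fun i hi => (h3 i hi).symm, ?_, .inl h3⟩
    by_cases hbh : b ≤ h
    · refine ⟨a, b, false, hab, hbh, fun i hi => ?_⟩
      refine (h2 i hi).trans ?_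
      rw [Bool.xor_false, decide_eq_decide]
      omega
    by_cases hah : h ≤ a
    · refine ⟨a - h, b - h, false, by omega, by omega, fun i hi => ?_⟩
      refine (h2 i hi).trans ?_
      rw [Bool.xor_false, decide_eq_decide]
      omega
    · refine ⟨b - h, a, true, by omega, by omega, fun i hi => ?_⟩
      refine (h2 i hi).trans ?_
      rw [Bool.xor_true, ← decide_not, decide_eq_decide]
      omega
  · have h3 : ∀ i < h, (f i || f (i + h)) = true := by
      intro i hi
      rw [h2 i hi, decide_eq_true_eq]
      omega
    refine ⟨⟨a, b - h, false, by omega, by omega, fun i hi => ?_⟩,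
      (bitonic_const h true).congr fun i hi => (h3 i hi).symm, .inr h3⟩
    refine (h1 i hi).trans ?_
    rw [Bool.xor_false, decide_eq_decide]
    omega

theorem halfClean {h : ℕ} {f : ℕ → Bool} (hf : Bitonic (2 * h) f) :
    Bitonic h (fun i => f i && f (i + h)) ∧ Bitonic h (fun i => f i || f (i + h)) ∧
      ((∀ i < h, (f i && f (i + h)) = false) ∨ ∀ i < h, (f i || f (i + h)) = true) := by
  obtain ⟨a, b, e, hab, hb, hf⟩ := hf
  cases e with
  | false => exact halfClean_of_interval hab hb fun i hi => by rw [hf i hi, Bool.xor_false]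
  | true =>
    obtain ⟨h1, h2, h3⟩ := halfClean_of_interval (f := fun i => !f i) hab hb
      fun i hi => by rw [hf i hi]; simp
    refine ⟨h2.not.congr fun i _ => by simp, h1.not.congr fun i _ => by simp, ?_⟩
    rcases h3 with h3 | h3
    · exact .inr fun i hi => by simpa using congrArg Bool.not (h3 i hi)
    · exact .inl fun i hi => by simpa using congrArg Bool.not (h3 i hi)

theorem exists_threshold {h : ℕ} {f : ℕ → Bool}
    (hf : ∀ i i', i ≤ i' → i' < h → f i ≤ f i') :
    ∃ z ≤ h, ∀ i < h, f i = decide (z ≤ i) := by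
  classical
  by_cases hex : ∃ i, i < h ∧ f i = true
  · refine ⟨Nat.find hex, (Nat.find_spec hex).1.le, fun i hi => ?_⟩
    by_cases hz : Nat.find hex ≤ i
    · have := hf _ _ hz hi
      rw [(Nat.find_spec hex).2] at this
      simp [hz, Bool.le_iff_imp] at this ⊢
      exact this
    · have := Nat.find_min hex (not_le.1 hz)
      simp [hz] 
      simpa [hi] using this
  · push Not at hex
    exact ⟨h, le_rfl, fun i hi => by simp [hi, hex i hi]⟩

/-- If the ones start at `z₁` and `z₂` in the two sorted halves, reflecting the second half makes
the conjunctions hold on `z₁ ≤ i ≤ h - 1 - z₂`. This is empty if `h ≤ z₁ + z₂`; otherwise the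
disjunctions leave no gap. -/
theorem mirrorClean {h : ℕ} {f : ℕ → Bool}
    (h₁ : ∀ i i', i ≤ i' → i' < h → f i ≤ f i')
    (h₂ : ∀ i i', i ≤ i' → i' < h → f (h + i) ≤ f (h + i')) :
    Bitonic h (fun i => f i && f (2 * h - 1 - i)) ∧
      Bitonic h (fun i => f (h + i) || f (h - 1 - i)) ∧
      ((∀ i < h, (f i && f (2 * h - 1 - i)) = false) ∨
        ∀ i < h, (f (h + i) || f (h - 1 - i)) = true) := by
  obtain ⟨z₁, hz₁, h₁⟩ := exists_threshold h₁
  obtain ⟨z₂, hz₂, h₂⟩ := exists_threshold h₂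
  have e1 : ∀ i < h, (f i && f (2 * h - 1 - i)) = decide (z₁ ≤ i ∧ z₂ ≤ h - 1 - i) := by
    intro i hi
    rw [h₁ i hi, show 2 * h - 1 - i = h + (h - 1 - i) by omega, h₂ (h - 1 - i) (by omega)]
    simp
  have e2 : ∀ i < h, (f (h + i) || f (h - 1 - i)) = decide (z₂ ≤ i ∨ z₁ ≤ h - 1 - i) := by
    intro i hi
    rw [h₂ i hi, h₁ (h - 1 - i) (by omega)]
    simp
  by_cases hz : h ≤ z₁ + z₂
  · have e3 : ∀ i < h, (f i && f (2 * h - 1 - i)) = false := by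
      intro i hi
      rw [e1 i hi, decide_eq_false_iff_not]
      omega
    refine ⟨(bitonic_const h false).congr fun i hi => (e3 i hi).symm,
      ⟨h - z₁, z₂, true, by omega, hz₂, fun i hi => ?_⟩, .inl e3⟩
    refine (e2 i hi).trans ?_
    rw [Bool.xor_true, ← decide_not, decide_eq_decide]
    omega
  · have e3 : ∀ i < h, (f (h + i) || f (h - 1 - i)) = true := by
      intro i hi
      rw [e2 i hi, decide_eq_true_eq]
      omega
    refine ⟨⟨z₁, h - z₂, false, by omega, by omega, fun i hi => ?_⟩,
      (bitonic_const h true).congr fun i hi => (e3 i hi).symm, .inr e3⟩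
    refine (e1 i hi).trans ?_
    rw [Bool.xor_false, decide_eq_decide]
    omega

theorem step_lower {β : Type*} [LinearOrder β] {k j C i : ℕ} (v : ℕ → β)
    (hi : i < 2 ^ (k - j)) :
    step k j v (C * (2 * 2 ^ (k - j)) + i) =
      min (v (C * (2 * 2 ^ (k - j)) + i)) (v (C * (2 * 2 ^ (k - j)) + pairing k j i)) := by
  have h0 : 0 < 2 * 2 ^ (k - j) := by positivity
  have h1 : (C * (2 * 2 ^ (k - j)) + i) % (2 * 2 ^ (k - j)) = i := by
    rw [mul_comm, Nat.mul_add_mod, Nat.mod_eq_of_lt (by omega)]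
  have h2 : (C * (2 * 2 ^ (k - j)) + i) / (2 * 2 ^ (k - j)) = C := by
    rw [mul_comm, Nat.mul_add_div h0, Nat.div_eq_of_lt (by omega), add_zero]
  rw [step, partner, upper, h1, h2]
  simp [hi]

theorem step_upper {β : Type*} [LinearOrder β] {k j C i : ℕ} (v : ℕ → β)
    (hi : i < 2 ^ (k - j)) :
    step k j v (C * (2 * 2 ^ (k - j)) + 2 ^ (k - j) + i) =
      max (v (C * (2 * 2 ^ (k - j)) + 2 ^ (k - j) + i))
        (v (C * (2 * 2 ^ (k - j)) + pairing k j (2 ^ (k - j) + i))) := by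
  have h0 : 0 < 2 * 2 ^ (k - j) := by positivity
  have h1 : (C * (2 * 2 ^ (k - j)) + 2 ^ (k - j) + i) % (2 * 2 ^ (k - j)) = 2 ^ (k - j) + i := by
    rw [add_assoc, mul_comm, Nat.mul_add_mod, Nat.mod_eq_of_lt (by omega)]
  have h2 : (C * (2 * 2 ^ (k - j)) + 2 ^ (k - j) + i) / (2 * 2 ^ (k - j)) = C := by
    rw [add_assoc, mul_comm, Nat.mul_add_div h0, Nat.div_eq_of_lt (by omega), add_zero]
  rw [step, partner, upper, h1, h2]
  simp

theorem bool_min (a b : Bool) : min a b = (a && b) := by cases a <;> cases b <;> rfl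

theorem bool_max (a b : Bool) : max a b = (a || b) := by cases a <;> cases b <;> rfl

/-- Blocks of length `2 ^ k` are sorted. -/
def SortedBlocks {β : Type*} [LinearOrder β] (k : ℕ) (v : ℕ → β) : Prop :=
  ∀ B i i', i ≤ i' → i' < 2 ^ k → v (B * 2 ^ k + i) ≤ v (B * 2 ^ k + i')

/-- Inside the blocks of length `2 ^ (k + 1)`, the subblocks of length `2 ^ (k - j)` are bitonic
and in the right order. -/
def MergeInv (k j : ℕ) (v : ℕ → Bool) : Prop :=
  (∀ C, Bitonic (2 ^ (k - j)) fun i => v (C * 2 ^ (k - j) + i)) ∧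
    ∀ B c c', c < c' → c' < 2 ^ (j + 1) → ∀ i < 2 ^ (k - j), ∀ i' < 2 ^ (k - j),
      v ((B * 2 ^ (j + 1) + c) * 2 ^ (k - j) + i) ≤ v ((B * 2 ^ (j + 1) + c') * 2 ^ (k - j) + i')

/-- The reflecting step is `mirrorClean` on each pair of neighbouring sorted blocks, and thus does
not require the second block to be sorted downwards. -/
theorem mergeInv_zero {k : ℕ} {v : ℕ → Bool} (hv : SortedBlocks k v) :
    MergeInv k 0 (step k 0 v) := by
  have hlow : ∀ C, ∀ i < 2 ^ k, step k 0 v (C * 2 * 2 ^ k + i) =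
      (v (C * 2 * 2 ^ k + i) && v (C * 2 * 2 ^ k + (2 * 2 ^ k - 1 - i))) := by
    intro C i hi
    have := step_lower (k := k) (j := 0) (C := C) v hi
    rwa [pairing, if_pos rfl, bool_min, Nat.sub_zero, ← mul_assoc] at this
  have hup : ∀ C, ∀ i < 2 ^ k, step k 0 v ((C * 2 + 1) * 2 ^ k + i) =
      (v (C * 2 * 2 ^ k + (2 ^ k + i)) || v (C * 2 * 2 ^ k + (2 ^ k - 1 - i))) := by
    intro C i hi
    have := step_upper (k := k) (j := 0) (C := C) v hi
    rw [pairing, if_pos rfl, bool_max, Nat.sub_zero, ← mul_assoc] at this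
    rw [show (C * 2 + 1) * 2 ^ k + i = C * 2 * 2 ^ k + 2 ^ k + i by ring, this, add_assoc]
    congr 3
    omega
  have hm : ∀ C, _ := fun C => mirrorClean (h := 2 ^ k) (f := fun i => v (C * 2 * 2 ^ k + i))
    (fun i i' h1 h2 => hv (C * 2) i i' h1 h2) (fun i i' h1 h2 => by
      have := hv (C * 2 + 1) i i' h1 h2
      rwa [show ∀ i, (C * 2 + 1) * 2 ^ k + i = C * 2 * 2 ^ k + (2 ^ k + i) from
        fun i => by ring, show ∀ i, (C * 2 + 1) * 2 ^ k + i = C * 2 * 2 ^ k + (2 ^ k + i) from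
        fun i => by ring] at this)
  refine ⟨fun C => ?_, ?_⟩
  · rw [Nat.sub_zero]
    obtain ⟨C, rfl | rfl⟩ : ∃ C', C = C' * 2 ∨ C = C' * 2 + 1 := ⟨C / 2, by omega⟩
    · exact (hm C).1.congr fun i hi => (hlow C i hi).symm
    · exact (hm C).2.1.congr fun i hi => (hup C i hi).symm
  · intro B c c' hc hc'
    rw [zero_add, pow_one] at *
    obtain rfl : c = 0 := by omega
    obtain rfl : c' = 1 := by omega
    rw [Nat.sub_zero]
    intro i hi i' hi'
    rw [add_zero, hlow B i hi, hup B i' hi']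
    rcases (hm B).2.2 with h | h
    · rw [h i hi]; exact Bool.false_le _
    · rw [h i' hi']; exact Bool.le_true _

/-- Inside a subblock `halfClean` splits into two bitonic halves in the right order; halves of
different subblocks inherit their order. -/
theorem mergeInv_succ {k j : ℕ} {v : ℕ → Bool} (hj : j + 1 ≤ k) (hv : MergeInv k j v) :
    MergeInv k (j + 1) (step k (j + 1) v) := by
  have hpow : 2 ^ (k - j) = 2 * 2 ^ (k - (j + 1)) := by
    rw [← pow_succ']; congr 1; omega
  unfold MergeInv at *
  rw [hpow] at hv
  have hlow : ∀ C, ∀ i < 2 ^ (k - (j + 1)), step k (j + 1) v (C * 2 * 2 ^ (k - (j + 1)) + i) =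
      (v (C * (2 * 2 ^ (k - (j + 1))) + i) &&
        v (C * (2 * 2 ^ (k - (j + 1))) + (i + 2 ^ (k - (j + 1))))) := by
    intro C i hi
    have := step_lower (k := k) (j := j + 1) (C := C) v hi
    rw [pairing, if_neg (by omega), if_pos hj, bool_min, Nat.mod_eq_of_lt (by omega)] at this
    rwa [mul_assoc C 2]
  have hup : ∀ C, ∀ i < 2 ^ (k - (j + 1)),
      step k (j + 1) v ((C * 2 + 1) * 2 ^ (k - (j + 1)) + i) =
      (v (C * (2 * 2 ^ (k - (j + 1))) + i) ||
        v (C * (2 * 2 ^ (k - (j + 1))) + (i + 2 ^ (k - (j + 1))))) := by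
    intro C i hi
    have := step_upper (k := k) (j := j + 1) (C := C) v hi
    rw [pairing, if_neg (by omega), if_pos hj, bool_max,
      show 2 ^ (k - (j + 1)) + i + 2 ^ (k - (j + 1)) = i + 2 * 2 ^ (k - (j + 1)) by ring,
      Nat.add_mod_right, Nat.mod_eq_of_lt (by omega)] at this
    rw [show (C * 2 + 1) * 2 ^ (k - (j + 1)) + i =
      C * (2 * 2 ^ (k - (j + 1))) + 2 ^ (k - (j + 1)) + i by ring, this, Bool.or_comm]
    congr 2
    ring
  generalize 2 ^ (k - (j + 1)) = h at *
  have hm : ∀ C, _ := fun C => halfClean (hv.1 C)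
  refine ⟨fun C => ?_, ?_⟩
  · obtain ⟨C, rfl | rfl⟩ : ∃ C', C = C' * 2 ∨ C = C' * 2 + 1 := ⟨C / 2, by omega⟩
    · exact (hm C).1.congr fun i hi => (hlow C i hi).symm
    · exact (hm C).2.1.congr fun i hi => (hup C i hi).symm
  · intro B c c' hc hc' i hi i' hi'
    -- Every output of the step is an entry of the same old subblock, so the order between different
    -- subblocks is not disturbed.
    have hmem : ∀ C e, e < 2 → ∀ i < h, ∃ i' < 2 * h,
        step k (j + 1) v ((C * 2 + e) * h + i) = v (C * (2 * h) + i') := by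
      intro C e he i hi
      have hor : ∀ a b : Bool, ((a && b) = a ∨ (a && b) = b) ∧ ((a || b) = a ∨ (a || b) = b) := by
        decide
      rcases (by omega : e = 0 ∨ e = 1) with rfl | rfl
      · rw [add_zero, hlow C i hi]
        rcases (hor (v (C * (2 * h) + i)) (v (C * (2 * h) + (i + h)))).1 with h1 | h1 <;> rw [h1]
        exacts [⟨i, by omega, rfl⟩, ⟨i + h, by omega, rfl⟩]
      · rw [hup C i hi]
        rcases (hor (v (C * (2 * h) + i)) (v (C * (2 * h) + (i + h)))).2 with h1 | h1 <;> rw [h1]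
        exacts [⟨i, by omega, rfl⟩, ⟨i + h, by omega, rfl⟩]
    have hidx : ∀ c, B * 2 ^ (j + 1 + 1) + c = (B * 2 ^ (j + 1) + c / 2) * 2 + c % 2 := by
      intro c
      have := Nat.div_add_mod c 2
      rw [pow_succ]
      linarith
    rw [hidx c, hidx c']
    rcases (by omega : c / 2 = c' / 2 ∨ c / 2 < c' / 2) with h1 | h1
    · rw [h1, show c % 2 = 0 by omega, show c' % 2 = 1 by omega, add_zero, hlow _ i hi,
        hup _ i' hi']
      rcases (hm (B * 2 ^ (j + 1) + c' / 2)).2.2 with h | h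
      · rw [h i hi]; exact Bool.false_le _
      · rw [h i' hi']; exact Bool.le_true _
    · obtain ⟨e, he, e1⟩ := hmem (B * 2 ^ (j + 1) + c / 2) (c % 2) (Nat.mod_lt _ two_pos) i hi
      obtain ⟨e', he', e1'⟩ := hmem (B * 2 ^ (j + 1) + c' / 2) (c' % 2) (Nat.mod_lt _ two_pos)
        i' hi'
      rw [e1, e1']
      refine hv.2 B _ _ h1 ?_ e he e' he'
      rw [pow_succ] at hc'
      omega

/-- For `j = k` the subblocks are single entries, and their order is the order of the entries. -/
theorem sortedBlocks_succ {k : ℕ} {v : ℕ → Bool} (hv : MergeInv k k v) :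
    SortedBlocks (k + 1) v := by
  intro B i i' hii hi'
  rcases hii.eq_or_lt with rfl | hlt
  · exact le_rfl
  · simpa using hv.2 B i i' hlt hi' 0 (by simp) 0 (by simp)

theorem net_stage {κ k : ℕ} {v : ℕ → Bool} (hk : k < κ)
    (hv : SortedBlocks k (net κ v (k * κ))) : SortedBlocks (k + 1) (net κ v ((k + 1) * κ)) := by
  have hstep : ∀ j < κ, net κ v (k * κ + (j + 1)) = step k j (net κ v (k * κ + j)) := by
    intro j hj
    have h1 : (k * κ + j) / κ = k := by
      rw [mul_comm, Nat.mul_add_div (by omega), Nat.div_eq_of_lt hj, add_zero]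
    have h2 : (k * κ + j) % κ = j := by rw [mul_comm, Nat.mul_add_mod, Nat.mod_eq_of_lt hj]
    rw [← add_assoc, net, h1, h2]
  have h1 : ∀ j ≤ k, MergeInv k j (net κ v (k * κ + (j + 1))) := by
    intro j
    induction j with
    | zero => intro _; rw [hstep 0 (by omega)]; exact mergeInv_zero hv
    | succ j ih =>
      intro hj
      rw [hstep (j + 1) (by omega)]
      exact mergeInv_succ hj (ih (by omega))
  -- The remaining steps of the stage are idle.
  have h2 : ∀ j, k ≤ j → j < κ → net κ v (k * κ + (j + 1)) = net κ v (k * κ + (k + 1)) := by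
    intro j hj
    induction j, hj using Nat.le_induction with
    | base => intro _; rfl
    | succ j hj ih => intro hlt; rw [hstep (j + 1) hlt, step_of_lt (by omega), ih (by omega)]
  have h3 := h2 (κ - 1) (by omega) (by omega)
  rw [show k * κ + (κ - 1 + 1) = (k + 1) * κ by rw [Nat.sub_add_cancel (by omega)]; ring] at h3
  rw [h3]
  exact sortedBlocks_succ (h1 k le_rfl)

theorem net_bool_sorted (κ : ℕ) (v : ℕ → Bool) : SortedBlocks κ (net κ v (κ * κ)) := by
  have : ∀ k ≤ κ, SortedBlocks k (net κ v (k * κ)) := by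
    intro k
    induction k with
    | zero =>
      intro _ B i i' _ h
      simp only [pow_zero] at h
      rw [show i = i' by omega]
    | succ k ih => intro h; exact net_stage (by omega) (ih (by omega))
  exact this κ le_rfl

/-- The network sorts. -/
theorem net_sorted {β : Type*} [LinearOrder β] (κ : ℕ) (v : ℕ → β) {p q : ℕ} (hpq : p ≤ q)
    (hq : q < 2 ^ κ) : net κ v (κ * κ) p ≤ net κ v (κ * κ) q := by
  by_contra hlt
  rw [not_le] at hlt
  set c := net κ v (κ * κ) q with hc
  -- The 0-1 principle: with the later entry `c` as threshold, two outputs in the wrong order would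
  -- become a `1` before a `0`.
  have hmono : Monotone fun x : β => decide (c < x) := by
    intro x y hxy
    rw [Bool.le_iff_imp]
    simpa using fun h => lt_of_lt_of_le h hxy
  have h1 := net_bool_sorted κ ((fun x : β => decide (c < x)) ∘ v) 0 p q hpq hq
  rw [net_comp hmono] at h1
  simp only [zero_mul, zero_add, Function.comp_apply, ← hc, lt_irrefl, hlt] at h1
  exact absurd h1 (by decide)

end SortNet

/-! ### Classical slices -/

section ActList

variable {A : Type} [DecidableEq A]

@[simp] theorem actList_nil (σ : A → Bool) : actList [] σ = σ := rfl

@[simp] theorem actList_cons (o : Op A) (l : List (Op A)) (σ : A → Bool) :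
    actList (o :: l) σ = actList l (o.act σ) := rfl

theorem actList_append (l₁ l₂ : List (Op A)) (σ : A → Bool) :
    actList (l₁ ++ l₂) σ = actList l₂ (actList l₁ σ) := by
  simp [actList, List.foldl_append]

theorem actList_of_not_target {l : List (Op A)} {w : A} (h : ∀ o ∈ l, o.target ≠ some w)
    (σ : A → Bool) : actList l σ w = σ w := by
  induction l generalizing σ with
  | nil => rfl
  | cons o l ih =>
    rw [actList_cons, ih (fun o ho => h o (List.mem_cons_of_mem _ ho)),
      Op.act_of_ne _ _ (h o List.mem_cons_self)]

/-- No other operation of the slice touches the wires of `o`, so its controls and its target still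
have their initial values when its turn comes. -/
theorem actList_of_target {l : List (Op A)} (hn : ∀ o ∈ l, o.wires.Nodup)
    (hd : l.Pairwise fun o o' => o.wires.Disjoint o'.wires) {o : Op A} (ho : o ∈ l) {w : A}
    (hw : o.target = some w) (σ : A → Bool) : actList l σ w = (σ w ^^ o.ctrl σ) := by
  induction l generalizing σ with
  | nil => simp at ho
  | cons o' l ih =>
    rw [List.pairwise_cons] at hd
    rw [actList_cons]
    rcases List.mem_cons.1 ho with rfl | ho
    · rw [actList_of_not_target, Op.act_of_target _ _ hw]
      intro o' ho' hw'
      exact hd.1 o' ho' (Op.target_mem_wires hw) (Op.target_mem_wires hw')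
    · have h1 : ∀ v ∈ o.wires, o'.act σ v = σ v := fun v hv =>
        Op.act_of_ne _ _ fun hv' => hd.1 o ho (Op.target_mem_wires hv') hv
      rw [ih (fun o ho => hn o (List.mem_cons_of_mem _ ho)) hd.2 ho,
        h1 w (Op.target_mem_wires hw),
        Op.ctrl_congr o (fun v hv _ => h1 v hv) (hn o (List.mem_cons_of_mem _ ho))]

/-- Slices of operations, applied one after the other. -/
def runSlices (L : List (List (Op A))) (σ : A → Bool) : A → Bool :=
  L.foldl (fun s l => actList l s) σ

@[simp] theorem runSlices_nil (σ : A → Bool) : runSlices [] σ = σ := rfl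

@[simp] theorem runSlices_cons (l : List (Op A)) (L : List (List (Op A))) (σ : A → Bool) :
    runSlices (l :: L) σ = runSlices L (actList l σ) := rfl

theorem runSlices_append (L₁ L₂ : List (List (Op A))) (σ : A → Bool) :
    runSlices (L₁ ++ L₂) σ = runSlices L₂ (runSlices L₁ σ) := by
  simp [runSlices, List.foldl_append]

theorem runSlices_range_succ (f : ℕ → List (List (Op A))) (n : ℕ) (σ : A → Bool) :
    runSlices ((List.range (n + 1)).flatMap f) σ =
      runSlices (f n) (runSlices ((List.range n).flatMap f) σ) := by
  rw [List.range_succ, List.flatMap_append, runSlices_append]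
  simp

theorem runSlices_range_map_succ (f : ℕ → List (Op A)) (n : ℕ) (σ : A → Bool) :
    runSlices ((List.range (n + 1)).map f) σ =
      actList (f n) (runSlices ((List.range n).map f) σ) := by
  rw [List.range_succ, List.map_append, runSlices_append]
  rfl

/-- All targets of the slices lie in `S`. -/
def Writes (L : List (List (Op A))) (S : A → Prop) : Prop :=
  ∀ l ∈ L, ∀ o ∈ l, ∀ w, o.target = some w → S w

theorem Writes.runSlices_eq {L : List (List (Op A))} {S : A → Prop} (h : Writes L S) {w : A}
    (hw : ¬ S w) (σ : A → Bool) : runSlices L σ w = σ w := by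
  induction L generalizing σ with
  | nil => rfl
  | cons l L ih =>
    rw [runSlices_cons, ih (fun l hl => h l (List.mem_cons_of_mem _ hl)),
      actList_of_not_target fun o ho e => hw (h l List.mem_cons_self o ho w e)]

theorem Writes.append {L₁ L₂ : List (List (Op A))} {S : A → Prop} (h₁ : Writes L₁ S)
    (h₂ : Writes L₂ S) : Writes (L₁ ++ L₂) S := by
  intro l hl
  rcases List.mem_append.1 hl with h | h
  exacts [h₁ l h, h₂ l h]

theorem Writes.mono {L : List (List (Op A))} {S T : A → Prop} (h : Writes L S)
    (hST : ∀ w, S w → T w) : Writes L T :=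
  fun l hl o ho w hw => hST w (h l hl o ho w hw)

/-- The slices in reverse order. -/
def revSlices (L : List (List (Op A))) : List (List (Op A)) := (L.map List.reverse).reverse

/-- Each operation is its own inverse, so reversing the order undoes them all. Uncomputation of the
scratch space rests on this. -/
theorem actList_reverse_actList {l : List (Op A)} (h : ∀ o ∈ l, o.wires.Nodup) (σ : A → Bool) :
    actList l.reverse (actList l σ) = σ := by
  induction l generalizing σ with
  | nil => rfl
  | cons o l ih =>
    rw [List.reverse_cons, actList_append, actList_cons o l,
      ih fun o ho => h o (List.mem_cons_of_mem _ ho), actList_cons, actList_nil,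
      Op.act_act _ (h o List.mem_cons_self)]

theorem runSlices_revSlices {L : List (List (Op A))} (h : ∀ l ∈ L, ∀ o ∈ l, o.wires.Nodup)
    (σ : A → Bool) : runSlices (revSlices L) (runSlices L σ) = σ := by
  induction L generalizing σ with
  | nil => rfl
  | cons l L ih =>
    have : revSlices (l :: L) = revSlices L ++ [l.reverse] := by simp [revSlices]
    rw [this, runSlices_append, runSlices_cons l L, ih fun l hl => h l (List.mem_cons_of_mem _ hl),
      runSlices_cons, runSlices_nil, actList_reverse_actList (h l List.mem_cons_self)]

theorem mem_revSlices {L : List (List (Op A))} {l : List (Op A)} :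
    l ∈ revSlices L ↔ l.reverse ∈ L := by
  constructor
  · intro h
    simp only [revSlices, List.mem_reverse, List.mem_map] at h
    obtain ⟨l', hl', rfl⟩ := h
    simpa
  · intro h
    simp only [revSlices, List.mem_reverse, List.mem_map]
    exact ⟨_, h, by simp⟩

open Classical in
/-- Operations that avoid the wires in `S` do not depend on them. -/
theorem actList_overlay {l : List (Op A)} {S : A → Prop} (h : ∀ o ∈ l, ∀ w ∈ o.wires, ¬ S w)
    (hn : ∀ o ∈ l, o.wires.Nodup) (σ τ : A → Bool) :
    actList l (fun w => if S w then τ w else σ w) =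
      fun w => if S w then τ w else actList l σ w := by
  induction l generalizing σ with
  | nil => rfl
  | cons o l ih =>
    have : o.act (fun w => if S w then τ w else σ w) =
        fun w => if S w then τ w else o.act σ w := by
      ext w
      by_cases ht : o.target = some w
      · have hS := h o List.mem_cons_self w (Op.target_mem_wires ht)
        rw [Op.act_of_target _ _ ht, if_neg hS, if_neg hS, Op.act_of_target _ _ ht]
        congr 1
        exact Op.ctrl_congr o (fun v hv _ => if_neg (h o List.mem_cons_self v hv))
          (hn o List.mem_cons_self)
      · rw [Op.act_of_ne _ _ ht, Op.act_of_ne _ _ ht]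
    rw [actList_cons, this, ih (fun o ho => h o (List.mem_cons_of_mem _ ho))
      fun o ho => hn o (List.mem_cons_of_mem _ ho)]
    rfl

open Classical in
theorem runSlices_overlay {L : List (List (Op A))} {S : A → Prop}
    (h : ∀ l ∈ L, ∀ o ∈ l, ∀ w ∈ o.wires, ¬ S w)
    (hn : ∀ l ∈ L, ∀ o ∈ l, o.wires.Nodup) (σ τ : A → Bool) :
    runSlices L (fun w => if S w then τ w else σ w) =
      fun w => if S w then τ w else runSlices L σ w := by
  induction L generalizing σ with
  | nil => rfl
  | cons l L ih =>
    rw [runSlices_cons, actList_overlay (h l List.mem_cons_self) (hn l List.mem_cons_self),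
      ih (fun o ho => h o (List.mem_cons_of_mem _ ho))
      fun o ho => hn o (List.mem_cons_of_mem _ ho)]
    rfl

end ActList

/-! ### Arrays of cells

The scratch qubits are arranged in `P` columns; `cell P p o` is the `o`-th wire of column `p`. -/

/-- The `o`-th scratch wire in column `p` of `P` columns. -/
def cell (P p o : ℕ) : Addr := .scratch (o * P + p)

theorem cell_inj {P p p' o o' : ℕ} (hp : p < P) (hp' : p' < P) :
    cell P p o = cell P p' o' ↔ p = p' ∧ o = o' := by
  constructor
  · intro h
    have h : o * P + p = o' * P + p' := Addr.scratch.inj h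
    have h1 := congrArg (· / P) h
    have h2 := congrArg (· % P) h
    have hP : 0 < P := by omega
    simp only [mul_comm _ P, Nat.mul_add_div hP, Nat.div_eq_of_lt hp, Nat.div_eq_of_lt hp',
      Nat.mul_add_mod, Nat.mod_eq_of_lt hp, Nat.mod_eq_of_lt hp'] at h1 h2
    exact ⟨h2, by simpa using h1⟩
  · rintro ⟨rfl, rfl⟩; rfl

theorem cell_inRange {N r d P F p o : ℕ} (hp : p < P) (ho : o < F) :
    (cell P p o).InRange N r d (F * P) := by
  change o * P + p < F * P
  calc o * P + p < o * P + P := by omega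
    _ = (o + 1) * P := by ring
    _ ≤ F * P := Nat.mul_le_mul_right _ ho

/-- The contents of column `p`. -/
def view (P : ℕ) (σ : Addr → Bool) (p o : ℕ) : Bool := σ (cell P p o)

/-- The wires in rows `lo, …, hi - 1` of the array. -/
def Rows (P lo hi : ℕ) (w : Addr) : Prop := ∃ p < P, ∃ o, lo ≤ o ∧ o < hi ∧ w = cell P p o

theorem Rows.mono {P lo hi lo' hi' : ℕ} (h : lo' ≤ lo) (h' : hi ≤ hi') {w : Addr}
    (hw : Rows P lo hi w) : Rows P lo' hi' w := by
  obtain ⟨p, hp, o, h1, h2, rfl⟩ := hw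
  exact ⟨p, hp, o, h.trans h1, h2.trans_le h', rfl⟩

theorem rows_cell {P lo hi p o : ℕ} (hp : p < P) :
    Rows P lo hi (cell P p o) ↔ lo ≤ o ∧ o < hi := by
  constructor
  · rintro ⟨p', hp', o', h1, h2, e⟩
    obtain ⟨rfl, rfl⟩ := (cell_inj hp hp').1 e
    exact ⟨h1, h2⟩
  · rintro ⟨h1, h2⟩
    exact ⟨p, hp, o, h1, h2, rfl⟩

theorem Writes.view_eq {P lo hi : ℕ} {L : List (List (Op Addr))} (h : Writes L (Rows P lo hi))
    (σ : Addr → Bool) {p o : ℕ} (hp : p < P) (ho : o < lo ∨ hi ≤ o) :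
    view P (runSlices L σ) p o = view P σ p o := by
  refine h.runSlices_eq ?_ σ
  rw [rows_cell hp]
  omega

/-- A family of operations, one for each index below `n`, on existing distinct wires. -/
theorem sliceValid_family {N r d w n : ℕ} {g : ℕ → Op Addr} (h : ∀ p < n, (g p).Valid N r d w)
    (hd : ∀ p < n, ∀ q < n, p ≠ q → (g p).wires.Disjoint (g q).wires) :
    SliceValid N r d w ((List.range n).map g) := by
  constructor
  · intro o ho
    obtain ⟨p, hp, rfl⟩ := List.mem_map.1 ho
    exact h p (List.mem_range.1 hp)
  · rw [List.pairwise_map]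
    refine List.nodup_range.imp_of_mem fun {p q} hp hq hpq => ?_
    exact hd p (List.mem_range.1 hp) q (List.mem_range.1 hq) hpq

/-- The operation `o` in each of the `P` columns. -/
def locSlice (P : ℕ) (o : Op ℕ) : List (Op Addr) :=
  (List.range P).map fun p => o.map (cell P p)

/-- Add row `o₁` of column `π p` to row `o₂` of column `p`, for the columns selected by `m`. -/
def fetchSlice (P : ℕ) (m : ℕ → Bool) (π : ℕ → ℕ) (o₁ o₂ : ℕ) : List (Op Addr) :=
  (List.range P).map fun p => bif m p then .cnot (cell P (π p) o₁) (cell P p o₂) else .nop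

/-- Negate row `o` in the columns selected by `m`. -/
def flipSlice (P : ℕ) (m : ℕ → Bool) (o : ℕ) : List (Op Addr) :=
  (List.range P).map fun p => bif m p then .x (cell P p o) else .nop

theorem Op.nodup_wires_map_of_inj {A B : Type} {f : A → B} (o : Op A)
    (hf : Function.Injective f) (hn : o.wires.Nodup) : (o.map f).wires.Nodup := by
  rw [Op.wires_map]
  exact hn.map hf

theorem cell_injective {P p : ℕ} (hp : p < P) : Function.Injective (cell P p) :=
  fun _ _ h => ((cell_inj hp hp).1 h).2

theorem locSlice_disjoint {P : ℕ} (o : Op ℕ) : ∀ p < P, ∀ q < P, p ≠ q →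
    (o.map (cell P p)).wires.Disjoint (o.map (cell P q)).wires := by
  intro p hp q hq hpq w hw hw'
  rw [Op.wires_map, List.mem_map] at hw hw'
  obtain ⟨a, -, rfl⟩ := hw
  obtain ⟨b, -, e⟩ := hw'
  exact hpq ((cell_inj hq hp).1 e).1.symm

theorem locSlice_valid {N r d P F : ℕ} {o : Op ℕ} (hn : o.wires.Nodup)
    (ho : ∀ i ∈ o.wires, i < F) : SliceValid N r d (F * P) (locSlice P o) := by
  refine sliceValid_family (fun p hp => ⟨?_, ?_⟩) (locSlice_disjoint o)
  · intro w hw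
    rw [Op.wires_map, List.mem_map] at hw
    obtain ⟨i, hi, rfl⟩ := hw
    exact cell_inRange hp (ho i hi)
  · exact Op.nodup_wires_map_of_inj o (cell_injective hp) hn

theorem Op.target_map {A B : Type} (f : A → B) (o : Op A) :
    (o.map f).target = o.target.map f := by
  cases o <;> rfl

theorem Op.ctrl_map {A B : Type} (f : A → B) (o : Op A) (s : B → Bool) :
    (o.map f).ctrl s = o.ctrl (s ∘ f) := by
  cases o <;> rfl

theorem view_locSlice {P : ℕ} {o : Op ℕ} (hn : o.wires.Nodup) (σ : Addr → Bool) {p : ℕ}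
    (hp : p < P) : view P (actList (locSlice P o) σ) p = o.act (view P σ p) := by
  -- Only the distinctness and disjointness of wires are needed, so the parameters are arbitrary and
  -- the row bound just has to exceed every wire of `o`.
  have hv := locSlice_valid (N := 0) (r := 0) (d := 0) (P := P) (F := o.wires.sum + 1) hn
    fun i hi => Nat.lt_succ_of_le (List.single_le_sum (by simp) i hi)
  ext i
  by_cases hi : o.target = some i
  · rw [Op.act_of_target _ _ hi]
    have := actList_of_target (fun o ho => (hv.1 o ho).2) hv.2 (o := o.map (cell P p))
      (List.mem_map_of_mem (List.mem_range.2 hp)) (w := cell P p i)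
      (by rw [Op.target_map, hi]; rfl) σ
    rw [view, this, Op.ctrl_map]
    rfl
  · rw [Op.act_of_ne _ _ hi]
    refine actList_of_not_target (fun o' ho' e => ?_) σ
    obtain ⟨q, hq, rfl⟩ := List.mem_map.1 ho'
    rw [Op.target_map] at e
    obtain ⟨j, hj, e⟩ := Option.map_eq_some_iff.1 e
    rw [(cell_inj (List.mem_range.1 hq) hp).1 e |>.2] at hj
    exact hi hj

theorem view_locSlices {P : ℕ} {l : List (Op ℕ)} (hn : ∀ o ∈ l, o.wires.Nodup)
    (σ : Addr → Bool) {p : ℕ} (hp : p < P) :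
    view P (runSlices (l.map (locSlice P)) σ) p = actList l (view P σ p) := by
  induction l generalizing σ with
  | nil => rfl
  | cons o l ih =>
    rw [List.map_cons, runSlices_cons, ih fun o ho => hn o (List.mem_cons_of_mem _ ho),
      view_locSlice (hn o List.mem_cons_self) _ hp]
    rfl

theorem locSlices_writes {P lo hi : ℕ} {l : List (Op ℕ)}
    (h : ∀ o ∈ l, ∀ i, o.target = some i → lo ≤ i ∧ i < hi) :
    Writes (l.map (locSlice P)) (Rows P lo hi) := by
  intro l' hl' o' ho' w hw
  obtain ⟨o, ho, rfl⟩ := List.mem_map.1 hl'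
  obtain ⟨p, hp, rfl⟩ := List.mem_map.1 ho'
  rw [Op.target_map] at hw
  obtain ⟨i, hi, rfl⟩ := Option.map_eq_some_iff.1 hw
  exact (rows_cell (List.mem_range.1 hp)).2 (h o ho i hi)

/-! ### Slices that move bits between columns or flip them -/

section Fetch

variable {P : ℕ} {m : ℕ → Bool} {π : ℕ → ℕ} {o₁ o₂ : ℕ}

theorem fetchSlice_valid {N r d F : ℕ} (hπ : ∀ p < P, m p = true → π p < P)
    (hinj : ∀ p < P, ∀ q < P, m p = true → m q = true → π p = π q → p = q) (h12 : o₁ ≠ o₂)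
    (h1 : o₁ < F) (h2 : o₂ < F) : SliceValid N r d (F * P) (fetchSlice P m π o₁ o₂) := by
  refine sliceValid_family (fun p hp => ?_) fun p hp q hq hpq => ?_
  · cases hm : m p
    · exact ⟨by simp [Op.wires], by simp [Op.wires]⟩
    · refine ⟨?_, ?_⟩
      · simp only [cond_true, Op.wires, List.mem_cons, List.not_mem_nil, or_false,
          forall_eq_or_imp, forall_eq]
        exact ⟨cell_inRange (hπ p hp hm) h1, cell_inRange hp h2⟩
      · simp [Op.wires, cell_inj (hπ p hp hm) hp, h12]
  · cases hm : m p
    · simp [Op.wires, List.Disjoint]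
    · cases hm' : m q
      · simp [Op.wires, List.Disjoint]
      · have := hinj p hp q hq hm hm'
        simp [Op.wires, cell_inj (hπ q hq hm') hp, cell_inj hq (hπ p hp hm), cell_inj hq hp,
          cell_inj (hπ q hq hm') (hπ p hp hm), h12, h12.symm]
        tauto

/-- All reads are in row `o₁` and all writes in row `o₂`, so no column sees a bit that has already
changed. Injectivity of `π` keeps the controls on distinct wires. -/
theorem view_fetchSlice (hπ : ∀ p < P, m p = true → π p < P)
    (hinj : ∀ p < P, ∀ q < P, m p = true → m q = true → π p = π q → p = q) (h12 : o₁ ≠ o₂)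
    (σ : Addr → Bool) {p : ℕ} (hp : p < P) :
    view P (actList (fetchSlice P m π o₁ o₂) σ) p =
      Function.update (view P σ p) o₂ (view P σ p o₂ ^^ (m p && view P σ (π p) o₁)) := by
  have hv := fetchSlice_valid (N := 0) (r := 0) (d := 0) (F := o₁ + o₂ + 1) hπ hinj h12
    (by omega) (by omega)
  have hother : ∀ i, (i = o₂ → m p = false) →
      view P (actList (fetchSlice P m π o₁ o₂) σ) p i = view P σ p i := by
    intro i hi
    refine actList_of_not_target (fun o ho e => ?_) σ
    obtain ⟨q, hq, rfl⟩ := List.mem_map.1 ho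
    cases hm : m q <;> simp only [hm, cond_false, cond_true, Op.target, reduceCtorEq,
      Option.some.injEq] at e
    obtain ⟨rfl, rfl⟩ := (cell_inj (List.mem_range.1 hq) hp).1 e
    simp [hi rfl] at hm
  ext i
  by_cases hi : i = o₂
  · subst hi
    rw [Function.update_self]
    cases hm : m p
    · rw [hother i fun _ => hm]; simp
    · have := actList_of_target (fun o ho => (hv.1 o ho).2) hv.2
        (o := .cnot (cell P (π p) o₁) (cell P p i))
        (List.mem_map.2 ⟨p, List.mem_range.2 hp, by simp [hm]⟩) (w := cell P p i) rfl σ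
      simpa [view, Op.ctrl] using this
  · rw [Function.update_of_ne hi, hother i fun e => (hi e).elim]

theorem fetchSlice_writes {lo hi : ℕ} (h1 : lo ≤ o₂) (h2 : o₂ < hi) :
    Writes [fetchSlice P m π o₁ o₂] (Rows P lo hi) := by
  intro l hl o ho w hw
  rw [List.mem_singleton] at hl
  subst hl
  obtain ⟨p, hp, rfl⟩ := List.mem_map.1 ho
  cases hm : m p <;> simp only [hm, cond_false, cond_true, Op.target, reduceCtorEq,
      Option.some.injEq] at hw
  subst hw
  exact (rows_cell (List.mem_range.1 hp)).2 ⟨h1, h2⟩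

theorem flipSlice_valid {N r d F o : ℕ} (ho : o < F) :
    SliceValid N r d (F * P) (flipSlice P m o) := by
  refine sliceValid_family (fun p hp => ?_) fun p hp q hq hpq => ?_
  · cases m p
    · exact ⟨by simp [Op.wires], by simp [Op.wires]⟩
    · refine ⟨?_, by simp [Op.wires]⟩
      simp only [cond_true, Op.wires, List.mem_cons, List.not_mem_nil, or_false, forall_eq]
      exact cell_inRange hp ho
  · cases m p <;> cases m q <;> simp [Op.wires, List.Disjoint, cell_inj hp hq, hpq]

theorem view_flipSlice {o : ℕ} (σ : Addr → Bool) {p : ℕ} (hp : p < P) :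
    view P (actList (flipSlice P m o) σ) p =
      Function.update (view P σ p) o (view P σ p o ^^ m p) := by
  have hv := flipSlice_valid (N := 0) (r := 0) (d := 0) (P := P) (m := m) (F := o + 1)
    (Nat.lt_succ_self o)
  have hother : ∀ i, (i = o → m p = false) →
      view P (actList (flipSlice P m o) σ) p i = view P σ p i := by
    intro i hi
    refine actList_of_not_target (fun o ho e => ?_) σ
    obtain ⟨q, hq, rfl⟩ := List.mem_map.1 ho
    cases hm : m q <;> simp only [hm, cond_false, cond_true, Op.target, reduceCtorEq,
      Option.some.injEq] at e
    obtain ⟨rfl, rfl⟩ := (cell_inj (List.mem_range.1 hq) hp).1 e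
    simp [hi rfl] at hm
  ext i
  by_cases hi : i = o
  · subst hi
    rw [Function.update_self]
    cases hm : m p
    · rw [hother i fun _ => hm]; simp
    · have := actList_of_target (fun o ho => (hv.1 o ho).2) hv.2
        (o := .x (cell P p i))
        (List.mem_map.2 ⟨p, List.mem_range.2 hp, by simp [hm]⟩) (w := cell P p i) rfl σ
      simpa [view, Op.ctrl] using this
  · rw [Function.update_of_ne hi, hother i fun e => (hi e).elim]

theorem flipSlice_writes {lo hi o : ℕ} (h1 : lo ≤ o) (h2 : o < hi) :
    Writes [flipSlice P m o] (Rows P lo hi) := by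
  intro l hl o ho w hw
  rw [List.mem_singleton] at hl
  subst hl
  obtain ⟨p, hp, rfl⟩ := List.mem_map.1 ho
  cases hm : m p <;> simp only [hm, cond_false, cond_true, Op.target, reduceCtorEq,
      Option.some.injEq] at hw
  subst hw
  exact (rows_cell (List.mem_range.1 hp)).2 ⟨h1, h2⟩

end Fetch

/-! ### Binary numbers and their comparison -/

/-- The number with given binary digits. -/
def bitsVal (W : ℕ) (f : ℕ → Bool) : ℕ :=
  match W with
  | 0 => 0
  | W + 1 => bitsVal W f + 2 ^ W * (f W).toNat

theorem bitsVal_lt (W : ℕ) (f : ℕ → Bool) : bitsVal W f < 2 ^ W := by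
  induction W with
  | zero => simp [bitsVal]
  | succ W ih =>
    rw [bitsVal, pow_succ]
    cases f W <;> simp <;> omega

theorem bitsVal_congr {W : ℕ} {f g : ℕ → Bool} (h : ∀ b < W, f b = g b) :
    bitsVal W f = bitsVal W g := by
  induction W with
  | zero => rfl
  | succ W ih => rw [bitsVal, bitsVal, ih fun b hb => h b (by omega), h W (by omega)]

/-- If the top digits differ they decide, and otherwise the lower digits do. The choice is written
as an XOR of the old result with a conjunction, so that CNOT and Toffoli operations compute it. -/
theorem bitsVal_succ_lt (W : ℕ) (f g : ℕ → Bool) :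
    decide (bitsVal (W + 1) g < bitsVal (W + 1) f) =
      (decide (bitsVal W g < bitsVal W f) ^^
        ((f W ^^ g W) && (f W ^^ decide (bitsVal W g < bitsVal W f)))) := by
  have h1 := bitsVal_lt W f
  have h2 := bitsVal_lt W g
  rw [bitsVal, bitsVal]
  cases f W <;> cases g W <;> simp <;> omega

theorem bitsVal_inj {W : ℕ} {f g : ℕ → Bool} (h : bitsVal W f = bitsVal W g) :
    ∀ b < W, f b = g b := by
  induction W with
  | zero => intro b hb; omega
  | succ W ih =>
    have h1 := bitsVal_lt W f
    have h2 := bitsVal_lt W g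
    rw [bitsVal, bitsVal] at h
    have h3 : f W = g W := by
      cases hf : f W <;> cases hg : g W <;> simp [hf, hg] at h ⊢ <;> omega
    have h4 : bitsVal W f = bitsVal W g := by rw [h3] at h; omega
    intro b hb
    rcases (by omega : b < W ∨ b = W) with h5 | rfl
    exacts [ih h4 b h5, h3]

theorem bitsVal_add (W V : ℕ) (f : ℕ → Bool) :
    bitsVal (W + V) f = bitsVal W f + 2 ^ W * bitsVal V fun b => f (W + b) := by
  induction V with
  | zero => simp [bitsVal]
  | succ V ih => rw [← add_assoc, bitsVal, ih, bitsVal, pow_add]; ring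

theorem bitsVal_testBit {W x : ℕ} (hx : x < 2 ^ W) : bitsVal W x.testBit = x := by
  have : ∀ W, bitsVal W x.testBit = x % 2 ^ W := by
    intro W
    induction W with
    | zero => simp [bitsVal, Nat.mod_one]
    | succ W ih =>
      rw [bitsVal, ih, Nat.mod_pow_succ, Nat.testBit_eq_decide_div_mod_eq]
      rcases Nat.mod_two_eq_zero_or_one (x / 2 ^ W) with h | h <;> simp [h]
  rw [this, Nat.mod_eq_of_lt hx]

/-! ### The sorting circuit

A compare step on records of `W` bits uses `5 * W + 1` rows: the own record in rows `base + b`, the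
record of the partner in rows `base + W + b`, comparison results in rows `base + 2 * W + b`,
    auxiliary
bits in rows `base + 3 * W + 1 + b`, and the selected record in rows `base + (4 * W + 1) + b`. -/

/-- Compare the two records bit by bit, starting with the least significant bit. -/
def compareOps (W base n : ℕ) : List (Op ℕ) :=
  (List.range n).flatMap fun b =>
    [.cnot (base + b) (base + W + b),
      .cnot (base + 2 * W + b) (base + 2 * W + (b + 1)),
      .cnot (base + b) (base + 3 * W + 1 + b),
      .cnot (base + 2 * W + b) (base + 3 * W + 1 + b),
      .tof (base + W + b) (base + 3 * W + 1 + b) (base + 2 * W + (b + 1))]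

/-- Write the selected record. -/
def selectOps (W base n : ℕ) : List (Op ℕ) :=
  (List.range n).flatMap fun b =>
    [.cnot (base + b) (base + (4 * W + 1) + b),
      .tof (base + 3 * W) (base + W + b) (base + (4 * W + 1) + b)]

theorem actList_flatMap_range_succ {A : Type} [DecidableEq A] (f : ℕ → List (Op A)) (n : ℕ)
    (σ : A → Bool) : actList ((List.range (n + 1)).flatMap f) σ =
      actList (f n) (actList ((List.range n).flatMap f) σ) := by
  rw [List.range_succ, List.flatMap_append, actList_append]
  simp

/-- Row `base + 2 * W + b` keeps the comparison of the lowest `b` digits, by the recursion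
`bitsVal_succ_lt`. The partner's digits are replaced by their XOR with the own digits, which both
the recursion and the later selection need. -/
theorem actList_compareOps {W base : ℕ} {μ : ℕ → Bool} (hμ : ∀ o, base + 2 * W ≤ o → μ o = false)
    {n : ℕ} (hn : n ≤ W) :
    (∀ o < base + W, actList (compareOps W base n) μ o = μ o) ∧
    (∀ b < W, actList (compareOps W base n) μ (base + W + b) =
      if b < n then μ (base + b) ^^ μ (base + W + b) else μ (base + W + b)) ∧
    (∀ b ≤ n, actList (compareOps W base n) μ (base + 2 * W + b) =
      decide (bitsVal b (fun i => μ (base + W + i)) < bitsVal b (fun i => μ (base + i)))) ∧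
    (∀ b, n < b → b ≤ W → actList (compareOps W base n) μ (base + 2 * W + b) = false) ∧
    (∀ b, n ≤ b → actList (compareOps W base n) μ (base + 3 * W + 1 + b) = false) := by
  induction n with
  | zero =>
    refine ⟨fun o _ => rfl, fun b _ => rfl, fun b hb => ?_, fun b _ _ => hμ _ (by omega),
      fun b _ => hμ _ (by omega)⟩
    obtain rfl : b = 0 := by omega
    exact hμ _ (by omega)
  | succ n ih =>
    obtain ⟨h1, h2, h3, h4, h5⟩ := ih (by omega)
    have hs := actList_flatMap_range_succ (fun b =>
      [.cnot (base + b) (base + W + b),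
      .cnot (base + 2 * W + b) (base + 2 * W + (b + 1)),
      .cnot (base + b) (base + 3 * W + 1 + b),
      .cnot (base + 2 * W + b) (base + 3 * W + 1 + b),
      .tof (base + W + b) (base + 3 * W + 1 + b) (base + 2 * W + (b + 1))]) n μ
    change actList (compareOps W base (n + 1)) μ = actList _ (actList (compareOps W base n) μ) at hs
    rw [hs]
    set ν := actList (compareOps W base n) μ with hν
    have a1 := h1 (base + n) (by omega)
    have a2 := h2 n (by omega)
    rw [if_neg (lt_irrefl n)] at a2
    have a3 := h3 n le_rfl
    have a4 := h4 (n + 1) (by omega) (by omega)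
    have a5 := h5 n le_rfl
    simp only [actList_cons, actList_nil, Op.act, Op.target, Op.ctrl]
    refine ⟨fun o ho => ?_, fun b hb => ?_, fun b hb => ?_, fun b hb hb' => ?_, fun b hb => ?_⟩
    · rw [← h1 o ho]
      simp only [Function.update_apply]
      simp only [show o ≠ base + 2 * W + (n + 1) by omega, show o ≠ base + 3 * W + 1 + n by omega,
        show o ≠ base + W + n by omega, if_false]
    · have e := h2 b hb
      simp only [Function.update_apply]
      simp only [show base + W + b ≠ base + 2 * W + (n + 1) by omega,
        show base + W + b ≠ base + 3 * W + 1 + n by omega, if_false]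
      by_cases hbn : b = n
      · subst hbn
        simp [a1, a2, Bool.xor_comm]
      · rw [if_neg (by omega), e]
        simp only [show b < n + 1 ↔ b < n by omega]
    · by_cases hbn : b = n + 1
      · subst hbn
        rw [bitsVal_succ_lt]
        simp only [Function.update_apply]
        simp only [show base + 2 * W + n ≠ base + 2 * W + (n + 1) by omega,
          show base + 2 * W + n ≠ base + 3 * W + 1 + n by omega,
          show base + 2 * W + (n + 1) ≠ base + 3 * W + 1 + n by omega,
          show base + 2 * W + (n + 1) ≠ base + W + n by omega,
          show base + 2 * W + n ≠ base + W + n by omega,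
          show base + W + n ≠ base + 2 * W + (n + 1) by omega,
          show base + W + n ≠ base + 3 * W + 1 + n by omega,
          show base + 3 * W + 1 + n ≠ base + 2 * W + (n + 1) by omega,
          show base + 3 * W + 1 + n ≠ base + W + n by omega,
          show base + n ≠ base + 2 * W + (n + 1) by omega,
          show base + n ≠ base + W + n by omega, if_false, if_true, a1, a2, a3, a4, a5]
        simp only [Bool.false_xor]
        rw [Bool.xor_comm (μ (base + W + n))]
      · rw [← h3 b (by omega)]
        simp only [Function.update_apply]
        simp only [show base + 2 * W + b ≠ base + 2 * W + (n + 1) by omega,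
          show base + 2 * W + b ≠ base + 3 * W + 1 + n by omega,
          show base + 2 * W + b ≠ base + W + n by omega, if_false]
    · rw [← h4 b (by omega) hb']
      simp only [Function.update_apply]
      simp only [show base + 2 * W + b ≠ base + 2 * W + (n + 1) by omega,
        show base + 2 * W + b ≠ base + 3 * W + 1 + n by omega,
        show base + 2 * W + b ≠ base + W + n by omega, if_false]
    · rw [← h5 b (by omega)]
      simp only [Function.update_apply]
      simp only [show base + 3 * W + 1 + b ≠ base + 2 * W + (n + 1) by omega,
        show base + 3 * W + 1 + b ≠ base + 3 * W + 1 + n by omega,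
        show base + 3 * W + 1 + b ≠ base + W + n by omega, if_false]

/-- Row `base + 3 * W` holds the decision. Since the rows `base + W + b` contain own digit XOR
partner's digit at that point, adding them under the decision exchanges one for the other. -/
theorem actList_selectOps {W base : ℕ} {μ : ℕ → Bool}
    (hμ : ∀ o, base + (4 * W + 1) ≤ o → μ o = false) {n : ℕ} (hn : n ≤ W) :
    (∀ o, o < base + (4 * W + 1) ∨ base + (4 * W + 1) + n ≤ o →
      actList (selectOps W base n) μ o = μ o) ∧
    (∀ b < n, actList (selectOps W base n) μ (base + (4 * W + 1) + b) =
      (μ (base + b) ^^ (μ (base + 3 * W) && μ (base + W + b)))) := by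
  induction n with
  | zero => exact ⟨fun o _ => rfl, fun b hb => by omega⟩
  | succ n ih =>
    obtain ⟨h1, h2⟩ := ih (by omega)
    have hs := actList_flatMap_range_succ (fun b =>
      [.cnot (base + b) (base + (4 * W + 1) + b),
      .tof (base + 3 * W) (base + W + b) (base + (4 * W + 1) + b)]) n μ
    change actList (selectOps W base (n + 1)) μ = actList _ (actList (selectOps W base n) μ) at hs
    rw [hs]
    set ν := actList (selectOps W base n) μ with hν
    simp only [actList_cons, actList_nil, Op.act, Op.target, Op.ctrl]
    refine ⟨fun o ho => ?_, fun b hb => ?_⟩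
    · rw [← h1 o (by omega), Function.update_of_ne (by omega), Function.update_of_ne (by omega)]
    · by_cases hbn : b = n
      · subst hbn
        rw [Function.update_self, Function.update_self, Function.update_of_ne (by omega),
          Function.update_of_ne (by omega), h1 (base + (4 * W + 1) + b) (by omega),
          h1 (base + b) (by omega), h1 (base + 3 * W) (by omega), h1 (base + W + b) (by omega),
          hμ _ (by omega)]
        simp
      · rw [Function.update_of_ne (by omega), Function.update_of_ne (by omega), h2 b (by omega)]

theorem compareOps_wires {W base n : ℕ} (hn : n ≤ W) {o : Op ℕ} (ho : o ∈ compareOps W base n) :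
    o.wires.Nodup ∧ (∀ i ∈ o.wires, i < base + (5 * W + 1)) ∧
      ∀ i, o.target = some i → base + W ≤ i := by
  obtain ⟨b, hb, ho⟩ := List.mem_flatMap.1 ho
  rw [List.mem_range] at hb
  simp only [List.mem_cons, List.not_mem_nil, or_false] at ho
  rcases ho with rfl | rfl | rfl | rfl | rfl <;> simp [Op.wires, Op.target] <;> omega

theorem selectOps_wires {W base n : ℕ} (hn : n ≤ W) {o : Op ℕ} (ho : o ∈ selectOps W base n) :
    o.wires.Nodup ∧ (∀ i ∈ o.wires, i < base + (5 * W + 1)) ∧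
      ∀ i, o.target = some i → base + W ≤ i := by
  obtain ⟨b, hb, ho⟩ := List.mem_flatMap.1 ho
  rw [List.mem_range] at hb
  simp only [List.mem_cons, List.not_mem_nil, or_false] at ho
  rcases ho with rfl | rfl <;> simp [Op.wires, Op.target] <;> omega

/-- A step of the sorting network. -/
def sortStep (P W base k j : ℕ) : List (List (Op Addr)) :=
  ((List.range W).map fun b => fetchSlice P (fun _ => true) (SortNet.partner k j) (base + b)
      (base + W + b)) ++
    ((compareOps W base W).map (locSlice P) ++
      ([flipSlice P (SortNet.upper k j) (base + 3 * W)] ++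
        (selectOps W base W).map (locSlice P)))

theorem partner_inj (k j : ℕ) {p q : ℕ} (h : SortNet.partner k j p = SortNet.partner k j q) :
    p = q := by
  rw [← SortNet.partner_partner k j p, h, SortNet.partner_partner]

theorem sortStep_valid {N r d κ F W base k j : ℕ} (hk : k < κ) (hF : base + (5 * W + 1) ≤ F)
    {l : List (Op Addr)} (hl : l ∈ sortStep (2 ^ κ) W base k j) :
    SliceValid N r d (F * 2 ^ κ) l := by
  simp only [sortStep, List.mem_append, List.mem_map, List.mem_singleton, List.mem_range] at hl
  rcases hl with ⟨b, hb, rfl⟩ | ⟨o, ho, rfl⟩ | rfl | ⟨o, ho, rfl⟩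
  · exact fetchSlice_valid (fun p hp _ => SortNet.partner_lt hk hp)
      (fun p _ q _ _ _ h => partner_inj k j h) (by omega) (by omega) (by omega)
  · have := compareOps_wires le_rfl ho
    exact locSlice_valid this.1 fun i hi => (this.2.1 i hi).trans_le hF
  · exact flipSlice_valid (by omega)
  · have := selectOps_wires le_rfl ho
    exact locSlice_valid this.1 fun i hi => (this.2.1 i hi).trans_le hF

theorem Writes.of_mem {A : Type} {L : List (List (Op A))} {S : A → Prop}
    (h : ∀ l ∈ L, Writes [l] S) : Writes L S :=
  fun l hl => h l hl l List.mem_cons_self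

theorem sortStep_writes {P W base k j : ℕ} :
    Writes (sortStep P W base k j) (Rows P (base + W) (base + (5 * W + 1))) := by
  refine Writes.append ?_ (Writes.append ?_ (Writes.append ?_ ?_))
  · refine Writes.of_mem fun l hl => ?_
    obtain ⟨b, hb, rfl⟩ := List.mem_map.1 hl
    rw [List.mem_range] at hb
    exact fetchSlice_writes (by omega) (by omega)
  · refine locSlices_writes fun o ho i hi => ?_
    have := compareOps_wires le_rfl ho
    exact ⟨this.2.2 i hi, this.2.1 i (Op.target_mem_wires hi)⟩
  · exact flipSlice_writes (by omega) (by omega)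
  · refine locSlices_writes fun o ho i hi => ?_
    have := selectOps_wires le_rfl ho
    exact ⟨this.2.2 i hi, this.2.1 i (Op.target_mem_wires hi)⟩

/-- Rows `base, …, base + W - 1` of column `p` as a number. -/
def record (P W base : ℕ) (σ : Addr → Bool) (p : ℕ) : ℕ :=
  bitsVal W fun b => view P σ p (base + b)

theorem view_fetchRecord {κ W base k j n : ℕ} (hk : k < κ) (hn : n ≤ W) (σ : Addr → Bool)
    {p : ℕ} (hp : p < 2 ^ κ) (o : ℕ) :
    view (2 ^ κ) (runSlices ((List.range n).map fun b => fetchSlice (2 ^ κ) (fun _ => true)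
      (SortNet.partner k j) (base + b) (base + W + b)) σ) p o =
      if base + W ≤ o ∧ o < base + W + n then
        (view (2 ^ κ) σ p o ^^ view (2 ^ κ) σ (SortNet.partner k j p) (o - W))
      else view (2 ^ κ) σ p o := by
  induction n generalizing p o with
  | zero => rw [if_neg (by omega)]; rfl
  | succ n ih =>
    rw [runSlices_range_map_succ, view_fetchSlice (fun p hp _ => SortNet.partner_lt hk hp)
      (fun p _ q _ _ _ h => partner_inj k j h) (by omega) _ hp, Function.update_apply,
      ih (by omega) hp, ih (by omega) hp, ih (by omega) (SortNet.partner_lt hk hp)]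
    by_cases ho : o = base + W + n
    · subst ho
      rw [if_pos rfl, if_neg (by omega), if_neg (by omega), if_pos (by omega),
        show base + W + n - W = base + n by omega]
      simp
    · rw [if_neg ho]
      simp only [show o < base + W + (n + 1) ↔ o < base + W + n ∨ o = base + W + n by omega,
        ho, or_false]

/-- The decision bit is "the partner is smaller" XOR "this column keeps the larger record"; for ties
either choice gives the same number. The selected record lands in fresh rows with only zeros behind
it, which is the hypothesis for the next step. -/
theorem record_sortStep {κ W base k j : ℕ} (hk : k < κ) {σ : Addr → Bool}
    (hσ : ∀ p < 2 ^ κ, ∀ o, base + W ≤ o → view (2 ^ κ) σ p o = false) :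
    (∀ p < 2 ^ κ, record (2 ^ κ) W (base + (4 * W + 1))
      (runSlices (sortStep (2 ^ κ) W base k j) σ) p =
        SortNet.step k j (record (2 ^ κ) W base σ) p) ∧
    ∀ p < 2 ^ κ, ∀ o, base + (4 * W + 1) + W ≤ o →
      view (2 ^ κ) (runSlices (sortStep (2 ^ κ) W base k j) σ) p o = false := by
  have main : ∀ p < 2 ^ κ, ∃ c : Bool,
      (c = (decide (record (2 ^ κ) W base σ (SortNet.partner k j p) <
        record (2 ^ κ) W base σ p) ^^ SortNet.upper k j p)) ∧
      (∀ b < W, view (2 ^ κ) (runSlices (sortStep (2 ^ κ) W base k j) σ) p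
        (base + (4 * W + 1) + b) = bif c then view (2 ^ κ) σ (SortNet.partner k j p) (base + b)
          else view (2 ^ κ) σ p (base + b)) := by
    intro p hp
    simp only [sortStep, runSlices_append]
    rw [view_locSlices (fun o ho => (selectOps_wires le_rfl ho).1) _ hp]
    rw [runSlices_cons, runSlices_nil, view_flipSlice _ hp]
    rw [view_locSlices (fun o ho => (compareOps_wires le_rfl ho).1) _ hp]
    have hfetch := view_fetchRecord (base := base) (j := j) hk (le_refl W) σ hp
    set ν := view (2 ^ κ) (runSlices ((List.range W).map fun b => fetchSlice (2 ^ κ)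
      (fun _ => true) (SortNet.partner k j) (base + b) (base + W + b)) σ) p with hν
    have hν0 : ∀ o, base + 2 * W ≤ o → ν o = false := by
      intro o ho
      rw [hfetch, if_neg (by omega), hσ p hp o (by omega)]
    have hνa : ∀ b < W, ν (base + b) = view (2 ^ κ) σ p (base + b) := by
      intro b hb
      rw [hfetch, if_neg (by omega)]
    have hνy : ∀ b < W, ν (base + W + b) =
        view (2 ^ κ) σ (SortNet.partner k j p) (base + b) := by
      intro b hb
      rw [hfetch, if_pos (by omega), hσ p hp _ (by omega),
        show base + W + b - W = base + b by omega]
      simp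
    obtain ⟨h1, h2, h3, h4, h5⟩ := actList_compareOps hν0 (le_refl W)
    set ξ := actList (compareOps W base W) ν with hξ
    have hlt := h3 W le_rfl
    rw [bitsVal_congr hνa, bitsVal_congr hνy,
      show base + 2 * W + W = base + 3 * W by ring] at hlt
    have hξ0 : ∀ o, base + (4 * W + 1) ≤ o → (Function.update ξ (base + 3 * W)
        (ξ (base + 3 * W) ^^ SortNet.upper k j p)) o = false := by
      intro o ho
      rw [Function.update_of_ne (by omega)]
      have := h5 (o - (base + 3 * W + 1)) (by omega)
      rwa [show base + 3 * W + 1 + (o - (base + 3 * W + 1)) = o by omega] at this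
    obtain ⟨-, s2⟩ := actList_selectOps hξ0 (le_refl W)
    refine ⟨_, rfl, fun b hb => ?_⟩
    rw [s2 b hb, Function.update_of_ne (by omega), Function.update_self, hlt, h1 _ (by omega),
      hνa b hb]
    by_cases hb0 : base + W + b = base + 3 * W
    · omega
    · rw [Function.update_of_ne hb0, h2 b hb, if_pos hb, hνa b hb, hνy b hb, record, record]
      generalize (decide (bitsVal W (fun b => view (2 ^ κ) σ (SortNet.partner k j p) (base + b)) <
        bitsVal W fun b => view (2 ^ κ) σ p (base + b)) ^^ SortNet.upper k j p) = c
      cases c <;> simp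
  refine ⟨fun p hp => ?_, fun p hp o ho => ?_⟩
  · obtain ⟨c, hc, h⟩ := main p hp
    rw [record, bitsVal_congr h, SortNet.step]
    rw [show bitsVal W (fun b => bif c then view (2 ^ κ) σ (SortNet.partner k j p) (base + b)
      else view (2 ^ κ) σ p (base + b)) = bif c then
        record (2 ^ κ) W base σ (SortNet.partner k j p) else record (2 ^ κ) W base σ p by
      cases c <;> rfl, hc]
    cases hu : SortNet.upper k j p
    · by_cases hlt : record (2 ^ κ) W base σ (SortNet.partner k j p) < record (2 ^ κ) W base σ p
      · simp [hlt, hlt.le]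
      · simp [hlt, not_lt.1 hlt]
    · by_cases hlt : record (2 ^ κ) W base σ (SortNet.partner k j p) < record (2 ^ κ) W base σ p
      · simp [hlt, hlt.le]
      · simp [hlt, not_lt.1 hlt]
  · rw [(sortStep_writes (P := 2 ^ κ) (k := k) (j := j)).view_eq σ hp (by omega)]
    exact hσ p hp o (by omega)

/-- The sorting circuit for `2 ^ κ` records of `W` bits, with input in row `base`. -/
def sortSlices (κ W base : ℕ) : List (List (Op Addr)) :=
  (List.range (κ * κ)).flatMap fun s =>
    sortStep (2 ^ κ) W (base + s * (4 * W + 1)) (s / κ) (s % κ)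

theorem sortSlices_valid {N r d κ F W base : ℕ} (hF : base + κ * κ * (4 * W + 1) + W ≤ F)
    {l : List (Op Addr)} (hl : l ∈ sortSlices κ W base) :
    SliceValid N r d (F * 2 ^ κ) l := by
  obtain ⟨s, hs, hl⟩ := List.mem_flatMap.1 hl
  rw [List.mem_range] at hs
  refine sortStep_valid (Nat.div_lt_of_lt_mul hs) ?_ hl
  have : (s + 1) * (4 * W + 1) ≤ κ * κ * (4 * W + 1) := Nat.mul_le_mul_right _ hs
  linarith

theorem sortSlices_writes {κ W base : ℕ} : Writes (sortSlices κ W base)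
    (Rows (2 ^ κ) (base + W) (base + κ * κ * (4 * W + 1) + W)) := by
  intro l hl
  obtain ⟨s, hs, hl⟩ := List.mem_flatMap.1 hl
  rw [List.mem_range] at hs
  have : (s + 1) * (4 * W + 1) ≤ κ * κ * (4 * W + 1) := Nat.mul_le_mul_right _ hs
  exact (sortStep_writes.mono fun w hw => hw.mono (by nlinarith) (by nlinarith)) l hl

/-- The sorting circuit sorts: its output is a sorted rearrangement of the input. -/
theorem record_sortSlices {κ W base : ℕ} {σ : Addr → Bool}
    (hσ : ∀ p < 2 ^ κ, ∀ o, base + W ≤ o → view (2 ^ κ) σ p o = false) :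
    (∃ τ : Equiv.Perm ℕ, (∀ p < 2 ^ κ, τ p < 2 ^ κ) ∧ ∀ p < 2 ^ κ, ∀ b < W,
      view (2 ^ κ) (runSlices (sortSlices κ W base) σ) p (base + κ * κ * (4 * W + 1) + b) =
        view (2 ^ κ) σ (τ p) (base + b)) ∧
    (∀ p q, p ≤ q → q < 2 ^ κ →
      record (2 ^ κ) W (base + κ * κ * (4 * W + 1)) (runSlices (sortSlices κ W base) σ) p ≤
      record (2 ^ κ) W (base + κ * κ * (4 * W + 1)) (runSlices (sortSlices κ W base) σ) q) ∧
    ∀ p < 2 ^ κ, ∀ o, base + κ * κ * (4 * W + 1) + W ≤ o →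
      view (2 ^ κ) (runSlices (sortSlices κ W base) σ) p o = false := by
  have main : ∀ n ≤ κ * κ, (∀ p < 2 ^ κ, record (2 ^ κ) W (base + n * (4 * W + 1))
      (runSlices ((List.range n).flatMap fun s =>
        sortStep (2 ^ κ) W (base + s * (4 * W + 1)) (s / κ) (s % κ)) σ) p =
        SortNet.net κ (record (2 ^ κ) W base σ) n p) ∧
      ∀ p < 2 ^ κ, ∀ o, base + n * (4 * W + 1) + W ≤ o →
        view (2 ^ κ) (runSlices ((List.range n).flatMap fun s =>
        sortStep (2 ^ κ) W (base + s * (4 * W + 1)) (s / κ) (s % κ)) σ) p o = false := by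
    intro n
    induction n with
    | zero => intro _; simpa [SortNet.net] using hσ
    | succ n ih =>
      intro hn
      obtain ⟨h1, h2⟩ := ih (by omega)
      have hk : n / κ < κ := Nat.div_lt_of_lt_mul (by omega)
      obtain ⟨h3, h4⟩ := record_sortStep (j := n % κ) hk h2
      rw [runSlices_range_succ, show base + (n + 1) * (4 * W + 1) =
        base + n * (4 * W + 1) + (4 * W + 1) by ring]
      refine ⟨fun p hp => ?_, h4⟩
      rw [h3 p hp, SortNet.net]
      exact SortNet.step_congr hk _ h1 p hp
  obtain ⟨h1, h2⟩ := main (κ * κ) le_rfl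
  refine ⟨?_, fun p q hpq hq => ?_, h2⟩
  -- The network rearranges records as numbers. Equal numbers have equal digits, so whole records
  -- are rearranged, payloads included.
  · obtain ⟨τ, ht, ht'⟩ := SortNet.exists_perm_net κ (record (2 ^ κ) W base σ) le_rfl
    refine ⟨τ, ht, fun p hp => ?_⟩
    have := (h1 p hp).trans (ht' p)
    exact bitsVal_inj this
  · have := SortNet.net_sorted κ (record (2 ^ κ) W base σ) hpq hq
    rw [← h1 p (hpq.trans_lt hq), ← h1 q hq] at this
    exact this

/-! ### Propagation of payloads

A stage for records of `e` payload bits and a validity bit: the own record is in rows `c + b`, the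
record of the column `2 ^ j` to the left in rows `c + (e + 1) + b`, and the next record in rows
`c + (2 * e + 3) + b`. -/

/-- Keep the own record if it is valid, and take the other one otherwise. -/
def mergeOps (e c n : ℕ) : List (Op ℕ) :=
  [.cnot (c + e) (c + (2 * e + 2)), .x (c + (2 * e + 2))] ++
    (List.range n).flatMap fun b => [.cnot (c + b) (c + (2 * e + 3) + b),
      .tof (c + (2 * e + 2)) (c + (e + 1) + b) (c + (2 * e + 3) + b)]

/-- Row `c + (2 * e + 2)` receives the negated validity bit, which controls the addition of the
other record. This amounts to a choice between the two records when invalid records are zero, as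
they are in the propagation. -/
theorem actList_mergeOps {e c : ℕ} {μ : ℕ → Bool} (hμ : ∀ o, c + (2 * e + 2) ≤ o → μ o = false)
    {n : ℕ} (hn : n ≤ e + 1) :
    (∀ o, o < c + (2 * e + 2) ∨ c + (2 * e + 3) + n ≤ o → actList (mergeOps e c n) μ o = μ o) ∧
    actList (mergeOps e c n) μ (c + (2 * e + 2)) = !μ (c + e) ∧
    (∀ b < n, actList (mergeOps e c n) μ (c + (2 * e + 3) + b) =
      (μ (c + b) ^^ (!μ (c + e) && μ (c + (e + 1) + b)))) := by
  induction n with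
  | zero =>
    simp only [mergeOps, List.range_zero, List.flatMap_nil, List.append_nil, actList_cons,
      actList_nil, Op.act, Op.target, Op.ctrl, Function.update_self, Function.update_idem]
    refine ⟨fun o ho => ?_, ?_, fun b hb => by omega⟩
    · by_cases h : o = c + (2 * e + 2)
      · omega
      · rw [Function.update_of_ne h]
    · simp [hμ _ le_rfl]
  | succ n ih =>
    obtain ⟨h1, h2, h3⟩ := ih (by omega)
    have hs : actList (mergeOps e c (n + 1)) μ = actList [.cnot (c + n) (c + (2 * e + 3) + n),
      .tof (c + (2 * e + 2)) (c + (e + 1) + n) (c + (2 * e + 3) + n)]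
        (actList (mergeOps e c n) μ) := by
      rw [mergeOps, actList_append, actList_flatMap_range_succ, mergeOps, actList_append]
    rw [hs]
    simp only [actList_cons, actList_nil, Op.act, Op.target, Op.ctrl]
    refine ⟨fun o ho => ?_, ?_, fun b hb => ?_⟩
    · rw [Function.update_of_ne (by omega), Function.update_of_ne (by omega), h1 o (by omega)]
    · rw [Function.update_of_ne (by omega), Function.update_of_ne (by omega), h2]
    · by_cases hbn : b = n
      · subst hbn
        rw [Function.update_self, Function.update_self, Function.update_of_ne (by omega),
          Function.update_of_ne (by omega), h2, h1 (c + (2 * e + 3) + b) (by omega),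
          h1 (c + b) (by omega), h1 (c + (e + 1) + b) (by omega), hμ _ (by omega)]
        simp
      · rw [Function.update_of_ne (by omega), Function.update_of_ne (by omega), h3 b (by omega)]

theorem mergeOps_wires {e c : ℕ} {o : Op ℕ} (ho : o ∈ mergeOps e c (e + 1)) :
    o.wires.Nodup ∧ (∀ i ∈ o.wires, i < c + (3 * e + 4)) ∧
      ∀ i, o.target = some i → c + (2 * e + 2) ≤ i := by
  rw [mergeOps, List.mem_append] at ho
  rcases ho with ho | ho
  · simp only [List.mem_cons, List.not_mem_nil, or_false] at ho
    rcases ho with rfl | rfl <;> simp [Op.wires, Op.target] <;> omega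
  · obtain ⟨b, hb, ho⟩ := List.mem_flatMap.1 ho
    rw [List.mem_range] at hb
    simp only [List.mem_cons, List.not_mem_nil, or_false] at ho
    rcases ho with rfl | rfl <;> simp [Op.wires, Op.target] <;> omega

/-- A stage of the propagation. -/
def mergeStep (P e c j : ℕ) : List (List (Op Addr)) :=
  ((List.range (e + 1)).map fun b => fetchSlice P (fun p => decide (2 ^ j ≤ p))
      (fun p => p - 2 ^ j) (c + b) (c + (e + 1) + b)) ++
    (mergeOps e c (e + 1)).map (locSlice P)

theorem shift_inj {j p q : ℕ} (hp : decide (2 ^ j ≤ p) = true) (hq : decide (2 ^ j ≤ q) = true)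
    (h : p - 2 ^ j = q - 2 ^ j) : p = q := by
  rw [decide_eq_true_eq] at hp hq
  omega

theorem mergeStep_valid {N r d P F e c j : ℕ} (hF : c + (3 * e + 4) ≤ F)
    {l : List (Op Addr)} (hl : l ∈ mergeStep P e c j) : SliceValid N r d (F * P) l := by
  simp only [mergeStep, List.mem_append, List.mem_map, List.mem_range] at hl
  rcases hl with ⟨b, hb, rfl⟩ | ⟨o, ho, rfl⟩
  · exact fetchSlice_valid (fun p hp _ => (Nat.sub_le _ _).trans_lt hp)
      (fun p _ q _ hp hq h => shift_inj hp hq h) (by omega) (by omega) (by omega)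
  · have := mergeOps_wires ho
    exact locSlice_valid this.1 fun i hi => (this.2.1 i hi).trans_le hF

theorem mergeStep_writes {P e c j : ℕ} :
    Writes (mergeStep P e c j) (Rows P (c + (e + 1)) (c + (3 * e + 4))) := by
  refine Writes.append ?_ ?_
  · refine Writes.of_mem fun l hl => ?_
    obtain ⟨b, hb, rfl⟩ := List.mem_map.1 hl
    rw [List.mem_range] at hb
    exact fetchSlice_writes (by omega) (by omega)
  · refine locSlices_writes fun o ho i hi => ?_
    have := mergeOps_wires ho
    have h1 := this.2.2 i hi
    exact ⟨by omega, this.2.1 i (Op.target_mem_wires hi)⟩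

theorem view_fetchShift {P e c j n : ℕ} (hn : n ≤ e + 1) (σ : Addr → Bool) {p : ℕ} (hp : p < P)
    (o : ℕ) :
    view P (runSlices ((List.range n).map fun b => fetchSlice P (fun p => decide (2 ^ j ≤ p))
      (fun p => p - 2 ^ j) (c + b) (c + (e + 1) + b)) σ) p o =
      if c + (e + 1) ≤ o ∧ o < c + (e + 1) + n then
        (view P σ p o ^^ (decide (2 ^ j ≤ p) && view P σ (p - 2 ^ j) (o - (e + 1))))
      else view P σ p o := by
  induction n generalizing p o with
  | zero => rw [if_neg (by omega)]; rfl
  | succ n ih =>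
    rw [runSlices_range_map_succ, view_fetchSlice (fun p hp _ => (Nat.sub_le _ _).trans_lt hp)
      (fun p _ q _ hp hq h => shift_inj hp hq h) (by omega) _ hp, Function.update_apply,
      ih (by omega) hp, ih (by omega) hp, ih (by omega) ((Nat.sub_le _ _).trans_lt hp)]
    by_cases ho : o = c + (e + 1) + n
    · subst ho
      rw [if_pos rfl, if_neg (by omega), if_neg (by omega), if_pos (by omega),
        show c + (e + 1) + n - (e + 1) = c + n by omega]
    · rw [if_neg ho]
      simp only [show o < c + (e + 1) + (n + 1) ↔ o < c + (e + 1) + n ∨ o = c + (e + 1) + n by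
        omega, ho, or_false]

theorem view_mergeStep {P e c j : ℕ} {σ : Addr → Bool}
    (hσ : ∀ p < P, ∀ o, c + (e + 1) ≤ o → view P σ p o = false) {p : ℕ} (hp : p < P) {b : ℕ}
    (hb : b < e + 1) :
    view P (runSlices (mergeStep P e c j) σ) p (c + (2 * e + 3) + b) =
      (view P σ p (c + b) ^^ (!view P σ p (c + e) &&
        (decide (2 ^ j ≤ p) && view P σ (p - 2 ^ j) (c + b)))) := by
  rw [mergeStep, runSlices_append, view_locSlices (fun o ho => (mergeOps_wires ho).1) _ hp,
    (actList_mergeOps _ le_rfl).2.2 b hb]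
  · rw [view_fetchShift le_rfl σ hp, view_fetchShift le_rfl σ hp, view_fetchShift le_rfl σ hp,
      if_neg (by omega), if_neg (by omega), if_pos (by omega),
      hσ p hp (c + (e + 1) + b) (by omega),
      show c + (e + 1) + b - (e + 1) = c + b by omega]
    simp
  · intro o ho
    rw [view_fetchShift le_rfl σ hp, if_neg (by omega), hσ p hp o (by omega)]

/-- The propagation for `2 ^ κ` columns. -/
def mergeSlices (κ e c : ℕ) : List (List (Op Addr)) :=
  (List.range κ).flatMap fun j => mergeStep (2 ^ κ) e (c + j * (2 * e + 3)) j

theorem mergeSlices_valid {N r d κ F e c : ℕ} (hF : c + κ * (2 * e + 3) + (e + 1) ≤ F)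
    {l : List (Op Addr)} (hl : l ∈ mergeSlices κ e c) : SliceValid N r d (F * 2 ^ κ) l := by
  obtain ⟨s, hs, hl⟩ := List.mem_flatMap.1 hl
  rw [List.mem_range] at hs
  refine mergeStep_valid ?_ hl
  have : (s + 1) * (2 * e + 3) ≤ κ * (2 * e + 3) := Nat.mul_le_mul_right _ hs
  linarith

theorem mergeSlices_writes {κ e c : ℕ} : Writes (mergeSlices κ e c)
    (Rows (2 ^ κ) (c + (e + 1)) (c + κ * (2 * e + 3) + (e + 1))) := by
  intro l hl
  obtain ⟨s, hs, hl⟩ := List.mem_flatMap.1 hl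
  rw [List.mem_range] at hs
  have : (s + 1) * (2 * e + 3) ≤ κ * (2 * e + 3) := Nat.mul_le_mul_right _ hs
  exact (mergeStep_writes.mono fun w hw => hw.mono (by nlinarith) (by nlinarith)) l hl

/-- If `g p` is the last column up to `p` with a valid record, then each column receives the
record of `g p`. -/
theorem view_mergeSlices {κ e c : ℕ} {σ : Addr → Bool}
    (hσ : ∀ p < 2 ^ κ, ∀ o, c + (e + 1) ≤ o → view (2 ^ κ) σ p o = false)
    (h0 : ∀ p < 2 ^ κ, view (2 ^ κ) σ p (c + e) = false →
      ∀ b < e + 1, view (2 ^ κ) σ p (c + b) = false)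
    (g : ℕ → ℕ) (hg : ∀ p < 2 ^ κ, g p ≤ p) (hg1 : ∀ p < 2 ^ κ, view (2 ^ κ) σ (g p) (c + e) = true)
    (hg2 : ∀ p < 2 ^ κ, ∀ q, g p < q → q ≤ p → view (2 ^ κ) σ q (c + e) = false) :
    (∀ p < 2 ^ κ, ∀ b < e + 1, view (2 ^ κ) (runSlices (mergeSlices κ e c) σ) p
      (c + κ * (2 * e + 3) + b) = view (2 ^ κ) σ (g p) (c + b)) ∧
    ∀ p < 2 ^ κ, ∀ o, c + κ * (2 * e + 3) + (e + 1) ≤ o →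
      view (2 ^ κ) (runSlices (mergeSlices κ e c) σ) p o = false := by
  -- All columns from `g p` to `p` share the same last valid column.
  have hgg : ∀ p < 2 ^ κ, ∀ q, g p ≤ q → q ≤ p → g q = g p := by
    intro p hp q h1 h2
    have h3 := hg q (h2.trans_lt hp)
    rcases lt_trichotomy (g q) (g p) with h | h | h
    · have := hg2 q (h2.trans_lt hp) (g p) h h1
      rw [hg1 p hp] at this
      cases this
    · exact h
    · have := hg2 p hp (g q) h (h3.trans h2)
      rw [hg1 q (h2.trans_lt hp)] at this
      cases this
  -- Doubling: after `j` stages a column holds the record of its source if that is less than `2 ^ j`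
  -- columns away, and zeros otherwise.
  have main : ∀ j, (∀ p < 2 ^ κ, ∀ b < e + 1,
      view (2 ^ κ) (runSlices ((List.range j).flatMap fun j =>
        mergeStep (2 ^ κ) e (c + j * (2 * e + 3)) j) σ) p (c + j * (2 * e + 3) + b) =
        (decide (p < g p + 2 ^ j) && view (2 ^ κ) σ (g p) (c + b))) ∧
      ∀ p < 2 ^ κ, ∀ o, c + j * (2 * e + 3) + (e + 1) ≤ o →
        view (2 ^ κ) (runSlices ((List.range j).flatMap fun j =>
        mergeStep (2 ^ κ) e (c + j * (2 * e + 3)) j) σ) p o = false := by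
    intro j
    induction j with
    | zero =>
      refine ⟨fun p hp b hb => ?_, by simpa using hσ⟩
      simp only [List.range_zero, List.flatMap_nil, runSlices_nil, zero_mul, add_zero, pow_zero]
      by_cases h : g p = p
      · simp [h]
      · have h1 := hg p hp
        rw [h0 p hp (hg2 p hp p (by omega) le_rfl) b hb, decide_eq_false (by omega)]
        rfl
    | succ j ih =>
      obtain ⟨h1, h2⟩ := ih
      rw [runSlices_range_succ]
      refine ⟨fun p hp b hb => ?_, fun p hp o ho => ?_⟩
      · rw [show c + (j + 1) * (2 * e + 3) + b = c + j * (2 * e + 3) + (2 * e + 3) + b by ring,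
          view_mergeStep h2 hp hb, h1 p hp b hb, h1 p hp e (by omega),
          h1 (p - 2 ^ j) ((Nat.sub_le _ _).trans_lt hp) b hb, hg1 p hp, pow_succ]
        have hpos := Nat.two_pow_pos j
        by_cases h3 : p < g p + 2 ^ j
        · rw [decide_eq_true h3, decide_eq_true (show p < g p + 2 ^ j * 2 by omega)]
          simp
        · by_cases h4 : 2 ^ j ≤ p
          · rw [hgg p hp (p - 2 ^ j) (by omega) (by omega)]
            by_cases h5 : p < g p + 2 ^ j * 2
            · rw [decide_eq_false h3, decide_eq_true h4, decide_eq_true h5,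
                decide_eq_true (show p - 2 ^ j < g p + 2 ^ j by omega)]
              simp
            · rw [decide_eq_false h3, decide_eq_true h4, decide_eq_false h5,
                decide_eq_false (show ¬ p - 2 ^ j < g p + 2 ^ j by omega)]
              simp
          · omega
      · rw [mergeStep_writes.view_eq _ hp (by
          have : (j + 1) * (2 * e + 3) = j * (2 * e + 3) + (2 * e + 3) := by ring
          omega)]
        exact h2 p hp o (by
          have : (j + 1) * (2 * e + 3) = j * (2 * e + 3) + (2 * e + 3) := by ring
          omega)
  obtain ⟨h1, h2⟩ := main κ
  refine ⟨fun p hp b hb => ?_, h2⟩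
  rw [mergeSlices, h1 p hp b hb, decide_eq_true (by omega), Bool.true_and]

/-! ### Copying rows -/

/-- Add rows `o₁, …, o₁ + n - 1` to rows `o₂, …, o₂ + n - 1`. -/
def copyOps (o₁ o₂ n : ℕ) : List (Op ℕ) := (List.range n).map fun b => .cnot (o₁ + b) (o₂ + b)

theorem actList_copyOps {o₁ o₂ n : ℕ} (h : o₁ + n ≤ o₂) (μ : ℕ → Bool) (o : ℕ) :
    actList (copyOps o₁ o₂ n) μ o =
      if o₂ ≤ o ∧ o < o₂ + n then μ o ^^ μ (o₁ + (o - o₂)) else μ o := by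
  induction n generalizing o with
  | zero => rw [if_neg (by omega)]; rfl
  | succ n ih =>
    rw [copyOps, List.range_succ, List.map_append, actList_append]
    have ih' := ih (by omega)
    simp only [copyOps] at ih'
    simp only [List.map_cons, List.map_nil, actList_cons, actList_nil, Op.act, Op.target, Op.ctrl,
      Function.update_apply]
    rw [ih', ih', ih']
    by_cases ho : o = o₂ + n
    · subst ho
      rw [if_pos rfl, if_neg (by omega), if_neg (by omega), if_pos (by omega),
        show o₂ + n - o₂ = n by omega]
    · rw [if_neg ho]
      simp only [show o < o₂ + (n + 1) ↔ o < o₂ + n ∨ o = o₂ + n by omega, ho, or_false]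

theorem copyOps_wires {o₁ o₂ n : ℕ} (h : o₁ + n ≤ o₂) {o : Op ℕ} (ho : o ∈ copyOps o₁ o₂ n) :
    o.wires.Nodup ∧ (∀ i ∈ o.wires, i < o₂ + n) ∧ ∀ i, o.target = some i → o₂ ≤ i := by
  obtain ⟨b, hb, rfl⟩ := List.mem_map.1 ho
  rw [List.mem_range] at hb
  simp [Op.wires, Op.target]
  omega

/-! ### Parallel table lookup

Column `p < 2 ^ m` provides the database entry with index `p % N` together with the `n` binary
    digits
of this index, under the address `p`.  Column `p` with `2 ^ m ≤ p < 2 ^ (m + 1)` requests the entry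
whose address it has in rows `ib, …, ib + m - 1`. -/

/-- Load bit `k` of the database entries into row `o` of the columns `c * N, …, c * N + N - 1`. -/
def dataSlice (P N m c k o : ℕ) : List (Op Addr) :=
  (List.range N).map fun j =>
    bif decide (c * N + j < 2 ^ m) then .cnot (.data j k) (cell P (c * N + j) o) else .nop

theorem data_ne_cell (j k P p o : ℕ) : Addr.data j k ≠ cell P p o := by simp [cell]

/-- Each database qubit controls at most one operation of the slice. Copying it to every block of
`N` columns therefore takes one slice per block, and the number of blocks is small because `2 ^ m`
will exceed `N` by a small factor only. -/
theorem dataSlice_valid {N r d m F c k o : ℕ} (hk : k < d) (ho : o < F) :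
    SliceValid N r d (F * 2 ^ (m + 1)) (dataSlice (2 ^ (m + 1)) N m c k o) := by
  have hlt : ∀ p, p < 2 ^ m → p < 2 ^ (m + 1) := fun p hp => by rw [pow_succ]; omega
  refine sliceValid_family (fun j hj => ?_) fun j hj j' hj' hne => ?_
  · cases hm : decide (c * N + j < 2 ^ m)
    · exact ⟨by simp [Op.wires], by simp [Op.wires]⟩
    · rw [decide_eq_true_eq] at hm
      refine ⟨?_, by simp [Op.wires, data_ne_cell]⟩
      simp only [cond_true, Op.wires, List.mem_cons, List.not_mem_nil, or_false,
        forall_eq_or_imp, forall_eq]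
      exact ⟨⟨hj, hk⟩, cell_inRange (hlt _ hm) ho⟩
  · cases hm : decide (c * N + j < 2 ^ m)
    · simp [Op.wires, List.Disjoint]
    · cases hm' : decide (c * N + j' < 2 ^ m)
      · simp [Op.wires, List.Disjoint]
      · rw [decide_eq_true_eq] at hm hm'
        simp [Op.wires, cell_inj (hlt _ hm') (hlt _ hm), hne.symm, data_ne_cell,
          (data_ne_cell _ _ _ _ _).symm]

theorem dataSlice_writes {N m c k o lo hi : ℕ} (h1 : lo ≤ o) (h2 : o < hi) :
    Writes [dataSlice (2 ^ (m + 1)) N m c k o] (Rows (2 ^ (m + 1)) lo hi) := by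
  have hlt : ∀ p, p < 2 ^ m → p < 2 ^ (m + 1) := fun p hp => by rw [pow_succ]; omega
  intro l hl o ho w hw
  rw [List.mem_singleton] at hl
  subst hl
  obtain ⟨p, hp, rfl⟩ := List.mem_map.1 ho
  cases hm : decide (c * N + p < 2 ^ m) <;> simp only [hm, cond_false, cond_true, Op.target,
    reduceCtorEq, Option.some.injEq] at hw
  subst hw
  rw [decide_eq_true_eq] at hm
  exact (rows_cell (hlt _ hm)).2 ⟨h1, h2⟩

theorem view_dataSlice {N m c k o : ℕ} (hN : 0 < N) (σ : Addr → Bool) {p : ℕ}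
    (hp : p < 2 ^ (m + 1)) (i : ℕ) :
    view (2 ^ (m + 1)) (actList (dataSlice (2 ^ (m + 1)) N m c k o) σ) p i =
      if i = o ∧ p / N = c ∧ p < 2 ^ m then (view (2 ^ (m + 1)) σ p i ^^ σ (.data (p % N) k))
      else view (2 ^ (m + 1)) σ p i := by
  have hlt : ∀ p, p < 2 ^ m → p < 2 ^ (m + 1) := fun p hp => by rw [pow_succ]; omega
  have hv := dataSlice_valid (N := N) (r := 0) (d := k + 1) (m := m) (F := o + 1) (c := c)
    (k := k) (o := o) (by omega) (by omega)
  split_ifs with h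
  · obtain ⟨rfl, rfl, hm⟩ := h
    have := actList_of_target (fun o ho => (hv.1 o ho).2) hv.2
      (o := .cnot (.data (p % N) k) (cell (2 ^ (m + 1)) p i))
      (List.mem_map.2 ⟨p % N, List.mem_range.2 (Nat.mod_lt _ hN), by
        simp [Nat.div_add_mod', hm]⟩) (w := cell (2 ^ (m + 1)) p i) rfl σ
    simpa [view, Op.ctrl] using this
  · refine actList_of_not_target (fun o' ho' e => ?_) σ
    obtain ⟨j, hj, rfl⟩ := List.mem_map.1 ho'
    rw [List.mem_range] at hj
    cases hm : decide (c * N + j < 2 ^ m) <;> simp only [hm, cond_false, cond_true, Op.target,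
      reduceCtorEq, Option.some.injEq] at e
    rw [decide_eq_true_eq] at hm
    obtain ⟨rfl, rfl⟩ := (cell_inj (hlt _ hm) hp).1 e
    refine h ⟨rfl, ?_, hm⟩
    rw [mul_comm, Nat.mul_add_div hN, Nat.div_eq_of_lt hj, add_zero]

theorem view_flipRows {P n o₀ : ℕ} (m : ℕ → ℕ → Bool) (σ : Addr → Bool) {p : ℕ} (hp : p < P)
    (o : ℕ) :
    view P (runSlices ((List.range n).map fun b => flipSlice P (m b) (o₀ + b)) σ) p o =
      if o₀ ≤ o ∧ o < o₀ + n then view P σ p o ^^ m (o - o₀) p else view P σ p o := by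
  induction n generalizing o with
  | zero => rw [if_neg (by omega)]; rfl
  | succ n ih =>
    rw [runSlices_range_map_succ, view_flipSlice _ hp, Function.update_apply, ih, ih]
    by_cases ho : o = o₀ + n
    · subst ho
      rw [if_pos rfl, if_neg (by omega), if_pos (by omega), show o₀ + n - o₀ = n by omega]
    · rw [if_neg ho]
      simp only [show o < o₀ + (n + 1) ↔ o < o₀ + n ∨ o = o₀ + n by omega, ho, or_false]

theorem view_fetchOwn {P n o₁ o₂ : ℕ} (m : ℕ → Bool) (h : o₁ + n ≤ o₂) (σ : Addr → Bool) {p : ℕ}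
    (hp : p < P) (o : ℕ) :
    view P (runSlices ((List.range n).map fun b => fetchSlice P m (fun p => p) (o₁ + b) (o₂ + b))
      σ) p o =
      if o₂ ≤ o ∧ o < o₂ + n then view P σ p o ^^ (m p && view P σ p (o₁ + (o - o₂)))
      else view P σ p o := by
  induction n generalizing o with
  | zero => rw [if_neg (by omega)]; rfl
  | succ n ih =>
    have ih := ih (by omega)
    rw [runSlices_range_map_succ, view_fetchSlice (fun p hp _ => hp) (fun _ _ _ _ _ _ h => h)
      (by omega) _ hp, Function.update_apply, ih, ih, ih]
    by_cases ho : o = o₂ + n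
    · subst ho
      rw [if_pos rfl, if_neg (by omega), if_neg (by omega), if_pos (by omega),
        show o₂ + n - o₂ = n by omega]
    · rw [if_neg ho]
      simp only [show o < o₂ + (n + 1) ↔ o < o₂ + n ∨ o = o₂ + n by omega, ho, or_false]

/-- Load the database into the columns below `2 ^ m`. -/
def dataSlices (N d m B : ℕ) : List (List (Op Addr)) :=
  (List.range (2 ^ m / N + 1)).flatMap fun c =>
    (List.range d).map fun k => dataSlice (2 ^ (m + 1)) N m c k (B + k)

theorem dataSlices_writes {N d m B : ℕ} :
    Writes (dataSlices N d m B) (Rows (2 ^ (m + 1)) B (B + d)) := by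
  refine Writes.of_mem fun l hl => ?_
  obtain ⟨c, -, hl⟩ := List.mem_flatMap.1 hl
  obtain ⟨k, hk, rfl⟩ := List.mem_map.1 hl
  rw [List.mem_range] at hk
  exact dataSlice_writes (by omega) (by omega)

theorem view_dataSlices {N d m B : ℕ} (hN : 0 < N) (σ : Addr → Bool) {p : ℕ}
    (hp : p < 2 ^ (m + 1)) (i : ℕ) :
    view (2 ^ (m + 1)) (runSlices (dataSlices N d m B) σ) p i =
      if (B ≤ i ∧ i < B + d) ∧ p < 2 ^ m then
        (view (2 ^ (m + 1)) σ p i ^^ σ (.data (p % N) (i - B)))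
      else view (2 ^ (m + 1)) σ p i := by
  -- Loading writes to cells only, so the database qubits keep their values while they serve as
  -- controls.
  have hW : ∀ L : List (List (Op Addr)), (∀ l ∈ L, ∃ c k,
      l = dataSlice (2 ^ (m + 1)) N m c k (B + k)) → ∀ τ j k,
      runSlices L τ (.data j k) = τ (.data j k) := by
    intro L hL τ j k
    refine Writes.runSlices_eq (S := fun w => ∃ p o, w = cell (2 ^ (m + 1)) p o)
      (Writes.of_mem fun l hl => ?_) (by rintro ⟨p, o, h⟩; exact data_ne_cell _ _ _ _ _ h) τ
    obtain ⟨c, k, rfl⟩ := hL l hl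
    refine (dataSlice_writes (lo := B + k) (hi := B + k + 1) le_rfl (by omega)).mono ?_
    rintro w ⟨p, -, o, -, -, rfl⟩
    exact ⟨p, o, rfl⟩
  have inner : ∀ (c n : ℕ) (σ : Addr → Bool) (i : ℕ), view (2 ^ (m + 1))
      (runSlices ((List.range n).map fun k => dataSlice (2 ^ (m + 1)) N m c k (B + k)) σ) p i =
      if (B ≤ i ∧ i < B + n) ∧ p / N = c ∧ p < 2 ^ m then
        (view (2 ^ (m + 1)) σ p i ^^ σ (.data (p % N) (i - B)))
      else view (2 ^ (m + 1)) σ p i := by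
    intro c n σ
    induction n with
    | zero => intro i; rw [if_neg (by omega)]; rfl
    | succ n ih =>
      intro i
      rw [runSlices_range_map_succ, view_dataSlice hN _ hp, ih, hW _ (by
        intro l hl
        obtain ⟨k, -, rfl⟩ := List.mem_map.1 hl
        exact ⟨c, k, rfl⟩)]
      by_cases hc : p / N = c ∧ p < 2 ^ m
      · by_cases hi : i = B + n
        · subst hi
          rw [if_pos ⟨rfl, hc⟩, if_neg (by omega), if_pos ⟨by omega, hc⟩,
            show B + n - B = n by omega]
        · rw [if_neg fun h => hi h.1]
          simp only [hc, and_true, show i < B + (n + 1) ↔ i < B + n ∨ i = B + n by omega, hi,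
            or_false]
      · rw [if_neg fun h => hc h.2, if_neg fun h => hc h.2, if_neg fun h => hc h.2]
  have outer : ∀ (C : ℕ) (i : ℕ), view (2 ^ (m + 1)) (runSlices ((List.range C).flatMap fun c =>
      (List.range d).map fun k => dataSlice (2 ^ (m + 1)) N m c k (B + k)) σ) p i =
      if (B ≤ i ∧ i < B + d) ∧ p / N < C ∧ p < 2 ^ m then
        (view (2 ^ (m + 1)) σ p i ^^ σ (.data (p % N) (i - B)))
      else view (2 ^ (m + 1)) σ p i := by
    intro C
    induction C with
    | zero => intro i; rw [if_neg fun h => absurd h.2.1 (Nat.not_lt_zero _)]; rfl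
    | succ C ih =>
      intro i
      rw [runSlices_range_succ, inner, ih, hW _ (by
        intro l hl
        obtain ⟨c, -, hl⟩ := List.mem_flatMap.1 hl
        obtain ⟨k, -, rfl⟩ := List.mem_map.1 hl
        exact ⟨c, k, rfl⟩)]
      by_cases hc : p / N = C
      · rw [if_neg (c := _ ∧ p / N < C ∧ _) (by omega)]
        simp only [hc, true_and, show C < C + 1 from Nat.lt_succ_self C]
      · rw [if_neg (c := _ ∧ p / N = C ∧ _) (by tauto)]
        simp only [show p / N < C + 1 ↔ p / N < C by omega]
  rw [dataSlices, outer]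
  by_cases hpm : p < 2 ^ m
  · have : p / N < 2 ^ m / N + 1 := Nat.lt_succ_of_le (Nat.div_le_div_right hpm.le)
    simp only [this, true_and]
  · rw [if_neg (by tauto), if_neg (by tauto)]

/-- Load the records: `d` data bits, `n` index bits, the number of the column, and the address. -/
def loadSlices (N d n m ib B : ℕ) : List (List (Op Addr)) :=
  dataSlices N d m B ++
    (((List.range n).map fun b => flipSlice (2 ^ (m + 1))
      (fun p => decide (p < 2 ^ m) && (p % N).testBit b) (B + d + b)) ++
    (((List.range (m + 1)).map fun b => flipSlice (2 ^ (m + 1))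
      (fun p => p.testBit b) (B + (d + n) + b)) ++
    (((List.range m).map fun b => flipSlice (2 ^ (m + 1))
      (fun p => decide (p < 2 ^ m) && p.testBit b) (B + (d + n + (m + 1)) + b)) ++
    ((List.range m).map fun b => fetchSlice (2 ^ (m + 1)) (fun p => decide (2 ^ m ≤ p))
      (fun p => p) (ib + b) (B + (d + n + (m + 1)) + b)))))

theorem loadSlices_valid {N r d n m ib B F : ℕ} (hib : ib + m ≤ B)
    (hF : B + (d + n + (m + 1) + m) ≤ F) {l : List (Op Addr)}
    (hl : l ∈ loadSlices N d n m ib B) : SliceValid N r d (F * 2 ^ (m + 1)) l := by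
  simp only [loadSlices, dataSlices, List.mem_append, List.mem_flatMap, List.mem_map,
    List.mem_range] at hl
  rcases hl with ⟨c, hc, k, hk, rfl⟩ | ⟨b, hb, rfl⟩ | ⟨b, hb, rfl⟩ | ⟨b, hb, rfl⟩ | ⟨b, hb, rfl⟩
  · exact dataSlice_valid hk (by omega)
  · exact flipSlice_valid (by omega)
  · exact flipSlice_valid (by omega)
  · exact flipSlice_valid (by omega)
  · exact fetchSlice_valid (fun p hp _ => hp) (fun _ _ _ _ _ _ h => h) (by omega) (by omega)
      (by omega)

theorem loadSlices_writes {N d n m ib B : ℕ} : Writes (loadSlices N d n m ib B)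
    (Rows (2 ^ (m + 1)) B (B + (d + n + (m + 1) + m))) := by
  refine Writes.append (dataSlices_writes.mono fun w hw => hw.mono le_rfl (by omega)) ?_
  refine Writes.of_mem fun l hl => ?_
  simp only [List.mem_append, List.mem_map, List.mem_range] at hl
  rcases hl with ⟨b, hb, rfl⟩ | ⟨b, hb, rfl⟩ | ⟨b, hb, rfl⟩ | ⟨b, hb, rfl⟩
  · exact flipSlice_writes (by omega) (by omega)
  · exact flipSlice_writes (by omega) (by omega)
  · exact flipSlice_writes (by omega) (by omega)
  · exact fetchSlice_writes (by omega) (by omega)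

/-- The fields are arranged by increasing significance: data bits, index digits, column number,
address. Sorting the records thus compares addresses first and columns next. Requests start with an
empty payload. -/
theorem view_loadSlices {N d n m ib B : ℕ} (hN : 0 < N) (hib : ib + m ≤ B) {σ : Addr → Bool}
    (hσ : ∀ p < 2 ^ (m + 1), ∀ o, B ≤ o → view (2 ^ (m + 1)) σ p o = false) {p : ℕ}
    (hp : p < 2 ^ (m + 1)) :
    (∀ b < d, view (2 ^ (m + 1)) (runSlices (loadSlices N d n m ib B) σ) p (B + b) =
      (decide (p < 2 ^ m) && σ (.data (p % N) b))) ∧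
    (∀ b < n, view (2 ^ (m + 1)) (runSlices (loadSlices N d n m ib B) σ) p (B + d + b) =
      (decide (p < 2 ^ m) && (p % N).testBit b)) ∧
    (∀ b < m + 1, view (2 ^ (m + 1)) (runSlices (loadSlices N d n m ib B) σ) p
      (B + (d + n) + b) = p.testBit b) ∧
    (∀ b < m, view (2 ^ (m + 1)) (runSlices (loadSlices N d n m ib B) σ) p
      (B + (d + n + (m + 1)) + b) =
        if p < 2 ^ m then p.testBit b else view (2 ^ (m + 1)) σ p (ib + b)) ∧
    (∀ o, B + (d + n + (m + 1) + m) ≤ o →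
      view (2 ^ (m + 1)) (runSlices (loadSlices N d n m ib B) σ) p o = false) := by
  have key := fun σ o => view_fetchOwn (P := 2 ^ (m + 1)) (o₁ := ib)
    (o₂ := B + (d + n + (m + 1))) (n := m) (fun p => decide (2 ^ m ≤ p)) (by omega) σ hp o
  have e1 := fun σ o => view_flipRows (P := 2 ^ (m + 1)) (n := m)
    (o₀ := B + (d + n + (m + 1))) (fun b p => decide (p < 2 ^ m) && p.testBit b) σ hp o
  have e2 := fun σ o => view_flipRows (P := 2 ^ (m + 1)) (n := m + 1) (o₀ := B + (d + n))
    (fun b p => p.testBit b) σ hp o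
  have e3 := fun σ o => view_flipRows (P := 2 ^ (m + 1)) (n := n) (o₀ := B + d)
    (fun b p => decide (p < 2 ^ m) && (p % N).testBit b) σ hp o
  have e4 := fun o => view_dataSlices (d := d) (B := B) hN σ hp o
  simp only [loadSlices, runSlices_append]
  refine ⟨fun b hb => ?_, fun b hb => ?_, fun b hb => ?_, fun b hb => ?_, fun o ho => ?_⟩
  · rw [key, if_neg (by omega), e1, if_neg (by omega), e2, if_neg (by omega), e3,
      if_neg (by omega), e4, hσ p hp _ (by omega), show B + b - B = b by omega]
    by_cases h : p < 2 ^ m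
    · rw [if_pos ⟨by omega, h⟩]; simp [h]
    · rw [if_neg (by tauto)]; simp [h]
  · rw [key, if_neg (by omega), e1, if_neg (by omega), e2, if_neg (by omega), e3,
      if_pos (by omega), e4, if_neg (by omega), hσ p hp _ (by omega),
      show B + d + b - (B + d) = b by omega]
    simp
  · rw [key, if_neg (by omega), e1, if_neg (by omega), e2, if_pos (by omega), e3,
      if_neg (by omega), e4, if_neg (by omega), hσ p hp _ (by omega),
      show B + (d + n) + b - (B + (d + n)) = b by omega]
    simp
  · rw [key, if_pos (by omega), e1, if_pos (by omega), e1, if_neg (by omega), e2,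
      if_neg (by omega), e2, if_neg (by omega), e3, if_neg (by omega), e3, if_neg (by omega),
      e4, if_neg (by omega), e4, if_neg (by omega), hσ p hp _ (by omega),
      show B + (d + n + (m + 1)) + b - (B + (d + n + (m + 1))) = b by omega]
    by_cases h : p < 2 ^ m
    · simp [h, not_le.2 h]
    · simp [h, not_lt.1 h]
  · rw [key, if_neg (by omega), e1, if_neg (by omega), e2, if_neg (by omega), e3,
      if_neg (by omega), e4, if_neg (by omega), hσ p hp _ (by omega)]

/-- The rows at which the phases of the table lookup place their output. -/
def sortedRow (d n m B : ℕ) : ℕ := B + (m + 1) * (m + 1) * (4 * (d + n + (m + 1) + m) + 1)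

def joinRow (d n m B : ℕ) : ℕ := sortedRow d n m B + (d + n + (m + 1) + m)

def joinedRow (d n m B : ℕ) : ℕ := joinRow d n m B + (m + 1) * (2 * (d + n) + 3)

def replyRow (d n m B : ℕ) : ℕ := joinedRow d n m B + (d + n + 1)

def resultRow (d n m B : ℕ) : ℕ :=
  replyRow d n m B + (m + 1) * (m + 1) * (4 * (d + n + (m + 1)) + 1)

def endRow (d n m B : ℕ) : ℕ := resultRow d n m B + (d + n + (m + 1))

/-- Copy the payloads of the sorted records and mark those which are in the table. -/
def markOps (d n m B : ℕ) : List (Op ℕ) :=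
  copyOps (sortedRow d n m B) (joinRow d n m B) (d + n) ++
    [.cnot (sortedRow d n m B + (d + n) + m) (joinRow d n m B + (d + n)),
      .x (joinRow d n m B + (d + n))]

/-- Attach to the payloads the columns they have to return to. -/
def replyOps (d n m B : ℕ) : List (Op ℕ) :=
  copyOps (joinedRow d n m B) (replyRow d n m B) (d + n) ++
    copyOps (sortedRow d n m B + (d + n)) (replyRow d n m B + (d + n)) (m + 1)

/-- The parallel table lookup: load, sort by address, propagate, sort by column. -/
def lookupSlices (N d n m ib B : ℕ) : List (List (Op Addr)) :=
  loadSlices N d n m ib B ++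
    (sortSlices (m + 1) (d + n + (m + 1) + m) B ++
    ((markOps d n m B).map (locSlice (2 ^ (m + 1))) ++
    (mergeSlices (m + 1) (d + n) (joinRow d n m B) ++
    ((replyOps d n m B).map (locSlice (2 ^ (m + 1))) ++
    sortSlices (m + 1) (d + n + (m + 1)) (replyRow d n m B)))))

theorem markOps_wires {d n m B : ℕ} {o : Op ℕ} (ho : o ∈ markOps d n m B) :
    o.wires.Nodup ∧ (∀ i ∈ o.wires, i < joinRow d n m B + (d + n + 1)) ∧
      ∀ i, o.target = some i → joinRow d n m B ≤ i := by
  rw [markOps, List.mem_append] at ho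
  rcases ho with ho | ho
  · have := copyOps_wires (by rw [joinRow]; omega) ho
    exact ⟨this.1, fun i hi => (this.2.1 i hi).trans (by omega), this.2.2⟩
  · simp only [List.mem_cons, List.not_mem_nil, or_false] at ho
    rcases ho with rfl | rfl <;> (simp [Op.wires, Op.target, joinRow]; try omega)

theorem replyOps_wires {d n m B : ℕ} {o : Op ℕ} (ho : o ∈ replyOps d n m B) :
    o.wires.Nodup ∧ (∀ i ∈ o.wires, i < replyRow d n m B + (d + n + (m + 1))) ∧
      ∀ i, o.target = some i → replyRow d n m B ≤ i := by
  have h1 : joinedRow d n m B + (d + n) ≤ replyRow d n m B := by rw [replyRow]; omega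
  have h2 : sortedRow d n m B + (d + n) + (m + 1) ≤ replyRow d n m B := by
    rw [replyRow, joinedRow, joinRow]; omega
  rw [replyOps, List.mem_append] at ho
  rcases ho with ho | ho
  · have := copyOps_wires h1 ho
    exact ⟨this.1, fun i hi => (this.2.1 i hi).trans_le (by omega), this.2.2⟩
  · have := copyOps_wires (by omega) ho
    exact ⟨this.1, fun i hi => (this.2.1 i hi).trans_le (by omega),
      fun i hi => le_trans (by omega) (this.2.2 i hi)⟩

theorem lookupSlices_valid {N r d n m ib B F : ℕ} (hib : ib + m ≤ B) (hF : endRow d n m B ≤ F)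
    {l : List (Op Addr)} (hl : l ∈ lookupSlices N d n m ib B) :
    SliceValid N r d (F * 2 ^ (m + 1)) l := by
  have h1 : B ≤ sortedRow d n m B := by rw [sortedRow]; omega
  have h2 : joinRow d n m B = sortedRow d n m B + (d + n + (m + 1) + m) := rfl
  have h3 : joinRow d n m B ≤ joinedRow d n m B := by rw [joinedRow]; omega
  have h4 : replyRow d n m B = joinedRow d n m B + (d + n + 1) := rfl
  have h5 : replyRow d n m B ≤ resultRow d n m B := by rw [resultRow]; omega
  have h6 : endRow d n m B = resultRow d n m B + (d + n + (m + 1)) := rfl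
  simp only [lookupSlices, List.mem_append] at hl
  rcases hl with hl | hl | hl | hl | hl | hl
  · exact loadSlices_valid hib (by omega) hl
  · exact sortSlices_valid (show sortedRow d n m B + _ ≤ F by omega) hl
  · obtain ⟨o, ho, rfl⟩ := List.mem_map.1 hl
    have := markOps_wires ho
    exact locSlice_valid this.1 fun i hi => (this.2.1 i hi).trans_le (by omega)
  · exact mergeSlices_valid (show joinedRow d n m B + _ ≤ F by omega) hl
  · obtain ⟨o, ho, rfl⟩ := List.mem_map.1 hl
    have := replyOps_wires ho
    exact locSlice_valid this.1 fun i hi => (this.2.1 i hi).trans_le (by omega)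
  · exact sortSlices_valid (show resultRow d n m B + _ ≤ F by omega) hl

theorem lookupSlices_writes {N d n m ib B : ℕ} : Writes (lookupSlices N d n m ib B)
    (Rows (2 ^ (m + 1)) B (endRow d n m B)) := by
  have h1 : B ≤ sortedRow d n m B := by rw [sortedRow]; omega
  have h2 : joinRow d n m B = sortedRow d n m B + (d + n + (m + 1) + m) := rfl
  have h3 : joinRow d n m B ≤ joinedRow d n m B := by rw [joinedRow]; omega
  have h4 : replyRow d n m B = joinedRow d n m B + (d + n + 1) := rfl
  have h5 : replyRow d n m B ≤ resultRow d n m B := by rw [resultRow]; omega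
  have h6 : endRow d n m B = resultRow d n m B + (d + n + (m + 1)) := rfl
  refine Writes.append (loadSlices_writes.mono fun w hw => hw.mono le_rfl (by omega)) ?_
  refine Writes.append (sortSlices_writes.mono fun w hw => hw.mono (by omega)
    (show sortedRow d n m B + _ ≤ _ by omega)) ?_
  refine Writes.append ?_ (Writes.append ?_ (Writes.append ?_ ?_))
  · refine locSlices_writes fun o ho i hi => ?_
    have := markOps_wires ho
    have h7 := this.2.1 i (Op.target_mem_wires hi)
    have h8 := this.2.2 i hi
    omega
  · exact mergeSlices_writes.mono fun w hw => hw.mono (by omega)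
      (show joinedRow d n m B + _ ≤ _ by omega)
  · refine locSlices_writes fun o ho i hi => ?_
    have := replyOps_wires ho
    have h7 := this.2.1 i (Op.target_mem_wires hi)
    have h8 := this.2.2 i hi
    omega
  · exact sortSlices_writes.mono fun w hw => hw.mono (by omega)
      (show resultRow d n m B + _ ≤ _ by omega)

/-- The address of column `p`. -/
def address (m ib : ℕ) (σ : Addr → Bool) (p : ℕ) : ℕ :=
  if p < 2 ^ m then p else bitsVal m fun b => view (2 ^ (m + 1)) σ p (ib + b)

theorem address_lt (m ib : ℕ) (σ : Addr → Bool) (p : ℕ) : address m ib σ p < 2 ^ m := by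
  rw [address]
  split_ifs with h
  exacts [h, bitsVal_lt _ _]

/-- The map is strictly increasing, so it grows by at least one per step: counting up from `0` gives
`p ≤ f p`, and counting up from `p` to `P - 1` gives `f p ≤ p`. -/
theorem eq_self_of_monotone_of_injective {P : ℕ} {f : ℕ → ℕ} (hf : ∀ p < P, f p < P)
    (hmono : ∀ p q, p ≤ q → q < P → f p ≤ f q)
    (hinj : ∀ p < P, ∀ q < P, f p = f q → p = q) {p : ℕ} (hp : p < P) : f p = p := by
  have key : ∀ k p, p + k < P → f p + k ≤ f (p + k) := by
    intro k
    induction k with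
    | zero => intro p _; exact le_rfl
    | succ k ih =>
      intro p hk
      have h1 := ih p (by omega)
      have h2 := hmono (p + k) (p + (k + 1)) (by omega) hk
      have h3 : f (p + k) ≠ f (p + (k + 1)) := fun h => by
        have := hinj _ (by omega) _ hk h
        omega
      omega
  have h1 := key p 0 (by omega)
  have h2 := key (P - 1 - p) p (by omega)
  have h3 := hf (p + (P - 1 - p)) (by omega)
  rw [zero_add] at h1
  omega

/-- Low digits cannot reverse the order of high digits. This extracts the order of columns and
addresses from that of whole records. -/
theorem le_of_add_mul_le {a b k l e : ℕ} (hb : b < e) (h : a + e * k ≤ b + e * l) : k ≤ l := by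
  by_contra hlt
  have : e * (l + 1) ≤ e * k := Nat.mul_le_mul_left _ (by omega)
  rw [mul_add] at this
  omega

/-- After the first sort, given by `τ`, the table record of an address precedes all requests for it,
as table columns are those below `2 ^ m`. The last table record up to any position therefore has the
address of that position, and propagation delivers its payload. The keys of the second sort, given
by `ρ`, are the column numbers themselves, so it carries every payload back to the column that asked
for it. -/
theorem view_lookupSlices {N d n m ib B : ℕ} (hN : 0 < N) (hib : ib + m ≤ B) {σ : Addr → Bool}
    (hσ : ∀ p < 2 ^ (m + 1), ∀ o, B ≤ o → view (2 ^ (m + 1)) σ p o = false) {p : ℕ}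
    (hp : p < 2 ^ (m + 1)) :
    (∀ k < d, view (2 ^ (m + 1)) (runSlices (lookupSlices N d n m ib B) σ) p
      (resultRow d n m B + k) = σ (.data (address m ib σ p % N) k)) ∧
    (∀ b < n, view (2 ^ (m + 1)) (runSlices (lookupSlices N d n m ib B) σ) p
      (resultRow d n m B + d + b) = (address m ib σ p % N).testBit b) := by
  have hPm : 2 ^ m < 2 ^ (m + 1) := Nat.pow_lt_pow_right (by norm_num) (by omega)
  have hload := fun q hq => view_loadSlices (d := d) (n := n) hN hib hσ (p := q) hq
  set σ₁ := runSlices (loadSlices N d n m ib B) σ with hσ₁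
  -- the key of a record
  set a := address m ib σ with ha
  have hrec : ∀ q < 2 ^ (m + 1), bitsVal (d + n + (m + 1) + m)
      (fun b => view (2 ^ (m + 1)) σ₁ q (B + b)) =
      bitsVal (d + n) (fun b => view (2 ^ (m + 1)) σ₁ q (B + b)) +
        2 ^ (d + n) * (q + 2 ^ (m + 1) * a q) := by
    intro q hq
    obtain ⟨-, -, h3, h4, -⟩ := hload q hq
    have e1 : bitsVal (m + 1) (fun b => view (2 ^ (m + 1)) σ₁ q (B + (d + n + b))) = q := by
      refine (bitsVal_congr fun b hb => ?_).trans (bitsVal_testBit hq)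
      rw [← add_assoc, h3 b hb]
    have e2 : bitsVal m (fun b => view (2 ^ (m + 1)) σ₁ q (B + (d + n + (m + 1 + b)))) = a q := by
      rw [ha, address]
      split_ifs with h
      · refine (bitsVal_congr fun b hb => ?_).trans (bitsVal_testBit h)
        rw [← add_assoc (d + n), ← add_assoc B, h4 b hb, if_pos h]
      · refine bitsVal_congr fun b hb => ?_
        rw [← add_assoc (d + n), ← add_assoc B, h4 b hb, if_neg h]
    rw [add_assoc (d + n), bitsVal_add (d + n), bitsVal_add (m + 1), e1, e2]
  obtain ⟨⟨τ, hτ, hτv⟩, hsort, hzero⟩ := record_sortSlices (κ := m + 1)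
    (W := d + n + (m + 1) + m) (base := B) (σ := σ₁) fun q hq o ho => (hload q hq).2.2.2.2 o ho
  set σ₂ := runSlices (sortSlices (m + 1) (d + n + (m + 1) + m) B) σ₁ with hσ₂
  change ∀ p < 2 ^ (m + 1), ∀ b < d + n + (m + 1) + m,
    view (2 ^ (m + 1)) σ₂ p (sortedRow d n m B + b) = _ at hτv
  change ∀ p < 2 ^ (m + 1), ∀ o, joinRow d n m B ≤ o → _ at hzero
  have hτ' : ∀ q < 2 ^ (m + 1), τ.symm q < 2 ^ (m + 1) := fun q hq =>
    Finset.mem_range.1 (Equiv.Perm.perm_symm_on_of_perm_on_finset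
      (s := Finset.range (2 ^ (m + 1))) (f := τ)
      (fun x hx => Finset.mem_range.2 (hτ x (Finset.mem_range.1 hx))) (Finset.mem_range.2 hq))
  have hkey : ∀ q q', q ≤ q' → q' < 2 ^ (m + 1) →
      τ q + 2 ^ (m + 1) * a (τ q) ≤ τ q' + 2 ^ (m + 1) * a (τ q') := by
    intro q q' h hq'
    have h1 := hsort q q' h hq'
    have e : ∀ q < 2 ^ (m + 1), record (2 ^ (m + 1)) (d + n + (m + 1) + m)
        (B + (m + 1) * (m + 1) * (4 * (d + n + (m + 1) + m) + 1)) σ₂ q = _ := fun q hq =>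
      (bitsVal_congr (hτv q hq)).trans (hrec (τ q) (hτ q hq))
    rw [e q (h.trans_lt hq'), e q' hq'] at h1
    exact le_of_add_mul_le (bitsVal_lt _ _) h1
  have haddr : ∀ q q', q ≤ q' → q' < 2 ^ (m + 1) → a (τ q) ≤ a (τ q') := fun q q' h hq' =>
    le_of_add_mul_le (hτ q' hq') (hkey q q' h hq')
  have hself : ∀ q < 2 ^ m, a q = q := fun q hq => by rw [ha, address, if_pos hq]
  -- the marked records
  have hmark : ∀ q < 2 ^ (m + 1), view (2 ^ (m + 1))
      (runSlices ((markOps d n m B).map (locSlice (2 ^ (m + 1)))) σ₂) q =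
      actList (markOps d n m B) (view (2 ^ (m + 1)) σ₂ q) := fun q hq =>
    view_locSlices (fun o ho => (markOps_wires ho).1) _ hq
  set σ₃ := runSlices ((markOps d n m B).map (locSlice (2 ^ (m + 1)))) σ₂ with hσ₃
  have hJ : sortedRow d n m B + (d + n) ≤ joinRow d n m B := by rw [joinRow]; omega
  have hJ' : joinRow d n m B = sortedRow d n m B + (d + n + (m + 1) + m) := rfl
  have hmark1 : ∀ q < 2 ^ (m + 1), ∀ b < d + n, view (2 ^ (m + 1)) σ₃ q (joinRow d n m B + b) =
      view (2 ^ (m + 1)) σ₁ (τ q) (B + b) := by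
    intro q hq b hb
    rw [hmark q hq, markOps, actList_append]
    simp only [actList_cons, actList_nil, Op.act, Op.target, Op.ctrl]
    rw [Function.update_of_ne (by omega), Function.update_of_ne (by omega),
      actList_copyOps hJ, if_pos (by omega), hzero q hq _ (by omega), ← hτv q hq b (by omega),
      show joinRow d n m B + b - joinRow d n m B = b by omega, Bool.false_xor]
  have hmark2 : ∀ q < 2 ^ (m + 1), view (2 ^ (m + 1)) σ₃ q (joinRow d n m B + (d + n)) =
      decide (τ q < 2 ^ m) := by
    intro q hq
    -- Bit `m` of the column number is `0` exactly for table columns, so its negation serves as the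
    -- validity bit.
    have h3 := (hload (τ q) (hτ q hq)).2.2.1 m (by omega)
    rw [hmark q hq, markOps, actList_append]
    simp only [actList_cons, actList_nil, Op.act, Op.target, Op.ctrl, Function.update_self]
    rw [actList_copyOps hJ, if_neg (by omega), actList_copyOps hJ, if_neg (by omega),
      hzero q hq _ (by omega), add_assoc, hτv q hq _ (by omega), ← add_assoc, h3,
      Nat.testBit_eq_decide_div_mod_eq]
    have := hτ q hq
    rw [pow_succ] at this
    by_cases h : τ q < 2 ^ m
    · simp [h, Nat.div_eq_of_lt h]
    · have h1 : τ q / 2 ^ m = 1 := by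
        rw [Nat.div_eq_iff (Nat.two_pow_pos m)]
        omega
      simp [h, h1]
  have hmark3 : ∀ q < 2 ^ (m + 1), ∀ o, joinRow d n m B + (d + n + 1) ≤ o →
      view (2 ^ (m + 1)) σ₃ q o = false := by
    intro q hq o ho
    rw [hmark q hq, actList_of_not_target, hzero q hq o (by omega)]
    intro o' ho' e
    have := (markOps_wires ho').2.1 o (Op.target_mem_wires e)
    omega
  have hmark4 : ∀ q < 2 ^ (m + 1), ∀ b < m + 1, view (2 ^ (m + 1)) σ₃ q
      (sortedRow d n m B + (d + n) + b) = (τ q).testBit b := by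
    intro q hq b hb
    rw [hmark q hq, actList_of_not_target, add_assoc, hτv q hq _ (by omega), ← add_assoc,
      (hload (τ q) (hτ q hq)).2.2.1 b hb]
    intro o' ho' e
    have := (markOps_wires ho').2.2 _ e
    omega
  -- propagation
  have hgτ : ∀ q, τ (τ.symm (a (τ q))) = a (τ q) := fun q => τ.apply_symm_apply _
  have hlt : ∀ q, a q < 2 ^ m := fun q => address_lt m ib σ q
  have hgP : ∀ q, τ.symm (a (τ q)) < 2 ^ (m + 1) := fun q => hτ' _ ((hlt _).trans hPm)
  -- The table record for address `a` is in column `a`, below the columns of all requests, so among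
  -- equal addresses it has the smallest key.
  have hg : ∀ q < 2 ^ (m + 1), τ.symm (a (τ q)) ≤ q := by
    intro q hq
    by_contra hlt'
    have h1 := hkey q (τ.symm (a (τ q))) (by omega) (hgP q)
    rw [hgτ, hself _ (hlt _)] at h1
    have h2 : τ q < 2 ^ m := (show τ q ≤ a (τ q) by omega).trans_lt (hlt _)
    rw [hself _ h2, Equiv.symm_apply_apply] at hlt'
    exact hlt' le_rfl
  obtain ⟨hm1, hm2⟩ := view_mergeSlices (κ := m + 1) (e := d + n) (c := joinRow d n m B) (σ := σ₃)
    (fun q hq o ho => hmark3 q hq o (by omega))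
    (fun q hq hv b hb => by
      rw [hmark2 q hq, decide_eq_false_iff_not] at hv
      obtain ⟨l1, l2, -⟩ := hload (τ q) (hτ q hq)
      rcases (by omega : b < d ∨ (d ≤ b ∧ b < d + n) ∨ b = d + n) with h | h | rfl
      · rw [hmark1 q hq b (by omega), l1 b h]; simp [hv]
      · rw [hmark1 q hq b (by omega), show B + b = B + d + (b - d) by omega, l2 _ (by omega)]
        simp [hv]
      · rw [hmark2 q hq]; simp [hv])
    (fun q => τ.symm (a (τ q))) hg
    (fun q hq => by rw [hmark2 _ (hgP q), hgτ]; simp [hlt])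
    -- A table record between the two positions would have the same address by monotonicity, and so
    -- would be the same record.
    (fun q hq q' h1 h2 => by
      rw [hmark2 q' (by omega), decide_eq_false_iff_not]
      intro h3
      have h4 := haddr _ _ h1.le (by omega)
      have h5 := haddr _ _ h2 hq
      rw [hgτ, hself _ (hlt _), hself _ h3] at h4
      rw [hself _ h3] at h5
      have h6 : τ q' = a (τ q) := by omega
      rw [← h6, Equiv.symm_apply_apply] at h1
      exact lt_irrefl _ h1)
  have hkeep : ∀ q < 2 ^ (m + 1), ∀ o, o < joinRow d n m B → view (2 ^ (m + 1))
      (runSlices (mergeSlices (m + 1) (d + n) (joinRow d n m B)) σ₃) q o =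
        view (2 ^ (m + 1)) σ₃ q o := fun q hq o ho =>
    mergeSlices_writes.view_eq _ hq (Or.inl (by omega))
  set σ₄ := runSlices (mergeSlices (m + 1) (d + n) (joinRow d n m B)) σ₃ with hσ₄
  change ∀ q < 2 ^ (m + 1), ∀ b < d + n + 1,
    view (2 ^ (m + 1)) σ₄ q (joinedRow d n m B + b) = _ at hm1
  change ∀ q < 2 ^ (m + 1), ∀ o, replyRow d n m B ≤ o → _ at hm2
  -- the replies
  have hR1 : joinedRow d n m B + (d + n) ≤ replyRow d n m B := by rw [replyRow]; omega
  have hR2 : sortedRow d n m B + (d + n) + (m + 1) ≤ replyRow d n m B := by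
    rw [replyRow, joinedRow, joinRow]; omega
  have hreply : ∀ q < 2 ^ (m + 1), view (2 ^ (m + 1))
      (runSlices ((replyOps d n m B).map (locSlice (2 ^ (m + 1)))) σ₄) q =
      actList (replyOps d n m B) (view (2 ^ (m + 1)) σ₄ q) := fun q hq =>
    view_locSlices (fun o ho => (replyOps_wires ho).1) _ hq
  set σ₅ := runSlices ((replyOps d n m B).map (locSlice (2 ^ (m + 1)))) σ₄ with hσ₅
  have hreply1 : ∀ q < 2 ^ (m + 1), ∀ b < d + n, view (2 ^ (m + 1)) σ₅ q (replyRow d n m B + b) =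
      view (2 ^ (m + 1)) σ₁ (a (τ q)) (B + b) := by
    intro q hq b hb
    rw [hreply q hq, replyOps, actList_append, actList_copyOps (by omega), if_neg (by omega),
      actList_copyOps hR1, if_pos (by omega), hm2 q hq _ (by omega), Bool.false_xor,
      show replyRow d n m B + b - replyRow d n m B = b by omega, hm1 q hq b (by omega),
      hmark1 _ (hgP q) b hb, hgτ]
  have hreply2 : ∀ q < 2 ^ (m + 1), ∀ b < m + 1, view (2 ^ (m + 1)) σ₅ q
      (replyRow d n m B + (d + n) + b) = (τ q).testBit b := by
    intro q hq b hb
    rw [hreply q hq, replyOps, actList_append, actList_copyOps (by omega), if_pos (by omega),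
      actList_copyOps hR1, if_neg (by omega), actList_copyOps hR1, if_neg (by omega),
      hm2 q hq _ (by omega), Bool.false_xor,
      show replyRow d n m B + (d + n) + b - (replyRow d n m B + (d + n)) = b by omega,
      hkeep q hq _ (by omega), hmark4 q hq b hb]
  have hreply3 : ∀ q < 2 ^ (m + 1), ∀ o, replyRow d n m B + (d + n + (m + 1)) ≤ o →
      view (2 ^ (m + 1)) σ₅ q o = false := by
    intro q hq o ho
    rw [hreply q hq, actList_of_not_target, hm2 q hq o (by omega)]
    intro o' ho' e
    have := (replyOps_wires ho').2.1 o (Op.target_mem_wires e)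
    omega
  obtain ⟨⟨ρ, hρ, hρv⟩, hsort', -⟩ := record_sortSlices (κ := m + 1)
    (W := d + n + (m + 1)) (base := replyRow d n m B) (σ := σ₅) hreply3
  have hfin : runSlices (lookupSlices N d n m ib B) σ =
      runSlices (sortSlices (m + 1) (d + n + (m + 1)) (replyRow d n m B)) σ₅ := by
    simp only [lookupSlices, runSlices_append, hσ₅, hσ₄, hσ₃, hσ₂, hσ₁]
  rw [hfin]
  set σ₆ := runSlices (sortSlices (m + 1) (d + n + (m + 1)) (replyRow d n m B)) σ₅ with hσ₆
  -- The column numbers in the order of the second sort are monotone and distinct, so the two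
  -- rearrangements cancel.
  have hid : τ (ρ p) = p := by
    refine eq_self_of_monotone_of_injective (f := fun q => τ (ρ q)) (fun q hq => hτ _ (hρ q hq))
      (fun q q' h hq' => ?_) (fun q _ q' _ h => ρ.injective (τ.injective h)) hp
    have h1 := hsort' q q' h hq'
    have e : ∀ q < 2 ^ (m + 1), record (2 ^ (m + 1)) (d + n + (m + 1))
        (replyRow d n m B + (m + 1) * (m + 1) * (4 * (d + n + (m + 1)) + 1)) σ₆ q =
        bitsVal (d + n) (fun b => view (2 ^ (m + 1)) σ₅ (ρ q) (replyRow d n m B + b)) +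
          2 ^ (d + n) * τ (ρ q) := by
      intro q hq
      refine (bitsVal_congr (hρv q hq)).trans ?_
      rw [bitsVal_add]
      congr 2
      refine (bitsVal_congr fun b hb => ?_).trans (bitsVal_testBit (hτ _ (hρ q hq)))
      rw [← add_assoc, hreply2 _ (hρ q hq) b hb]
    rw [e q (h.trans_lt hq'), e q' hq'] at h1
    exact le_of_add_mul_le (bitsVal_lt _ _) h1
  have hout : ∀ b < d + n, view (2 ^ (m + 1)) σ₆ p (resultRow d n m B + b) =
      view (2 ^ (m + 1)) σ₁ (a p) (B + b) := by
    intro b hb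
    rw [resultRow, hρv p hp b (by omega), hreply1 _ (hρ p hp) b hb, hid]
  obtain ⟨l1, l2, -⟩ := hload (a p) ((hlt p).trans hPm)
  refine ⟨fun k hk => ?_, fun b hb => ?_⟩
  · rw [hout k (by omega), l1 k hk]; simp [hlt]
  · rw [add_assoc, hout (d + b) (by omega), ← add_assoc, l2 b hb]; simp [hlt]

/-! ### The lookup is classical and stays off the processors' registers -/

/-- A classical operation on data and scratch qubits. -/
def Op.Plain (o : Op Addr) : Prop :=
  o.IsClassical ∧ ∀ w ∈ o.wires, (∃ j k, w = .data j k) ∨ ∃ t, w = .scratch t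

theorem locSlice_plain {P : ℕ} {o : Op ℕ} (h : o.IsClassical) : ∀ o' ∈ locSlice P o, o'.Plain := by
  intro o' ho'
  obtain ⟨p, -, rfl⟩ := List.mem_map.1 ho'
  refine ⟨h.map _, fun w hw => Or.inr ?_⟩
  rw [Op.wires_map, List.mem_map] at hw
  obtain ⟨i, -, rfl⟩ := hw
  exact ⟨_, rfl⟩

theorem fetchSlice_plain {P : ℕ} {m : ℕ → Bool} {π : ℕ → ℕ} {o₁ o₂ : ℕ} :
    ∀ o ∈ fetchSlice P m π o₁ o₂, o.Plain := by
  intro o ho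
  obtain ⟨p, -, rfl⟩ := List.mem_map.1 ho
  cases m p
  · exact ⟨trivial, by simp [Op.wires]⟩
  · exact ⟨trivial, by simp [Op.wires, cell]⟩

theorem flipSlice_plain {P : ℕ} {m : ℕ → Bool} {i : ℕ} : ∀ o ∈ flipSlice P m i, o.Plain := by
  intro o ho
  obtain ⟨p, -, rfl⟩ := List.mem_map.1 ho
  cases m p
  · exact ⟨trivial, by simp [Op.wires]⟩
  · exact ⟨trivial, by simp [Op.wires, cell]⟩

theorem dataSlice_plain {P N m c k i : ℕ} : ∀ o ∈ dataSlice P N m c k i, o.Plain := by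
  intro o ho
  obtain ⟨p, -, rfl⟩ := List.mem_map.1 ho
  cases decide (c * N + p < 2 ^ m)
  · exact ⟨trivial, by simp [Op.wires]⟩
  · exact ⟨trivial, by simp [Op.wires, cell]⟩

theorem loadSlices_plain {N d n m ib B : ℕ} :
    ∀ l ∈ loadSlices N d n m ib B, ∀ o ∈ l, o.Plain := by
  intro l hl
  simp only [loadSlices, dataSlices, List.mem_append, List.mem_flatMap, List.mem_map,
    List.mem_range] at hl
  rcases hl with ⟨c, hc, k, hk, rfl⟩ | ⟨b, hb, rfl⟩ | ⟨b, hb, rfl⟩ | ⟨b, hb, rfl⟩ | ⟨b, hb, rfl⟩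
  exacts [dataSlice_plain, flipSlice_plain, flipSlice_plain, flipSlice_plain, fetchSlice_plain]

theorem locSlices_plain {P : ℕ} {L : List (Op ℕ)} (h : ∀ o ∈ L, o.IsClassical) :
    ∀ l ∈ L.map (locSlice P), ∀ o ∈ l, o.Plain := by
  intro l hl
  obtain ⟨o, ho, rfl⟩ := List.mem_map.1 hl
  exact locSlice_plain (h o ho)

theorem sortSlices_plain {κ W B : ℕ} : ∀ l ∈ sortSlices κ W B, ∀ o ∈ l, o.Plain := by
  intro l hl
  simp only [sortSlices, sortStep, List.mem_append, List.mem_flatMap] at hl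
  obtain ⟨s, -, hl | hl | hl | hl⟩ := hl
  · obtain ⟨b, -, rfl⟩ := List.mem_map.1 hl
    exact fetchSlice_plain
  · refine locSlices_plain (fun o ho => ?_) l hl
    simp only [compareOps, List.mem_flatMap, List.mem_cons, List.not_mem_nil, or_false] at ho
    obtain ⟨b, -, rfl | rfl | rfl | rfl | rfl⟩ := ho <;> trivial
  · rw [List.mem_singleton] at hl
    subst hl
    exact flipSlice_plain
  · refine locSlices_plain (fun o ho => ?_) l hl
    simp only [selectOps, List.mem_flatMap, List.mem_cons, List.not_mem_nil, or_false] at ho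
    obtain ⟨b, -, rfl | rfl⟩ := ho <;> trivial

theorem mergeSlices_plain {κ e c : ℕ} : ∀ l ∈ mergeSlices κ e c, ∀ o ∈ l, o.Plain := by
  intro l hl
  simp only [mergeSlices, mergeStep, List.mem_append, List.mem_flatMap] at hl
  obtain ⟨s, -, hl | hl⟩ := hl
  · obtain ⟨b, -, rfl⟩ := List.mem_map.1 hl
    exact fetchSlice_plain
  · refine locSlices_plain (fun o ho => ?_) l hl
    simp only [mergeOps, List.mem_append, List.mem_flatMap, List.mem_cons, List.not_mem_nil,
      or_false] at ho
    rcases ho with (rfl | rfl) | ⟨b, -, rfl | rfl⟩ <;> trivial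

theorem isClassical_of_mem_copyOps {o₁ o₂ n : ℕ} {o : Op ℕ} (h : o ∈ copyOps o₁ o₂ n) :
    o.IsClassical := by
  obtain ⟨b, -, rfl⟩ := List.mem_map.1 h
  trivial

theorem lookupSlices_plain {N d n m ib B : ℕ} :
    ∀ l ∈ lookupSlices N d n m ib B, ∀ o ∈ l, o.Plain := by
  intro l hl
  simp only [lookupSlices, List.mem_append] at hl
  rcases hl with hl | hl | hl | hl | hl | hl
  · exact loadSlices_plain l hl
  · exact sortSlices_plain l hl
  · refine locSlices_plain (fun o ho => ?_) l hl
    rw [markOps, List.mem_append] at ho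
    rcases ho with ho | ho
    · exact isClassical_of_mem_copyOps ho
    · simp only [List.mem_cons, List.not_mem_nil, or_false] at ho
      rcases ho with rfl | rfl <;> trivial
  · exact mergeSlices_plain l hl
  · refine locSlices_plain (fun o ho => ?_) l hl
    rw [replyOps, List.mem_append] at ho
    rcases ho with ho | ho <;> exact isClassical_of_mem_copyOps ho
  · exact sortSlices_plain l hl

/-! ### Running instructions -/

section Exec

theorem Circuit.run_smul {Q : Type} [DecidableEq Q] (C : Circuit Q) (c : ℂ) (ψ : Ket Q) :
    C.run (c • ψ) = c • C.run ψ := by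
  rw [Circuit.run_eq_runGates, Circuit.run_eq_runGates, runGates_smul]

variable {N r d w : ℕ} {a : Fin N → ℕ} (A : ∀ i, Circuit (OracleQubit r d (a i)))

/-- The action of a list of instructions on state vectors. -/
noncomputable def exec (L : List Instr) (ψ : Ket (Qubit N r d w a)) : Ket (Qubit N r d w a) :=
  Circuit.run ((L.flatMap Instr.steps).flatMap (Step.compile w A)) ψ

theorem exec_nil (ψ : Ket (Qubit N r d w a)) : exec A [] ψ = ψ := rfl

theorem exec_append (L₁ L₂ : List Instr) (ψ : Ket (Qubit N r d w a)) :
    exec A (L₁ ++ L₂) ψ = exec A L₂ (exec A L₁ ψ) := by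
  simp [exec, Circuit.run_eq_runGates, runGates_append]

theorem exec_smul (L : List Instr) (c : ℂ) (ψ : Ket (Qubit N r d w a)) :
    exec A L (c • ψ) = c • exec A L ψ := by
  simp [exec, Circuit.run_eq_runGates, runGates_smul]

theorem exec_sum {ι : Type} (s : Finset ι) (L : List Instr) (ψ : ι → Ket (Qubit N r d w a)) :
    exec A L (∑ i ∈ s, ψ i) = ∑ i ∈ s, exec A L (ψ i) := by
  simp [exec, Circuit.run_eq_runGates, runGates_sum]

theorem exec_slice (l : List (Op Addr)) (ψ : Ket (Qubit N r d w a)) :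
    exec A [some l] ψ = Circuit.run ((sliceSteps l).flatMap (Step.compile w A)) ψ := by
  simp [exec, Instr.steps]

theorem exec_query (ψ : Ket (Qubit N r d w a)) :
    exec A [none] ψ = (queryCircuit w A).run ψ := by
  simp [exec, Instr.steps, Step.compile]

theorem exec_slices (q₀ : Qubit N r d w a) {L : List (List (Op Addr))}
    (hv : ∀ l ∈ L, SliceValid N r d w l) (hc : ∀ l ∈ L, ∀ o ∈ l, o.IsClassical)
    (σ : Addr → Bool) :
    exec A (L.map some) (Ket.basis (Qubit.lift (w := w) (a := a) σ)) = Ket.basis (Qubit.lift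
        (runSlices L σ)) := by
  induction L generalizing σ with
  | nil => rfl
  | cons l L ih =>
    rw [List.map_cons, ← List.singleton_append, exec_append, exec_slice,
      run_classical_slice q₀ (hv l List.mem_cons_self) (hc l List.mem_cons_self),
      ih (fun l hl => hv l (List.mem_cons_of_mem _ hl))
        fun l hl => hc l (List.mem_cons_of_mem _ hl)]
    rfl

theorem queryAct_queryAct (α : Fin N → (Fin r → Fin d → Bool) → Bool) (σ : Addr → Bool) :
    queryAct α (queryAct α σ) = σ := by
  ext q
  cases q with
  | target i =>
    by_cases h : i < N
    · simp [queryAct, h]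
    · simp [queryAct, h]
  | _ => rfl

theorem SliceValid.reverse {l : List (Op Addr)} (h : SliceValid N r d w l) :
    SliceValid N r d w l.reverse := by
  refine ⟨fun o ho => h.1 o (List.mem_reverse.1 ho), ?_⟩
  rw [List.pairwise_reverse]
  exact h.2.imp fun h => h.symm

theorem exec_revSlices (q₀ : Qubit N r d w a) {L : List (List (Op Addr))}
    (hv : ∀ l ∈ L, SliceValid N r d w l) (hc : ∀ l ∈ L, ∀ o ∈ l, o.IsClassical)
    (σ : Addr → Bool) :
    exec A ((revSlices L).map some)
        (Ket.basis (Qubit.lift (w := w) (a := a) (runSlices L σ))) =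
      Ket.basis (Qubit.lift σ) := by
  rw [exec_slices A q₀, runSlices_revSlices fun l hl o ho => ((hv l hl).1 o ho).2]
  · intro l hl
    have := (hv _ (mem_revSlices.1 hl)).reverse
    rwa [List.reverse_reverse] at this
  · intro l hl o ho
    exact hc _ (mem_revSlices.1 hl) o (List.mem_reverse.2 ho)

/-- Compute, query, apply `Z` gates, and undo. -/
def oraclePhase (L : List (List (Op Addr))) (zs : List Addr) : List Instr :=
  L.map some ++ ([none] ++ ([some (zs.map Op.z)] ++ ([none] ++ (revSlices L).map some)))

/-- Compute, apply `Z` gates, and undo. -/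
def plainPhase (L : List (List (Op Addr))) (zs : List Addr) : List Instr :=
  L.map some ++ ([some (zs.map Op.z)] ++ (revSlices L).map some)

theorem exec_plainPhase (q₀ : Qubit N r d w a) {L : List (List (Op Addr))} {zs : List Addr}
    (hv : ∀ l ∈ L, SliceValid N r d w l) (hc : ∀ l ∈ L, ∀ o ∈ l, o.IsClassical)
    (hz : SliceValid N r d w (zs.map Op.z)) (σ : Addr → Bool) :
    exec A (plainPhase L zs) (Ket.basis (Qubit.lift (w := w) (a := a) σ)) =
      (zs.map fun q => if runSlices L σ q then (-1 : ℂ) else 1).prod •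
        Ket.basis (Qubit.lift σ) := by
  rw [plainPhase, exec_append, exec_append, exec_slices A q₀ hv hc, exec_slice,
    run_z_slice q₀ hz, exec_smul, exec_revSlices A q₀ hv hc]

/-- The `Z` gates leave the basis state in place, so the second query and the reversed slices undo
the computation exactly and only the signs remain. Both queries see the same arguments, to which
`harg` applies. -/
theorem exec_oraclePhase (q₀ : Qubit N r d w a) {x : Fin N → Fin d → Bool}
    {α : Fin N → (Fin r → Fin d → Bool) → Bool} (hA : ∀ i, ComputesOn x (α i) (A i))
    {L : List (List (Op Addr))} {zs : List Addr}
    (hv : ∀ l ∈ L, SliceValid N r d w l) (hc : ∀ l ∈ L, ∀ o ∈ l, o.IsClassical)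
    (hz : SliceValid N r d w (zs.map Op.z)) {σ : Addr → Bool}
    (harg : ∀ i : Fin N, ∃ sel : Fin r → Fin N, ∀ (l : Fin r) (k : Fin d),
      runSlices L σ (.arg i l k) = x (sel l) k) :
    exec A (oraclePhase L zs) (Ket.basis (Qubit.lift (w := w) (a := a) σ)) =
      (zs.map fun q => if queryAct α (runSlices L σ) q then (-1 : ℂ) else 1).prod •
        Ket.basis (Qubit.lift σ) := by
  have h2 := run_query (w := w) hA (queryAct α (runSlices L σ)) harg
  rw [queryAct_queryAct] at h2
  rw [oraclePhase, exec_append, exec_append, exec_append, exec_append, exec_slices A q₀ hv hc,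
    exec_query, exec_query, run_query hA _ harg, exec_slice, run_z_slice q₀ hz, Circuit.run_smul,
    h2, exec_smul, exec_revSlices A q₀ hv hc]

end Exec

/-! ### Evaluation of the predicates -/

theorem actList_family {N r d w n : ℕ} {g : ℕ → Op Addr}
    (hv : SliceValid N r d w ((List.range n).map g)) {p : ℕ} (hp : p < n) {q : Addr}
    (hq : (g p).target = some q) (σ : Addr → Bool) :
    actList ((List.range n).map g) σ q = (σ q ^^ (g p).ctrl σ) :=
  actList_of_target (fun o ho => (hv.1 o ho).2) hv.2
    (List.mem_map_of_mem (List.mem_range.2 hp)) hq σ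

theorem actList_family_of_ne {n : ℕ} {g : ℕ → Op Addr} {q : Addr}
    (hq : ∀ p < n, (g p).target ≠ some q) (σ : Addr → Bool) :
    actList ((List.range n).map g) σ q = σ q := by
  refine actList_of_not_target (fun o ho => ?_) σ
  obtain ⟨p, hp, rfl⟩ := List.mem_map.1 ho
  exact hq p (List.mem_range.1 hp)

/-- The column that holds the `l`-th index register of processor `i`. -/
def indexCol (r m i l : ℕ) : ℕ := 2 ^ m + (i * r + l)

/-- Copy bit `k` of the entries that were looked up to the argument registers. -/
def argSlice (N r d n m B k : ℕ) : List (Op Addr) :=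
  (List.range (N * r)).map fun q =>
    .cnot (cell (2 ^ (m + 1)) (2 ^ m + q) (resultRow d n m B + k)) (.arg (q / r) (q % r) k)

/-- Look up the database entries with the indices in the rows `ib, …, ib + m - 1`, and copy them to
the argument registers. -/
def argSlices (N r d n m ib B : ℕ) : List (List (Op Addr)) :=
  lookupSlices N d n m ib B ++ (List.range d).map fun k => argSlice N r d n m B k

theorem mul_add_lt {N r i l : ℕ} (hi : i < N) (hl : l < r) : i * r + l < N * r := by
  calc i * r + l < i * r + r := by omega
    _ = (i + 1) * r := by ring
    _ ≤ N * r := Nat.mul_le_mul_right _ hi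

theorem mul_add_div_mod {r i l : ℕ} (hl : l < r) : (i * r + l) / r = i ∧ (i * r + l) % r = l := by
  constructor
  · rw [mul_comm, Nat.mul_add_div (by omega), Nat.div_eq_of_lt hl, add_zero]
  · rw [mul_comm, Nat.mul_add_mod, Nat.mod_eq_of_lt hl]

theorem indexCol_lt {N r m i l : ℕ} (hm : N * r ≤ 2 ^ m) (hi : i < N) (hl : l < r) :
    indexCol r m i l < 2 ^ (m + 1) := by
  have := mul_add_lt hi hl
  rw [indexCol, pow_succ]
  omega

theorem argSlice_valid {N r d n m B k F : ℕ} (hm : N * r ≤ 2 ^ m) (hr : 0 < r) (hk : k < d)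
    (hF : endRow d n m B ≤ F) :
    SliceValid N r d (F * 2 ^ (m + 1)) (argSlice N r d n m B k) := by
  have hlt : ∀ q, q < N * r → 2 ^ m + q < 2 ^ (m + 1) := fun q hq => by rw [pow_succ]; omega
  have hrow : resultRow d n m B + k < F := by rw [endRow] at hF; omega
  refine sliceValid_family (fun q hq => ⟨?_, by simp [Op.wires, cell]⟩) fun q hq q' hq' hne => ?_
  · simp only [Op.wires, List.mem_cons, List.not_mem_nil, or_false, forall_eq_or_imp, forall_eq]
    refine ⟨cell_inRange (hlt q hq) hrow, ?_, Nat.mod_lt _ hr, hk⟩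
    exact Nat.div_lt_of_lt_mul (by rwa [mul_comm])
  · have h1 : ¬ (q / r = q' / r ∧ q % r = q' % r) := by
      rintro ⟨h1, h2⟩
      have := Nat.div_add_mod q r
      rw [h1, h2, Nat.div_add_mod] at this
      exact hne this.symm
    have h2 : 2 ^ m + q ≠ 2 ^ m + q' := by omega
    intro z hz hz'
    simp only [Op.wires, List.mem_cons, List.not_mem_nil, or_false] at hz hz'
    rcases hz with rfl | rfl
    · rcases hz' with h | h
      · exact h2 ((cell_inj (hlt q hq) (hlt q' hq')).1 h).1
      · simp [cell] at h
    · rcases hz' with h | h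
      · simp [cell] at h
      · simp only [Addr.arg.injEq, and_true] at h
        exact h1 h

theorem argSlices_valid {N r d n m ib B F : ℕ} (hm : N * r ≤ 2 ^ m) (hr : 0 < r) (hib : ib + m ≤ B)
    (hF : endRow d n m B ≤ F) {l : List (Op Addr)} (hl : l ∈ argSlices N r d n m ib B) :
    SliceValid N r d (F * 2 ^ (m + 1)) l := by
  rcases List.mem_append.1 hl with hl | hl
  · exact lookupSlices_valid hib hF hl
  · obtain ⟨k, hk, rfl⟩ := List.mem_map.1 hl
    exact argSlice_valid hm hr (List.mem_range.1 hk) hF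

theorem argSlices_classical {N r d n m ib B : ℕ} {l : List (Op Addr)}
    (hl : l ∈ argSlices N r d n m ib B) {o : Op Addr} (ho : o ∈ l) : o.IsClassical := by
  rcases List.mem_append.1 hl with hl | hl
  · exact (lookupSlices_plain l hl o ho).1
  · obtain ⟨k, hk, rfl⟩ := List.mem_map.1 hl
    obtain ⟨q, -, rfl⟩ := List.mem_map.1 ho
    trivial

/-- This is one reason why evaluating the predicates and recording the results do not interfere. -/
theorem argSlices_wires {N r d n m ib B : ℕ} {l : List (Op Addr)}
    (hl : l ∈ argSlices N r d n m ib B) {o : Op Addr} (ho : o ∈ l) {q : Addr} (hq : q ∈ o.wires) :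
    (∀ i, q ≠ .found i) ∧ ∀ i l b, q ≠ .out i l b := by
  rcases List.mem_append.1 hl with hl | hl
  · rcases (lookupSlices_plain l hl o ho).2 q hq with ⟨_, _, rfl⟩ | ⟨_, rfl⟩ <;> simp
  · obtain ⟨k, hk, rfl⟩ := List.mem_map.1 hl
    obtain ⟨q, -, rfl⟩ := List.mem_map.1 ho
    simp only [Op.wires, List.mem_cons, List.not_mem_nil, or_false] at hq
    rcases hq with rfl | rfl <;> simp [cell]

theorem argSlices_writes {N r d n m ib B : ℕ} : Writes (argSlices N r d n m ib B)
    fun q => Rows (2 ^ (m + 1)) B (endRow d n m B) q ∨ ∃ i l k, q = .arg i l k := by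
  refine Writes.append (lookupSlices_writes.mono fun w hw => Or.inl hw) ?_
  refine Writes.of_mem fun l hl => ?_
  obtain ⟨k, -, rfl⟩ := List.mem_map.1 hl
  intro l hl o ho w hw
  rw [List.mem_singleton] at hl
  subst hl
  obtain ⟨q, -, rfl⟩ := List.mem_map.1 ho
  simp only [Op.target, Option.some.injEq] at hw
  exact Or.inr ⟨_, _, _, hw.symm⟩

/-- What the argument registers and the output rows contain after the lookup. -/
theorem runSlices_argSlices {N r d n m ib B : ℕ} (hN : 0 < N) (hm : N * r ≤ 2 ^ m) (hr : 0 < r)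
    (hib : ib + m ≤ B) {σ : Addr → Bool}
    (hσ : ∀ p < 2 ^ (m + 1), ∀ o, B ≤ o → view (2 ^ (m + 1)) σ p o = false)
    {i l : ℕ} (hi : i < N) (hl : l < r) :
    (∀ k < d, runSlices (argSlices N r d n m ib B) σ (.arg i l k) =
      (σ (.arg i l k) ^^ σ (.data (address m ib σ (indexCol r m i l) % N) k))) ∧
    (∀ b < n, runSlices (argSlices N r d n m ib B) σ
      (cell (2 ^ (m + 1)) (indexCol r m i l) (resultRow d n m B + d + b)) =
        (address m ib σ (indexCol r m i l) % N).testBit b) := by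
  obtain ⟨h1, h2⟩ := view_lookupSlices (d := d) (n := n) hN hib hσ (indexCol_lt hm hi hl)
  have harg : ∀ k, runSlices (lookupSlices N d n m ib B) σ (.arg i l k) = σ (.arg i l k) :=
    fun k => lookupSlices_writes.runSlices_eq (by rintro ⟨p, -, o, -, -, h⟩; simp [cell] at h) σ
  rw [argSlices, runSlices_append]
  set τ := runSlices (lookupSlices N d n m ib B) σ
  have key : ∀ K ≤ d, (∀ q, (∀ i l k, q ≠ .arg i l k) →
      runSlices ((List.range K).map fun k => argSlice N r d n m B k) τ q = τ q) ∧
      ∀ k, runSlices ((List.range K).map fun k => argSlice N r d n m B k) τ (.arg i l k) =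
        if k < K then (τ (.arg i l k) ^^
          τ (cell (2 ^ (m + 1)) (indexCol r m i l) (resultRow d n m B + k)))
        else τ (.arg i l k) := by
    intro K
    induction K with
    | zero => exact fun _ => ⟨fun q _ => rfl, fun k => by simp⟩
    | succ K ih =>
      intro hK
      obtain ⟨ih1, ih2⟩ := ih (by omega)
      constructor
      · intro q hq
        rw [runSlices_range_map_succ, argSlice, actList_family_of_ne, ih1 q hq]
        intro p _ h
        simp only [Op.target, Option.some.injEq] at h
        exact hq _ _ _ h.symm
      · intro k
        rw [runSlices_range_map_succ]
        obtain ⟨e1, e2⟩ := mul_add_div_mod (i := i) hl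
        by_cases hk : k = K
        · subst hk
          rw [argSlice, actList_family (argSlice_valid (n := n) (B := B) hm hr
            (show k < d by omega) le_rfl) (mul_add_lt hi hl) (q := .arg i l k)
            (by simp only [Op.target, e1, e2]), Op.ctrl, ih2, if_neg (by simp),
            ih1 _ (by simp [cell]), if_pos (by simp)]
          rfl
        · rw [argSlice, actList_family_of_ne, ih2]
          · simp only [show k < K + 1 ↔ k < K by omega]
          · intro p _ h
            simp only [Op.target, Option.some.injEq, Addr.arg.injEq] at h
            exact hk h.2.2.symm
  obtain ⟨k1, k2⟩ := key d le_rfl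
  refine ⟨fun k hk => ?_, fun b hb => ?_⟩
  · rw [k2, if_pos hk, harg, ← h1 k hk]
    rfl
  · rw [k1 _ (by simp [cell]), ← h2 b hb]
    rfl

/-! ### The layout of the scratch qubits

The scratch qubits form an array with `2 ^ (m + 1)` columns.  The index register of round `t` is in
the rows `t * m, …, t * m + m - 1`.  There follow rows to test whether an index register is `0`, the
rows for the table lookup, and one row for each round to mark the newly found solutions. -/

/-- The first row used to test whether an index register is `0`. -/
def testRow (m R : ℕ) : ℕ := R * m

/-- The first row used by the table lookup. -/
def baseRow (r m R : ℕ) : ℕ := testRow m R + (2 * (r * m) + 1)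

/-- The first row used to mark new solutions. -/
def newRow (r d n m R : ℕ) : ℕ := endRow d n m (baseRow r m R)

/-- The number of scratch qubits. -/
def scratchSize (r d n m R : ℕ) : ℕ := (newRow r d n m R + R) * 2 ^ (m + 1)

theorem baseRow_le_endRow (d n m B : ℕ) : B ≤ endRow d n m B := by
  simp only [endRow, resultRow, replyRow, joinedRow, joinRow, sortedRow]
  omega

theorem round_row_lt {m R t b : ℕ} (ht : t < R) (hb : b < m) : t * m + b < testRow m R :=
  mul_add_lt ht hb

theorem round_rows_le {m R t : ℕ} (ht : t < R) : t * m + m ≤ testRow m R := by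
  calc t * m + m = (t + 1) * m := by ring
    _ ≤ R * m := Nat.mul_le_mul_right _ ht

/-! ### Testing for zero -/

/-- Test whether the `n` bits from row `c + n + 1` on are `0`, with the negated result in row
`c + n`. -/
def zeroOps (c n k : ℕ) : List (Op ℕ) :=
  .x c :: (List.range k).flatMap fun b =>
    [.x (c + n + 1 + b), .tof (c + b) (c + n + 1 + b) (c + (b + 1))]

/-- The rows `c + b` hold the partial conjunctions of negated bits, starting with the empty one,
which is `1`. Tested bits stay negated until the whole test is undone. -/
theorem actList_zeroOps {c n : ℕ} {μ : ℕ → Bool} (hμ : ∀ b ≤ n, μ (c + b) = false) {k : ℕ}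
    (hk : k ≤ n) :
    actList (zeroOps c n k) μ (c + k) = decide (∀ b < k, μ (c + n + 1 + b) = false) ∧
    (∀ b, k < b → b ≤ n → actList (zeroOps c n k) μ (c + b) = false) ∧
    ∀ b, k ≤ b → actList (zeroOps c n k) μ (c + n + 1 + b) = μ (c + n + 1 + b) := by
  induction k with
  | zero =>
    have h0 := hμ 0 (by omega)
    rw [add_zero] at h0
    simp only [zeroOps, List.range_zero, List.flatMap_nil, actList_cons, actList_nil, Op.act,
      Op.target, Op.ctrl]
    refine ⟨by simp [h0], fun b h1 h2 => ?_, fun b _ => ?_⟩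
    · rw [Function.update_of_ne (by omega), hμ b h2]
    · rw [Function.update_of_ne (by omega)]
  | succ k ih =>
    obtain ⟨h1, h2, h3⟩ := ih (by omega)
    have e : zeroOps c n (k + 1) = zeroOps c n k ++
        [.x (c + n + 1 + k), .tof (c + k) (c + n + 1 + k) (c + (k + 1))] := by
      simp [zeroOps, List.range_succ]
    rw [e, actList_append]
    simp only [actList_cons, actList_nil, Op.act, Op.target, Op.ctrl]
    refine ⟨?_, fun b hb hb' => ?_, fun b hb => ?_⟩
    · rw [Function.update_self, Function.update_of_ne (by omega), h2 _ (by omega) hk,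
        Function.update_of_ne (by omega), h1, Function.update_self, h3 k le_rfl]
      simp only [Nat.forall_lt_succ_right]
      cases μ (c + n + 1 + k) <;> simp
    · rw [Function.update_of_ne (by omega), Function.update_of_ne (by omega), h2 b (by omega) hb']
    · rw [Function.update_of_ne (by omega), Function.update_of_ne (by omega), h3 b (by omega)]

theorem zeroOps_wires {c n : ℕ} {o : Op ℕ} (ho : o ∈ zeroOps c n n) :
    o.wires.Nodup ∧ (∀ i ∈ o.wires, i < c + (2 * n + 1)) ∧ o.IsClassical := by
  simp only [zeroOps, List.mem_cons, List.mem_flatMap, List.mem_range, List.not_mem_nil,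
    or_false] at ho
  rcases ho with rfl | ⟨b, hb, rfl | rfl⟩ <;> simp [Op.wires, Op.IsClassical] <;> omega

/-- Collect the index bits of each processor in its own column, and test whether they are all `0`.
    -/
def zeroSlices (N r m ib c : ℕ) : List (List (Op Addr)) :=
  ((List.range (r * m)).map fun k => fetchSlice (2 ^ (m + 1)) (fun p => decide (p < N))
    (fun p => indexCol r m p (k / m)) (ib + k % m) (c + r * m + 1 + k)) ++
    (zeroOps c (r * m) (r * m) ++ [Op.x (c + r * m)]).map (locSlice (2 ^ (m + 1)))

theorem div_mod_lt {r m k : ℕ} (hk : k < r * m) : k / m < r ∧ k % m < m := by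
  have hm : 0 < m := Nat.pos_of_ne_zero fun h => by simp [h] at hk
  exact ⟨Nat.div_lt_of_lt_mul (by rwa [mul_comm]), Nat.mod_lt _ hm⟩

theorem indexCol_inj {r m l p q : ℕ} (hl : l < r) (h : indexCol r m p l = indexCol r m q l) :
    p = q := by
  rw [indexCol, indexCol] at h
  exact Nat.eq_of_mul_eq_mul_right (show 0 < r by omega) (by omega)

theorem zeroSlices_valid {N r d m ib c F : ℕ} (hm : N * r ≤ 2 ^ m) (hc : ib + m ≤ c)
    (hF : c + (2 * (r * m) + 1) ≤ F) {l : List (Op Addr)} (hl : l ∈ zeroSlices N r m ib c) :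
    SliceValid N r d (F * 2 ^ (m + 1)) l := by
  rcases List.mem_append.1 hl with hl | hl
  · obtain ⟨k, hk, rfl⟩ := List.mem_map.1 hl
    rw [List.mem_range] at hk
    obtain ⟨h1, h2⟩ := div_mod_lt hk
    exact fetchSlice_valid (fun p _ hp => indexCol_lt hm (of_decide_eq_true hp) h1)
      (fun p _ q _ _ _ h => indexCol_inj h1 h) (by omega) (by omega) (by omega)
  · obtain ⟨o, ho, rfl⟩ := List.mem_map.1 hl
    rcases List.mem_append.1 ho with ho | ho
    · have := zeroOps_wires ho
      exact locSlice_valid this.1 fun i hi => (this.2.1 i hi).trans_le hF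
    · rw [List.mem_singleton] at ho
      subst ho
      exact locSlice_valid (by simp [Op.wires]) (by simp [Op.wires]; omega)

theorem zeroSlices_classical {N r m ib c : ℕ} {l : List (Op Addr)}
    (hl : l ∈ zeroSlices N r m ib c) {o : Op Addr} (ho : o ∈ l) : o.IsClassical := by
  rcases List.mem_append.1 hl with hl | hl
  · obtain ⟨k, hk, rfl⟩ := List.mem_map.1 hl
    exact (fetchSlice_plain o ho).1
  · refine (locSlices_plain (fun o ho => ?_) l hl o ho).1
    rcases List.mem_append.1 ho with ho | ho
    · exact (zeroOps_wires ho).2.2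
    · rw [List.mem_singleton] at ho
      subst ho
      trivial

/-- The index bits of a processor lie in `r` different columns. They are first gathered in column
`i`, whose rows from `c` on are empty, and then tested there for all processors at once. -/
theorem view_zeroSlices {N r m ib c : ℕ} (hm : N * r ≤ 2 ^ m) (hc : ib + m ≤ c)
    (hr : 0 < r) {σ : Addr → Bool}
    (hσ : ∀ p < 2 ^ (m + 1), ∀ o, c ≤ o → view (2 ^ (m + 1)) σ p o = false) {i : ℕ}
    (hi : i < N) :
    view (2 ^ (m + 1)) (runSlices (zeroSlices N r m ib c) σ) i (c + r * m) =
      !decide (∀ l < r, ∀ b < m, view (2 ^ (m + 1)) σ (indexCol r m i l) (ib + b) = false) := by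
  have hiP : i < 2 ^ (m + 1) := by
    have : N * 1 ≤ N * r := Nat.mul_le_mul_left _ hr
    rw [pow_succ]
    omega
  have key : ∀ K ≤ r * m, ∀ p < 2 ^ (m + 1), ∀ o,
      view (2 ^ (m + 1)) (runSlices ((List.range K).map fun k => fetchSlice (2 ^ (m + 1))
        (fun p => decide (p < N)) (fun p => indexCol r m p (k / m)) (ib + k % m)
        (c + r * m + 1 + k)) σ) p o =
      if c + r * m + 1 ≤ o ∧ o < c + r * m + 1 + K then (decide (p < N) &&
        view (2 ^ (m + 1)) σ (indexCol r m p ((o - (c + r * m + 1)) / m))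
          (ib + (o - (c + r * m + 1)) % m))
      else view (2 ^ (m + 1)) σ p o := by
    intro K
    induction K with
    | zero => exact fun _ p _ o => by rw [if_neg (by omega)]; rfl
    | succ K ih =>
      intro hK p hp o
      obtain ⟨h1, h2⟩ := div_mod_lt (show K < r * m by omega)
      rw [runSlices_range_map_succ, view_fetchSlice
        (fun p _ hp => indexCol_lt hm (of_decide_eq_true hp) h1)
        (fun p _ q _ _ _ h => indexCol_inj h1 h) (by omega) _ hp, Function.update_apply,
        ih (by omega) p hp]
      by_cases ho : o = c + r * m + 1 + K
      · subst ho
        rw [if_pos rfl, if_neg (by omega), if_pos (by omega), hσ p hp _ (by omega),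
          show c + r * m + 1 + K - (c + r * m + 1) = K by omega, Bool.false_xor]
        by_cases hpN : p < N
        · rw [ih (by omega) _ (indexCol_lt hm hpN h1), if_neg (by omega)]
        · simp [hpN]
      · rw [if_neg ho, ih (by omega) p hp]
        simp only [show o < c + r * m + 1 + (K + 1) ↔ o < c + r * m + 1 + K ∨
          o = c + r * m + 1 + K by omega, ho, or_false]
  rw [zeroSlices, runSlices_append, view_locSlices _ _ hiP, actList_append]
  · simp only [actList_cons, actList_nil, Op.act, Op.target, Op.ctrl, Function.update_self]
    rw [(actList_zeroOps (fun b hb => ?_) le_rfl).1, Bool.xor_true]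
    · congr 1
      rw [decide_eq_decide]
      have e : ∀ k < r * m, _ := fun k hk => key (r * m) le_rfl i hiP (c + r * m + 1 + k)
      constructor
      · intro h l hl b hb
        have h1 := h (l * m + b) (mul_add_lt hl hb)
        rw [e _ (mul_add_lt hl hb), if_pos ⟨by omega, by have := mul_add_lt hl hb; omega⟩,
          show c + r * m + 1 + (l * m + b) - (c + r * m + 1) = l * m + b by omega,
          (mul_add_div_mod hb).1, (mul_add_div_mod hb).2] at h1
        simpa [hi] using h1
      · intro h k hk
        obtain ⟨h1, h2⟩ := div_mod_lt hk
        rw [e k hk, if_pos (by omega), show c + r * m + 1 + k - (c + r * m + 1) = k by omega,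
          h _ h1 _ h2, Bool.and_false]
    · rw [key (r * m) le_rfl i hiP, if_neg (by omega), hσ i hiP _ (by omega)]
  · intro o ho
    rcases List.mem_append.1 ho with ho | ho
    · exact (zeroOps_wires ho).1
    · rw [List.mem_singleton] at ho
      subst ho
      simp [Op.wires]

/-! ### The states of the index registers -/

section State

variable {N r d m R : ℕ}

/-- The index registers: for each round and processor there are `r` indices with `m` bits. -/
abbrev IndexBit (N r m R : ℕ) := (Fin R × Fin N) × (Fin r × Fin m)

/-- The names of the qubits of the index registers. -/
def IndexBit.name (q : IndexBit N r m R) : Addr :=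
  cell (2 ^ (m + 1)) (indexCol r m q.1.2 q.2.1) (q.1.1 * m + q.2.2)

theorem IndexBit.name_injective (hm : N * r ≤ 2 ^ m) :
    Function.Injective (IndexBit.name : IndexBit N r m R → Addr) := by
  rintro ⟨⟨t, i⟩, l, b⟩ ⟨⟨t', i'⟩, l', b'⟩ h
  obtain ⟨h1, h2⟩ := (cell_inj (indexCol_lt hm i.2 l.2) (indexCol_lt hm i'.2 l'.2)).1 h
  simp only [indexCol, Nat.add_left_cancel_iff] at h1 h2
  have e1 := congrArg (· / r) h1
  have e2 := congrArg (· % r) h1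
  have e3 := congrArg (· / m) h2
  have e4 := congrArg (· % m) h2
  simp only [mul_add_div_mod l.2, mul_add_div_mod l'.2, mul_add_div_mod b.2,
    mul_add_div_mod b'.2] at e1 e2 e3 e4
  simp only [Prod.mk.injEq, Fin.ext_iff]
  exact ⟨⟨e3, e1⟩, e2, e4⟩

theorem IndexBit.name_inRange {F : ℕ} (hm : N * r ≤ 2 ^ m) (hF : testRow m R ≤ F)
    (q : IndexBit N r m R) : q.name.InRange N r d (F * 2 ^ (m + 1)) :=
  cell_inRange (indexCol_lt hm q.1.2.2 q.2.1.2) ((round_row_lt q.1.1.2 q.2.2.2).trans_le hF)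

/-- The initial contents of the qubits. -/
def dataState (x : Fin N → Fin d → Bool) : Addr → Bool
  | .data j k => if h : j < N ∧ k < d then x ⟨j, h.1⟩ ⟨k, h.2⟩ else false
  | _ => false

/-- The state with the given contents of the index registers. -/
noncomputable def indexState (x : Fin N → Fin d → Bool) (φ : IndexBit N r m R → Bool) :
    Addr → Bool :=
  Function.extend IndexBit.name φ (dataState x)

variable (x : Fin N → Fin d → Bool) (φ : IndexBit N r m R → Bool)

theorem indexState_name (hm : N * r ≤ 2 ^ m) (q : IndexBit N r m R) :
    indexState x φ q.name = φ q :=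
  (IndexBit.name_injective hm).extend_apply _ _ _

theorem indexState_of_ne {q : Addr} (h : ∀ p < 2 ^ (m + 1), ∀ o < testRow m R,
    q ≠ cell (2 ^ (m + 1)) p o) (hm : N * r ≤ 2 ^ m) : indexState x φ q = dataState x q := by
  refine Function.extend_apply' _ _ _ ?_
  rintro ⟨q', rfl⟩
  exact h _ (indexCol_lt hm q'.1.2.2 q'.2.1.2) _ (round_row_lt q'.1.1.2 q'.2.2.2) rfl

theorem view_indexState (hm : N * r ≤ 2 ^ m) {p o : ℕ} (hp : p < 2 ^ (m + 1))
    (ho : testRow m R ≤ o) : view (2 ^ (m + 1)) (indexState x φ) p o = false := by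
  rw [view, indexState_of_ne x φ (fun p' hp' o' ho' h => ?_) hm]
  · rfl
  · obtain ⟨-, rfl⟩ := (cell_inj hp hp').1 h
    omega

theorem view_indexState_index (hm : N * r ≤ 2 ^ m) (t : Fin R) (i : Fin N) (l : Fin r)
    (b : Fin m) : view (2 ^ (m + 1)) (indexState x φ) (indexCol r m i l) (t * m + b) =
      φ ((t, i), (l, b)) :=
  indexState_name x φ hm ((t, i), (l, b))

/-- The number in an index register. -/
def registerVal (u : Fin r × Fin m → Bool) (l : Fin r) : ℕ :=
  bitsVal m fun b => if h : b < m then u (l, ⟨b, h⟩) else false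

/-- The tuple of indices of database entries in the index registers of a processor. -/
def selection [NeZero N] (u : Fin r × Fin m → Bool) (l : Fin r) : Fin N :=
  Fin.ofNat N (registerVal u l)

theorem selection_val [NeZero N] (u : Fin r × Fin m → Bool) (l : Fin r) :
    (selection u l : Fin N).val = registerVal u l % N := rfl

theorem address_indexState (hm : N * r ≤ 2 ^ m) (t : Fin R) (i : Fin N) (l : Fin r) :
    address m (t * m) (indexState x φ) (indexCol r m i l) =
      registerVal (fun c => φ ((t, i), c)) l := by
  rw [address, if_neg (by rw [indexCol]; omega), registerVal]
  refine bitsVal_congr fun b hb => ?_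
  rw [dif_pos hb]
  exact view_indexState_index x φ hm t i l ⟨b, hb⟩

end State

theorem sliceValid_targets {N r d w : ℕ} : SliceValid N r d w (((List.range N).map .target).map .z)
    := by
  rw [List.map_map]
  refine sliceValid_family (fun p hp => ⟨?_, by simp [Op.wires]⟩) fun p _ q _ hpq => ?_
  · simpa [Op.wires, Addr.InRange] using hp
  · simpa [Op.wires, List.Disjoint] using hpq

theorem sliceValid_tests {N r d m F c : ℕ} (hm : N * r ≤ 2 ^ m) (hr : 0 < r) (hc : c < F) :
    SliceValid N r d (F * 2 ^ (m + 1))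
      (((List.range N).map fun i => cell (2 ^ (m + 1)) i c).map .z) := by
  have hNm : N ≤ 2 ^ m := le_trans (by simpa using Nat.mul_le_mul_left N hr) hm
  have hlt : ∀ i < N, i < 2 ^ (m + 1) := fun i hi => by rw [pow_succ]; omega
  rw [List.map_map]
  refine sliceValid_family (fun p hp => ⟨?_, by simp [Op.wires]⟩) fun p hp q hq hpq => ?_
  · simp only [Function.comp, Op.wires, List.mem_singleton, forall_eq]
    exact cell_inRange (hlt p hp) hc
  · simpa [Op.wires, List.Disjoint, cell_inj (hlt p hp) (hlt q hq)] using hpq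

/-! ### The two Grover phases on the index registers -/

section Phases

variable {N r d n m R : ℕ} {a : Fin N → ℕ} [NeZero N]

theorem baseRow_bounds {r d n m R t : ℕ} (ht : t < R) :
    t * m + m ≤ testRow m R ∧ testRow m R + (2 * (r * m) + 1) = baseRow r m R ∧
      endRow d n m (baseRow r m R) ≤ newRow r d n m R + R ∧
      baseRow r m R ≤ newRow r d n m R :=
  ⟨round_rows_le ht, rfl, Nat.le_add_right _ _, baseRow_le_endRow _ _ _ _⟩

/-- The entries selected in round `t` by processor `i`. -/
def entries (x : Fin N → Fin d → Bool) (φ : IndexBit N r m R → Bool) (t : Fin R) (i : Fin N) :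
    Fin r → Fin d → Bool :=
  fun l => x (selection (fun c => φ ((t, i), c)) l)

/-- The argument registers start at zero, so adding the bits that were looked up writes them. As
register contents are reduced modulo `N`, the arguments are database entries on every branch of the
superposition, and the query is always admissible. -/
theorem argSlices_indexState_arg {x : Fin N → Fin d → Bool} {φ : IndexBit N r m R → Bool}
    (hm : N * r ≤ 2 ^ m) (t : Fin R) (i : Fin N) (l : Fin r) (k : Fin d) :
    runSlices (argSlices N r d n m (t * m) (baseRow r m R)) (indexState x φ) (.arg i l k) =
      entries x φ t i l k := by
  obtain ⟨h1, h2, -, -⟩ := baseRow_bounds (r := r) (d := d) (n := n) (m := m) t.2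
  rw [(runSlices_argSlices (NeZero.pos N) hm (Nat.zero_lt_of_lt l.2) (by omega)
    (fun p hp o ho => view_indexState x φ hm hp (by omega)) i.2 l.2).1 k k.2,
    address_indexState x φ hm, indexState_of_ne x φ (by simp [cell]) hm,
    indexState_of_ne x φ (by simp [cell]) hm]
  have h : registerVal (fun c => φ ((t, i), c)) l % N < N := Nat.mod_lt _ (NeZero.pos N)
  simp only [dataState, h, k.2, and_self, dif_pos, Bool.false_xor]
  rfl

theorem argSlices_indexState_target {x : Fin N → Fin d → Bool} {φ : IndexBit N r m R → Bool}
    (hm : N * r ≤ 2 ^ m) (ib B i : ℕ) :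
    runSlices (argSlices N r d n m ib B) (indexState x φ) (.target i) = false := by
  rw [argSlices_writes.runSlices_eq, indexState_of_ne x φ (by simp [cell]) hm]
  · rfl
  · rintro (⟨p, -, o, -, -, h⟩ | ⟨_, _, _, h⟩) <;> simp [cell] at h

theorem argSlices_indexState_result {x : Fin N → Fin d → Bool} {φ : IndexBit N r m R → Bool}
    (hm : N * r ≤ 2 ^ m) (t : Fin R) (i : Fin N) (l : Fin r) {b : ℕ} (hb : b < n) :
    runSlices (argSlices N r d n m (t * m) (baseRow r m R)) (indexState x φ)
      (cell (2 ^ (m + 1)) (indexCol r m i l) (resultRow d n m (baseRow r m R) + d + b)) =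
      (selection (fun c => φ ((t, i), c)) l : Fin N).val.testBit b := by
  obtain ⟨h1, h2, -, -⟩ := baseRow_bounds (r := r) (d := d) (n := n) (m := m) t.2
  rw [(runSlices_argSlices (NeZero.pos N) hm (Nat.zero_lt_of_lt l.2) (by omega)
    (fun p hp o ho => view_indexState x φ hm hp (by omega)) i.2 l.2).2 b hb,
    address_indexState x φ hm, selection_val]

theorem list_prod_range_map (f : ℕ → ℂ) (n : ℕ) :
    ((List.range n).map f).prod = ∏ i : Fin n, f i := by
  rw [Fin.prod_univ_eq_prod_range f n]
  rfl

/-- The predicates act as phases. -/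
theorem exec_oraclePhase_indexState (q₀ : Qubit N r d (scratchSize r d n m R) a)
    {A : ∀ i, Circuit (OracleQubit r d (a i))} {x : Fin N → Fin d → Bool}
    {α : Fin N → (Fin r → Fin d → Bool) → Bool} (hA : ∀ i, ComputesOn x (α i) (A i))
    (hm : N * r ≤ 2 ^ m) (hr : 0 < r) (t : Fin R) (φ : IndexBit N r m R → Bool) :
    exec A (oraclePhase (argSlices N r d n m (t * m) (baseRow r m R))
      ((List.range N).map .target))
      (Ket.basis (Qubit.lift (w := scratchSize r d n m R) (a := a) (indexState x φ))) =
      (∏ i, if α i (entries x φ t i) then (-1 : ℂ) else 1) •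
        Ket.basis (Qubit.lift (indexState x φ)) := by
  obtain ⟨h1, h2, h3, -⟩ := baseRow_bounds (r := r) (d := d) (n := n) (m := m) t.2
  rw [exec_oraclePhase A q₀ hA (fun l hl => argSlices_valid hm hr (by omega) h3 hl)
    (fun l hl o ho => argSlices_classical hl ho)]
  · rw [List.map_map, list_prod_range_map]
    congr 1
    refine Finset.prod_congr rfl fun i _ => ?_
    simp only [Function.comp, queryAct, i.2, dif_pos, argSlices_indexState_target hm,
      argSlices_indexState_arg hm, Bool.false_xor, Fin.eta]
  · exact sliceValid_targets
  · exact fun i => ⟨_, fun l k => argSlices_indexState_arg hm t i l k⟩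

/-- The phase for the inversion about the mean, in the Hadamard basis. -/
theorem exec_plainPhase_indexState (q₀ : Qubit N r d (scratchSize r d n m R) a)
    {A : ∀ i, Circuit (OracleQubit r d (a i))} {x : Fin N → Fin d → Bool}
    (hm : N * r ≤ 2 ^ m) (hr : 0 < r) (t : Fin R) (φ : IndexBit N r m R → Bool) :
    exec A (plainPhase (zeroSlices N r m (t * m) (testRow m R))
      ((List.range N).map fun i => cell (2 ^ (m + 1)) i (testRow m R + r * m)))
      (Ket.basis (Qubit.lift (w := scratchSize r d n m R) (a := a) (indexState x φ))) =
      (∏ i, if (fun c => φ ((t, i), c)) = fun _ => false then (1 : ℂ) else -1) •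
        Ket.basis (Qubit.lift (indexState x φ)) := by
  obtain ⟨h1, h2, h3, h4⟩ := baseRow_bounds (r := r) (d := d) (n := n) (m := m) t.2
  rw [exec_plainPhase A q₀ (fun l hl => zeroSlices_valid hm (by omega) (by omega) hl)
    (fun l hl o ho => zeroSlices_classical hl ho)]
  · rw [List.map_map, list_prod_range_map]
    congr 1
    refine Finset.prod_congr rfl fun i _ => ?_
    have := view_zeroSlices hm (by omega) hr
      (fun p hp o ho => view_indexState x φ hm hp ho) i.2 (c := testRow m R) (ib := t * m)
    simp only [view] at this
    simp only [Function.comp, this]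
    have e : (∀ l < r, ∀ b < m, indexState x φ (cell (2 ^ (m + 1)) (indexCol r m i l)
        (t * m + b)) = false) ↔ (fun c => φ ((t, i), c)) = fun _ => false := by
      constructor
      · intro h
        ext ⟨l, b⟩
        rw [← view_indexState_index x φ hm, view, h l l.2 b b.2]
      · intro h l hl b hb
        have := view_indexState_index x φ hm t i ⟨l, hl⟩ ⟨b, hb⟩
        rw [view] at this
        rw [this]
        exact congrFun h _
    simp only [e]
    split_ifs with h1 h2 h2 <;> simp_all
  · exact sliceValid_tests hm hr (by omega)

end Phases

/-! ### Recording the solutions -/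

section Update

variable {N r d n m R : ℕ}

/-- The mark for a new solution found by processor `i` in round `t`. -/
def newFlag (r d n m R t i : ℕ) : Addr := cell (2 ^ (m + 1)) i (newRow r d n m R + t)

/-- A digit of an index of a database entry that was looked up. -/
def foundDigit (r d n m R i l b : ℕ) : Addr :=
  cell (2 ^ (m + 1)) (indexCol r m i l) (resultRow d n m (baseRow r m R) + d + b)

/-- Mark the processors which have found their first solution. -/
def markSlices (N r d n m R t : ℕ) : List (List (Op Addr)) :=
  [(List.range N).map fun i => .x (.found i),
    (List.range N).map fun i => .tof (.target i) (.found i) (newFlag r d n m R t i),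
    (List.range N).map fun i => .x (.found i)]

/-- Copy one digit of the new solutions. -/
def outSlice (N r d n m R t l b : ℕ) : List (Op Addr) :=
  (List.range N).map fun i =>
    .tof (newFlag r d n m R t i) (foundDigit r d n m R i l b) (.out i l b)

/-- Record the new solutions. -/
def updateSlices (N r d n m R t : ℕ) : List (List (Op Addr)) :=
  markSlices N r d n m R t ++
    (((List.range (r * n)).map fun k => outSlice N r d n m R t (k / n) (k % n)) ++
      [(List.range N).map fun i => .cnot (newFlag r d n m R t i) (.found i)])

/-- The qubits that are not used to evaluate the predicates. -/
def IsRecord (r d n m R : ℕ) (q : Addr) : Prop :=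
  (∃ i, q = .found i) ∨ (∃ i l b, q = .out i l b) ∨
    ∃ i < 2 ^ (m + 1), ∃ t, q = newFlag r d n m R t i

theorem newFlag_inj {t t' i i' : ℕ} (hi : i < 2 ^ (m + 1)) (hi' : i' < 2 ^ (m + 1)) :
    newFlag r d n m R t i = newFlag r d n m R t' i' ↔ t = t' ∧ i = i' := by
  rw [newFlag, newFlag, cell_inj hi hi']
  omega

theorem foundDigit_row_lt {b : ℕ} (hb : b < n) :
    resultRow d n m (baseRow r m R) + d + b < newRow r d n m R := by
  rw [newRow, endRow]
  omega

theorem foundDigit_ne_newFlag {i j l b t : ℕ} (hb : b < n) (hm : N * r ≤ 2 ^ m) (hi : i < N)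
    (hl : l < r) (hj : j < 2 ^ (m + 1)) : foundDigit r d n m R i l b ≠ newFlag r d n m R t j := by
  have := foundDigit_row_lt (r := r) (d := d) (m := m) (R := R) hb
  rw [foundDigit, newFlag, ne_eq, cell_inj (indexCol_lt hm hi hl) hj]
  omega

theorem foundDigit_inj {i j l b : ℕ} (hm : N * r ≤ 2 ^ m) (hi : i < N) (hj : j < N) (hl : l < r)
    (h : foundDigit r d n m R i l b = foundDigit r d n m R j l b) : i = j :=
  indexCol_inj hl ((cell_inj (indexCol_lt hm hi hl) (indexCol_lt hm hj hl)).1 h).1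

theorem newFlag_inRange {t i : ℕ} (hi : i < 2 ^ (m + 1)) (ht : t < R) :
    (newFlag r d n m R t i).InRange N r d (scratchSize r d n m R) :=
  cell_inRange hi (by omega)

theorem foundDigit_inRange {i l b : ℕ} (hm : N * r ≤ 2 ^ m) (hi : i < N) (hl : l < r)
    (hb : b < n) : (foundDigit r d n m R i l b).InRange N r d (scratchSize r d n m R) :=
  cell_inRange (indexCol_lt hm hi hl) ((foundDigit_row_lt hb).trans_le (Nat.le_add_right _ _))

theorem lt_two_pow_of_mul_le {i : ℕ} (hm : N * r ≤ 2 ^ m) (hr : 0 < r) (hi : i < N) :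
    i < 2 ^ (m + 1) := by
  have : N * 1 ≤ N * r := Nat.mul_le_mul_left _ hr
  rw [pow_succ]
  omega

theorem flipFound_valid {w : ℕ} :
    SliceValid N r d w ((List.range N).map fun i => .x (.found i)) :=
  sliceValid_family (fun p hp => ⟨by simpa [Op.wires, Addr.InRange] using hp, by simp [Op.wires]⟩)
    fun p _ q _ hpq => by simpa [Op.wires, List.Disjoint] using hpq

theorem markNew_valid (hm : N * r ≤ 2 ^ m) (hr : 0 < r) {t : ℕ} (ht : t < R) :
    SliceValid N r d (scratchSize r d n m R) ((List.range N).map fun i =>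
      .tof (.target i) (.found i) (newFlag r d n m R t i)) := by
  have hlt := fun i hi => lt_two_pow_of_mul_le (i := i) hm hr hi
  refine sliceValid_family (fun p hp => ⟨?_, ?_⟩) fun p hp q hq hpq => ?_
  · simp only [Op.wires, List.mem_cons, List.not_mem_nil, or_false, forall_eq_or_imp, forall_eq]
    exact ⟨hp, hp, newFlag_inRange (hlt p hp) ht⟩
  · simp [Op.wires, newFlag, cell]
  · simp [Op.wires, List.Disjoint, newFlag_inj (hlt p hp) (hlt q hq), hpq]
    simp [newFlag, cell]

theorem unmarkNew_valid (hm : N * r ≤ 2 ^ m) (hr : 0 < r) {t : ℕ} (ht : t < R) :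
    SliceValid N r d (scratchSize r d n m R) ((List.range N).map fun i =>
      .cnot (newFlag r d n m R t i) (.found i)) := by
  have hlt := fun i hi => lt_two_pow_of_mul_le (i := i) hm hr hi
  refine sliceValid_family (fun p hp => ⟨?_, ?_⟩) fun p hp q hq hpq => ?_
  · simp only [Op.wires, List.mem_cons, List.not_mem_nil, or_false, forall_eq_or_imp, forall_eq]
    exact ⟨newFlag_inRange (hlt p hp) ht, hp⟩
  · simp [Op.wires, newFlag, cell]
  · simp [Op.wires, List.Disjoint, newFlag_inj (hlt p hp) (hlt q hq), hpq]
    simp [newFlag, cell]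

theorem outSlice_valid (hm : N * r ≤ 2 ^ m) (hr : 0 < r) (hn : n = Nat.clog 2 N) {t l b : ℕ}
    (ht : t < R) (hl : l < r) (hb : b < n) :
    SliceValid N r d (scratchSize r d n m R) (outSlice N r d n m R t l b) := by
  have hlt := fun i hi => lt_two_pow_of_mul_le (i := i) hm hr hi
  refine sliceValid_family (fun p hp => ⟨?_, ?_⟩) fun p hp q hq hpq => ?_
  · simp only [Op.wires, List.mem_cons, List.not_mem_nil, or_false, forall_eq_or_imp, forall_eq]
    exact ⟨newFlag_inRange (hlt p hp) ht, foundDigit_inRange hm hp hl hb, hp, hl, hn ▸ hb⟩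
  · have := (foundDigit_ne_newFlag (d := d) (R := R) (t := t) hb hm hp hl (hlt p hp)).symm
    simp [Op.wires, this]
    simp [newFlag, foundDigit, cell]
  · have h1 := foundDigit_ne_newFlag (d := d) (R := R) (t := t) hb hm hp hl (hlt q hq)
    have h2 := foundDigit_ne_newFlag (d := d) (R := R) (t := t) hb hm hq hl (hlt p hp)
    have h3 : foundDigit r d n m R p l b ≠ foundDigit r d n m R q l b := fun h =>
      hpq (foundDigit_inj hm hp hq hl h)
    simp [Op.wires, List.Disjoint, newFlag_inj (hlt p hp) (hlt q hq), hpq, h1, h2.symm, h3]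
    simp [newFlag, foundDigit, cell]

theorem updateSlices_valid (hm : N * r ≤ 2 ^ m) (hr : 0 < r) (hn : n = Nat.clog 2 N) {t : ℕ}
    (ht : t < R) {l : List (Op Addr)} (hl : l ∈ updateSlices N r d n m R t) :
    SliceValid N r d (scratchSize r d n m R) l := by
  simp only [updateSlices, markSlices, List.mem_append, List.mem_cons, List.not_mem_nil,
    or_false, List.mem_map, List.mem_range] at hl
  rcases hl with (rfl | rfl | rfl) | ⟨k, hk, rfl⟩ | rfl
  · exact flipFound_valid
  · exact markNew_valid hm hr ht
  · exact flipFound_valid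
  · obtain ⟨h1, h2⟩ := div_mod_lt hk
    exact outSlice_valid hm hr hn ht h1 h2
  · exact unmarkNew_valid hm hr ht

theorem updateSlices_classical {t : ℕ} {l : List (Op Addr)}
    (hl : l ∈ updateSlices N r d n m R t) {o : Op Addr} (ho : o ∈ l) : o.IsClassical := by
  simp only [updateSlices, markSlices, List.mem_append, List.mem_cons, List.not_mem_nil,
    or_false, List.mem_map, List.mem_range] at hl
  rcases hl with (rfl | rfl | rfl) | ⟨k, hk, rfl⟩ | rfl <;>
    obtain ⟨i, -, rfl⟩ := List.mem_map.1 ho <;> trivial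

theorem updateSlices_writes (hm : N * r ≤ 2 ^ m) (hr : 0 < r) {t : ℕ} :
    Writes (updateSlices N r d n m R t) (IsRecord r d n m R) := by
  intro l hl o ho w hw
  simp only [updateSlices, markSlices, List.mem_append, List.mem_cons, List.not_mem_nil,
    or_false, List.mem_map, List.mem_range] at hl
  rcases hl with (rfl | rfl | rfl) | ⟨k, hk, rfl⟩ | rfl <;>
    obtain ⟨i, hi, rfl⟩ := List.mem_map.1 ho <;>
    simp only [Op.target, Option.some.injEq] at hw <;> subst hw
  · exact Or.inl ⟨i, rfl⟩
  · exact Or.inr (Or.inr ⟨i, lt_two_pow_of_mul_le hm hr (List.mem_range.1 hi), t, rfl⟩)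
  · exact Or.inl ⟨i, rfl⟩
  · exact Or.inr (Or.inl ⟨_, _, _, rfl⟩)
  · exact Or.inl ⟨i, rfl⟩

theorem found_ne_newFlag (i j t : ℕ) : Addr.found i ≠ newFlag r d n m R t j := by
  simp [newFlag, cell]

theorem out_ne_newFlag (i l b j t : ℕ) : Addr.out i l b ≠ newFlag r d n m R t j := by
  simp [newFlag, cell]

/-- The flag is flipped before and after the Toffoli operation, so it acts as a negative control:
the mark is toggled only for a solution that is the first one. -/
theorem runSlices_markSlices (hm : N * r ≤ 2 ^ m) (hr : 0 < r) {t i : ℕ} (ht : t < R)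
    (hi : i < N) (σ : Addr → Bool) :
    (runSlices (markSlices N r d n m R t) σ (newFlag r d n m R t i) =
      (σ (newFlag r d n m R t i) ^^ (σ (.target i) && !σ (.found i)))) ∧
    (∀ j, runSlices (markSlices N r d n m R t) σ (.found j) = σ (.found j)) ∧
    ∀ q, (∀ j < N, q ≠ newFlag r d n m R t j) → (∀ j, q ≠ .found j) →
      runSlices (markSlices N r d n m R t) σ q = σ q := by
  have hf : ∀ (σ : Addr → Bool) j, actList ((List.range N).map fun i => Op.x (.found i)) σ
      (.found j) = if j < N then !σ (.found j) else σ (.found j) := by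
    intro σ j
    split_ifs with h
    · rw [actList_family (w := 0) (r := 0) (d := 0) flipFound_valid h rfl]
      simp [Op.ctrl]
    · rw [actList_family_of_ne]
      intro p hp e
      simp only [Op.target, Option.some.injEq, Addr.found.injEq] at e
      omega
  have hf' : ∀ (σ : Addr → Bool) q, (∀ j, q ≠ .found j) →
      actList ((List.range N).map fun i => Op.x (.found i)) σ q = σ q := by
    intro σ q hq
    rw [actList_family_of_ne]
    intro p _ e
    simp only [Op.target, Option.some.injEq] at e
    exact hq _ e.symm
  have hm' : ∀ (σ : Addr → Bool) q, (∀ j < N, q ≠ newFlag r d n m R t j) →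
      actList ((List.range N).map fun i =>
        .tof (.target i) (.found i) (newFlag r d n m R t i)) σ q = σ q := by
    intro σ q hq
    rw [actList_family_of_ne]
    intro p hp e
    simp only [Op.target, Option.some.injEq] at e
    exact hq _ hp e.symm
  rw [markSlices]
  simp only [runSlices_cons, runSlices_nil]
  refine ⟨?_, fun j => ?_, fun q h1 h2 => ?_⟩
  · rw [hf' _ _ fun j => (found_ne_newFlag j i t).symm,
      actList_family (markNew_valid (d := d) (n := n) hm hr ht) hi rfl, Op.ctrl,
      hf' _ _ fun j => (found_ne_newFlag j i t).symm, hf' _ _ (by simp), hf, if_pos hi]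
  · rw [hf, hm' _ _ fun _ _ => found_ne_newFlag _ _ _, hf]
    split_ifs <;> simp
  · rw [hf' _ _ h2, hm' _ _ h1, hf' _ _ h2]

theorem runSlices_outSlices (hm : N * r ≤ 2 ^ m) (hr : 0 < r) (hn : n = Nat.clog 2 N) {t : ℕ}
    (ht : t < R) (σ : Addr → Bool) {K : ℕ} (hK : K ≤ r * n) :
    (∀ i < N, ∀ l < r, ∀ b < n, runSlices ((List.range K).map fun k =>
      outSlice N r d n m R t (k / n) (k % n)) σ (.out i l b) =
      if l * n + b < K then (σ (.out i l b) ^^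
        (σ (newFlag r d n m R t i) && σ (foundDigit r d n m R i l b)))
      else σ (.out i l b)) ∧
    ∀ q, (∀ i l b, q ≠ .out i l b) → runSlices ((List.range K).map fun k =>
      outSlice N r d n m R t (k / n) (k % n)) σ q = σ q := by
  induction K with
  | zero => exact ⟨fun i _ l _ b _ => by rw [if_neg (by omega)]; rfl, fun q _ => rfl⟩
  | succ K ih =>
    obtain ⟨ih1, ih2⟩ := ih (by omega)
    obtain ⟨hl', hb'⟩ := div_mod_lt (show K < r * n by omega)
    refine ⟨fun i hi l hl b hb => ?_, fun q hq => ?_⟩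
    · rw [runSlices_range_map_succ]
      by_cases hk : l * n + b = K
      · have e1 : K / n = l := by rw [← hk, (mul_add_div_mod hb).1]
        have e2 : K % n = b := by rw [← hk, (mul_add_div_mod hb).2]
        rw [e1, e2, outSlice, actList_family (outSlice_valid (d := d) hm hr hn ht hl hb) hi rfl,
          Op.ctrl, ih1 i hi l hl b hb, if_neg (by omega), if_pos (by omega),
          ih2 _ (by simp [newFlag, cell]), ih2 _ (by simp [foundDigit, cell])]
      · rw [outSlice, actList_family_of_ne, ih1 i hi l hl b hb]
        · simp only [show l * n + b < K + 1 ↔ l * n + b < K by omega]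
        · intro p _ e
          simp only [Op.target, Option.some.injEq, Addr.out.injEq] at e
          obtain ⟨-, rfl, rfl⟩ := e
          exact hk (Nat.div_add_mod' _ _)
    · rw [runSlices_range_map_succ, outSlice, actList_family_of_ne, ih2 q hq]
      intro p _ e
      simp only [Op.target, Option.some.injEq] at e
      exact hq _ _ _ e.symm

/-- The mark excludes an earlier hit, so adding it to the flag is a disjunction, and digits are
added to the output only if nothing was found before. -/
theorem runSlices_updateSlices (hm : N * r ≤ 2 ^ m) (hr : 0 < r) (hn : n = Nat.clog 2 N)
    {t i : ℕ} (ht : t < R) (hi : i < N) {σ : Addr → Bool}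
    (hσ : σ (newFlag r d n m R t i) = false) :
    (runSlices (updateSlices N r d n m R t) σ (.found i) = (σ (.found i) || σ (.target i))) ∧
    (∀ l < r, ∀ b < n, runSlices (updateSlices N r d n m R t) σ (.out i l b) =
      (σ (.out i l b) ^^ ((σ (.target i) && !σ (.found i)) &&
        σ (foundDigit r d n m R i l b)))) ∧
    ∀ t' ≠ t, runSlices (updateSlices N r d n m R t) σ (newFlag r d n m R t' i) =
      σ (newFlag r d n m R t' i) := by
  have hlt := fun i hi => lt_two_pow_of_mul_le (i := i) hm hr hi
  obtain ⟨m1, m2, m3⟩ := runSlices_markSlices (d := d) (n := n) hm hr ht hi σ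
  obtain ⟨o1, o2⟩ := runSlices_outSlices (d := d) hm hr hn ht
    (runSlices (markSlices N r d n m R t) σ) le_rfl
  have u1 : ∀ (σ : Addr → Bool) q, (∀ j, q ≠ .found j) → actList ((List.range N).map fun i =>
      .cnot (newFlag r d n m R t i) (.found i)) σ q = σ q := by
    intro σ q hq
    rw [actList_family_of_ne]
    intro p _ e
    simp only [Op.target, Option.some.injEq] at e
    exact hq _ e.symm
  rw [updateSlices, runSlices_append, runSlices_append, runSlices_cons, runSlices_nil]
  refine ⟨?_, fun l hl b hb => ?_, fun t' ht' => ?_⟩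
  · rw [actList_family (unmarkNew_valid (d := d) (n := n) hm hr ht) hi rfl, Op.ctrl,
      o2 _ (by simp), o2 _ (by simp [newFlag, cell]), m1, m2, hσ]
    cases σ (.found i) <;> cases σ (.target i) <;> rfl
  · rw [u1 _ _ (by simp), o1 i hi l hl b hb, if_pos (mul_add_lt hl hb), m1, hσ,
      m3 _ (fun j _ => out_ne_newFlag _ _ _ _ _) (by simp),
      m3 _ (fun j hj => foundDigit_ne_newFlag hb hm hi hl (hlt j hj)) (by simp [foundDigit, cell])]
    simp
  · rw [u1 _ _ fun j => (found_ne_newFlag _ _ _).symm, o2 _ (by simp [newFlag, cell]),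
      m3 _ (fun j hj h => ht' ((newFlag_inj (hlt i hi) (hlt j hj)).1 h).1)
      fun j => (found_ne_newFlag _ _ _).symm]

end Update

/-! ### Evaluation in the presence of recorded results -/

open Classical in
/-- The bits of `τ` on the qubits in `S`, and of `σ` on the others. -/
noncomputable def overlay (S : Addr → Prop) (τ σ : Addr → Bool) : Addr → Bool :=
  fun q => if S q then τ q else σ q

theorem overlay_of_mem {S : Addr → Prop} {q : Addr} (h : S q) (τ σ : Addr → Bool) :
    overlay S τ σ q = τ q := if_pos h

theorem overlay_of_not_mem {S : Addr → Prop} {q : Addr} (h : ¬ S q) (τ σ : Addr → Bool) :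
    overlay S τ σ q = σ q := if_neg h

theorem overlay_self (S : Addr → Prop) (σ : Addr → Bool) : overlay S σ σ = σ := by
  ext q
  by_cases h : S q
  exacts [overlay_of_mem h _ _, overlay_of_not_mem h _ _]

section Final

variable {N r d n m R w : ℕ} {a : Fin N → ℕ}

theorem isRecord_target (i : ℕ) : ¬ IsRecord r d n m R (.target i) := by
  simp [IsRecord, newFlag, cell]

theorem isRecord_arg (i l k : ℕ) : ¬ IsRecord r d n m R (.arg i l k) := by
  simp [IsRecord, newFlag, cell]

/-- A query reads and writes only arguments and targets, none of which is a record qubit. -/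
theorem queryAct_overlay (α : Fin N → (Fin r → Fin d → Bool) → Bool) (τ σ : Addr → Bool) :
    queryAct α (overlay (IsRecord r d n m R) τ σ) =
      overlay (IsRecord r d n m R) τ (queryAct α σ) := by
  have h : ∀ q, (∀ i, q ≠ .target i) → ∀ σ, queryAct α σ q = σ q := by
    intro q hq σ
    cases q <;> simp_all [queryAct]
  ext q
  by_cases ht : ∃ i, q = .target i
  · obtain ⟨i, rfl⟩ := ht
    rw [overlay_of_not_mem (isRecord_target i)]
    simp only [queryAct, overlay_of_not_mem (isRecord_target i),
      overlay_of_not_mem (isRecord_arg _ _ _)]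
  · rw [h q fun i e => ht ⟨i, e⟩]
    by_cases hq : IsRecord r d n m R q
    · rw [overlay_of_mem hq, overlay_of_mem hq]
    · rw [overlay_of_not_mem hq, overlay_of_not_mem hq, h q fun i e => ht ⟨i, e⟩]

/-- Evaluate the predicates, record the solutions found, and undo the evaluation. -/
def recordRound (N r d n m R t : ℕ) : List Instr :=
  (argSlices N r d n m (t * m) (baseRow r m R)).map some ++ ([none] ++
    ((updateSlices N r d n m R t).map some ++ ([none] ++
      (revSlices (argSlices N r d n m (t * m) (baseRow r m R))).map some)))

theorem argSlices_not_isRecord (hm : N * r ≤ 2 ^ m) (hr : 0 < r) {t : ℕ} (ht : t < R) :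
    ∀ l ∈ argSlices N r d n m (t * m) (baseRow r m R), ∀ o ∈ l, ∀ q ∈ o.wires,
      ¬ IsRecord r d n m R q := by
  intro l hl o ho q hq
  obtain ⟨h1, h2, -, -⟩ := baseRow_bounds (r := r) (d := d) (n := n) (m := m) ht
  have hv := ((argSlices_valid hm hr (by omega) (le_refl (newRow r d n m R)) hl).1 o ho).1 q hq
  obtain ⟨w1, w2⟩ := argSlices_wires hl ho hq
  rintro (⟨i, rfl⟩ | ⟨i, l, b, rfl⟩ | ⟨i, hi, t, rfl⟩)
  · exact w1 _ rfl
  · exact w2 _ _ _ rfl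
  · change (newRow r d n m R + t) * 2 ^ (m + 1) + i < newRow r d n m R * 2 ^ (m + 1) at hv
    have : newRow r d n m R * 2 ^ (m + 1) ≤ (newRow r d n m R + t) * 2 ^ (m + 1) :=
      Nat.mul_le_mul_right _ (by omega)
    omega

/-- Evaluation does not use the record qubits, and recording changes nothing else. The second query
and the reversed slices therefore restore `σ` as if nothing had been recorded. -/
theorem exec_recordRound (q₀ : Qubit N r d (scratchSize r d n m R) a)
    {A : ∀ i, Circuit (OracleQubit r d (a i))} {x : Fin N → Fin d → Bool}
    {α : Fin N → (Fin r → Fin d → Bool) → Bool} (hA : ∀ i, ComputesOn x (α i) (A i))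
    (hm : N * r ≤ 2 ^ m) (hr : 0 < r) (hn : n = Nat.clog 2 N) {t : ℕ} (ht : t < R)
    {σ : Addr → Bool} (τ : Addr → Bool)
    (harg : ∀ i : Fin N, ∃ sel : Fin r → Fin N, ∀ (l : Fin r) (k : Fin d),
      runSlices (argSlices N r d n m (t * m) (baseRow r m R)) σ (.arg i l k) = x (sel l) k) :
    exec A (recordRound N r d n m R t) (Ket.basis (Qubit.lift (w := scratchSize r d n m R)
      (a := a) (overlay (IsRecord r d n m R) τ σ))) =
      Ket.basis (Qubit.lift (overlay (IsRecord r d n m R)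
        (runSlices (updateSlices N r d n m R t) (overlay (IsRecord r d n m R) τ
          (queryAct α (runSlices (argSlices N r d n m (t * m) (baseRow r m R)) σ)))) σ)) := by
  obtain ⟨h1, h2, h3, -⟩ := baseRow_bounds (r := r) (d := d) (n := n) (m := m) ht
  set L := argSlices N r d n m (t * m) (baseRow r m R) with hL
  have hv : ∀ l ∈ L, SliceValid N r d (scratchSize r d n m R) l := fun l hl =>
    argSlices_valid hm hr (by omega) h3 hl
  have hc : ∀ l ∈ L, ∀ o ∈ l, o.IsClassical := fun l hl o ho => argSlices_classical hl ho
  have hover : ∀ τ, runSlices L (overlay (IsRecord r d n m R) τ σ) = overlay (IsRecord r d n m R) τ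
      (runSlices L σ) := fun τ =>
    runSlices_overlay (argSlices_not_isRecord hm hr ht) (fun l hl o ho => ((hv l hl).1 o ho).2) σ τ
  set U := updateSlices N r d n m R t with hU
  set ρ := runSlices U (overlay (IsRecord r d n m R) τ (queryAct α (runSlices L σ))) with hρ
  -- Off the record qubits, recording leaves the state as it was after the first query.
  have hρS : ρ = overlay (IsRecord r d n m R) ρ (queryAct α (runSlices L σ)) := by
    ext q
    by_cases hq : IsRecord r d n m R q
    · rw [overlay_of_mem hq]
    · rw [overlay_of_not_mem hq, hρ, (updateSlices_writes hm hr).runSlices_eq hq,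
        overlay_of_not_mem hq]
  have hargS : ∀ (τ : Addr → Bool) (i l k : ℕ), overlay (IsRecord r d n m R) τ (runSlices L σ) (.arg
      i l k) =
      runSlices L σ (.arg i l k) := fun τ i l k => overlay_of_not_mem (isRecord_arg _ _ _) _ _
  have hquery : Ket.basis (Qubit.lift (r := r) (d := d)
      (w := scratchSize r d n m R) (a := a) ρ) = Ket.basis
      (Qubit.lift (queryAct α (overlay (IsRecord r d n m R) ρ (runSlices L σ)))) := by
    rw [queryAct_overlay, ← hρS]
  rw [recordRound, exec_append, exec_append, exec_append, exec_append, exec_slices A q₀ hv hc,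
    hover, exec_query, exec_query, run_query hA _ fun i => by simpa only [hargS] using harg i,
    queryAct_overlay, exec_slices A q₀ (fun l hl => updateSlices_valid hm hr hn ht hl)
      (fun l hl o ho => updateSlices_classical hl ho), ← hρ, hquery,
    run_query hA _ fun i => by simpa only [queryAct, hargS] using harg i, queryAct_queryAct,
    ← hover, exec_revSlices A q₀ hv hc]

/-- Evaluate the predicates for the contents of the index registers of all rounds. -/
def recordRounds (N r d n m R : ℕ) : List Instr :=
  (List.range R).flatMap (recordRound N r d n m R)

variable [NeZero N]

/-- The output `τ` is correct for the solutions contained in the first `T` index registers. -/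
structure Recorded (x : Fin N → Fin d → Bool) (α : Fin N → (Fin r → Fin d → Bool) → Bool)
    (φ : IndexBit N r m R → Bool) (n T : ℕ) (τ : Addr → Bool) : Prop where
  found : ∀ i : Fin N, τ (.found i) = true → ∃ t : Fin R, α i (entries x φ t i) = true ∧
    ∀ (l : Fin r), ∀ b < n, τ (.out i l b) =
      (selection (fun c => φ ((t, i), c)) l : Fin N).val.testBit b
  not_found : ∀ i : Fin N, τ (.found i) = false →
    (∀ t : Fin R, t < T → α i (entries x φ t i) = false) ∧
      ∀ (l : Fin r), ∀ b < n, τ (.out i l b) = false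
  fresh : ∀ t, T ≤ t → ∀ i : Fin N, τ (newFlag r d n m R t i) = false

theorem isRecord_found (i : ℕ) : IsRecord r d n m R (.found i) := Or.inl ⟨i, rfl⟩

theorem isRecord_out (i l b : ℕ) : IsRecord r d n m R (.out i l b) := Or.inr (Or.inl ⟨i, l, b, rfl⟩)

theorem isRecord_newFlag {i : ℕ} (hi : i < 2 ^ (m + 1)) (t : ℕ) :
    IsRecord r d n m R (newFlag r d n m R t i) := Or.inr (Or.inr ⟨i, hi, t, rfl⟩)

theorem not_isRecord_foundDigit {i l b : ℕ} (hb : b < n) (hm : N * r ≤ 2 ^ m) (hi : i < N)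
    (hl : l < r) : ¬ IsRecord r d n m R (foundDigit r d n m R i l b) := by
  rintro (⟨i, h⟩ | ⟨i, l, b, h⟩ | ⟨i, hi', t, h⟩)
  · simp [foundDigit, cell] at h
  · simp [foundDigit, cell] at h
  · exact foundDigit_ne_newFlag hb hm hi hl hi' h

/-- Each processor keeps the first solution among its registers so far. The predicate itself
decides, so a raised flag is never wrong. Every round has a separate row for marks, which is still
zero when the round begins. -/
theorem exec_recordRounds (q₀ : Qubit N r d (scratchSize r d n m R) a)
    {A : ∀ i, Circuit (OracleQubit r d (a i))} {x : Fin N → Fin d → Bool}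
    {α : Fin N → (Fin r → Fin d → Bool) → Bool} (hA : ∀ i, ComputesOn x (α i) (A i))
    (hm : N * r ≤ 2 ^ m) (hr : 0 < r) (hn : n = Nat.clog 2 N) (φ : IndexBit N r m R → Bool) :
    ∃ τ : Addr → Bool, Recorded x α φ n R τ ∧
      exec A (recordRounds N r d n m R) (Ket.basis (Qubit.lift (w := scratchSize r d n m R)
        (a := a) (indexState x φ))) =
        Ket.basis (Qubit.lift (overlay (IsRecord r d n m R) τ (indexState x φ))) := by
  have hlt : ∀ i : Fin N, (i : ℕ) < 2 ^ (m + 1) := fun i => lt_two_pow_of_mul_le hm hr i.2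
  have key : ∀ T ≤ R, ∃ τ : Addr → Bool, Recorded x α φ n T τ ∧
      exec A ((List.range T).flatMap (recordRound N r d n m R))
        (Ket.basis (Qubit.lift (w := scratchSize r d n m R) (a := a) (indexState x φ))) =
        Ket.basis (Qubit.lift (overlay (IsRecord r d n m R) τ (indexState x φ))) := by
    intro T
    induction T with
    | zero =>
      intro _
      refine ⟨indexState x φ, ⟨fun i h => ?_, fun i _ => ⟨fun t ht => by omega, fun l b hb => ?_⟩,
        fun t _ i => ?_⟩, ?_⟩
      · rw [indexState_of_ne x φ (by simp [cell]) hm] at h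
        simp [dataState] at h
      · rw [indexState_of_ne x φ (by simp [cell]) hm]
        rfl
      · refine view_indexState x φ hm (hlt i) ?_
        have h1 : testRow m R ≤ baseRow r m R := by rw [baseRow]; omega
        have h2 := baseRow_le_endRow d n m (baseRow r m R)
        rw [newRow]
        omega
      · rw [overlay_self]
        rfl
    | succ T ih =>
      intro hT
      obtain ⟨τ, hτ, hexec⟩ := ih (by omega)
      have hstep := exec_recordRound q₀ hA hm hr hn (show T < R by omega) (σ := indexState x φ) τ
        fun i => ⟨_, fun l k => argSlices_indexState_arg hm ⟨T, hT⟩ i l k⟩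
      refine ⟨_, ?_, by rw [List.range_succ, List.flatMap_append, exec_append, hexec,
        List.flatMap_singleton, hstep]⟩
      set ρ := overlay (IsRecord r d n m R) τ (queryAct α
        (runSlices (argSlices N r d n m (T * m) (baseRow r m R)) (indexState x φ))) with hρ
      have hup := fun i : Fin N => runSlices_updateSlices (σ := ρ) (d := d) hm hr hn
        (show T < R by omega) i.2 (by
          rw [hρ, overlay_of_mem (isRecord_newFlag (hlt i) T)]; exact hτ.fresh T le_rfl i)
      have hfound : ∀ i : ℕ, ρ (.found i) = τ (.found i) := fun i =>
        overlay_of_mem (isRecord_found _) _ _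
      have hout : ∀ i l b : ℕ, ρ (.out i l b) = τ (.out i l b) := fun i l b =>
        overlay_of_mem (isRecord_out _ _ _) _ _
      have htarget : ∀ i : Fin N, ρ (.target i) = α i (entries x φ ⟨T, by omega⟩ i) := by
        intro i
        rw [hρ, overlay_of_not_mem (isRecord_target _)]
        simp only [queryAct, i.2, dif_pos, argSlices_indexState_target hm, Bool.false_xor]
        congr 1
        ext l k
        exact argSlices_indexState_arg hm ⟨T, by omega⟩ i l k
      have hdigit : ∀ (i : Fin N) (l : Fin r), ∀ b < n, ρ (foundDigit r d n m R i l b) =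
          (selection (fun c => φ ((⟨T, by omega⟩, i), c)) l : Fin N).val.testBit b := by
        intro i l b hb
        rw [hρ, overlay_of_not_mem (not_isRecord_foundDigit hb hm i.2 l.2)]
        exact argSlices_indexState_result hm ⟨T, by omega⟩ i l hb
      refine ⟨fun i h => ?_, fun i h => ?_, fun t ht i => ?_⟩
      · rw [(hup i).1, hfound, htarget] at h
        cases hf : τ (.found i) with
        | true =>
          obtain ⟨t, h1, h2⟩ := hτ.found i hf
          refine ⟨t, h1, fun l b hb => ?_⟩
          rw [(hup i).2.1 l l.2 b hb, hfound, hf, hout, h2 l b hb]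
          simp
        | false =>
          rw [hf, Bool.false_or] at h
          refine ⟨⟨T, by omega⟩, h, fun l b hb => ?_⟩
          rw [(hup i).2.1 l l.2 b hb, hfound, hf, hout, (hτ.not_found i hf).2 l b hb, htarget, h,
            hdigit i l b hb]
          simp
      · rw [(hup i).1, hfound, htarget, Bool.or_eq_false_iff] at h
        obtain ⟨h1, h2⟩ := hτ.not_found i h.1
        refine ⟨fun t ht => ?_, fun l b hb => ?_⟩
        · rcases (by omega : (t : ℕ) < T ∨ (t : ℕ) = T) with h3 | h3
          · exact h1 t h3
          · rw [show t = ⟨T, hT⟩ from Fin.ext h3]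
            exact h.2
        · rw [(hup i).2.1 l l.2 b hb, hout, h2 l b hb, htarget, h.2]
          simp
      · rw [(hup i).2.2 t (by omega), hρ, overlay_of_mem (isRecord_newFlag (hlt i) t)]
        exact hτ.fresh t (by omega) i
  exact key R le_rfl

/-- If the recorded solutions include one for each predicate that has a solution, then the outputs
are correct. -/
theorem Recorded.correctAt {x : Fin N → Fin d → Bool}
    {α : Fin N → (Fin r → Fin d → Bool) → Bool} {φ : IndexBit N r m R → Bool} {τ : Addr → Bool}
    (h : Recorded x α φ (Nat.clog 2 N) R τ) {i : Fin N}
    (hi : (∃ s : Fin r → Fin N, α i (fun l => x (s l)) = true) →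
      ∃ t, α i (entries x φ t i) = true) (σ : Addr → Bool) :
    CorrectAt x (α i) i (Qubit.lift (w := w) (a := a)
      (overlay (IsRecord r d (Nat.clog 2 N) m R) τ σ)) := by
  have hfound : overlay (IsRecord r d (Nat.clog 2 N) m R) τ σ (.found i) = τ (.found i) :=
    overlay_of_mem (isRecord_found _) _ _
  have hout : ∀ i l b : ℕ, overlay (IsRecord r d (Nat.clog 2 N) m R) τ σ (.out i l b) =
      τ (.out i l b) := fun i l b => overlay_of_mem (isRecord_out _ _ _) _ _
  cases hf : τ (.found i) with
  | true =>
    obtain ⟨t, h1, h2⟩ := h.found i hf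
    refine Or.inl ⟨hfound.trans hf, _, fun l b => ?_, h1⟩
    exact (hout i l b).trans (h2 l b b.2)
  | false =>
    refine Or.inr ⟨hfound.trans hf, fun s => ?_⟩
    by_contra hs
    obtain ⟨t, ht⟩ := hi ⟨s, by simpa using hs⟩
    rw [(h.not_found i hf).1 t t.2] at ht
    exact Bool.false_ne_true ht

end Final

/-! ### Hadamard gates -/

section Walsh

variable {Q : Type} [DecidableEq Q]

theorem hGate_hGate (q : Q) (ψ : Ket Q) : (hGate q).apply ((hGate q).apply ψ) = ψ := by
  have := IsDiag.hadamard_conj (l := []) (q := q) (g := fun _ => false)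
    (fun ψ s => by simp) (fun _ _ => rfl) ψ
  simpa using this

/-- Hadamard gates on the qubits in a list. -/
noncomputable def walsh (cs : List Q) (ψ : Ket Q) : Ket Q := runGates (cs.map hGate) ψ

theorem walsh_append (cs cs' : List Q) (ψ : Ket Q) :
    walsh (cs ++ cs') ψ = walsh cs' (walsh cs ψ) := by
  rw [walsh, List.map_append, runGates_append]
  rfl

theorem walsh_cons (c : Q) (cs : List Q) (ψ : Ket Q) :
    walsh (c :: cs) ψ = walsh cs ((hGate c).apply ψ) := rfl

theorem walsh_walsh_reverse (cs : List Q) (ψ : Ket Q) : walsh cs (walsh cs.reverse ψ) = ψ := by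
  induction cs generalizing ψ with
  | nil => rfl
  | cons c cs ih =>
    rw [List.reverse_cons, walsh_append, walsh_cons c cs]
    rw [walsh_cons, show ∀ χ : Ket Q, walsh [] χ = χ from fun _ => rfl, hGate_hGate, ih]

theorem walsh_smul_add (cs : List Q) (z z' : ℂ) (ψ ψ' : Ket Q) :
    walsh cs (z • ψ + z' • ψ') = z • walsh cs ψ + z' • walsh cs ψ' := by
  simp only [walsh, runGates_add, runGates_smul]

variable [Fintype Q]

/-- The Hadamard matrix is symmetric; the involution exchanges the values of `q` before and after
the gate. -/
theorem sum_hGate_mul (q : Q) (φ ψ : Ket Q) :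
    ∑ s, (hGate q).apply φ s * ψ s = ∑ s, φ s * (hGate q).apply ψ s := by
  have hinv : Function.Involutive fun p : (Q → Bool) × Bool =>
      (Function.update p.1 q p.2, p.1 q) := by
    rintro ⟨s, a⟩
    simp
  have h0 : ∀ (χ : Ket Q) (s : Q → Bool), (hGate q).apply χ s = ∑ a : Bool,
      ((if s q && a then -1 else 1) * ((Real.sqrt 2 : ℝ) : ℂ)⁻¹) * χ (Function.update s q a) :=
    fun χ s => rfl
  simp only [h0, Finset.sum_mul, Finset.mul_sum]
  rw [← Fintype.sum_prod_type' (f := fun (s : Q → Bool) (a : Bool) =>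
      ((if s q && a then -1 else 1) * ((Real.sqrt 2 : ℝ) : ℂ)⁻¹) * φ (Function.update s q a) * ψ s),
    ← Fintype.sum_prod_type' (f := fun (s : Q → Bool) (a : Bool) =>
      φ s * (((if s q && a then -1 else 1) * ((Real.sqrt 2 : ℝ) : ℂ)⁻¹) *
        ψ (Function.update s q a))), ← Equiv.sum_comp (Function.Involutive.toPerm _ hinv)]
  refine Finset.sum_congr rfl fun p _ => ?_
  obtain ⟨s, a⟩ := p
  simp only [Function.Involutive.coe_toPerm, Function.update_self, Function.update_idem,
    Function.update_eq_self, Bool.and_comm a (s q)]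
  ring

theorem sum_walsh_mul (cs : List Q) (φ ψ : Ket Q) :
    ∑ s, walsh cs φ s * ψ s = ∑ s, φ s * walsh cs.reverse ψ s := by
  induction cs generalizing φ with
  | nil => rfl
  | cons c cs ih =>
    rw [walsh_cons, ih, sum_hGate_mul, List.reverse_cons, walsh_append]
    rfl

theorem walsh_basis_zero {cs : List Q} (hcs : cs.Nodup) (s : Q → Bool) :
    walsh cs (Ket.basis fun _ => false) s =
      if ∀ q, q ∉ cs → s q = false then (((Real.sqrt 2 : ℝ) : ℂ)⁻¹) ^ cs.length else 0 := by
  induction cs using List.reverseRecOn generalizing s with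
  | nil =>
    rw [show walsh [] (Ket.basis fun _ : Q => false) = Ket.basis fun _ => false from rfl,
      Ket.basis_apply]
    simp [funext_iff]
  | append_singleton cs c ih =>
    have hc : c ∉ cs := by
      rw [List.nodup_append] at hcs
      exact fun h => hcs.2.2 c h c (by simp) rfl
    have ih := fun s => ih (hcs.sublist (List.sublist_append_left _ _)) s
    rw [walsh_append, walsh_cons, show ∀ χ : Ket Q, walsh [] χ = χ from fun _ => rfl, hGate_apply,
      ih, ih]
    have h1 : ¬ ∀ q, q ∉ cs → Function.update s c true q = false := fun h => by
      simpa using h c hc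
    have h2 : (∀ q, q ∉ cs → Function.update s c false q = false) ↔
        ∀ q, q ∉ cs ++ [c] → s q = false := by
      refine forall_congr' fun q => ?_
      by_cases hq : q = c
      · subst hq; simp
      · simp [hq]
    rw [if_neg h1, mul_zero, add_zero, List.length_append, List.length_singleton, pow_succ']
    by_cases h : ∀ q, q ∉ cs ++ [c] → s q = false
    · rw [if_pos (h2.2 h), if_pos h]
    · rw [if_neg (h2.not.2 h), if_neg h, mul_zero]

/-- A list of all elements without repetition. -/
def IsEnum (cs : List Q) : Prop := cs.Nodup ∧ ∀ c, c ∈ cs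

theorem IsEnum.length {cs : List Q} (h : IsEnum cs) : cs.length = Fintype.card Q := by
  rw [← List.toFinset_card_of_nodup h.1, ← Finset.card_univ]
  congr 1
  ext c
  simp [h.2]

/-- Inversion about the mean. -/
theorem walsh_phase_walsh {cs : List Q} (h : IsEnum cs) (ψ : Ket Q) (s : Q → Bool) :
    walsh cs (fun s => (if s = fun _ => false then (1 : ℂ) else -1) * walsh cs.reverse ψ s) s =
      2 / 2 ^ Fintype.card Q * (∑ s, ψ s) - ψ s := by
  have hunif : ∀ s, walsh cs (Ket.basis fun _ => false) s =
      (((Real.sqrt 2 : ℝ) : ℂ)⁻¹) ^ Fintype.card Q := by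
    intro s
    rw [walsh_basis_zero h.1, if_pos fun q hq => absurd (h.2 q) hq, h.length]
  -- By symmetry, the amplitude at zero is the pairing of `ψ` with the uniform state.
  have h0 : walsh cs.reverse ψ (fun _ => false) =
      (((Real.sqrt 2 : ℝ) : ℂ)⁻¹) ^ Fintype.card Q * ∑ s, ψ s := by
    have := sum_walsh_mul cs (Ket.basis fun _ => false) ψ
    simp only [hunif, ← Finset.mul_sum] at this
    rw [this]
    simp [Ket.basis_apply]
  -- The phase is minus the identity plus twice the projection onto the zero state.
  have e : (fun s => (if s = fun _ => false then (1 : ℂ) else -1) * walsh cs.reverse ψ s) =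
      (-1 : ℂ) • walsh cs.reverse ψ +
        (2 * walsh cs.reverse ψ fun _ => false) • Ket.basis fun _ => false := by
    ext s
    simp only [Pi.add_apply, Pi.smul_apply, smul_eq_mul, Ket.basis_apply]
    split_ifs with hs
    · subst hs; ring
    · ring
  have h2 : ((Real.sqrt 2 : ℝ) : ℂ)⁻¹ ^ Fintype.card Q * ((Real.sqrt 2 : ℝ) : ℂ)⁻¹ ^ Fintype.card Q
      =
      1 / 2 ^ Fintype.card Q := by
    rw [← mul_pow, ← mul_inv, ← Complex.ofReal_mul, Real.mul_self_sqrt (by norm_num)]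
    simp
  rw [e, walsh_smul_add, walsh_walsh_reverse, h0]
  simp only [Pi.add_apply, Pi.smul_apply, smul_eq_mul, hunif]
  linear_combination (2 * ∑ s, ψ s) * h2

end Walsh

/-! ### Product states -/

section Product

variable {J I : Type} [DecidableEq J] [DecidableEq I] [Fintype J]

/-- The product of states of the registers labelled by `J`. -/
noncomputable def prodKet (Φ : J → Ket I) : Ket (J × I) := fun s => ∏ j, Φ j fun c => s (j, c)

/-- Only one factor contains the qubit, and the gate passes through the others. Hadamard gates thus
preserve product states. -/
theorem hGate_prodKet (Φ : J → Ket I) (j : J) (c : I) :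
    (hGate (j, c)).apply (prodKet Φ) =
      prodKet (Function.update Φ j ((hGate c).apply (Φ j))) := by
  ext s
  have hj : ∀ b, (fun c' => Function.update s (j, c) b (j, c')) =
      Function.update (fun c' => s (j, c')) c b := by
    intro b
    ext c'
    by_cases h : c' = c
    · subst h; simp
    · rw [Function.update_of_ne h, Function.update_of_ne (by simp [h])]
  have hne : ∀ b, ∀ j' ∈ Finset.univ.erase j,
      Φ j' (fun c' => Function.update s (j, c) b (j', c')) = Φ j' fun c' => s (j', c') := by
    intro b j' hj'
    congr 1
    ext c'
    rw [Function.update_of_ne (by simp [Finset.ne_of_mem_erase hj'])]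
  have hne' : ∀ ξ : Ket I, ∀ j' ∈ Finset.univ.erase j,
      Function.update Φ j ξ j' (fun c' => s (j', c')) = Φ j' fun c' => s (j', c') := by
    intro ξ j' hj'
    rw [Function.update_of_ne (Finset.ne_of_mem_erase hj')]
  rw [hGate_apply]
  simp only [prodKet]
  rw [← Finset.mul_prod_erase _ _ (Finset.mem_univ j), ← Finset.mul_prod_erase _ _ (Finset.mem_univ
      j),
    ← Finset.mul_prod_erase _ _ (Finset.mem_univ j), Finset.prod_congr rfl (hne _),
    Finset.prod_congr rfl (hne _), Finset.prod_congr rfl (hne' _), Function.update_self,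
        hGate_apply,
    hj, hj]
  ring

theorem runGates_hGates_prodKet (Φ : J → Ket I) (j : J) (cs : List I) :
    runGates (cs.map fun c => hGate (j, c)) (prodKet Φ) =
      prodKet (Function.update Φ j (walsh cs (Φ j))) := by
  induction cs generalizing Φ with
  | nil => simp [walsh]
  | cons c cs ih =>
    rw [List.map_cons, runGates_cons, hGate_prodKet, ih, Function.update_idem,
      Function.update_self, walsh_cons]

theorem runGates_flatMap_hGates_prodKet (Φ : J → Ket I) {js : List J} (hjs : js.Nodup)
    (cs : List I) :
    runGates (js.flatMap fun j => cs.map fun c => hGate (j, c)) (prodKet Φ) =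
      prodKet fun j => if j ∈ js then walsh cs (Φ j) else Φ j := by
  induction js generalizing Φ with
  | nil => simp
  | cons j js ih =>
    rw [List.nodup_cons] at hjs
    rw [List.flatMap_cons, runGates_append, runGates_hGates_prodKet, ih _ hjs.2]
    congr 1
    ext j' s
    by_cases h : j' = j
    · subst h; simp [hjs.1]
    · simp [h]

end Product

/-! ### The Grover iteration on one register -/

section Grover

open Real

variable {I : Type} [Fintype I] [DecidableEq I]

/-- The angle of the Grover rotation. -/
noncomputable def groverAngle (good : (I → Bool) → Bool) : ℝ :=
  arcsin √((Finset.univ.filter fun s => good s = true).card / 2 ^ Fintype.card I)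

/-- The state after `j` Grover iterations. -/
noncomputable def groverAmp (good : (I → Bool) → Bool) (j : ℕ) (s : I → Bool) : ℝ :=
  if good s then
    sin ((2 * j + 1) * groverAngle good) / √(Finset.univ.filter fun s => good s = true).card
  else cos ((2 * j + 1) * groverAngle good) /
    √(Finset.univ.filter fun s => ¬ good s = true).card

variable (good : (I → Bool) → Bool)

theorem card_good_add_card_bad :
    ((Finset.univ.filter fun s => good s = true).card : ℝ) +
      (Finset.univ.filter fun s => ¬ good s = true).card = 2 ^ Fintype.card I := by
  rw [← Nat.cast_add, Finset.card_filter_add_card_filter_not]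
  simp

theorem sin_groverAngle : sin (groverAngle good) =
    √(Finset.univ.filter fun s => good s = true).card / √(2 ^ Fintype.card I) := by
  have h := card_good_add_card_bad good
  rw [groverAngle, sin_arcsin, sqrt_div (by positivity)]
  · linarith [sqrt_nonneg ((Finset.univ.filter fun s => good s = true).card /
      2 ^ Fintype.card I : ℝ)]
  · rw [sqrt_le_one]
    rw [div_le_one (by positivity)]
    linarith [Nat.cast_nonneg (α := ℝ) (Finset.univ.filter fun s => ¬ good s = true).card]

theorem cos_groverAngle : cos (groverAngle good) =
    √(Finset.univ.filter fun s => ¬ good s = true).card / √(2 ^ Fintype.card I) := by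
  have h := card_good_add_card_bad good
  rw [groverAngle, cos_arcsin, sq_sqrt (by positivity), ← sqrt_div (by positivity)]
  congr 1
  rw [eq_div_iff (by positivity), sub_mul, div_mul_cancel₀ _ (by positivity)]
  linarith

/-- The sum of a function that only depends on whether `s` is good. -/
theorem sum_good_bad (u v : ℝ) : ∑ s, (if good s then u else v) =
    (Finset.univ.filter fun s => good s = true).card * u +
      (Finset.univ.filter fun s => ¬ good s = true).card * v := by
  rw [Finset.sum_ite, Finset.sum_const, Finset.sum_const, nsmul_eq_mul, nsmul_eq_mul]

/-- This also holds for `x = 0`, so predicates without solutions, or with nothing but solutions,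
need no separate treatment. -/
theorem mul_div_sqrt_self {x : ℝ} (hx : 0 ≤ x) (y : ℝ) : x * (y / √x) = √x * y := by
  rcases hx.eq_or_lt with rfl | h
  · simp
  · have := mul_self_sqrt hx
    field_simp
    rw [sq_sqrt hx]
    ring

theorem card_good_pos {s : I → Bool} (h : good s = true) :
    (0 : ℝ) < (Finset.univ.filter fun s => good s = true).card :=
  Nat.cast_pos.2 (Finset.card_pos.2 ⟨s, by simp [h]⟩)

theorem card_bad_pos {s : I → Bool} (h : ¬ good s = true) :
    (0 : ℝ) < (Finset.univ.filter fun s => ¬ good s = true).card :=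
  Nat.cast_pos.2 (Finset.card_pos.2 ⟨s, by simp [h]⟩)

theorem groverAmp_zero (s : I → Bool) : groverAmp good 0 s = 1 / √(2 ^ Fintype.card I) := by
  rw [groverAmp]
  simp only [Nat.cast_zero, mul_zero, zero_add, one_mul]
  split_ifs with h
  · have := (sqrt_pos.2 (card_good_pos good h)).ne'
    rw [sin_groverAngle]
    field_simp
  · have := (sqrt_pos.2 (card_bad_pos good h)).ne'
    rw [cos_groverAngle]
    field_simp

/-- A phase on the good states and an inversion about the mean. -/
theorem groverAmp_succ (j : ℕ) (s : I → Bool) :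
    groverAmp good (j + 1) s = 2 / 2 ^ Fintype.card I *
      (∑ s, (if good s then -1 else 1) * groverAmp good j s) -
        (if good s then -1 else 1) * groverAmp good j s := by
  set θ := groverAngle good with hθ
  set L : ℝ := 2 ^ Fintype.card I with hL
  have hLp : 0 < √L := sqrt_pos.2 (by positivity)
  have hLL : √L * √L = L := mul_self_sqrt (by positivity)
  -- Up to the factor `√L` this is the overlap with the uniform state at angle `θ`; the sign change
  -- has reflected the angle `(2j + 1)θ` to its negative.
  have hsum : ∑ s, (if good s then -1 else 1) * groverAmp good j s =
      √L * cos ((2 * j + 1) * θ + θ) := by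
    have : ∀ s, (if good s then -1 else 1) * groverAmp good j s = if good s then
        -(sin ((2 * j + 1) * θ) / √(Finset.univ.filter fun s => good s = true).card) else
        cos ((2 * j + 1) * θ) / √(Finset.univ.filter fun s => ¬ good s = true).card := by
      intro s
      rw [groverAmp]
      split_ifs <;> ring
    simp only [this]
    rw [sum_good_bad, mul_neg, mul_div_sqrt_self (by positivity),
      mul_div_sqrt_self (by positivity), cos_add, hθ, sin_groverAngle, cos_groverAngle]
    field_simp
    ring
  have hang : (2 * ((j + 1 : ℕ) : ℝ) + 1) * θ = ((2 * j + 1) * θ + θ) + θ := by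
    push_cast
    ring
  have hang' : (2 * (j : ℝ) + 1) * θ = ((2 * j + 1) * θ + θ) - θ := by ring
  rw [hsum]
  -- In terms of `β` the claims are `sin (β + θ) = 2 cos β sin θ + sin (β - θ)` on good states and
  -- `cos (β + θ) = 2 cos β cos θ - cos (β - θ)` on the others.
  generalize (2 * (j : ℝ) + 1) * θ + θ = β at hang hang'
  have hcoef : 2 / L * (√L * cos β) = 2 * cos β / √L := by
    rw [div_mul_eq_mul_div, div_eq_div_iff (by positivity) hLp.ne']
    linear_combination (2 * cos β) * hLL
  rw [hcoef, groverAmp, groverAmp, ← hθ, hang, hang', sin_add, sin_sub, cos_add, cos_sub]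
  split_ifs with h
  · have := (sqrt_pos.2 (card_good_pos good h)).ne'
    rw [hθ, sin_groverAngle]
    field_simp
    ring
  · have := (sqrt_pos.2 (card_bad_pos good h)).ne'
    rw [hθ, cos_groverAngle]
    field_simp
    ring

theorem sum_groverAmp_sq_good (j : ℕ) (h : ∃ s, good s = true) :
    ∑ s, (if good s then groverAmp good j s ^ 2 else 0) =
      sin ((2 * j + 1) * groverAngle good) ^ 2 := by
  obtain ⟨s, hs⟩ := h
  have := card_good_pos good hs
  have e : ∀ s, (if good s then groverAmp good j s ^ 2 else 0) = if good s then
      (sin ((2 * j + 1) * groverAngle good) /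
        √(Finset.univ.filter fun s => good s = true).card) ^ 2 else 0 := by
    intro s
    rw [groverAmp]
    split_ifs <;> rfl
  simp only [e]
  rw [sum_good_bad, div_pow, sq_sqrt this.le]
  field_simp
  ring

/-- The state is normalized. -/
theorem sum_groverAmp_sq (j : ℕ) : ∑ s, groverAmp good j s ^ 2 = 1 := by
  induction j with
  | zero =>
    simp only [groverAmp_zero, div_pow, one_pow]
    rw [sq_sqrt (by positivity)]
    simp
  | succ j ih =>
    have hs : ∀ s, ((if good s then -1 else 1) * groverAmp good j s) ^ 2 = groverAmp good j s ^ 2 :=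
        by
      intro s
      split_ifs <;> ring
    simp only [groverAmp_succ, sub_sq, hs, Finset.sum_add_distrib, Finset.sum_sub_distrib, ih,
      Finset.sum_const, ← Finset.mul_sum]
    simp only [Finset.card_univ, Fintype.card_fun, Fintype.card_bool, nsmul_eq_mul, Nat.cast_pow,
      Nat.cast_ofNat]
    field_simp
    ring

end Grover

/-! ### The Grover iterations -/

/-- The names of the qubits in the index registers of round `t`. -/
def roundQubits (N r m t : ℕ) : List Addr :=
  (List.range N).flatMap fun i => (List.range r).flatMap fun l =>
    (List.range m).map fun b => cell (2 ^ (m + 1)) (indexCol r m i l) (t * m + b)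

/-- One Grover iteration on the index registers of round `t`. -/
def groverStep (N r d n m R t : ℕ) : List Instr :=
  oraclePhase (argSlices N r d n m (t * m) (baseRow r m R)) ((List.range N).map .target) ++
    ([some ((roundQubits N r m t).reverse.map .had)] ++
    (plainPhase (zeroSlices N r m (t * m) (testRow m R))
      ((List.range N).map fun i => cell (2 ^ (m + 1)) i (testRow m R + r * m)) ++
    [some ((roundQubits N r m t).map .had)]))

/-- Prepare the index registers of round `t`, and apply `j` Grover iterations. -/
def groverRound (N r d n m R t j : ℕ) : List Instr :=
  some ((roundQubits N r m t).map .had) :: (List.range j).flatMap fun _ => groverStep N r d n m R t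

/-- Apply Grover's algorithm in each round, with `its t` iterations in round `t`. -/
def groverRounds (N r d n m R : ℕ) (its : ℕ → ℕ) : List Instr :=
  (List.range R).flatMap fun t => groverRound N r d n m R t (its t)

section Amplitudes

variable {N r d n m R : ℕ} {a : Fin N → ℕ}

theorem map_val_finRange (k : ℕ) : (List.finRange k).map Fin.val = List.range k :=
  List.ext_getElem (by simp) (by simp)

theorem isEnum_product (r m : ℕ) : IsEnum (List.finRange r ×ˢ List.finRange m) :=
  ⟨(List.nodup_finRange r).product (List.nodup_finRange m), fun c => by
    obtain ⟨l, b⟩ := c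
    exact List.mem_product.2 ⟨List.mem_finRange l, List.mem_finRange b⟩⟩

/-- The index bits of round `t`. -/
def roundBits (t : Fin R) : List (IndexBit N r m R) :=
  ((List.finRange N).map fun i => (t, i)).flatMap fun j =>
    (List.finRange r ×ˢ List.finRange m).map fun c => (j, c)

theorem map_name_roundBits (t : Fin R) :
    (roundBits t : List (IndexBit N r m R)).map IndexBit.name = roundQubits N r m t := by
  rw [roundQubits, roundBits, List.map_flatMap, List.flatMap_map, ← map_val_finRange N,
    List.flatMap_map]
  refine List.flatMap_congr fun i _ => ?_
  rw [← map_val_finRange r, List.flatMap_map, List.map_map]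
  change List.map _ ((List.finRange r).flatMap fun l => (List.finRange m).map fun b => (l, b)) = _
  rw [List.map_flatMap]
  refine List.flatMap_congr fun l _ => ?_
  rw [← map_val_finRange m, List.map_map, List.map_map]
  rfl

theorem nodup_roundBits (t : Fin R) : (roundBits t : List (IndexBit N r m R)).Nodup := by
  have : (roundBits t : List (IndexBit N r m R)) = ((List.finRange N).map fun i => (t, i)) ×ˢ
    (List.finRange r ×ˢ List.finRange m) := rfl
  rw [this]
  exact ((List.nodup_finRange N).map fun i j h => (Prod.mk.inj h).2).product
    (isEnum_product r m).1

theorem hadSlice_valid {w : ℕ} {qs : List (IndexBit N r m R)} (hm : N * r ≤ 2 ^ m)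
    (hw : ∀ q : IndexBit N r m R, q.name.InRange N r d w) (hqs : qs.Nodup) :
    SliceValid N r d w ((qs.map IndexBit.name).map .had) := by
  constructor
  · intro o ho
    rw [List.map_map] at ho
    obtain ⟨q, -, rfl⟩ := List.mem_map.1 ho
    exact ⟨by simpa [Op.wires] using hw q, by simp [Op.wires]⟩
  · rw [List.pairwise_map, List.pairwise_map]
    refine hqs.imp fun {p q} hpq => ?_
    simpa [Op.wires, List.Disjoint] using fun h => hpq (IndexBit.name_injective hm h)

/-- The state with amplitudes `ψ` for the contents of the index registers. -/
noncomputable def indexKet (w : ℕ) (a : Fin N → ℕ) (x : Fin N → Fin d → Bool)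
    (ψ : Ket (IndexBit N r m R)) : Ket (Qubit N r d w a) :=
  ∑ φ, ψ φ • Ket.basis (Qubit.lift (indexState x φ))

/-- With the index qubits viewed as an embedded register, gates on them can be computed in that
register alone by `runGates_map_extend`. -/
theorem lift_indexState {w : ℕ} (q₀ : Qubit N r d w a) (hm : N * r ≤ 2 ^ m)
    (hw : ∀ q : IndexBit N r m R, q.name.InRange N r d w) (x : Fin N → Fin d → Bool)
    (φ : IndexBit N r m R → Bool) : Qubit.lift (indexState x φ) =
      Function.extend (fun q : IndexBit N r m R => q.name.get q₀) φ
        (Qubit.lift (w := w) (a := a) (dataState x)) := by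
  have hinj : Function.Injective fun q : IndexBit N r m R => q.name.get q₀ := fun p q h =>
    IndexBit.name_injective hm (Addr.get_injOn q₀ (hw p) (hw q) h)
  rw [eq_extend_iff hinj]
  constructor
  · intro q hq
    rcases Qubit.exists_name q₀ q with ⟨i, t, rfl⟩ | ⟨p, hp, rfl⟩
    · rfl
    · rw [Qubit.lift_get _ _ hp, Qubit.lift_get _ _ hp, indexState, Function.extend_apply']
      rintro ⟨b, rfl⟩
      exact hq ⟨b, rfl⟩
  · ext q
    rw [Function.comp, Qubit.lift_get _ _ (hw q), indexState_name x φ hm]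

theorem exec_hadSlice {w : ℕ} (q₀ : Qubit N r d w a) (A : ∀ i, Circuit (OracleQubit r d (a i)))
    (hm : N * r ≤ 2 ^ m) (hw : ∀ q : IndexBit N r m R, q.name.InRange N r d w)
    (x : Fin N → Fin d → Bool) {qs : List (IndexBit N r m R)} (hqs : qs.Nodup)
    (ψ : Ket (IndexBit N r m R)) :
    exec A [some ((qs.map IndexBit.name).map .had)] (indexKet w a x ψ) =
      indexKet w a x (runGates (qs.map hGate) ψ) := by
  have hinj : Function.Injective fun q : IndexBit N r m R => q.name.get q₀ := fun p q h =>
    IndexBit.name_injective hm (Addr.get_injOn q₀ (hw p) (hw q) h)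
  have hket : ∀ ψ, indexKet w a x ψ = Ket.extend (fun q : IndexBit N r m R => q.name.get q₀)
      (Qubit.lift (dataState x)) ψ := by
    intro ψ
    rw [Ket.extend_eq_sum hinj, indexKet]
    refine Finset.sum_congr rfl fun φ _ => ?_
    rw [lift_indexState q₀ hm hw]
  rw [hket, hket, ← runGates_map_extend hinj, exec_slice, run_sliceSteps q₀ (hadSlice_valid hm hw
      hqs)]
  congr 1
  induction qs with
  | nil => rfl
  | cons q qs ih => exact congrArg (hGate (q.name.get q₀) :: ·) (ih (List.nodup_cons.1 hqs).2)

/-- A phase that is a product over processors is absorbed factor by factor. This keeps the state a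
product, although the shared lookup in between mixes all processors. -/
theorem exec_phase_indexKet {w : ℕ} {A : ∀ i, Circuit (OracleQubit r d (a i))}
    {x : Fin N → Fin d → Bool} {L : List Instr} (t : Fin R)
    {f : Fin N → Ket (Fin r × Fin m)}
    (hL : ∀ φ : IndexBit N r m R → Bool,
      exec A L (Ket.basis (Qubit.lift (w := w) (a := a) (indexState x φ))) =
      (∏ i, f i fun c => φ ((t, i), c)) • Ket.basis (Qubit.lift (indexState x φ)))
    (Φ : Fin R × Fin N → Ket (Fin r × Fin m)) :
    exec A L (indexKet w a x (prodKet Φ)) = indexKet w a x (prodKet fun p =>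
      if p.1 = t then fun u => f p.2 u * Φ p u else Φ p) := by
  rw [indexKet, exec_sum, indexKet]
  refine Finset.sum_congr rfl fun φ _ => ?_
  rw [exec_smul, hL, smul_smul]
  congr 1
  have h : ∏ i, f i (fun c => φ ((t, i), c)) =
      ∏ p : Fin R × Fin N, if p.1 = t then f p.2 (fun c => φ (p, c)) else 1 := by
    rw [Fintype.prod_prod_type, Finset.prod_eq_single t]
    · simp
    · intro b _ hb
      simp [hb]
    · simp
  rw [prodKet, h, ← Finset.prod_mul_distrib]
  refine Finset.prod_congr rfl fun p _ => ?_
  by_cases hp : p.1 = t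
  · simp only [hp, if_true, mul_comm]
  · simp only [hp, if_false, mul_one]

theorem runGates_roundBits (t : Fin R) (Φ : Fin R × Fin N → Ket (Fin r × Fin m)) :
    runGates ((roundBits t).map hGate) (prodKet Φ) = prodKet fun p =>
      if p.1 = t then walsh (List.finRange r ×ˢ List.finRange m) (Φ p) else Φ p := by
  rw [roundBits, List.map_flatMap]
  simp only [List.map_map]
  refine (runGates_flatMap_hGates_prodKet Φ ?_ _).trans ?_
  · exact (List.nodup_finRange N).map fun i j h => (Prod.mk.inj h).2
  · congr 1
    ext ⟨t', i⟩ u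
    simp [eq_comm]

theorem runGates_roundBits_reverse (t : Fin R) (Φ : Fin R × Fin N → Ket (Fin r × Fin m)) :
    runGates ((roundBits t).reverse.map hGate) (prodKet Φ) = prodKet fun p =>
      if p.1 = t then walsh (List.finRange r ×ˢ List.finRange m).reverse (Φ p) else Φ p := by
  rw [roundBits, List.reverse_flatMap, List.map_flatMap]
  simp only [Function.comp, ← List.map_reverse, List.map_map]
  refine (runGates_flatMap_hGates_prodKet Φ ?_ _).trans ?_
  · exact (List.nodup_reverse.2 (List.nodup_finRange N)).map fun i j h => (Prod.mk.inj h).2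
  · congr 1
    ext ⟨t', i⟩ u
    simp [eq_comm]

end Amplitudes

/-! ### From the amplitudes of the index registers to correct outputs -/

section Search

variable {N r d n m R : ℕ} {a : Fin N → ℕ} [NeZero N]

/-- The contents of the index registers which select a solution. -/
def isGood (m : ℕ) (x : Fin N → Fin d → Bool) (α : Fin N → (Fin r → Fin d → Bool) → Bool)
    (i : Fin N) (u : Fin r × Fin m → Bool) : Bool :=
  α i fun l => x (selection u l)

/-- The amplitudes of the index registers, after `its t` iterations in each round `t < T`. -/
noncomputable def searchAmp (x : Fin N → Fin d → Bool)
    (α : Fin N → (Fin r → Fin d → Bool) → Bool) (its : ℕ → ℕ) (T : ℕ) (p : Fin R × Fin N) :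
    Ket (Fin r × Fin m) :=
  if (p.1 : ℕ) < T then fun u => (groverAmp (isGood m x α p.2) (its p.1) u : ℂ)
  else Ket.basis fun _ => false

/-- The first phase flips the sign of the good contents of each register. The second one, between
Hadamard gates, inverts each factor about its mean by `walsh_phase_walsh`. Together they are the
recursion `groverAmp_succ`. -/
theorem exec_groverStep (q₀ : Qubit N r d (scratchSize r d n m R) a)
    {A : ∀ i, Circuit (OracleQubit r d (a i))} {x : Fin N → Fin d → Bool}
    {α : Fin N → (Fin r → Fin d → Bool) → Bool} (hA : ∀ i, ComputesOn x (α i) (A i))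
    (hm : N * r ≤ 2 ^ m) (hr : 0 < r)
    (hw : ∀ q : IndexBit N r m R, q.name.InRange N r d (scratchSize r d n m R))
    (t : Fin R) (j : ℕ) {Φ Φ' : Fin R × Fin N → Ket (Fin r × Fin m)}
    (hΦ : ∀ i, Φ (t, i) = fun u => (groverAmp (isGood m x α i) j u : ℂ))
    (hΦ' : ∀ i, Φ' (t, i) = fun u => (groverAmp (isGood m x α i) (j + 1) u : ℂ))
    (hne : ∀ p, p.1 ≠ t → Φ' p = Φ p) :
    exec A (groverStep N r d n m R t) (indexKet (scratchSize r d n m R) a x (prodKet Φ)) =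
      indexKet (scratchSize r d n m R) a x (prodKet Φ') := by
  rw [groverStep, exec_append, exec_append, exec_append,
    exec_phase_indexKet t (f := fun i u => if isGood m x α i u then (-1 : ℂ) else 1)
      (fun φ => exec_oraclePhase_indexState q₀ hA hm hr t φ),
    ← map_name_roundBits, ← List.map_reverse,
    exec_hadSlice q₀ A hm hw x (List.nodup_reverse.2 (nodup_roundBits t)),
    runGates_roundBits_reverse,
    exec_phase_indexKet t (f := fun _ u => if u = fun _ => false then (1 : ℂ) else -1)
      (fun φ => exec_plainPhase_indexState q₀ hm hr t φ),
    exec_hadSlice q₀ A hm hw x (nodup_roundBits t), runGates_roundBits]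
  congr 2
  funext ⟨t', i⟩
  by_cases ht : t' = t
  · subst ht
    simp only [if_true]
    funext u
    rw [walsh_phase_walsh (isEnum_product r m), hΦ, hΦ']
    beta_reduce
    rw [groverAmp_succ]
    push_cast
    have e : ∀ u, (((if isGood m x α i u = true then -1 else 1 : ℝ)) : ℂ) =
        if isGood m x α i u = true then -1 else 1 := fun u => by split_ifs <;> simp
    simp only [e]
  · simp only [ht, if_false]
    exact (hne _ ht).symm

theorem exec_prepare (q₀ : Qubit N r d (scratchSize r d n m R) a)
    {A : ∀ i, Circuit (OracleQubit r d (a i))} {x : Fin N → Fin d → Bool}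
    {α : Fin N → (Fin r → Fin d → Bool) → Bool}
    (hm : N * r ≤ 2 ^ m)
    (hw : ∀ q : IndexBit N r m R, q.name.InRange N r d (scratchSize r d n m R))
    (t : Fin R) {Φ Φ' : Fin R × Fin N → Ket (Fin r × Fin m)}
    (hΦ : ∀ i, Φ (t, i) = Ket.basis fun _ => false)
    (hΦ' : ∀ i, Φ' (t, i) = fun u => (groverAmp (isGood m x α i) 0 u : ℂ))
    (hne : ∀ p, p.1 ≠ t → Φ' p = Φ p) :
    exec A [some ((roundQubits N r m t).map .had)]
        (indexKet (scratchSize r d n m R) a x (prodKet Φ)) =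
      indexKet (scratchSize r d n m R) a x (prodKet Φ') := by
  rw [← map_name_roundBits, exec_hadSlice q₀ A hm hw x (nodup_roundBits t), runGates_roundBits]
  congr 2
  funext ⟨t', i⟩
  by_cases ht : t' = t
  · subst ht
    simp only [if_true]
    funext u
    rw [hΦ, hΦ']
    beta_reduce
    rw [groverAmp_zero, walsh_basis_zero (isEnum_product r m).1, if_pos,
      (isEnum_product r m).length, Real.sqrt_eq_rpow, Real.sqrt_eq_rpow, ← Real.rpow_natCast,
      ← Real.rpow_mul (by norm_num)]
    · push_cast
      rw [mul_comm, Real.rpow_mul (by norm_num), Real.rpow_natCast]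
      simp
    · exact fun q hq => absurd ((isEnum_product r m).2 q) hq
  · simp only [ht, if_false]
    exact (hne _ ht).symm

theorem exec_groverRound (q₀ : Qubit N r d (scratchSize r d n m R) a)
    {A : ∀ i, Circuit (OracleQubit r d (a i))} {x : Fin N → Fin d → Bool}
    {α : Fin N → (Fin r → Fin d → Bool) → Bool} (hA : ∀ i, ComputesOn x (α i) (A i))
    (hm : N * r ≤ 2 ^ m) (hr : 0 < r)
    (hw : ∀ q : IndexBit N r m R, q.name.InRange N r d (scratchSize r d n m R))
    (t : Fin R) (j : ℕ) {Φ Φ' : Fin R × Fin N → Ket (Fin r × Fin m)}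
    (hΦ : ∀ i, Φ (t, i) = Ket.basis fun _ => false)
    (hΦ' : ∀ i, Φ' (t, i) = fun u => (groverAmp (isGood m x α i) j u : ℂ))
    (hne : ∀ p, p.1 ≠ t → Φ' p = Φ p) :
    exec A (groverRound N r d n m R t j)
        (indexKet (scratchSize r d n m R) a x (prodKet Φ)) =
      indexKet (scratchSize r d n m R) a x (prodKet Φ') := by
  induction j generalizing Φ' with
  | zero => exact exec_prepare q₀ hm hw t hΦ hΦ' hne
  | succ j ih =>
    let Ψ : Fin R × Fin N → Ket (Fin r × Fin m) := fun p =>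
      if p.1 = t then fun u => (groverAmp (isGood m x α p.2) j u : ℂ) else Φ p
    have h := ih (Φ' := Ψ) (fun i => if_pos rfl) (fun p hp => if_neg hp)
    rw [groverRound] at h ⊢
    rw [List.range_succ, List.flatMap_append, ← List.cons_append, exec_append, h]
    simpa using exec_groverStep q₀ hA hm hr hw t j (Φ := Ψ) (fun i => if_pos rfl) hΦ'
      fun p hp => (hne p hp).trans (if_neg hp).symm

theorem exec_groverRounds (q₀ : Qubit N r d (scratchSize r d n m R) a)
    {A : ∀ i, Circuit (OracleQubit r d (a i))} {x : Fin N → Fin d → Bool}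
    {α : Fin N → (Fin r → Fin d → Bool) → Bool} (hA : ∀ i, ComputesOn x (α i) (A i))
    (hm : N * r ≤ 2 ^ m) (hr : 0 < r)
    (hw : ∀ q : IndexBit N r m R, q.name.InRange N r d (scratchSize r d n m R)) (its : ℕ → ℕ)
    {T : ℕ} (hT : T ≤ R) :
    exec A ((List.range T).flatMap fun t => groverRound N r d n m R t (its t))
      (Ket.basis (Qubit.init x)) =
      indexKet (scratchSize r d n m R) a x (prodKet (searchAmp (R := R) (m := m) x α its T)) := by
  induction T with
  | zero =>
    rw [List.range_zero, List.flatMap_nil, exec_nil]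
    have hinit : (Qubit.init x : Qubit N r d (scratchSize r d n m R) a → Bool) =
        Qubit.lift (indexState x fun _ : IndexBit N r m R => false) := by
      have h : indexState x (fun _ : IndexBit N r m R => false) = dataState x := by
        funext q
        by_cases h : ∃ p : IndexBit N r m R, p.name = q
        · obtain ⟨p, rfl⟩ := h
          rw [indexState_name x _ hm]
          rfl
        · exact Function.extend_apply' _ _ _ h
      rw [h]
      funext q
      cases q <;> simp [Qubit.init, Qubit.lift, dataState]
    rw [indexKet, Finset.sum_eq_single (fun _ => false), ← hinit]
    · simp [prodKet, searchAmp, Ket.basis_apply]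
    · intro φ _ hφ
      obtain ⟨⟨p, c⟩, h⟩ := Function.ne_iff.1 hφ
      rw [prodKet, Finset.prod_eq_zero (Finset.mem_univ p), zero_smul]
      rw [searchAmp, if_neg (by omega), Ket.basis_apply, if_neg]
      exact fun h' => h (congrFun h' c)
    · simp
  | succ T ih =>
    rw [List.range_succ, List.flatMap_append, exec_append, ih (by omega), List.flatMap_singleton]
    refine exec_groverRound q₀ hA hm hr hw ⟨T, hT⟩ (its T) (fun i => ?_) (fun i => ?_)
      fun p hp => ?_
    · exact if_neg (lt_irrefl _)
    · exact if_pos (Nat.lt_succ_self _)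
    · have : (p.1 : ℕ) ≠ T := fun h => hp (Fin.ext h)
      by_cases h : (p.1 : ℕ) < T
      · rw [searchAmp, searchAmp, if_pos h, if_pos (by omega)]
      · rw [searchAmp, searchAmp, if_neg h, if_neg (by omega)]

variable (x : Fin N → Fin d → Bool) (α : Fin N → (Fin r → Fin d → Bool) → Bool)

open Classical in
/-- The probability of a correct result is at least the probability that for each predicate that
has a solution, the index registers of some round contain a solution. -/
theorem le_sum_correctAt (q₀ : Qubit N r d (scratchSize r d n m R) a)
    {A : ∀ i, Circuit (OracleQubit r d (a i))} (hA : ∀ i, ComputesOn x (α i) (A i))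
    (hm : N * r ≤ 2 ^ m) (hr : 0 < r) (hn : n = Nat.clog 2 N) (its : ℕ → ℕ) :
    (∑ φ : IndexBit N r m R → Bool,
      if ∀ i, (∃ s : Fin r → Fin N, α i (fun l => x (s l)) = true) →
        ∃ t, isGood m x α i (fun c => φ ((t, i), c)) = true then
        ∏ p : Fin R × Fin N,
          groverAmp (isGood m x α p.2) (its p.1) (fun c => φ (p, c)) ^ 2 else 0) ≤
      ∑ s : Qubit N r d (scratchSize r d n m R) a → Bool, if ∀ i, CorrectAt x (α i) i s then
        ‖exec A (groverRounds N r d n m R its ++ recordRounds N r d n m R)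
          (Ket.basis (Qubit.init x)) s‖ ^ 2 else 0 := by
  have hw : ∀ q : IndexBit N r m R, q.name.InRange N r d (scratchSize r d n m R) := fun q =>
    IndexBit.name_inRange hm (by
      have := baseRow_bounds (r := r) (d := d) (n := n) (m := m) q.1.1.2
      omega) q
  choose τ hτ hexec using exec_recordRounds q₀ hA hm hr hn (x := x) (R := R) (d := d) (m := m)
  let g : (IndexBit N r m R → Bool) → Qubit N r d (scratchSize r d n m R) a → Bool := fun φ =>
    Qubit.lift (overlay (IsRecord r d n m R) (τ φ) (indexState x φ))
  -- Index registers are not record qubits, so their contents can be read off the final basis state.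
  -- Different contents therefore do not interfere, and probabilities add up.
  have hg : Function.Injective g := by
    intro φ φ' h
    funext q
    have h1 : ∀ φ, g φ (q.name.get q₀) = φ q := by
      intro φ
      change Qubit.lift _ _ = _
      rw [Qubit.lift_get _ _ (hw q), overlay_of_not_mem, indexState_name x φ hm]
      rintro (⟨i, h⟩ | ⟨i, l, b, h⟩ | ⟨i, hi, t, h⟩)
      · simp [IndexBit.name, cell] at h
      · simp [IndexBit.name, cell] at h
      · have h2 := ((cell_inj (indexCol_lt hm q.1.2.2 q.2.1.2) hi).1 h).2
        have h3 := round_row_lt q.1.1.2 q.2.2.2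
        have h4 := baseRow_bounds (r := r) (d := d) (n := n) (m := m) q.1.1.2
        omega
    rw [← h1 φ, h, h1]
  have hfinal : ∀ φ, exec A (groverRounds N r d n m R its ++ recordRounds N r d n m R)
      (Ket.basis (Qubit.init x)) (g φ) =
        ∏ p : Fin R × Fin N, (groverAmp (isGood m x α p.2) (its p.1) (fun c => φ (p, c)) : ℂ) := by
    intro φ
    rw [exec_append, groverRounds, exec_groverRounds q₀ hA hm hr hw its le_rfl, indexKet, exec_sum,
      Finset.sum_apply, Finset.sum_eq_single φ]
    · rw [exec_smul, hexec, Pi.smul_apply, Ket.basis_apply, if_pos rfl, smul_eq_mul, mul_one,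
        prodKet]
      exact Finset.prod_congr rfl fun p _ => by rw [searchAmp, if_pos p.1.2]
    · intro φ' _ hφ'
      rw [exec_smul, hexec, Pi.smul_apply, Ket.basis_apply, if_neg, smul_zero]
      exact fun h => hφ' (hg h.symm)
    · simp
  calc _ ≤ ∑ φ, (fun s => if ∀ i, CorrectAt x (α i) i s then
        ‖exec A (groverRounds N r d n m R its ++ recordRounds N r d n m R)
          (Ket.basis (Qubit.init x)) s‖ ^ 2 else 0) (g φ) := by
        refine Finset.sum_le_sum fun φ _ => ?_
        by_cases h : ∀ i, (∃ s : Fin r → Fin N, α i (fun l => x (s l)) = true) →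
          ∃ t, isGood m x α i (fun c => φ ((t, i), c)) = true
        · subst hn
          rw [if_pos h]
          beta_reduce
          rw [if_pos fun i => (hτ φ).correctAt (h i) _, hfinal, norm_prod, ← Finset.prod_pow]
          simp
        · rw [if_neg h]
          positivity
    _ = ∑ s ∈ Finset.univ.image g, _ := by rw [Finset.sum_image fun φ _ φ' _ h => hg h]
    _ ≤ _ := Finset.sum_le_sum_of_subset_of_nonneg (Finset.subset_univ _) fun s _ _ => by positivity

end Search

/-! ### The success probability -/

section Factor

variable {ι κ V : Type} [Fintype ι] [Fintype κ] [Fintype V] [DecidableEq ι] [DecidableEq κ]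

-- The rounds are independent, so the probability that all of them miss is a product; a hit is the
-- complement.
open Classical in
theorem sum_hit_eq (P : κ → V → ℝ) (hP : ∀ t, ∑ v, P t v = 1) (g : V → Bool) (S : Prop) :
    (∑ f : κ → V, if S → ∃ t, g (f t) then ∏ t, P t (f t) else 0) =
      if S then 1 - ∏ t, (1 - ∑ v, if g v then P t v else 0) else 1 := by
  have h1 : ∑ f : κ → V, ∏ t, P t (f t) = 1 := by
    rw [← Fintype.prod_sum]
    exact Finset.prod_eq_one fun t _ => hP t
  by_cases hS : S
  · have h2 : ∑ f : κ → V, ∏ t, (if g (f t) then 0 else P t (f t)) =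
        ∏ t, (1 - ∑ v, if g v then P t v else 0) := by
      rw [← Fintype.prod_sum fun t v => if g v then 0 else P t v]
      refine Finset.prod_congr rfl fun t _ => ?_
      rw [← hP t, ← Finset.sum_sub_distrib]
      exact Finset.sum_congr rfl fun v _ => by split_ifs <;> ring
    rw [if_pos hS, ← h2, ← h1, ← Finset.sum_sub_distrib]
    refine Finset.sum_congr rfl fun f _ => ?_
    by_cases h : ∃ t, g (f t)
    · obtain ⟨t, ht⟩ := h
      have h0 : ∏ t, (if g (f t) then 0 else P t (f t)) = 0 :=
        Finset.prod_eq_zero (Finset.mem_univ t) (if_pos ht)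
      rw [if_pos fun _ => ⟨t, ht⟩, h0, sub_zero]
    · rw [if_neg fun h' => h (h' hS)]
      push Not at h
      simp [h]
  · simp [hS, h1]

-- Regrouping the contents by processor turns the joint event into independent events, one per
-- processor, to which `sum_hit_eq` applies.
open Classical in
theorem sum_all_hit_eq {I : Type} [Fintype I] [DecidableEq I] (P : κ × ι → (I → Bool) → ℝ)
    (hP : ∀ p, ∑ v, P p v = 1) (g : ι → (I → Bool) → Bool) (S : ι → Prop)
    [DecidablePred fun φ : (κ × ι) × I → Bool =>
      ∀ i, S i → ∃ t, g i (fun c => φ ((t, i), c)) = true] :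
    (∑ φ : (κ × ι) × I → Bool,
      if ∀ i, S i → ∃ t, g i (fun c => φ ((t, i), c)) then ∏ p, P p (fun c => φ (p, c)) else 0) =
      ∏ i, if S i then 1 - ∏ t, (1 - ∑ v, if g i v then P (t, i) v else 0) else 1 := by
  let e : (ι → κ → I → Bool) ≃ ((κ × ι) × I → Bool) :=
    { toFun := fun f q => f q.1.2 q.1.1 q.2
      invFun := fun φ i t c => φ ((t, i), c)
      left_inv := fun f => rfl
      right_inv := fun φ => rfl }
  rw [← e.sum_comp, ← Finset.prod_congr rfl fun i _ =>
    sum_hit_eq (fun t => P (t, i)) (fun t => hP _) (g i) (S i), Fintype.prod_sum]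
  refine Finset.sum_congr rfl fun f _ => ?_
  by_cases h : ∀ i, S i → ∃ t, g i (fun c => e f ((t, i), c)) = true
  · rw [if_pos h, Fintype.prod_prod_type_right]
    exact Finset.prod_congr rfl fun i _ => (if_pos (h i)).symm
  · rw [if_neg h]
    push Not at h
    obtain ⟨i, hi, hi'⟩ := h
    rw [Finset.prod_eq_zero (Finset.mem_univ i)]
    rw [if_neg]
    exact fun h' => (h' hi).elim hi'

end Factor

/-! ### Iteration counts for an unknown number of solutions -/

section Angle

open Real

/-- Tripling a number below `π / 6` stays below `π / 2`, so the first multiple that reaches the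
interval does not overshoot it. -/
theorem exists_three_pow_mul {θ : ℝ} {K : ℕ} (h0 : θ ≤ π / 2) (h : π / 6 ≤ 3 ^ K * θ) :
    ∃ k ≤ K, π / 6 ≤ 3 ^ k * θ ∧ 3 ^ k * θ ≤ π / 2 := by
  induction K with
  | zero => exact ⟨0, le_rfl, h, by simpa using h0⟩
  | succ K ih =>
    by_cases h' : π / 6 ≤ 3 ^ K * θ
    · obtain ⟨k, hk, h⟩ := ih h'
      exact ⟨k, by omega, h⟩
    · exact ⟨K + 1, le_rfl, h, by rw [pow_succ]; linarith⟩

theorem quarter_le_sin_sq {y : ℝ} (h1 : π / 6 ≤ y) (h2 : y ≤ π / 2) : 1 / 4 ≤ sin y ^ 2 := by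
  have h : 1 / 2 ≤ sin y := by
    rw [← sin_pi_div_six]
    exact sin_le_sin_of_le_of_le_pi_div_two (by linarith [pi_pos]) h2 h1
  nlinarith

/-- The angle is at least `√ρ`, and `3 ^ K * √ρ` is at least `√(1 / 2)`, which exceeds `π / 6`.
Hence one of the first `K` triplings reaches the interval on which the sine is at least `1 / 2`. -/
theorem exists_quarter_le_sin_sq {ρ : ℝ} {K : ℕ} (h1 : ρ ≤ 1) (h : 1 / 2 ≤ 9 ^ K * ρ) :
    ∃ k ≤ K, 1 / 4 ≤ sin (3 ^ k * arcsin √ρ) ^ 2 := by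
  have hs : √ρ ≤ arcsin √ρ := by
    have h3 := sin_arcsin (x := √ρ) (by linarith [sqrt_nonneg ρ]) (sqrt_le_one.2 h1)
    calc √ρ = sin (arcsin √ρ) := h3.symm
      _ ≤ _ := sin_le (arcsin_nonneg.2 (sqrt_nonneg _))
  have h4 : π / 6 ≤ 3 ^ K * √ρ := by
    have h5 : √(1 / 2) ≤ 3 ^ K * √ρ := by
      have : (3 : ℝ) ^ K * √ρ = √(9 ^ K * ρ) := by
        rw [sqrt_mul (by positivity), show (9 : ℝ) ^ K = (3 ^ K) ^ 2 by
          rw [← pow_mul, mul_comm, pow_mul]; norm_num, sqrt_sq (by positivity)]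
      rw [this]
      exact sqrt_le_sqrt h
    refine le_trans ?_ h5
    refine le_sqrt_of_sq_le ?_
    nlinarith [pi_lt_d2, pi_pos]
  obtain ⟨k, hk, h6, h7⟩ := exists_three_pow_mul (arcsin_le_pi_div_two _)
    (h4.trans (mul_le_mul_of_nonneg_left hs (by positivity)))
  exact ⟨k, hk, quarter_le_sin_sq h6 h7⟩

end Angle

/-! ### The density of register contents that select a solution -/

section Count

variable {N r d m : ℕ} [NeZero N]

/-- The register contents that encode the given numbers. -/
def encodeIndex (m : ℕ) (f : Fin r → ℕ) (c : Fin r × Fin m) : Bool := (f c.1).testBit c.2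

theorem registerVal_encodeIndex {f : Fin r → ℕ} {l : Fin r} (h : f l < 2 ^ m) :
    registerVal (encodeIndex m f) l = f l := by
  rw [registerVal]
  refine (bitsVal_congr fun b hb => ?_).trans (bitsVal_testBit h)
  rw [dif_pos hb]
  rfl

/-- Each tuple of indices has at least `⌊2^m / N⌋^r` codes. -/
theorem numSolutions_mul_le (x : Fin N → Fin d → Bool) (α : Fin N → (Fin r → Fin d → Bool) → Bool)
    (i : Fin N) : numSolutions x (α i) * (2 ^ m / N) ^ r ≤
      (Finset.univ.filter fun u => isGood m x α i u = true).card := by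
  -- The codes of an index `s` used here are the numbers `s + N * c`: they fit into `m` bits and
  -- reduce to `s` modulo `N`.
  have hlt : ∀ (s : Fin N) (c : Fin (2 ^ m / N)), (s : ℕ) + N * c < 2 ^ m := fun s c => by
    have h1 : N * (c + 1) ≤ N * (2 ^ m / N) := Nat.mul_le_mul_left _ c.2
    have h2 := Nat.mul_div_le (2 ^ m) N
    have := s.2
    rw [mul_add, mul_one] at h1
    omega
  have hcard : numSolutions x (α i) * (2 ^ m / N) ^ r = ((Finset.univ.filter
      fun s : Fin r → Fin N => α i (fun l => x (s l)) = true) ×ˢ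
        (Finset.univ : Finset (Fin r → Fin (2 ^ m / N)))).card := by
    rw [Finset.card_product]
    simp [numSolutions]
  rw [hcard]
  have hval : ∀ (p : (Fin r → Fin N) × (Fin r → Fin (2 ^ m / N))) l, registerVal
      (encodeIndex m fun l => (p.1 l : ℕ) + N * p.2 l) l = (p.1 l : ℕ) + N * p.2 l := fun p l =>
    registerVal_encodeIndex (hlt _ _)
  refine Finset.card_le_card_of_injOn
    (fun p => encodeIndex m fun l => (p.1 l : ℕ) + N * p.2 l) ?_ ?_
  · rintro ⟨s, c⟩ h
    rw [Finset.mem_coe, Finset.mem_product, Finset.mem_filter_univ] at h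
    replace h := h.1
    rw [Finset.mem_coe, Finset.mem_filter_univ, isGood, ← h]
    congr 1
    funext l
    congr 1
    ext
    rw [selection_val, hval (s, c)]
    simp [Nat.mod_eq_of_lt (s l).2]
  · rintro ⟨s, c⟩ - ⟨s', c'⟩ - h
    have hl : ∀ l, (s l : ℕ) + N * c l = s' l + N * c' l := fun l => by
      rw [← hval (s, c) l, ← hval (s', c') l]
      exact congrArg (registerVal · l) h
    have h1 : ∀ l, (s l : ℕ) = s' l := fun l => by
      simpa [Nat.mod_eq_of_lt (s l).2, Nat.mod_eq_of_lt (s' l).2] using congrArg (· % N) (hl l)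
    refine Prod.ext (funext fun l => Fin.ext (h1 l)) (funext fun l => Fin.ext ?_)
    have := hl l
    rw [h1 l] at this
    exact Nat.eq_of_mul_eq_mul_left (NeZero.pos N) (by simpa using this)

/-- Rounding `2 ^ m / N` down loses at most the fraction `1 / (2 * r)`, by the choice of `m`. Over
`r` registers Bernoulli's inequality still leaves one half. -/
theorem half_le_density {M : ℕ} (hr : 0 < r) (hm : 2 * r * N ≤ 2 ^ m)
    (x : Fin N → Fin d → Bool) (α : Fin N → (Fin r → Fin d → Bool) → Bool)
    {i : Fin N} (hM : M ≤ numSolutions x (α i)) :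
    (M : ℝ) / (2 * N ^ r) ≤ ((Finset.univ.filter fun u => isGood m x α i u = true).card : ℝ) /
      2 ^ Fintype.card (Fin r × Fin m) := by
  have hN : (0 : ℝ) < N := Nat.cast_pos.2 (NeZero.pos N)
  have hr' : (0 : ℝ) < r := Nat.cast_pos.2 hr
  have h1 : (M : ℝ) * ((2 ^ m / N : ℕ) : ℝ) ^ r ≤
      (Finset.univ.filter fun u => isGood m x α i u = true).card := by
    exact_mod_cast (Nat.mul_le_mul_right _ hM).trans (numSolutions_mul_le x α i)
  have h2 : (2 : ℝ) ^ m / N * (1 - 1 / (2 * r)) ≤ ((2 ^ m / N : ℕ) : ℝ) := by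
    have h3 : ((2 : ℝ) ^ m) < N * ((2 ^ m / N : ℕ) + 1) := by
      exact_mod_cast Nat.lt_mul_div_succ (2 ^ m) (NeZero.pos N)
    have h4 : (2 * r * N : ℝ) ≤ 2 ^ m := by exact_mod_cast hm
    have h5 : (2 : ℝ) ^ m / N * (1 / (2 * r)) ≥ 1 := by
      rw [ge_iff_le, div_mul_div_comm, one_le_div (by positivity)]
      linarith
    have h6 : (2 : ℝ) ^ m / N < (2 ^ m / N : ℕ) + 1 := by
      rw [div_lt_iff₀ hN]
      linarith
    linarith
  have h3 : (1 / 2 : ℝ) ≤ (1 - 1 / (2 * r)) ^ r := by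
    have hr1 : (1 : ℝ) ≤ r := by exact_mod_cast hr
    have h5 : 1 / (2 * r) ≤ (1 / 2 : ℝ) := by
      rw [div_le_div_iff₀ (by positivity) (by norm_num)]
      linarith
    have := one_add_mul_le_pow (a := -(1 / (2 * r : ℝ))) (by linarith) r
    calc (1 / 2 : ℝ) = 1 + r * -(1 / (2 * r)) := by field_simp; ring
      _ ≤ _ := this
      _ = _ := by rw [sub_eq_add_neg]
  have h0 : (0 : ℝ) ≤ 1 - 1 / (2 * r) := by
    have hr1 : (1 : ℝ) ≤ r := by exact_mod_cast hr
    rw [sub_nonneg, div_le_one (by positivity)]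
    linarith
  have h6 : ((2 : ℝ) ^ m / N) ^ r * (1 / 2) ≤ ((2 ^ m / N : ℕ) : ℝ) ^ r := by
    refine le_trans ?_ (pow_le_pow_left₀ (mul_nonneg (by positivity) h0) h2 r)
    rw [mul_pow]
    exact mul_le_mul_of_nonneg_left h3 (by positivity)
  rw [Fintype.card_prod, Fintype.card_fin, Fintype.card_fin, div_le_div_iff₀ (by positivity)
    (by positivity)]
  have h7 : ((2 : ℝ) ^ m / N) ^ r = 2 ^ (r * m) / N ^ r := by
    rw [div_pow, ← pow_mul, mul_comm m]
  calc (M : ℝ) * 2 ^ (r * m) = M * (((2 : ℝ) ^ m / N) ^ r * (1 / 2)) * (2 * N ^ r) := by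
        rw [h7]; field_simp
    _ ≤ M * ((2 ^ m / N : ℕ) : ℝ) ^ r * (2 * N ^ r) := by gcongr
    _ ≤ _ := by gcongr

end Count

/-! ### All solvable predicates are hit with probability at least one half -/

section Bound

variable {N r d m R n reps K M : ℕ} [NeZero N]

/-- The number of Grover iterations in round `t`, where each number is used in `reps` rounds. -/
def iterations (reps t : ℕ) : ℕ := 3 ^ (t / reps) / 2

theorem two_mul_iterations (reps t : ℕ) : 2 * iterations reps t + 1 = 3 ^ (t / reps) := by
  have : 3 ^ (t / reps) % 2 = 1 := Nat.odd_iff.1 (Odd.pow (by decide))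
  rw [iterations]
  omega

theorem le_prod_one_sub {s : ℕ} {q : ℝ} (hq : q ≤ 1) (h : s * q ≤ 1 / 2) :
    1 / 2 ≤ (1 - q) ^ s := by
  have := one_add_mul_le_pow (a := -q) (by linarith) s
  rw [← sub_eq_add_neg] at this
  linarith

/-- Only the `reps` rounds with the right number of iterations are used; the miss probabilities of
the others are bounded by one. -/
theorem prod_le_of_block {f : ℕ → ℝ} (hf0 : ∀ t, 0 ≤ f t) (hf1 : ∀ t, f t ≤ 1) {k : ℕ}
    (hk : k ≤ K) (hreps : 0 < reps) (h : ∀ t, t / reps = k → f t ≤ 3 / 4) :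
    ∏ t : Fin ((K + 1) * reps), f t ≤ (3 / 4) ^ reps := by
  rw [Fin.prod_univ_eq_prod_range f]
  have hle : k * reps + reps ≤ (K + 1) * reps := by
    rw [← Nat.succ_mul]
    exact Nat.mul_le_mul_right _ (by omega)
  calc ∏ t ∈ Finset.range ((K + 1) * reps), f t
      ≤ ∏ t ∈ Finset.Ico (k * reps) (k * reps + reps), f t :=
        Finset.prod_le_prod_of_subset_of_le_one (fun t ht => by
          simp only [Finset.mem_Ico, Finset.mem_range] at ht ⊢; omega) (fun t _ => hf0 t)
          fun t _ _ => hf1 t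
    _ ≤ ∏ t ∈ Finset.Ico (k * reps) (k * reps + reps), (3 / 4 : ℝ) :=
        Finset.prod_le_prod (fun t _ => hf0 t) fun t ht => h t (by
          rw [Finset.mem_Ico] at ht
          rw [Nat.div_eq_iff hreps]
          omega)
    _ = _ := by rw [Finset.prod_const, Nat.card_Ico, Nat.add_sub_cancel_left]

-- For each solvable predicate some block of `4 * (n + 1)` rounds succeeds with probability at least
-- `1 / 4` per round. Since `(3 / 4) ^ 4 < 1 / 2` and `N ≤ 2 ^ n`, the whole block misses with
-- probability at most `1 / (2 * N)`, and Bernoulli's inequality handles the product over the `N`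
-- processors.
open Classical in
theorem half_le_sum_hit (hr : 0 < r) (hm : 2 * r * N ≤ 2 ^ m) (hn : N ≤ 2 ^ n)
    (hK : N ^ r ≤ 9 ^ K * M) (x : Fin N → Fin d → Bool)
    (α : Fin N → (Fin r → Fin d → Bool) → Bool)
    (hM : ∀ i, numSolutions x (α i) = 0 ∨ M ≤ numSolutions x (α i)) :
    1 / 2 ≤ ∑ φ : IndexBit N r m ((K + 1) * (4 * (n + 1))) → Bool,
      if ∀ i, (∃ s : Fin r → Fin N, α i (fun l => x (s l)) = true) →
        ∃ t, isGood m x α i (fun c => φ ((t, i), c)) = true then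
        ∏ p : Fin ((K + 1) * (4 * (n + 1))) × Fin N,
          groverAmp (isGood m x α p.2) (iterations (4 * (n + 1)) p.1) (fun c => φ (p, c)) ^ 2
        else 0 := by
  rw [sum_all_hit_eq (κ := Fin ((K + 1) * (4 * (n + 1)))) (fun p u => groverAmp (isGood m x α p.2)
      (iterations (4 * (n + 1)) p.1) u ^ 2)
    (fun p => sum_groverAmp_sq _ _) (isGood m x α)]
  have hq : (N : ℝ) * (3 / 4) ^ (4 * (n + 1)) ≤ 1 / 2 := by
    have h1 : (N : ℝ) ≤ 2 ^ n := by exact_mod_cast hn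
    calc (N : ℝ) * (3 / 4) ^ (4 * (n + 1)) ≤ 2 ^ n * (1 / 2) ^ (n + 1) := by
          rw [pow_mul]
          gcongr
          norm_num
      _ = 1 / 2 := by rw [pow_succ, ← mul_assoc, ← mul_pow]; norm_num
  refine (le_prod_one_sub (pow_le_one₀ (by norm_num) (by norm_num)) hq).trans ?_
  rw [show (1 - (3 / 4 : ℝ) ^ (4 * (n + 1))) ^ N = ∏ _i : Fin N, (1 - (3 / 4) ^ (4 * (n + 1))) by
    simp]
  refine Finset.prod_le_prod (fun _ _ => sub_nonneg.2 (pow_le_one₀ (by norm_num) (by norm_num)))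
    fun i _ => ?_
  split_ifs with hS
  · obtain ⟨s, hs⟩ := hS
    have hMi : M ≤ numSolutions x (α i) := (hM i).resolve_left fun h => by
      rw [numSolutions, Finset.card_eq_zero, Finset.filter_eq_empty_iff] at h
      exact h (Finset.mem_univ s) hs
    have hdens := half_le_density hr hm x α hMi
    have hN : (0 : ℝ) < N := Nat.cast_pos.2 (NeZero.pos N)
    have hMpos : (0 : ℝ) < M := by
      rcases Nat.eq_zero_or_pos M with h | h
      · rw [h, mul_zero] at hK
        exact absurd hK (pow_pos (NeZero.pos N) r).not_ge
      · exact_mod_cast h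
    have hpos : 0 < M / (2 * (N : ℝ) ^ r) := by positivity
    set ρ : ℝ := ((Finset.univ.filter fun u => isGood m x α i u = true).card : ℝ) /
      2 ^ Fintype.card (Fin r × Fin m) with hρ
    have hρ1 : ρ ≤ 1 := by
      rw [hρ, div_le_one (by positivity)]
      have := Finset.card_filter_le (Finset.univ : Finset (Fin r × Fin m → Bool))
        fun u => isGood m x α i u = true
      rw [Finset.card_univ, Fintype.card_fun, Fintype.card_bool] at this
      exact_mod_cast this
    have hgood : ∃ u, isGood m x α i u = true := by
      by_contra h
      push Not at h
      have : ρ = 0 := by rw [hρ]; simp [h]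
      linarith
    obtain ⟨k, hk, hsin⟩ := exists_quarter_le_sin_sq (K := K) hρ1 <| by
      have h1 : (N : ℝ) ^ r ≤ 9 ^ K * M := by exact_mod_cast hK
      calc (1 / 2 : ℝ) ≤ 9 ^ K * (M / (2 * N ^ r)) := by
            rw [← mul_div_assoc, div_le_div_iff₀ (by norm_num) (by positivity)]
            linarith
        _ ≤ _ := by gcongr
    refine sub_le_sub_left ?_ 1
    simp only [sum_groverAmp_sq_good _ _ hgood]
    refine prod_le_of_block (f := fun t => 1 - Real.sin ((2 * (iterations (4 * (n + 1)) t : ℝ) + 1)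
        *
      groverAngle (isGood m x α i)) ^ 2) (fun t => ?_) (fun t => ?_) hk (by omega) fun t ht => ?_
    · linarith [Real.sin_sq_le_one ((2 * (iterations (4 * (n + 1)) t : ℝ) + 1) *
        groverAngle (isGood m x α i))]
    · linarith [sq_nonneg (Real.sin ((2 * (iterations (4 * (n + 1)) t : ℝ) + 1) *
        groverAngle (isGood m x α i)))]
    · have h2 : (2 * (iterations (4 * (n + 1)) t : ℝ) + 1) = 3 ^ k := by
        rw [← ht]
        exact_mod_cast two_mul_iterations (4 * (n + 1)) t
      rw [h2]
      change _ - Real.sin (_ * Real.arcsin √ρ) ^ 2 ≤ _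
      linarith
  · linarith [pow_pos (show (0 : ℝ) < 3 / 4 by norm_num) (4 * (n + 1))]

end Bound

/-! ### The algorithm -/

/-- The instructions of the search, with `reps` rounds for each of the numbers `3 ^ k / 2`, `k ≤ K`,
of Grover iterations. -/
def searchInstrs (N r d n m K : ℕ) : List Instr :=
  groverRounds N r d n m ((K + 1) * (4 * (n + 1))) (iterations (4 * (n + 1))) ++
    recordRounds N r d n m ((K + 1) * (4 * (n + 1)))

/-- The number of bits of an index register. -/
def indexWidth (N r : ℕ) : ℕ := Nat.clog 2 (2 * r * N)

/-- The largest power of three needed for the number of Grover iterations. -/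
def maxExponent (N r M : ℕ) : ℕ := Nat.clog 9 (N ^ r / M + 1)

/-- The multi-Grover search. -/
def searchProgram (N r d M : ℕ) : Program :=
  (scratchSize r d (Nat.clog 2 N) (indexWidth N r)
      ((maxExponent N r M + 1) * (4 * (Nat.clog 2 N + 1))),
    (searchInstrs N r d (Nat.clog 2 N) (indexWidth N r) (maxExponent N r M)).flatMap Instr.steps)

theorem two_mul_mul_le_two_pow (N r : ℕ) : 2 * r * N ≤ 2 ^ indexWidth N r :=
  Nat.le_pow_clog (by norm_num) _

theorem mul_le_two_pow (N r : ℕ) : N * r ≤ 2 ^ indexWidth N r := by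
  refine le_trans ?_ (two_mul_mul_le_two_pow N r)
  rw [mul_assoc, mul_comm N]
  exact Nat.le_mul_of_pos_left _ (by norm_num)

theorem pow_le_nine_pow_mul {N r M : ℕ} (hM : 0 < M) : N ^ r ≤ 9 ^ maxExponent N r M * M := by
  have h1 : N ^ r < M * (N ^ r / M + 1) := Nat.lt_mul_div_succ _ hM
  have h2 : N ^ r / M + 1 ≤ 9 ^ maxExponent N r M := Nat.le_pow_clog (by norm_num) _
  rw [mul_comm]
  exact h1.le.trans (Nat.mul_le_mul_left _ h2)

/-! ### Validity of all slices of the program -/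

section Valid

variable {N r d n m R w : ℕ}

/-- All slices of a list of instructions are valid. -/
def InstrsValid (N r d w : ℕ) (L : List Instr) : Prop := ∀ l, some l ∈ L → SliceValid N r d w l

theorem InstrsValid.append {L L' : List Instr} (h : InstrsValid N r d w L)
    (h' : InstrsValid N r d w L') : InstrsValid N r d w (L ++ L') := fun l hl =>
  (List.mem_append.1 hl).elim (h l) (h' l)

theorem InstrsValid.flatMap {ι : Type} {I : List ι} {f : ι → List Instr}
    (h : ∀ i ∈ I, InstrsValid N r d w (f i)) : InstrsValid N r d w (I.flatMap f) := fun l hl => by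
  obtain ⟨i, hi, hl⟩ := List.mem_flatMap.1 hl
  exact h i hi l hl

theorem instrsValid_map {L : List (List (Op Addr))} (h : ∀ l ∈ L, SliceValid N r d w l) :
    InstrsValid N r d w (L.map some) := fun l hl => by
  obtain ⟨l', hl', h'⟩ := List.mem_map.1 hl
  exact Option.some.inj h' ▸ h l' hl'

theorem instrsValid_revSlices {L : List (List (Op Addr))} (h : ∀ l ∈ L, SliceValid N r d w l) :
    InstrsValid N r d w ((revSlices L).map some) := instrsValid_map fun l hl => by
  have := (h _ (mem_revSlices.1 hl)).reverse
  rwa [List.reverse_reverse] at this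

theorem instrsValid_query : InstrsValid N r d w [none] := fun l hl => by simp at hl

theorem instrsValid_slice {l : List (Op Addr)} (h : SliceValid N r d w l) :
    InstrsValid N r d w [some l] := fun l' hl => by
  rw [List.mem_singleton, Option.some.injEq] at hl
  exact hl ▸ h

theorem instrsValid_oraclePhase {L : List (List (Op Addr))} {zs : List Addr}
    (hv : ∀ l ∈ L, SliceValid N r d w l) (hz : SliceValid N r d w (zs.map Op.z)) :
    InstrsValid N r d w (oraclePhase L zs) :=
  (instrsValid_map hv).append (instrsValid_query.append ((instrsValid_slice hz).append
    (instrsValid_query.append (instrsValid_revSlices hv))))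

theorem instrsValid_plainPhase {L : List (List (Op Addr))} {zs : List Addr}
    (hv : ∀ l ∈ L, SliceValid N r d w l) (hz : SliceValid N r d w (zs.map Op.z)) :
    InstrsValid N r d w (plainPhase L zs) :=
  (instrsValid_map hv).append ((instrsValid_slice hz).append (instrsValid_revSlices hv))

theorem instrsValid_groverRound (hm : N * r ≤ 2 ^ m) (hr : 0 < r) {t : ℕ} (ht : t < R) (j : ℕ) :
    InstrsValid N r d (scratchSize r d n m R) (groverRound N r d n m R t j) := by
  obtain ⟨h1, h2, h3, h4⟩ := baseRow_bounds (r := r) (d := d) (n := n) (m := m) ht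
  have hw : ∀ q : IndexBit N r m R, q.name.InRange N r d (scratchSize r d n m R) := fun q =>
    IndexBit.name_inRange hm (by omega) q
  have hname := map_name_roundBits (N := N) (r := r) (m := m) (⟨t, ht⟩ : Fin R)
  have hhad : SliceValid N r d (scratchSize r d n m R) ((roundQubits N r m t).map .had) := by
    rw [← hname]
    exact hadSlice_valid hm hw (nodup_roundBits _)
  have hrev : SliceValid N r d (scratchSize r d n m R)
      ((roundQubits N r m t).reverse.map .had) := by
    rw [List.map_reverse]
    exact hhad.reverse
  refine (instrsValid_slice hhad).append (InstrsValid.flatMap fun _ _ => ?_)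
  refine (instrsValid_oraclePhase (fun l hl => argSlices_valid hm hr (by omega) h3 hl)
    (sliceValid_targets)).append ((instrsValid_slice hrev).append ((instrsValid_plainPhase
      (fun l hl => zeroSlices_valid hm (by omega) (by omega) hl) (sliceValid_tests hm hr (by
          omega))).append
        (instrsValid_slice hhad)))

theorem instrsValid_recordRound (hm : N * r ≤ 2 ^ m) (hr : 0 < r) (hn : n = Nat.clog 2 N) {t : ℕ}
    (ht : t < R) : InstrsValid N r d (scratchSize r d n m R) (recordRound N r d n m R t) := by
  obtain ⟨h1, h2, h3, h4⟩ := baseRow_bounds (r := r) (d := d) (n := n) (m := m) ht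
  have hv : ∀ l ∈ argSlices N r d n m (t * m) (baseRow r m R),
      SliceValid N r d (scratchSize r d n m R) l := fun l hl =>
    argSlices_valid hm hr (by omega) h3 hl
  exact (instrsValid_map hv).append (instrsValid_query.append
    ((instrsValid_map fun l hl => updateSlices_valid hm hr hn ht hl).append
      (instrsValid_query.append (instrsValid_revSlices hv))))

theorem instrsValid_searchInstrs (hm : N * r ≤ 2 ^ m) (hr : 0 < r) (hn : n = Nat.clog 2 N)
    (K : ℕ) : InstrsValid N r d (scratchSize r d n m ((K + 1) * (4 * (n + 1))))
      (searchInstrs N r d n m K) :=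
  (InstrsValid.flatMap fun _ ht => instrsValid_groverRound hm hr (List.mem_range.1 ht) _).append
    (InstrsValid.flatMap fun _ ht => instrsValid_recordRound hm hr hn (List.mem_range.1 ht))

theorem InstrsValid.isValid {a : Fin N → ℕ} (q₀ : Qubit N r d w a) {L : List Instr}
    (h : InstrsValid N r d w L) {A : ∀ i, Circuit (OracleQubit r d (a i))}
    (hA : ∀ i, (A i).IsValid) :
    Circuit.IsValid ((L.flatMap Instr.steps).flatMap (Step.compile w A)) := by
  intro s hs
  simp only [List.mem_flatMap] at hs
  obtain ⟨st, ⟨c, hc, hst⟩, hs⟩ := hs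
  cases c with
  | none =>
    obtain rfl : st = Step.query := by simpa [Instr.steps] using hst
    exact isValid_queryCircuit hA s hs
  | some l => exact isValid_sliceSteps q₀ (h l hc) A s (List.mem_flatMap.2 ⟨st, hst, hs⟩)

end Valid

/-! ### Validity and success probability of the compiled program -/

section Correct

variable {N r d M : ℕ} {a : Fin N → ℕ} {A : ∀ i, Circuit (OracleQubit r d (a i))}

theorem isValid_searchProgram (hN : 0 < N) (hr : 0 < r) (hA : ∀ i, (A i).IsValid) :
    ((searchProgram N r d M).compile A).IsValid :=
  (instrsValid_searchInstrs (mul_le_two_pow N r) hr rfl _).isValid (.target ⟨0, hN⟩) hA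

theorem half_le_successProb (hN : 0 < N) (hr : 0 < r) (hM : 0 < M) {x : Fin N → Fin d → Bool}
    {α : Fin N → (Fin r → Fin d → Bool) → Bool} (hA : ∀ i, ComputesOn x (α i) (A i))
    (hsol : ∀ i, numSolutions x (α i) = 0 ∨ M ≤ numSolutions x (α i)) :
    1 / 2 ≤ successProb ((searchProgram N r d M).compile A) x α := by
  have : NeZero N := ⟨hN.ne'⟩
  refine le_trans (half_le_sum_hit hr (two_mul_mul_le_two_pow N r)
    (Nat.le_pow_clog (by norm_num) _) (pow_le_nine_pow_mul hM) x α hsol) ?_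
  exact le_sum_correctAt x α (.target ⟨0, hN⟩) hA (mul_le_two_pow N r) hr rfl _

end Correct

/-! ### Computability of the program -/

-- With closure properties registered here and below, the primitive recursiveness of each routine is
-- found by unfolding its definition.
attribute [fun_prop] Primrec Primrec.id Primrec.const Primrec.comp

section Basic

variable {α β γ σ : Type} [Primcodable α] [Primcodable β] [Primcodable γ] [Primcodable σ]

@[fun_prop]
theorem primrec_fst {f : α → β × γ} (hf : Primrec f) : Primrec fun a => (f a).1 :=
  Primrec.fst.comp hf

@[fun_prop]
theorem primrec_snd {f : α → β × γ} (hf : Primrec f) : Primrec fun a => (f a).2 :=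
  Primrec.snd.comp hf

@[fun_prop]
theorem primrec_pair {f : α → β} {g : α → γ} (hf : Primrec f) (hg : Primrec g) :
    Primrec fun a => (f a, g a) := hf.pair hg

@[fun_prop]
theorem primrec_add {f g : α → ℕ} (hf : Primrec f) (hg : Primrec g) :
    Primrec fun a => f a + g a := Primrec.nat_add.comp hf hg

@[fun_prop]
theorem primrec_sub {f g : α → ℕ} (hf : Primrec f) (hg : Primrec g) :
    Primrec fun a => f a - g a := Primrec.nat_sub.comp hf hg

@[fun_prop]
theorem primrec_mul {f g : α → ℕ} (hf : Primrec f) (hg : Primrec g) :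
    Primrec fun a => f a * g a := Primrec.nat_mul.comp hf hg

@[fun_prop]
theorem primrec_div {f g : α → ℕ} (hf : Primrec f) (hg : Primrec g) :
    Primrec fun a => f a / g a := Primrec.nat_div.comp hf hg

@[fun_prop]
theorem primrec_mod {f g : α → ℕ} (hf : Primrec f) (hg : Primrec g) :
    Primrec fun a => f a % g a := Primrec.nat_mod.comp hf hg

@[fun_prop]
theorem primrec_pow {f g : α → ℕ} (hf : Primrec f) (hg : Primrec g) :
    Primrec fun a => f a ^ g a := by
  have h : Primrec₂ fun (x y : ℕ) => x ^ y := by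
    refine ((Primrec.nat_rec (f := fun _ : ℕ => 1) (g := fun x p => p.2 * x) (Primrec.const 1)
      (Primrec.nat_mul.comp (Primrec.snd.comp Primrec.snd) Primrec.fst))).of_eq fun x y => ?_
    induction y with
    | zero => rfl
    | succ y ih => rw [pow_succ, ← ih]
  exact h.comp hf hg

@[fun_prop]
theorem primrec_decide_le {f g : α → ℕ} (hf : Primrec f) (hg : Primrec g) :
    Primrec fun a => decide (f a ≤ g a) := (Primrec.nat_le.comp hf hg).decide

@[fun_prop]
theorem primrec_decide_lt {f g : α → ℕ} (hf : Primrec f) (hg : Primrec g) :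
    Primrec fun a => decide (f a < g a) := (Primrec.nat_lt.comp hf hg).decide

/-- The logarithm of `x`, rounded up, is the largest `y ≤ x` with `b ^ (y - 1) < x`, or `0` if there
is no positive one, so a bounded search finds it. -/
theorem primrec_clog {b : ℕ} (hb : 1 < b) {f : α → ℕ} (hf : Primrec f) :
    Primrec fun a => Nat.clog b (f a) := by
  have h : PrimrecRel fun x y : ℕ => b ^ (y - 1) < x :=
    Primrec.primrecPred (by fun_prop : Primrec fun p : ℕ × ℕ => decide (b ^ (p.2 - 1) < p.1))
  refine ((Primrec.nat_findGreatest Primrec.id h).of_eq fun x => ?_).comp hf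
  rw [Nat.findGreatest_eq_iff]
  refine ⟨Nat.clog_le_of_le_pow (Nat.lt_pow_self hb).le, fun h0 => Nat.pow_lt_of_lt_clog (by omega),
    fun y hy _ h' => ?_⟩
  have := Nat.pow_le_pow_right (by omega : 0 < b) (by omega : Nat.clog b x ≤ y - 1)
  exact absurd (h'.trans_le (Nat.le_pow_clog hb x)) this.not_gt

@[fun_prop]
theorem primrec_clog_two {f : α → ℕ} (hf : Primrec f) : Primrec fun a => Nat.clog 2 (f a) :=
  primrec_clog (by norm_num) hf

@[fun_prop]
theorem primrec_clog_nine {f : α → ℕ} (hf : Primrec f) : Primrec fun a => Nat.clog 9 (f a) :=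
  primrec_clog (by norm_num) hf

@[fun_prop]
theorem primrec_decide_eq {f g : α → ℕ} (hf : Primrec f) (hg : Primrec g) :
    Primrec fun a => decide (f a = g a) := (Primrec.eq.comp hf hg).decide

@[fun_prop]
theorem primrec_testBit {f g : α → ℕ} (hf : Primrec f) (hg : Primrec g) :
    Primrec fun a => (f a).testBit (g a) := by
  simp only [Nat.testBit_eq_decide_div_mod_eq]
  fun_prop

@[fun_prop]
theorem primrec_and {f g : α → Bool} (hf : Primrec f) (hg : Primrec g) :
    Primrec fun a => f a && g a := Primrec.and.comp hf hg

@[fun_prop]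
theorem primrec_cond {c : α → Bool} {f g : α → σ} (hc : Primrec c) (hf : Primrec f)
    (hg : Primrec g) : Primrec fun a => bif c a then f a else g a := Primrec.cond hc hf hg

@[fun_prop]
theorem primrec_some {f : α → β} (hf : Primrec f) : Primrec fun a => some (f a) :=
  Primrec.option_some.comp hf

@[fun_prop]
theorem primrec_cons {f : α → β} {g : α → List β} (hf : Primrec f) (hg : Primrec g) :
    Primrec fun a => f a :: g a := Primrec.list_cons.comp hf hg

@[fun_prop]
theorem primrec_append {f g : α → List β} (hf : Primrec f) (hg : Primrec g) :
    Primrec fun a => f a ++ g a := Primrec.list_append.comp hf hg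

@[fun_prop]
theorem primrec_reverse {f : α → List β} (hf : Primrec f) : Primrec fun a => (f a).reverse :=
  Primrec.list_reverse.comp hf

@[fun_prop]
theorem primrec_range {f : α → ℕ} (hf : Primrec f) : Primrec fun a => List.range (f a) :=
  Primrec.list_range.comp hf

@[fun_prop]
theorem primrec_map {f : α → List β} {g : α → β → γ} (hf : Primrec f)
    (hg : Primrec fun p : α × β => g p.1 p.2) : Primrec fun a => (f a).map (g a) :=
  Primrec.list_map hf hg

@[fun_prop]
theorem primrec_flatMap {f : α → List β} {g : α → β → List γ} (hf : Primrec f)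
    (hg : Primrec fun p : α × β => g p.1 p.2) : Primrec fun a => (f a).flatMap (g a) :=
  Primrec.list_flatMap hf hg

@[fun_prop]
theorem primrec_filterMap {f : α → List β} {g : α → β → Option γ} (hf : Primrec f)
    (hg : Primrec fun p : α × β => g p.1 p.2) : Primrec fun a => (f a).filterMap (g a) :=
  Primrec.listFilterMap hf hg

@[fun_prop]
theorem primrec_getElem? {f : α → List β} {g : α → ℕ} (hf : Primrec f) (hg : Primrec g) :
    Primrec fun a => (f a)[g a]? := Primrec.list_getElem?.comp hf hg

@[fun_prop]
theorem primrec_inl {f : α → β} (hf : Primrec f) : Primrec fun a => (Sum.inl (f a) : β ⊕ γ) :=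
  Primrec.sumInl.comp hf

@[fun_prop]
theorem primrec_inr {f : α → γ} (hf : Primrec f) : Primrec fun a => (Sum.inr (f a) : β ⊕ γ) :=
  Primrec.sumInr.comp hf

theorem primrec_sumElim {o : α → β ⊕ γ} {g : α → β → σ} {h : α → γ → σ} (ho : Primrec o)
    (hg : Primrec fun p : α × β => g p.1 p.2) (hh : Primrec fun p : α × γ => h p.1 p.2) :
    Primrec fun a => Sum.elim (g a) (h a) (o a) :=
  (Primrec.sumCasesOn ho hg hh).of_eq fun a => by cases o a <;> rfl

end Basic

/-! ### Primitive recursive constructors and basic slices -/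

section Codes

variable {α β γ : Type} [Primcodable α] [Primcodable β] [Primcodable γ]

@[fun_prop]
theorem primrec_data {f g : α → ℕ} (hf : Primrec f) (hg : Primrec g) :
    Primrec fun a => Addr.data (f a) (g a) :=
  (Primrec.of_equiv_symm (e := Addr.equiv)).comp (by fun_prop :
    Primrec fun a => (.inl (f a, g a) : (ℕ × ℕ) ⊕ (ℕ × ℕ × ℕ) ⊕ ℕ ⊕ ℕ ⊕ (ℕ × ℕ × ℕ) ⊕ ℕ))

@[fun_prop]
theorem primrec_arg {f g h : α → ℕ} (hf : Primrec f) (hg : Primrec g) (hh : Primrec h) :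
    Primrec fun a => Addr.arg (f a) (g a) (h a) :=
  (Primrec.of_equiv_symm (e := Addr.equiv)).comp (by fun_prop : Primrec fun a =>
    (.inr (.inl (f a, g a, h a)) : (ℕ × ℕ) ⊕ (ℕ × ℕ × ℕ) ⊕ ℕ ⊕ ℕ ⊕ (ℕ × ℕ × ℕ) ⊕ ℕ))

@[fun_prop]
theorem primrec_target {f : α → ℕ} (hf : Primrec f) : Primrec fun a => Addr.target (f a) :=
  (Primrec.of_equiv_symm (e := Addr.equiv)).comp (by fun_prop : Primrec fun a =>
    (.inr (.inr (.inl (f a))) : (ℕ × ℕ) ⊕ (ℕ × ℕ × ℕ) ⊕ ℕ ⊕ ℕ ⊕ (ℕ × ℕ × ℕ) ⊕ ℕ))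

@[fun_prop]
theorem primrec_found {f : α → ℕ} (hf : Primrec f) : Primrec fun a => Addr.found (f a) :=
  (Primrec.of_equiv_symm (e := Addr.equiv)).comp (by fun_prop : Primrec fun a =>
    (.inr (.inr (.inr (.inl (f a)))) : (ℕ × ℕ) ⊕ (ℕ × ℕ × ℕ) ⊕ ℕ ⊕ ℕ ⊕ (ℕ × ℕ × ℕ) ⊕ ℕ))

@[fun_prop]
theorem primrec_out {f g h : α → ℕ} (hf : Primrec f) (hg : Primrec g) (hh : Primrec h) :
    Primrec fun a => Addr.out (f a) (g a) (h a) :=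
  (Primrec.of_equiv_symm (e := Addr.equiv)).comp (by fun_prop : Primrec fun a =>
    (.inr (.inr (.inr (.inr (.inl (f a, g a, h a))))) :
      (ℕ × ℕ) ⊕ (ℕ × ℕ × ℕ) ⊕ ℕ ⊕ ℕ ⊕ (ℕ × ℕ × ℕ) ⊕ ℕ))

@[fun_prop]
theorem primrec_scratch {f : α → ℕ} (hf : Primrec f) : Primrec fun a => Addr.scratch (f a) :=
  (Primrec.of_equiv_symm (e := Addr.equiv)).comp (by fun_prop : Primrec fun a =>
    (.inr (.inr (.inr (.inr (.inr (f a))))) : (ℕ × ℕ) ⊕ (ℕ × ℕ × ℕ) ⊕ ℕ ⊕ ℕ ⊕ (ℕ × ℕ × ℕ) ⊕ ℕ))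

@[fun_prop]
theorem primrec_hadamard {f : α → Addr} (hf : Primrec f) :
    Primrec fun a => BasicGate.hadamard (f a) :=
  (Primrec.of_equiv_symm (e := BasicGate.equiv)).comp (by fun_prop : Primrec fun a =>
    (.inl (f a) : Addr ⊕ Addr ⊕ (Addr × Addr)))

@[fun_prop]
theorem primrec_phaseT {f : α → Addr} (hf : Primrec f) : Primrec fun a => BasicGate.phaseT (f a) :=
  (Primrec.of_equiv_symm (e := BasicGate.equiv)).comp (by fun_prop : Primrec fun a =>
    (.inr (.inl (f a)) : Addr ⊕ Addr ⊕ (Addr × Addr)))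

@[fun_prop]
theorem primrec_basicCnot {f g : α → Addr} (hf : Primrec f) (hg : Primrec g) :
    Primrec fun a => BasicGate.cnot (f a) (g a) :=
  (Primrec.of_equiv_symm (e := BasicGate.equiv)).comp (by fun_prop : Primrec fun a =>
    (.inr (.inr (f a, g a)) : Addr ⊕ Addr ⊕ (Addr × Addr)))

@[fun_prop]
theorem primrec_gates {f : α → List BasicGate} (hf : Primrec f) :
    Primrec fun a => Step.gates (f a) :=
  (Primrec.of_equiv_symm (e := Step.equiv)).comp (by fun_prop : Primrec fun a => some (f a))

/-- Operations as a disjoint union. -/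
def Op.equiv (A : Type) : Op A ≃ Unit ⊕ A ⊕ A ⊕ A ⊕ (A × A) ⊕ (A × A × A) where
  toFun
    | .nop => .inl ()
    | .x q => .inr (.inl q)
    | .z q => .inr (.inr (.inl q))
    | .had q => .inr (.inr (.inr (.inl q)))
    | .cnot p q => .inr (.inr (.inr (.inr (.inl (p, q)))))
    | .tof p q t => .inr (.inr (.inr (.inr (.inr (p, q, t)))))
  invFun
    | .inl () => .nop
    | .inr (.inl q) => .x q
    | .inr (.inr (.inl q)) => .z q
    | .inr (.inr (.inr (.inl q))) => .had q
    | .inr (.inr (.inr (.inr (.inl (p, q))))) => .cnot p q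
    | .inr (.inr (.inr (.inr (.inr (p, q, t))))) => .tof p q t
  left_inv o := by cases o <;> rfl
  right_inv o := by rcases o with _ | _ | _ | _ | _ | _ <;> rfl

instance {A : Type} [Primcodable A] : Primcodable (Op A) := Primcodable.ofEquiv _ (Op.equiv A)

@[fun_prop]
theorem primrec_x {f : α → β} (hf : Primrec f) : Primrec fun a => Op.x (f a) :=
  (Primrec.of_equiv_symm (e := Op.equiv β)).comp (by fun_prop : Primrec fun a =>
    (.inr (.inl (f a)) : Unit ⊕ β ⊕ β ⊕ β ⊕ (β × β) ⊕ (β × β × β)))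

@[fun_prop]
theorem primrec_z {f : α → β} (hf : Primrec f) : Primrec fun a => Op.z (f a) :=
  (Primrec.of_equiv_symm (e := Op.equiv β)).comp (by fun_prop : Primrec fun a =>
    (.inr (.inr (.inl (f a))) : Unit ⊕ β ⊕ β ⊕ β ⊕ (β × β) ⊕ (β × β × β)))

@[fun_prop]
theorem primrec_had {f : α → β} (hf : Primrec f) : Primrec fun a => Op.had (f a) :=
  (Primrec.of_equiv_symm (e := Op.equiv β)).comp (by fun_prop : Primrec fun a =>
    (.inr (.inr (.inr (.inl (f a)))) : Unit ⊕ β ⊕ β ⊕ β ⊕ (β × β) ⊕ (β × β × β)))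

@[fun_prop]
theorem primrec_cnot {f g : α → β} (hf : Primrec f) (hg : Primrec g) :
    Primrec fun a => Op.cnot (f a) (g a) :=
  (Primrec.of_equiv_symm (e := Op.equiv β)).comp (by fun_prop : Primrec fun a =>
    (.inr (.inr (.inr (.inr (.inl (f a, g a))))) : Unit ⊕ β ⊕ β ⊕ β ⊕ (β × β) ⊕ (β × β × β)))

@[fun_prop]
theorem primrec_tof {f g h : α → β} (hf : Primrec f) (hg : Primrec g) (hh : Primrec h) :
    Primrec fun a => Op.tof (f a) (g a) (h a) :=
  (Primrec.of_equiv_symm (e := Op.equiv β)).comp (by fun_prop : Primrec fun a =>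
    (.inr (.inr (.inr (.inr (.inr (f a, g a, h a))))) : Unit ⊕ β ⊕ β ⊕ β ⊕ (β × β) ⊕ (β × β × β)))

/-- The case distinction is carried out on the encoding as an iterated disjoint union. The auxiliary
facts `k₁` to `k₅` turn hypotheses about tuples into composition rules that fit the nested contexts.
-/
theorem primrec_op_cases {o : α → Op β} {g₀ : α → γ} {g₁ g₂ g₃ : α → β → γ} {g₄ : α → β → β → γ}
    {g₅ : α → β → β → β → γ} (ho : Primrec o) (h₀ : Primrec g₀)
    (h₁ : Primrec fun p : α × β => g₁ p.1 p.2) (h₂ : Primrec fun p : α × β => g₂ p.1 p.2)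
    (h₃ : Primrec fun p : α × β => g₃ p.1 p.2)
    (h₄ : Primrec fun p : α × β × β => g₄ p.1 p.2.1 p.2.2)
    (h₅ : Primrec fun p : α × β × β × β => g₅ p.1 p.2.1 p.2.2.1 p.2.2.2) :
    Primrec fun a => (Op.casesOn (o a) (g₀ a) (g₁ a) (g₂ a) (g₃ a) (g₄ a) (g₅ a) : γ) := by
  have k₁ : ∀ {δ : Type} [Primcodable δ] {u : δ → α} {v : δ → β}, Primrec u → Primrec v →
      Primrec fun p => g₁ (u p) (v p) := fun hu hv => h₁.comp (hu.pair hv)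
  have k₂ : ∀ {δ : Type} [Primcodable δ] {u : δ → α} {v : δ → β}, Primrec u → Primrec v →
      Primrec fun p => g₂ (u p) (v p) := fun hu hv => h₂.comp (hu.pair hv)
  have k₃ : ∀ {δ : Type} [Primcodable δ] {u : δ → α} {v : δ → β}, Primrec u → Primrec v →
      Primrec fun p => g₃ (u p) (v p) := fun hu hv => h₃.comp (hu.pair hv)
  have k₄ : ∀ {δ : Type} [Primcodable δ] {u : δ → α} {v : δ → β} {w : δ → β}, Primrec u → Primrec v
      → Primrec w →
      Primrec fun p => g₄ (u p) (v p) (w p) := fun hu hv hw => h₄.comp (hu.pair (hv.pair hw))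
  have k₅ : ∀ {δ : Type} [Primcodable δ] {u : δ → α} {v : δ → β} {w : δ → β} {t : δ → β}, Primrec u
      → Primrec v → Primrec w → Primrec t →
      Primrec fun p => g₅ (u p) (v p) (w p) (t p) := fun hu hv hw ht => h₅.comp (hu.pair (hv.pair
          (hw.pair ht)))
  have he : Primrec fun a => Op.equiv β (o a) := Primrec.of_equiv.comp ho
  refine Primrec.of_eq (f := fun a => Sum.elim (fun _ => g₀ a) (Sum.elim (g₁ a) (Sum.elim (g₂ a)
    (Sum.elim (g₃ a) (Sum.elim (fun q => g₄ a q.1 q.2) fun q => g₅ a q.1 q.2.1 q.2.2))))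
      (Op.equiv β (o a))) ?_ fun a => ?_
  · refine primrec_sumElim he (h₀.comp Primrec.fst) ?_
    refine primrec_sumElim Primrec.snd ?_ (primrec_sumElim Primrec.snd ?_
      (primrec_sumElim Primrec.snd ?_ (primrec_sumElim Primrec.snd ?_ ?_)))
    · exact k₁ (by fun_prop) (by fun_prop)
    · exact k₂ (by fun_prop) (by fun_prop)
    · exact k₃ (by fun_prop) (by fun_prop)
    · exact k₄ (by fun_prop) (by fun_prop) (by fun_prop)
    · exact k₅ (by fun_prop) (by fun_prop) (by fun_prop) (by fun_prop)
  · cases o a <;> rfl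

@[fun_prop]
theorem primrec_opMap {o : α → Op β} {f : α → β → γ} (ho : Primrec o)
    (hf : Primrec fun p : α × β => f p.1 p.2) : Primrec fun a => (o a).map (f a) := by
  have hf' : ∀ {δ : Type} [Primcodable δ] {u : δ → α} {v : δ → β}, Primrec u → Primrec v →
      Primrec fun p => f (u p) (v p) := fun hu hv => hf.comp (hu.pair hv)
  refine (primrec_op_cases (g₀ := fun _ => .nop) (g₁ := fun a q => .x (f a q))
    (g₂ := fun a q => .z (f a q)) (g₃ := fun a q => .had (f a q))
    (g₄ := fun a p q => .cnot (f a p) (f a q)) (g₅ := fun a p q t => .tof (f a p) (f a q) (f a t))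
    ho (Primrec.const _) (primrec_x hf) (primrec_z hf) (primrec_had hf)
    (primrec_cnot (hf' (by fun_prop) (by fun_prop)) (hf' (by fun_prop) (by fun_prop)))
    (primrec_tof (hf' (by fun_prop) (by fun_prop)) (hf' (by fun_prop) (by fun_prop))
      (hf' (by fun_prop) (by fun_prop)))).of_eq fun a => ?_
  cases o a <;> rfl

@[fun_prop]
theorem primrec_basic {o : α → Op Addr} (ho : Primrec o) : Primrec fun a => (o a).basic := by
  have hrep : ∀ {k : ℕ}, Primrec fun q : Addr => List.replicate k (BasicGate.phaseT q) := by
    intro k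
    induction k with
    | zero => exact Primrec.const []
    | succ k ih => exact primrec_cons (by fun_prop) ih
  have hrep' : ∀ {k : ℕ} {δ : Type} [Primcodable δ] {u : δ → Addr}, Primrec u →
      Primrec fun p => List.replicate k (BasicGate.phaseT (u p)) := fun hu => hrep.comp hu
  refine (primrec_op_cases (g₀ := fun _ => Op.basic .nop) (g₁ := fun _ q => Op.basic (.x q))
    (g₂ := fun _ q => Op.basic (.z q)) (g₃ := fun _ q => Op.basic (.had q))
    (g₄ := fun _ p q => Op.basic (.cnot p q)) (g₅ := fun _ p q t => Op.basic (.tof p q t))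
    ho (Primrec.const _) ?_ ?_ ?_ ?_ ?_).of_eq fun a => ?_
  · exact primrec_cons (by fun_prop) (primrec_append (hrep' (by fun_prop)) (by fun_prop))
  · exact hrep' (by fun_prop)
  · simp only [Op.basic]
    fun_prop
  · simp only [Op.basic]
    fun_prop
  · simp only [Op.basic, List.replicate]
    fun_prop
  · cases o a <;> rfl

@[fun_prop]
theorem primrec_steps {f : α → Instr} (hf : Primrec f) : Primrec fun a => (f a).steps := by
  have h : Primrec fun l : List (Op Addr) => sliceSteps l := by
    unfold sliceSteps
    fun_prop
  refine (Primrec.option_casesOn hf (Primrec.const [Step.query])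
    (g := fun _ l => sliceSteps l) (h.comp Primrec.snd)).of_eq fun a => ?_
  cases f a <;> rfl

@[fun_prop]
theorem primrec_cell {P p o : α → ℕ} (hP : Primrec P) (hp : Primrec p) (ho : Primrec o) :
    Primrec fun a => cell (P a) (p a) (o a) := by
  unfold cell
  fun_prop

@[fun_prop]
theorem primrec_locSlice {P : α → ℕ} {o : α → Op ℕ} (hP : Primrec P) (ho : Primrec o) :
    Primrec fun a => locSlice (P a) (o a) := by
  unfold locSlice
  fun_prop

@[fun_prop]
theorem primrec_revSlices {f : α → List (List (Op β))} (hf : Primrec f) :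
    Primrec fun a => revSlices (f a) := by
  unfold revSlices
  fun_prop

@[fun_prop]
theorem primrec_fetchSlice {P o₁ o₂ : α → ℕ} {m : α → ℕ → Bool} {π : α → ℕ → ℕ} (hP : Primrec P)
    (hm : Primrec fun p : α × ℕ => m p.1 p.2) (hπ : Primrec fun p : α × ℕ => π p.1 p.2)
    (h₁ : Primrec o₁) (h₂ : Primrec o₂) :
    Primrec fun a => fetchSlice (P a) (m a) (π a) (o₁ a) (o₂ a) := by
  unfold fetchSlice
  fun_prop

@[fun_prop]
theorem primrec_flipSlice {P o : α → ℕ} {m : α → ℕ → Bool} (hP : Primrec P)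
    (hm : Primrec fun p : α × ℕ => m p.1 p.2) (ho : Primrec o) :
    Primrec fun a => flipSlice (P a) (m a) (o a) := by
  unfold flipSlice
  fun_prop

end Codes

/-! ### Primitive recursive routines of the search -/

section Programs

variable {α : Type} [Primcodable α]

@[fun_prop]
theorem primrec_partner {k j p : α → ℕ} (hk : Primrec k) (hj : Primrec j) (hp : Primrec p) :
    Primrec fun x => SortNet.partner (k x) (j x) (p x) := by
  -- The branches are rewritten as Boolean conditionals, which is the form covered by the registered
  -- rules.
  have h : ∀ k j i : ℕ, SortNet.pairing k j i = bif decide (j = 0) then 2 * 2 ^ (k - j) - 1 - i else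
      bif decide (j ≤ k) then (i + 2 ^ (k - j)) % (2 * 2 ^ (k - j)) else i := fun k j i => by
    simp only [SortNet.pairing, Bool.cond_decide]
  simp only [SortNet.partner, h]
  fun_prop

@[fun_prop]
theorem primrec_upper {k j p : α → ℕ} (hk : Primrec k) (hj : Primrec j) (hp : Primrec p) :
    Primrec fun x => SortNet.upper (k x) (j x) (p x) := by
  unfold SortNet.upper
  fun_prop

@[fun_prop]
theorem primrec_compareOps {W B n : α → ℕ} (hW : Primrec W) (hB : Primrec B) (hn : Primrec n) :
    Primrec fun x => compareOps (W x) (B x) (n x) := by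
  unfold compareOps
  fun_prop

@[fun_prop]
theorem primrec_selectOps {W B n : α → ℕ} (hW : Primrec W) (hB : Primrec B) (hn : Primrec n) :
    Primrec fun x => selectOps (W x) (B x) (n x) := by
  unfold selectOps
  fun_prop

@[fun_prop]
theorem primrec_sortStep {P W B k j : α → ℕ} (hP : Primrec P) (hW : Primrec W) (hB : Primrec B)
    (hk : Primrec k) (hj : Primrec j) :
    Primrec fun x => sortStep (P x) (W x) (B x) (k x) (j x) := by
  unfold sortStep
  fun_prop

@[fun_prop]
theorem primrec_sortSlices {κ W B : α → ℕ} (hκ : Primrec κ) (hW : Primrec W) (hB : Primrec B) :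
    Primrec fun x => sortSlices (κ x) (W x) (B x) := by
  unfold sortSlices
  fun_prop

@[fun_prop]
theorem primrec_mergeOps {e c n : α → ℕ} (he : Primrec e) (hc : Primrec c) (hn : Primrec n) :
    Primrec fun x => mergeOps (e x) (c x) (n x) := by
  unfold mergeOps
  fun_prop

@[fun_prop]
theorem primrec_mergeStep {P e c j : α → ℕ} (hP : Primrec P) (he : Primrec e) (hc : Primrec c)
    (hj : Primrec j) :
    Primrec fun x => mergeStep (P x) (e x) (c x) (j x) := by
  unfold mergeStep
  fun_prop

@[fun_prop]
theorem primrec_mergeSlices {κ e c : α → ℕ} (hκ : Primrec κ) (he : Primrec e) (hc : Primrec c) :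
    Primrec fun x => mergeSlices (κ x) (e x) (c x) := by
  unfold mergeSlices
  fun_prop

@[fun_prop]
theorem primrec_copyOps {o₁ o₂ n : α → ℕ} (ho₁ : Primrec o₁) (ho₂ : Primrec o₂) (hn : Primrec n) :
    Primrec fun x => copyOps (o₁ x) (o₂ x) (n x) := by
  unfold copyOps
  fun_prop

@[fun_prop]
theorem primrec_dataSlice {P N m c k o : α → ℕ} (hP : Primrec P) (hN : Primrec N)
    (hm : Primrec m) (hc : Primrec c) (hk : Primrec k) (ho : Primrec o) :
    Primrec fun x => dataSlice (P x) (N x) (m x) (c x) (k x) (o x) := by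
  unfold dataSlice
  fun_prop

@[fun_prop]
theorem primrec_dataSlices {N d m B : α → ℕ} (hN : Primrec N) (hd : Primrec d) (hm : Primrec m)
    (hB : Primrec B) :
    Primrec fun x => dataSlices (N x) (d x) (m x) (B x) := by
  unfold dataSlices
  fun_prop

@[fun_prop]
theorem primrec_loadSlices {N d n m ib B : α → ℕ} (hN : Primrec N) (hd : Primrec d)
    (hn : Primrec n) (hm : Primrec m) (hib : Primrec ib) (hB : Primrec B) :
    Primrec fun x => loadSlices (N x) (d x) (n x) (m x) (ib x) (B x) := by
  unfold loadSlices
  fun_prop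

@[fun_prop]
theorem primrec_sortedRow {d n m B : α → ℕ} (hd : Primrec d) (hn : Primrec n) (hm : Primrec m)
    (hB : Primrec B) :
    Primrec fun x => sortedRow (d x) (n x) (m x) (B x) := by
  unfold sortedRow
  fun_prop

@[fun_prop]
theorem primrec_joinRow {d n m B : α → ℕ} (hd : Primrec d) (hn : Primrec n) (hm : Primrec m)
    (hB : Primrec B) :
    Primrec fun x => joinRow (d x) (n x) (m x) (B x) := by
  unfold joinRow
  fun_prop

@[fun_prop]
theorem primrec_joinedRow {d n m B : α → ℕ} (hd : Primrec d) (hn : Primrec n) (hm : Primrec m)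
    (hB : Primrec B) :
    Primrec fun x => joinedRow (d x) (n x) (m x) (B x) := by
  unfold joinedRow
  fun_prop

@[fun_prop]
theorem primrec_replyRow {d n m B : α → ℕ} (hd : Primrec d) (hn : Primrec n) (hm : Primrec m)
    (hB : Primrec B) :
    Primrec fun x => replyRow (d x) (n x) (m x) (B x) := by
  unfold replyRow
  fun_prop

@[fun_prop]
theorem primrec_resultRow {d n m B : α → ℕ} (hd : Primrec d) (hn : Primrec n) (hm : Primrec m)
    (hB : Primrec B) :
    Primrec fun x => resultRow (d x) (n x) (m x) (B x) := by
  unfold resultRow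
  fun_prop

@[fun_prop]
theorem primrec_endRow {d n m B : α → ℕ} (hd : Primrec d) (hn : Primrec n) (hm : Primrec m)
    (hB : Primrec B) :
    Primrec fun x => endRow (d x) (n x) (m x) (B x) := by
  unfold endRow
  fun_prop

@[fun_prop]
theorem primrec_markOps {d n m B : α → ℕ} (hd : Primrec d) (hn : Primrec n) (hm : Primrec m)
    (hB : Primrec B) :
    Primrec fun x => markOps (d x) (n x) (m x) (B x) := by
  unfold markOps
  fun_prop

@[fun_prop]
theorem primrec_replyOps {d n m B : α → ℕ} (hd : Primrec d) (hn : Primrec n) (hm : Primrec m)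
    (hB : Primrec B) :
    Primrec fun x => replyOps (d x) (n x) (m x) (B x) := by
  unfold replyOps
  fun_prop

@[fun_prop]
theorem primrec_lookupSlices {N d n m ib B : α → ℕ} (hN : Primrec N) (hd : Primrec d)
    (hn : Primrec n) (hm : Primrec m) (hib : Primrec ib) (hB : Primrec B) :
    Primrec fun x => lookupSlices (N x) (d x) (n x) (m x) (ib x) (B x) := by
  unfold lookupSlices
  fun_prop

@[fun_prop]
theorem primrec_indexCol {r m i l : α → ℕ} (hr : Primrec r) (hm : Primrec m) (hi : Primrec i)
    (hl : Primrec l) :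
    Primrec fun x => indexCol (r x) (m x) (i x) (l x) := by
  unfold indexCol
  fun_prop

@[fun_prop]
theorem primrec_argSlice {N r d n m B k : α → ℕ} (hN : Primrec N) (hr : Primrec r)
    (hd : Primrec d) (hn : Primrec n) (hm : Primrec m) (hB : Primrec B) (hk : Primrec k) :
    Primrec fun x => argSlice (N x) (r x) (d x) (n x) (m x) (B x) (k x) := by
  unfold argSlice
  fun_prop

@[fun_prop]
theorem primrec_argSlices {N r d n m ib B : α → ℕ} (hN : Primrec N) (hr : Primrec r)
    (hd : Primrec d) (hn : Primrec n) (hm : Primrec m) (hib : Primrec ib) (hB : Primrec B) :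
    Primrec fun x => argSlices (N x) (r x) (d x) (n x) (m x) (ib x) (B x) := by
  unfold argSlices
  fun_prop

@[fun_prop]
theorem primrec_testRow {m R : α → ℕ} (hm : Primrec m) (hR : Primrec R) :
    Primrec fun x => testRow (m x) (R x) := by
  unfold testRow
  fun_prop

@[fun_prop]
theorem primrec_baseRow {r m R : α → ℕ} (hr : Primrec r) (hm : Primrec m) (hR : Primrec R) :
    Primrec fun x => baseRow (r x) (m x) (R x) := by
  unfold baseRow
  fun_prop

@[fun_prop]
theorem primrec_newRow {r d n m R : α → ℕ} (hr : Primrec r) (hd : Primrec d) (hn : Primrec n)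
    (hm : Primrec m) (hR : Primrec R) :
    Primrec fun x => newRow (r x) (d x) (n x) (m x) (R x) := by
  unfold newRow
  fun_prop

@[fun_prop]
theorem primrec_scratchSize {r d n m R : α → ℕ} (hr : Primrec r) (hd : Primrec d)
    (hn : Primrec n) (hm : Primrec m) (hR : Primrec R) :
    Primrec fun x => scratchSize (r x) (d x) (n x) (m x) (R x) := by
  unfold scratchSize
  fun_prop

@[fun_prop]
theorem primrec_zeroOps {c n k : α → ℕ} (hc : Primrec c) (hn : Primrec n) (hk : Primrec k) :
    Primrec fun x => zeroOps (c x) (n x) (k x) := by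
  unfold zeroOps
  fun_prop

@[fun_prop]
theorem primrec_zeroSlices {N r m ib c : α → ℕ} (hN : Primrec N) (hr : Primrec r)
    (hm : Primrec m) (hib : Primrec ib) (hc : Primrec c) :
    Primrec fun x => zeroSlices (N x) (r x) (m x) (ib x) (c x) := by
  unfold zeroSlices
  fun_prop

@[fun_prop]
theorem primrec_newFlag {r d n m R t i : α → ℕ} (hr : Primrec r) (hd : Primrec d)
    (hn : Primrec n) (hm : Primrec m) (hR : Primrec R) (ht : Primrec t) (hi : Primrec i) :
    Primrec fun x => newFlag (r x) (d x) (n x) (m x) (R x) (t x) (i x) := by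
  unfold newFlag
  fun_prop

@[fun_prop]
theorem primrec_foundDigit {r d n m R i l b : α → ℕ} (hr : Primrec r) (hd : Primrec d)
    (hn : Primrec n) (hm : Primrec m) (hR : Primrec R) (hi : Primrec i) (hl : Primrec l)
    (hb : Primrec b) :
    Primrec fun x => foundDigit (r x) (d x) (n x) (m x) (R x) (i x) (l x) (b x) := by
  unfold foundDigit
  fun_prop

@[fun_prop]
theorem primrec_markSlices {N r d n m R t : α → ℕ} (hN : Primrec N) (hr : Primrec r)
    (hd : Primrec d) (hn : Primrec n) (hm : Primrec m) (hR : Primrec R) (ht : Primrec t) :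
    Primrec fun x => markSlices (N x) (r x) (d x) (n x) (m x) (R x) (t x) := by
  unfold markSlices
  fun_prop

@[fun_prop]
theorem primrec_outSlice {N r d n m R t l b : α → ℕ} (hN : Primrec N) (hr : Primrec r)
    (hd : Primrec d) (hn : Primrec n) (hm : Primrec m) (hR : Primrec R) (ht : Primrec t)
    (hl : Primrec l) (hb : Primrec b) :
    Primrec fun x => outSlice (N x) (r x) (d x) (n x) (m x) (R x) (t x) (l x) (b x) := by
  unfold outSlice
  fun_prop

@[fun_prop]
theorem primrec_updateSlices {N r d n m R t : α → ℕ} (hN : Primrec N) (hr : Primrec r)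
    (hd : Primrec d) (hn : Primrec n) (hm : Primrec m) (hR : Primrec R) (ht : Primrec t) :
    Primrec fun x => updateSlices (N x) (r x) (d x) (n x) (m x) (R x) (t x) := by
  unfold updateSlices
  fun_prop

@[fun_prop]
theorem primrec_oraclePhase {L : α → List (List (Op Addr))} {zs : α → List Addr} (hL : Primrec L)
    (hzs : Primrec zs) : Primrec fun x => oraclePhase (L x) (zs x) := by
  unfold oraclePhase
  fun_prop

@[fun_prop]
theorem primrec_plainPhase {L : α → List (List (Op Addr))} {zs : α → List Addr} (hL : Primrec L)
    (hzs : Primrec zs) : Primrec fun x => plainPhase (L x) (zs x) := by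
  unfold plainPhase
  fun_prop

@[fun_prop]
theorem primrec_recordRound {N r d n m R t : α → ℕ} (hN : Primrec N) (hr : Primrec r)
    (hd : Primrec d) (hn : Primrec n) (hm : Primrec m) (hR : Primrec R) (ht : Primrec t) :
    Primrec fun x => recordRound (N x) (r x) (d x) (n x) (m x) (R x) (t x) := by
  unfold recordRound
  fun_prop

@[fun_prop]
theorem primrec_recordRounds {N r d n m R : α → ℕ} (hN : Primrec N) (hr : Primrec r)
    (hd : Primrec d) (hn : Primrec n) (hm : Primrec m) (hR : Primrec R) :
    Primrec fun x => recordRounds (N x) (r x) (d x) (n x) (m x) (R x) := by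
  unfold recordRounds
  fun_prop

@[fun_prop]
theorem primrec_roundQubits {N r m t : α → ℕ} (hN : Primrec N) (hr : Primrec r) (hm : Primrec m)
    (ht : Primrec t) :
    Primrec fun x => roundQubits (N x) (r x) (m x) (t x) := by
  unfold roundQubits
  fun_prop

@[fun_prop]
theorem primrec_groverStep {N r d n m R t : α → ℕ} (hN : Primrec N) (hr : Primrec r)
    (hd : Primrec d) (hn : Primrec n) (hm : Primrec m) (hR : Primrec R) (ht : Primrec t) :
    Primrec fun x => groverStep (N x) (r x) (d x) (n x) (m x) (R x) (t x) := by
  unfold groverStep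
  fun_prop

@[fun_prop]
theorem primrec_groverRound {N r d n m R t j : α → ℕ} (hN : Primrec N) (hr : Primrec r)
    (hd : Primrec d) (hn : Primrec n) (hm : Primrec m) (hR : Primrec R) (ht : Primrec t)
    (hj : Primrec j) :
    Primrec fun x => groverRound (N x) (r x) (d x) (n x) (m x) (R x) (t x) (j x) := by
  unfold groverRound
  fun_prop

@[fun_prop]
theorem primrec_iterations {reps t : α → ℕ} (hreps : Primrec reps) (ht : Primrec t) :
    Primrec fun x => iterations (reps x) (t x) := by
  unfold iterations
  fun_prop

@[fun_prop]
theorem primrec_searchInstrs {N r d n m K : α → ℕ} (hN : Primrec N) (hr : Primrec r)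
    (hd : Primrec d) (hn : Primrec n) (hm : Primrec m) (hK : Primrec K) :
    Primrec fun x => searchInstrs (N x) (r x) (d x) (n x) (m x) (K x) := by
  unfold searchInstrs groverRounds
  fun_prop

@[fun_prop]
theorem primrec_indexWidth {N r : α → ℕ} (hN : Primrec N) (hr : Primrec r) :
    Primrec fun x => indexWidth (N x) (r x) := by
  unfold indexWidth
  fun_prop

@[fun_prop]
theorem primrec_maxExponent {N r M : α → ℕ} (hN : Primrec N) (hr : Primrec r) (hM : Primrec M) :
    Primrec fun x => maxExponent (N x) (r x) (M x) := by
  unfold maxExponent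
  fun_prop

@[fun_prop]
theorem primrec_searchProgram {N r d M : α → ℕ} (hN : Primrec N) (hr : Primrec r)
    (hd : Primrec d) (hM : Primrec M) :
    Primrec fun x => searchProgram (N x) (r x) (d x) (M x) := by
  unfold searchProgram
  fun_prop

end Programs

theorem computable_searchProgram :
    Computable fun q : ℕ × ℕ × ℕ × ℕ => searchProgram q.1 q.2.1 q.2.2.1 q.2.2.2 :=
  Primrec.to_comp (by fun_prop)

/-! ### Width and depth -/

theorem length_flatMap_le {α β : Type} {l : List α} {f : α → List β} {b : ℕ}
    (h : ∀ x ∈ l, (f x).length ≤ b) : (l.flatMap f).length ≤ l.length * b := by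
  rw [List.length_flatMap]
  have := List.sum_le_card_nsmul (l.map fun x => (f x).length) b fun x hx => by
    obtain ⟨x, hx', rfl⟩ := List.mem_map.1 hx
    exact h x hx'
  simpa using this

/-! ### Numbers of instructions and of scratch qubits -/

section Lengths

theorem length_sortSlices (κ W B : ℕ) : (sortSlices κ W B).length = κ * κ * (8 * W + 1) := by
  simp [sortSlices, sortStep, compareOps, selectOps, List.length_flatMap]
  ring_nf
  simp

theorem length_mergeSlices (κ e c : ℕ) : (mergeSlices κ e c).length = κ * (3 * e + 5) := by
  simp [mergeSlices, mergeStep, mergeOps, List.length_flatMap]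
  ring_nf
  simp

theorem length_loadSlices (N d n m ib B : ℕ) : (loadSlices N d n m ib B).length =
    (2 ^ m / N + 1) * d + (n + (m + 1) + m + m) := by
  simp [loadSlices, dataSlices, List.length_flatMap]
  ring

theorem length_argSlices (N r d n m ib B : ℕ) : (argSlices N r d n m ib B).length =
    (2 ^ m / N + 1) * d + (n + (m + 1) + m + m) +
      (m + 1) * (m + 1) * (8 * (d + n + (m + 1) + m) + 1) + (d + n + 2) +
      (m + 1) * (3 * (d + n) + 5) + (d + n + (m + 1)) +
      (m + 1) * (m + 1) * (8 * (d + n + (m + 1)) + 1) + d := by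
  simp [argSlices, lookupSlices, length_loadSlices, length_sortSlices, length_mergeSlices, markOps,
    replyOps, copyOps]
  ring

theorem length_zeroSlices (N r m ib c : ℕ) : (zeroSlices N r m ib c).length = 3 * (r * m) + 2 := by
  simp [zeroSlices, zeroOps, List.length_flatMap]
  ring

theorem length_updateSlices (N r d n m R t : ℕ) :
    (updateSlices N r d n m R t).length = r * n + 4 := by
  simp [updateSlices, markSlices]

variable {N r d n m y : ℕ}

/-- The cubic terms come from sorting: quadratically many network steps, each of length linear in
the record width. The hypothesis `hmN` controls the number of blocks into which the database is
loaded. -/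
theorem length_argSlices_le (h : d + n + m + 1 ≤ y) (hmN : 2 ^ m / N ≤ 4 * y) (ib B : ℕ) :
    (argSlices N r d n m ib B).length ≤ 60 * y ^ 3 := by
  rw [length_argSlices]
  calc _ ≤ (4 * y + 1) * y + 4 * y +
      y * y * (8 * (2 * y) + 1) + 2 * y +
      y * (3 * y + 5) + y + y * y * (8 * y + 1) + y := by
        gcongr <;> omega
    _ ≤ _ := by
        -- After expansion in `z` the inequality is linear in the powers of `z`, which can be
        -- treated as independent nonnegative unknowns.
        obtain ⟨z, rfl⟩ : ∃ z, y = z + 1 := ⟨y - 1, by omega⟩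
        ring_nf
        omega

theorem length_groverStep_le (h : d + n + m + r + 1 ≤ y) (hmN : 2 ^ m / N ≤ 4 * y) (R t : ℕ) :
    (groverStep N r d n m R t).length ≤ 140 * y ^ 3 := by
  have h1 := length_argSlices_le (N := N) (r := r) (d := d) (n := n) (m := m) (y := y) (by omega)
      hmN
    (t * m) (baseRow r m R)
  have h2 : (zeroSlices N r m (t * m) (testRow m R)).length ≤ 5 * y ^ 3 := by
    rw [length_zeroSlices]
    calc _ ≤ 3 * (y * y) + 2 := by gcongr <;> omega
      _ ≤ _ := by
        obtain ⟨z, rfl⟩ : ∃ z, y = z + 1 := ⟨y - 1, by omega⟩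
        ring_nf
        omega
  have h3 : 1 ≤ y ^ 3 := Nat.one_le_pow _ _ (by omega)
  simp only [groverStep, oraclePhase, plainPhase, revSlices, List.length_append, List.length_map,
    List.length_reverse, List.length_singleton]
  omega

theorem length_recordRound_le (h : d + n + m + r + 1 ≤ y) (hmN : 2 ^ m / N ≤ 4 * y) (R t : ℕ) :
    (recordRound N r d n m R t).length ≤ 130 * y ^ 3 := by
  have h1 := length_argSlices_le (N := N) (r := r) (d := d) (n := n) (m := m) (y := y) (by omega)
      hmN
    (t * m) (baseRow r m R)
  have h2 : (updateSlices N r d n m R t).length ≤ 5 * y ^ 3 := by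
    rw [length_updateSlices]
    calc _ ≤ y * y + 4 := by gcongr <;> omega
      _ ≤ _ := by
        obtain ⟨z, rfl⟩ : ∃ z, y = z + 1 := ⟨y - 1, by omega⟩
        ring_nf
        omega
  have h3 : 1 ≤ y ^ 3 := Nat.one_le_pow _ _ (by omega)
  simp only [recordRound, revSlices, List.length_append, List.length_map,
    List.length_reverse, List.length_singleton]
  omega

theorem iterations_le {K reps t : ℕ} (ht : t < (K + 1) * reps) : iterations reps t ≤ 3 ^ K := by
  have : t / reps < K + 1 := Nat.div_lt_of_lt_mul (by rwa [mul_comm])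
  exact (Nat.div_le_self _ _).trans (Nat.pow_le_pow_right (by norm_num) (by omega))

/-- There are at most `12 * y ^ 3` rounds, each with at most `3 ^ K` Grover steps and one final
evaluation of length `O(y ^ 3)`; only the Grover steps carry the exponential factor. -/
theorem length_searchInstrs_le (h : d + n + m + r + 1 ≤ y) (hmN : 2 ^ m / N ≤ 4 * y) {K : ℕ}
    (hK : K + 1 ≤ 3 * y ^ 2) (hn : n + 1 ≤ y) :
    (searchInstrs N r d n m K).length ≤ 4000 * y ^ 6 * 3 ^ K := by
  set R := (K + 1) * (4 * (n + 1)) with hR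
  have hRy : R ≤ 12 * y ^ 3 := by
    calc R ≤ 3 * y ^ 2 * (4 * y) := by rw [hR]; gcongr
      _ = _ := by ring
  have h3 : 1 ≤ y ^ 3 := Nat.one_le_pow _ _ (by omega)
  have hK1 : 1 ≤ 3 ^ K := Nat.one_le_pow _ _ (by norm_num)
  have h1 : (groverRounds N r d n m R (iterations (4 * (n + 1)))).length ≤
      R * (1 + 3 ^ K * (140 * y ^ 3)) := by
    refine (length_flatMap_le (b := 1 + 3 ^ K * (140 * y ^ 3)) fun t ht => ?_).trans_eq
      (by rw [List.length_range])
    have hit := iterations_le (List.mem_range.1 ht)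
    rw [groverRound, List.length_cons, add_comm]
    have := length_flatMap_le (l := List.range (iterations (4 * (n + 1)) t))
      (f := fun _ => groverStep N r d n m R t)
      fun _ _ => length_groverStep_le h hmN R t
    rw [List.length_range] at this
    have h2 : iterations (4 * (n + 1)) t * (140 * y ^ 3) ≤ 3 ^ K * (140 * y ^ 3) := by gcongr
    omega
  have h2 : (recordRounds N r d n m R).length ≤ R * (130 * y ^ 3) :=
    (length_flatMap_le fun t _ => length_recordRound_le h hmN R t).trans_eq
      (by rw [List.length_range])
  rw [searchInstrs, List.length_append]
  calc _ ≤ R * (1 + 3 ^ K * (140 * y ^ 3)) + R * (130 * y ^ 3) := add_le_add h1 h2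
    _ = R * (1 + 3 ^ K * (140 * y ^ 3) + 130 * y ^ 3) := by ring
    _ ≤ R * (3 ^ K * y ^ 3 + 3 ^ K * (140 * y ^ 3) + 130 * (3 ^ K * y ^ 3)) := by
        have : y ^ 3 ≤ 3 ^ K * y ^ 3 := Nat.le_mul_of_pos_left _ (by omega)
        gcongr
        omega
    _ ≤ 12 * y ^ 3 * (3 ^ K * y ^ 3 + 3 ^ K * (140 * y ^ 3) + 130 * (3 ^ K * y ^ 3)) := by gcongr
    _ = 3252 * y ^ 6 * 3 ^ K := by ring
    _ ≤ _ := by gcongr; norm_num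

/-- The array has at most `50 * y ^ 4` rows, and its number of columns exceeds `N` by a factor of at
most `8 * y`. -/
theorem scratchSize_le (h : d + n + m + r + 1 ≤ y) {R : ℕ} (hR : R ≤ 12 * y ^ 3)
    (hmN : 2 ^ (m + 1) ≤ 8 * y * N) : scratchSize r d n m R ≤ 400 * y ^ 5 * N := by
  have h1 : newRow r d n m R + R ≤ 50 * y ^ 4 := by
    simp only [newRow, endRow, resultRow, replyRow, joinedRow, joinRow, sortedRow, baseRow, testRow]
    calc _ ≤ 12 * y ^ 3 * y + (2 * (y * y) + 1) +
        y * y * (4 * (2 * y) + 1) + 2 * y + y * (2 * y + 3) + y +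
        y * y * (4 * y + 1) + y + 12 * y ^ 3 := by
          gcongr <;> omega
      _ ≤ _ := by
        obtain ⟨z, rfl⟩ : ∃ z, y = z + 1 := ⟨y - 1, by omega⟩
        ring_nf
        omega
  calc scratchSize r d n m R ≤ 50 * y ^ 4 * (8 * y * N) := by
        rw [scratchSize]; gcongr
    _ = _ := by ring

end Lengths

/-! ### Depth and number of qubits after compilation -/

section Sizes

variable {N r d w : ℕ} {a : Fin N → ℕ}

/-- A slice of operations takes 40 time slices, and a query takes as many as the deepest given
circuit. -/
theorem length_compile_le {A : ∀ i, Circuit (OracleQubit r d (a i))} {D : ℕ}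
    (hD : ∀ i, (A i).depth ≤ D) (L : List Instr) :
    ((L.flatMap Instr.steps).flatMap (Step.compile w A)).length ≤ L.length * (40 + D) := by
  rw [List.flatMap_assoc]
  refine length_flatMap_le fun c _ => ?_
  cases c with
  | none =>
    simp only [Instr.steps, Option.elim, List.flatMap_singleton, Step.compile, queryCircuit,
      List.length_map, List.length_range]
    exact (Finset.sup_le fun i _ => hD i).trans (Nat.le_add_left _ _)
  | some l =>
    simp [Instr.steps, sliceSteps, Step.compile, List.flatMap_map]

/-- Apart from scratch, every qubit belongs to a database entry or a processor. The ancillas of a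
processor are among the qubits of its given circuit, hence at most `W`. -/
theorem card_qubit_le {W : ℕ} (hW : ∀ i, Fintype.card (OracleQubit r d (a i)) ≤ W) :
    Fintype.card (Qubit N r d w a) ≤
      N * (d + r * d + 2 + r * Nat.clog 2 N + W) + w := by
  let f : Qubit N r d w a → (Fin N × (Fin d ⊕ (Fin r × Fin d) ⊕ Bool ⊕ (Fin r × Fin (Nat.clog 2 N))
      ⊕
      Fin W)) ⊕ Fin w
    | .data j k => .inl (j, .inl k)
    | .arg i l k => .inl (i, .inr (.inl (l, k)))
    | .target i => .inl (i, .inr (.inr (.inl true)))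
    | .found i => .inl (i, .inr (.inr (.inl false)))
    | .out i l b => .inl (i, .inr (.inr (.inr (.inl (l, b)))))
    | .scratch t => .inr t
    | .anc i t => .inl (i, .inr (.inr (.inr (.inr (t.castLE ((by
        simpa using Fintype.card_le_of_injective (OracleQubit.anc (r := r) (d := d) (a := a i))
          fun _ _ h => OracleQubit.anc.inj h : a i ≤ _).trans (hW i)))))))
  have hf : Function.Injective f := by
    rintro (_ | _ | _ | _ | _ | _ | ⟨i, t⟩) (_ | _ | _ | _ | _ | _ | ⟨i', t'⟩) h <;>
      simp only [f, Sum.inl.injEq, Sum.inr.injEq, Prod.mk.injEq, reduceCtorEq, and_false,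
        Bool.true_eq_false, Bool.false_eq_true] at h
    all_goals first
      | (obtain ⟨rfl, rfl, rfl⟩ := h; rfl)
      | (obtain ⟨rfl, h⟩ := h; obtain rfl := Fin.castLE_injective _ h; rfl)
  refine (Fintype.card_le_of_injective f hf).trans_eq ?_
  simp only [Fintype.card_sum, Fintype.card_prod, Fintype.card_fin, Fintype.card_bool]
  ring

end Sizes

/-! ### The parameters in terms of `r * log N` -/

section Parameters

variable {N r d M : ℕ}

theorem two_pow_indexWidth_lt (hN : 0 < N) (hr : 0 < r) : 2 ^ indexWidth N r < 4 * r * N := by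
  have h1 : 1 < 2 * r * N := by
    have := Nat.mul_pos hr hN
    rw [mul_assoc]
    omega
  have h2 := Nat.pow_pred_clog_lt_self (b := 2) (by norm_num) h1
  have h3 := Nat.clog_pos (b := 2) (by norm_num) h1
  rw [indexWidth, ← Nat.succ_pred_eq_of_pos h3, pow_succ]
  linarith

theorem indexWidth_le : indexWidth N r ≤ 1 + r + Nat.clog 2 N := by
  refine Nat.clog_le_of_le_pow ?_
  rw [pow_add, pow_add, pow_one]
  exact Nat.mul_le_mul (Nat.mul_le_mul_left _ (Nat.lt_two_pow_self).le)
    (Nat.le_pow_clog (by norm_num) _)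

theorem maxExponent_le : maxExponent N r M ≤ Nat.clog 2 N * r + 1 := by
  refine Nat.clog_le_of_le_pow ?_
  have h1 : N ^ r ≤ 2 ^ (Nat.clog 2 N * r) := by
    rw [pow_mul]
    exact Nat.pow_le_pow_left (Nat.le_pow_clog (by norm_num) _) _
  calc N ^ r / M + 1 ≤ 2 ^ (Nat.clog 2 N * r) + 2 ^ (Nat.clog 2 N * r) :=
        add_le_add ((Nat.div_le_self _ _).trans h1) (Nat.one_le_pow _ _ (by norm_num))
    _ = 2 ^ (Nat.clog 2 N * r + 1) := by rw [pow_succ]; ring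
    _ ≤ _ := Nat.pow_le_pow_left (by norm_num) _

/-- Since the exponent is minimal, lowering it by one brings `9 ^ k` to at most `N ^ r / M`. The
square root is then taken, with the generous constants `18 ≤ 5 ^ 2`, which also cover exponent zero.
-/
theorem three_pow_maxExponent_le (hM : 0 < M) (h : M ≤ N ^ r) :
    (3 : ℝ) ^ maxExponent N r M ≤ 5 * √((N : ℝ) ^ r / M) := by
  have hM' : (0 : ℝ) < M := Nat.cast_pos.2 hM
  set q : ℝ := (N : ℝ) ^ r / M with hq
  have hq1 : 1 ≤ q := by
    rw [hq, one_le_div hM']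
    exact_mod_cast h
  have h9 : (9 : ℝ) ^ maxExponent N r M ≤ 18 * q := by
    rcases Nat.eq_zero_or_pos (maxExponent N r M) with h0 | h0
    · rw [h0, pow_zero]
      linarith
    · have h1 : 9 ^ (maxExponent N r M - 1) < N ^ r / M + 1 :=
        Nat.pow_lt_of_lt_clog (by rw [maxExponent] at h0 ⊢; omega)
      have h2 : (9 : ℝ) ^ (maxExponent N r M - 1) ≤ q := by
        have h3 : ((9 ^ (maxExponent N r M - 1) : ℕ) : ℝ) ≤ ((N ^ r / M : ℕ) : ℝ) :=
          Nat.cast_le.2 (Nat.lt_succ_iff.1 h1)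
        have h4 : ((N ^ r / M : ℕ) : ℝ) ≤ ((N ^ r : ℕ) : ℝ) / M := Nat.cast_div_le
        push_cast at h3 h4
        exact h3.trans h4
      rw [← Nat.sub_add_cancel h0, pow_succ]
      linarith
  rw [← pow_le_pow_iff_left₀ (by positivity) (by positivity) two_ne_zero, mul_pow,
    Real.sq_sqrt (by positivity), ← pow_mul, mul_comm (maxExponent N r M), pow_mul]
  norm_num
  linarith

/-- A bound for all parameters of the search. -/
def parameterSum (N r d : ℕ) : ℕ := d + Nat.clog 2 N + indexWidth N r + r + 1

/-- Because `r * log N` is at least one, lower powers of it are dominated by higher ones, so that a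
single power bounds all parameters. The third bound prepares the hypotheses on the given circuits.
-/
theorem parameterSum_le {K : ℕ} (hN : 2 ≤ N) (hr : 1 ≤ r)
    (hd : (d : ℝ) ≤ K * Real.logb 2 N ^ K) :
    1 ≤ r * Real.logb 2 N ∧
      (parameterSum N r d : ℝ) ≤ (8 + K) * (r * Real.logb 2 N) ^ (K + 1) ∧
      r * Real.logb 2 N * (d + 1) ≤ (8 + K) * (r * Real.logb 2 N) ^ (K + 1) := by
  have hr1 : (1 : ℝ) ≤ r := by exact_mod_cast hr
  have hL : 1 ≤ Real.logb 2 N := by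
    rw [Real.le_logb_iff_rpow_le (by norm_num) (by positivity), Real.rpow_one]
    exact_mod_cast hN
  set L := Real.logb 2 N with hL'
  have hn : (Nat.clog 2 N : ℝ) ≤ L + 1 := by
    have := Nat.ceil_lt_add_one (show (0 : ℝ) ≤ Real.logb 2 N by linarith)
    rw [show ⌈Real.logb 2 N⌉₊ = Nat.clog 2 N
        by exact_mod_cast Real.natCeil_logb_natCast 2 N] at this
    exact this.le
  have hX : 1 ≤ r * L := one_le_mul_of_one_le_of_one_le hr1 hL
  have hLX : L ≤ r * L := le_mul_of_one_le_left (by linarith) hr1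
  have hrX : r ≤ r * L := le_mul_of_one_le_right (by linarith) hL
  set X := r * L
  have hd' : (d : ℝ) ≤ K * X ^ K := hd.trans (by gcongr)
  have hm : (indexWidth N r : ℝ) ≤ 1 + r + Nat.clog 2 N := by exact_mod_cast indexWidth_le
  have hXK : X ≤ X ^ (K + 1) := le_self_pow₀ hX (by omega)
  have hdX : K * X ^ K ≤ K * X ^ (K + 1) := by gcongr; omega
  refine ⟨hX, ?_, ?_⟩
  · rw [parameterSum]
    push_cast
    linarith
  · calc X * (d + 1) ≤ X * (K * X ^ K + 1) := by gcongr
      _ = K * X ^ (K + 1) + X := by ring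
      _ ≤ _ := by linarith

theorem two_pow_div_le (hN : 0 < N) (hr : 0 < r) :
    2 ^ indexWidth N r / N ≤ 4 * parameterSum N r d := by
  rw [Nat.div_le_iff_le_mul_add_pred hN]
  have h1 := two_pow_indexWidth_lt hN hr
  have h2 : 4 * r * N ≤ N * (4 * parameterSum N r d) := by
    rw [mul_comm]
    gcongr
    rw [parameterSum]
    omega
  omega

theorem maxExponent_succ_le : maxExponent N r M + 1 ≤ 3 * parameterSum N r d ^ 2 := by
  have h1 := maxExponent_le (N := N) (r := r) (M := M)
  have h2 : Nat.clog 2 N * r ≤ parameterSum N r d * parameterSum N r d := by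
    gcongr <;> rw [parameterSum] <;> omega
  have h3 : 1 ≤ parameterSum N r d * parameterSum N r d :=
    Nat.mul_pos (Nat.succ_pos _) (Nat.succ_pos _)
  rw [pow_two]
  omega

end Parameters

/-! ### Width and depth of the search program -/

section Bounds

variable {N r d M : ℕ} {a : Fin N → ℕ} {A : ∀ i, Circuit (OracleQubit r d (a i))}

theorem depth_searchProgram_le (hN : 0 < N) (hr : 0 < r) {D : ℕ} (hD : ∀ i, (A i).depth ≤ D) :
    ((searchProgram N r d M).compile A).depth ≤
      4000 * parameterSum N r d ^ 6 * 3 ^ maxExponent N r M * (40 + D) := by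
  refine (length_compile_le hD _).trans ?_
  gcongr
  exact length_searchInstrs_le (y := parameterSum N r d) le_rfl (two_pow_div_le hN hr)
      maxExponent_succ_le
    (by rw [parameterSum]; omega)

theorem width_searchProgram_le (hN : 0 < N) (hr : 0 < r) {W : ℕ} (hW : ∀ i, (A i).width ≤ W) :
    ((searchProgram N r d M).compile A).width ≤ N * (404 * parameterSum N r d ^ 5 + W) := by
  have h1 : scratchSize r d (Nat.clog 2 N) (indexWidth N r)
      ((maxExponent N r M + 1) * (4 * (Nat.clog 2 N + 1))) ≤ 400 * parameterSum N r d ^ 5 * N := by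
    refine scratchSize_le (y := parameterSum N r d) le_rfl ?_ ?_
    · calc _ ≤ 3 * parameterSum N r d ^ 2 * (4 * parameterSum N r d) := by
            gcongr
            · exact maxExponent_succ_le
            · rw [parameterSum]; omega
        _ = _ := by ring
    · calc 2 ^ (indexWidth N r + 1) ≤ 2 * (4 * r * N) := by
            rw [pow_succ, mul_comm]
            exact Nat.mul_le_mul_left _ (two_pow_indexWidth_lt hN hr).le
        _ = 8 * r * N := by ring
        _ ≤ _ := by gcongr; rw [parameterSum]; omega
  refine (card_qubit_le hW).trans ((Nat.add_le_add_left h1 _).trans ?_)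
  have h2 : d + r * d + 2 + r * Nat.clog 2 N ≤ 4 * parameterSum N r d ^ 5 := by
    have h3 : parameterSum N r d ^ 2 ≤ parameterSum N r d ^ 5 :=
      Nat.pow_le_pow_right (Nat.succ_pos _) (by norm_num)
    have h4 : parameterSum N r d ≤ parameterSum N r d ^ 2 := Nat.le_self_pow (by norm_num) _
    have h5 : r * d ≤ parameterSum N r d ^ 2 := by
      rw [pow_two]; gcongr <;> rw [parameterSum] <;> omega
    have h6 : r * Nat.clog 2 N ≤ parameterSum N r d ^ 2 := by
      rw [pow_two]; gcongr <;> rw [parameterSum] <;> omega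
    have h7 : d + 1 ≤ parameterSum N r d := by rw [parameterSum]; omega
    have h8 : 1 ≤ parameterSum N r d := Nat.succ_pos _
    omega
  calc _ ≤ N * (4 * parameterSum N r d ^ 5 + W) + 400 * parameterSum N r d ^ 5 * N := by gcongr
    _ = _ := by ring

/-- Bounds that depend on the given polynomials only. -/
theorem searchProgram_bounds (K : ℕ) : ∃ C : ℕ, ∀ N r d M : ℕ, 2 ≤ N → 1 ≤ r → 1 ≤ M → M ≤ N ^ r →
    (d : ℝ) ≤ K * Real.logb 2 N ^ K →
    ∀ (a : Fin N → ℕ) (A : ∀ i, Circuit (OracleQubit r d (a i))),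
      (∀ i, ((A i).width : ℝ) ≤ K * (r * Real.logb 2 N * (d + 1)) ^ K) →
      (∀ i, ((A i).depth : ℝ) ≤ K * (r * Real.logb 2 N * (d + 1)) ^ K) →
      (((searchProgram N r d M).compile A).width : ℝ) ≤ C * (r * Real.logb 2 N) ^ C * N ∧
      (((searchProgram N r d M).compile A).depth : ℝ) ≤
        C * (r * Real.logb 2 N) ^ C * √((N : ℝ) ^ r / M) := by
  -- The factor `20000 = 4000 * 5` comes from the instruction count and the bound on `3 ^ K`; `(8 +
  -- K) ^ (K + 6)` is the constant part of `Y ^ (K + 6)`, with exponent 6 from the search and `K`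
  -- from the given circuits.
  set C₁ : ℕ := 20000 * (41 + K) * (8 + K) ^ (K + 6) with hC₁
  -- One number has to serve as coefficient and as exponent, so the two requirements are added.
  refine ⟨C₁ + (K + 1) * (K + 6), fun N r d M hN hr hM hMN hd a A hw hdep => ?_⟩
  obtain ⟨hX, hy, hXd⟩ := parameterSum_le hN hr hd
  set X : ℝ := r * Real.logb 2 N with hXdef
  set Y : ℝ := (8 + K) * X ^ (K + 1) with hYdef
  have hY : 1 ≤ Y := one_le_mul_of_one_le_of_one_le (by
    have : (0 : ℝ) ≤ K := Nat.cast_nonneg K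
    linarith) (one_le_pow₀ hX)
  have hbound : 20000 * (41 + K) * Y ^ (K + 6) ≤
      ((C₁ + (K + 1) * (K + 6) : ℕ) : ℝ) * X ^ (C₁ + (K + 1) * (K + 6)) := by
    have h1 : 20000 * (41 + K) * Y ^ (K + 6) = (C₁ : ℝ) * X ^ ((K + 1) * (K + 6)) := by
      rw [hYdef, hC₁, mul_pow, ← pow_mul]
      push_cast
      ring
    rw [h1]
    have h2 : X ^ ((K + 1) * (K + 6)) ≤ X ^ (C₁ + (K + 1) * (K + 6)) :=
      pow_le_pow_right₀ hX (Nat.le_add_left _ _)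
    have h3 : (C₁ : ℝ) ≤ ((C₁ + (K + 1) * (K + 6) : ℕ) : ℝ) :=
      Nat.cast_le.2 (Nat.le_add_right _ _)
    gcongr
  have hKY : (K : ℝ) * (X * (d + 1)) ^ K ≤ K * Y ^ K := by gcongr
  have hpow : ∀ k ≤ K + 6, Y ^ k ≤ Y ^ (K + 6) := fun k hk => pow_le_pow_right₀ hY hk
  have hfloor : ∀ {s : ℕ}, (s : ℝ) ≤ K * (X * (d + 1)) ^ K → s ≤ ⌊(K : ℝ) * Y ^ K⌋₊ := fun h =>
    Nat.le_floor (h.trans hKY)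
  have hfl : ((⌊(K : ℝ) * Y ^ K⌋₊ : ℕ) : ℝ) ≤ K * Y ^ K := Nat.floor_le (by positivity)
  have hK0 : (0 : ℝ) ≤ K := Nat.cast_nonneg K
  constructor
  · have h := width_searchProgram_le (M := M) (by omega) hr fun i => hfloor (hw i)
    calc _ ≤ ((N * (404 * parameterSum N r d ^ 5 + ⌊(K : ℝ) * Y ^ K⌋₊) : ℕ) : ℝ) := Nat.cast_le.2 h
      _ ≤ N * (404 * Y ^ 5 + K * Y ^ K) := by push_cast; gcongr
      _ ≤ N * (404 * Y ^ (K + 6) + K * Y ^ (K + 6)) := by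
          gcongr <;> first | exact hY | omega
      _ = (404 + K) * Y ^ (K + 6) * N := by ring
      _ ≤ 20000 * (41 + K) * Y ^ (K + 6) * N := by gcongr; linarith
      _ ≤ _ := by gcongr
  · have h := depth_searchProgram_le (M := M) (by omega) hr fun i => hfloor (hdep i)
    calc _ ≤ ((4000 * parameterSum N r d ^ 6 * 3 ^ maxExponent N r M *
          (40 + ⌊(K : ℝ) * Y ^ K⌋₊) : ℕ) : ℝ) := Nat.cast_le.2 h
      _ ≤ 4000 * Y ^ 6 * (5 * √((N : ℝ) ^ r / M)) * (40 + K * Y ^ K) := by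
          push_cast
          have := three_pow_maxExponent_le (N := N) (r := r) hM hMN
          gcongr
      _ ≤ 4000 * Y ^ 6 * (5 * √((N : ℝ) ^ r / M)) * ((40 + K) * Y ^ K) := by
          have : 1 ≤ Y ^ K := one_le_pow₀ hY
          gcongr
          linarith
      _ = 20000 * (40 + K) * Y ^ (K + 6) * √((N : ℝ) ^ r / M) := by ring
      _ ≤ 20000 * (41 + K) * Y ^ (K + 6) * √((N : ℝ) ^ r / M) := by gcongr; norm_num
      _ ≤ _ := by gcongr

end Bounds

end MultiGrover

/-! ### The multi-Grover theorem -/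

theorem theorem5 :
    ∃ prog : ℕ × ℕ × ℕ × ℕ → MultiGrover.Program, Computable prog ∧
    ∃ p : ℝ, 0 < p ∧
    ∀ K : ℕ, ∃ C : ℕ,
    ∀ N r d M : ℕ, 2 ≤ N → 1 ≤ r → 1 ≤ M → M ≤ N ^ r →
      (d : ℝ) ≤ K * Real.logb 2 N ^ K →
    ∀ (x : Fin N → Fin d → Bool) (α : Fin N → (Fin r → Fin d → Bool) → Bool)
      (a : Fin N → ℕ) (A : ∀ i, MultiGrover.Circuit (MultiGrover.OracleQubit r d (a i))),
      (∀ i, (A i).IsValid) →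
      (∀ i, MultiGrover.ComputesOn x (α i) (A i)) →
      (∀ i, ((A i).width : ℝ) ≤ K * (r * Real.logb 2 N * (d + 1)) ^ K) →
      (∀ i, ((A i).depth : ℝ) ≤ K * (r * Real.logb 2 N * (d + 1)) ^ K) →
      (∀ i, MultiGrover.numSolutions x (α i) = 0 ∨ M ≤ MultiGrover.numSolutions x (α i)) →
      ((prog (N, r, d, M)).compile A).IsValid ∧
      (((prog (N, r, d, M)).compile A).width : ℝ) ≤ C * (r * Real.logb 2 N) ^ C * N ∧
      (((prog (N, r, d, M)).compile A).depth : ℝ) ≤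
        C * (r * Real.logb 2 N) ^ C * Real.sqrt ((N : ℝ) ^ r / M) ∧
      p ≤ MultiGrover.successProb ((prog (N, r, d, M)).compile A) x α := by
  refine ⟨fun q => MultiGrover.searchProgram q.1 q.2.1 q.2.2.1 q.2.2.2,
    MultiGrover.computable_searchProgram, 1 / 2, by norm_num, fun K => ?_⟩
  obtain ⟨C, hC⟩ := MultiGrover.searchProgram_bounds K
  refine ⟨C, fun N r d M hN hr hM hMN hd x α a A hA hcomp hw hdep hsol => ?_⟩
  obtain ⟨h1, h2⟩ := hC N r d M hN hr hM hMN hd a A hw hdep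
  exact ⟨MultiGrover.isValid_searchProgram (by omega) hr hA, h1, h2,
    MultiGrover.half_le_successProb (by omega) hr hM hcomp hsol⟩
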